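/- **Setting.** Let $F_0$ be a complete discretely valued field with ring of integers $O_{F_0}$ and perfect residue field of characteristic $\neq 2$; let $F/F_0$ be a ramified quadratic extension with ring of integers $O_F$ and residue field $k$, let $\pi\in F$ be a uniformizer such that $\pi_0=\pi^2$ is a uniformizer of $F_0$, and let $a\mapsto\bar a$ be the nontrivial element of $\mathrm{Gal}(F/F_0)$. Let $n>3$, $m=\lfloor n/2\rfloor$, and let $0\le \ell\le m$ be strongly non-special, i.e. $\ell\ne 0,m-1,m$ if $n=2m$ and $\ell\neq 0,m$ if $n=2m+1$. Let $V$ be the split hermitian space of dimension $n$, with basis $e_1,\dots,e_n$ and form $\phi(ae_i,be_{n+1-j})=\bar a b\,\delta_{ij}$, and put $(x,y)=\tfrac12\mathrm{Tr}_{F/F_0}\phi(x,y)$. Let $\Lambda_i=\mathrm{span}_{O_F}\{\pi^{-1}e_1,\dots,\pi^{-1}e_i,e_{i+1},\dots,e_n\}$. The form $(\ ,\ )$ induces a pairing $\Lambda_{n-\ell}\times\Lambda_\ell\to O_{F_0}$. Write $t$ for the action of $\pi$ on the lattices. For an $O_F$-algebra $R$ write $\Lambda_{i,R}=\Lambda_i\otimes_{O_{F_0}}R$,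 with the $R$-linear operator $t$ and the scalar $\pi\in R$; let $A_\ell:\Lambda_{\ell,R}\to\Lambda_{n-\ell,R}$ and $A_{n-\ell}:\Lambda_{n-\ell,R}\to (\pi^{-1}\Lambda_{\ell})_R\cong\Lambda_{\ell,R}$ (the isomorphism being multiplication by $\pi$) be induced by the inclusions of lattices. The splitting model $M^{\rm spl}_I$, $I=\{\ell\}$, for the signature $(r,s)=(n-1,1)$ is the $O_F$-scheme representing the functor which sends an $O_F$-algebra $R$ to the set of triples $(\mathcal F_\ell,\mathcal F_{n-\ell},\mathcal G)$, where $\mathcal F_\kappa\subset\Lambda_{\kappa,R}$ ($\kappa=\ell,n-\ell$) are $t$-stable direct summands of rank $n$ and $\mathcal G\subset\mathcal F_{n-\ell}$ is a direct summand of rank $1$, such that 1. $A_\ell(\mathcal F_\ell)\subset\mathcal F_{n-\ell}$, $A_{n-\ell}(\mathcal F_{n-\ell})\subset \mathcal F_\ell$, and $\mathcal F_{n-\ell}$ is the orthogonal complement of $\mathcal F_\ell$ for $(\ ,\ )$; 2. $\mathrm{char}_{t|\mathcal F_\kappa}(X)=(X+\pi)^{r}(X-\pi)^{s}$ for $\kappa=\ell,n-\ell$;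 3. $\wedge^{r+1}(t-\pi\,|\,\mathcal F_\kappa)=0$ and $\wedge^{s+1}(t+\pi\,|\,\mathcal F_\kappa)=0$ for $\kappa=\ell,n-\ell$; 4. $(t+\pi)\mathcal F_{n-\ell}\subset\mathcal G$ and $(t-\pi)\mathcal G=0$. Let $\mathcal G^{\perp'}\subset (t-\pi)\Lambda_{\ell,R}$ be the orthogonal complement of $\mathcal G\subset(t+\pi)\Lambda_{n-\ell,R}$ for the pairing $\{(t+\pi)x,(t-\pi)y\}=((t+\pi)x,y)$; thus $(t-\pi)y\in\mathcal G^{\perp'}$ if and only if $(g,y)=0$ for all $g\in\mathcal G$. **Theorem.** The scheme $M^{\rm spl}_I$ exists, and the following conditions on triples over $k$-algebras $R$ define closed subschemes $M_1,M_2,M_3$ of its special fiber $M^{\rm spl}_I\otimes_{O_F} k$: - $M_1$: $\ t\mathcal F_\ell=0$ and $t\mathcal F_{n-\ell}=0$; - $M_2$: $\ tA_\ell^{-1}(\mathcal G)\subset\mathcal G^{\perp'}$ and $A_\ell(\mathcal F_\ell)\subset t\Lambda_{n-\ell,R}$; - $M_3$: $\ \mathcal G\subset A_\ell(\mathcal G^{\perp'})$.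 These subschemes are integral, and their underlying sets are pairwise distinct and are exactly the irreducible components of the special fiber. The components $M_1$ and $M_3$ are smooth over $k$, and $M_2$ is singular, i.e. not smooth over $k$. -/

import Mathlib

open AlgebraicGeometry CategoryTheory CategoryTheory.Limits IsLocalRing
open scoped TensorProduct

universe u

set_option linter.unusedSectionVars false

noncomputable section

namespace Splitting

/-- `{ℓ}` is strongly non-special for `n`, where `m = n / 2` (rounded down): `0 ≤ ℓ ≤ m`, with
`ℓ ≠ 0, m - 1, m` for `n = 2 m` and `ℓ ≠ 0, m` for `n = 2 m + 1`. -/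
def StronglyNonSpecial (n ℓ : ℕ) : Prop :=
  ℓ ≤ n / 2 ∧ ℓ ≠ 0 ∧ ℓ ≠ n / 2 ∧ (Even n → ℓ + 1 ≠ n / 2)

/-- The data on which everything depends. Here `O₀ = O_{F₀}`, `O = O_F`; the extension `F / F₀` is
ramified quadratic, of residue characteristic different from `2`, with uniformizers `π` and
`π₀ = π ^ 2`; `σ` is the nontrivial element of `Gal(F / F₀)`; `n > 3` is the dimension of the
hermitian space and `{ℓ}` is a strongly non-special index. -/
structure Datum (O₀ F₀ O F : Type u)
    [CommRing O₀] [IsDomain O₀] [IsDiscreteValuationRing O₀]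
    [Field F₀] [Algebra O₀ F₀] [IsFractionRing O₀ F₀]
    [CommRing O] [IsDomain O] [IsDiscreteValuationRing O]
    [Field F] [Algebra O F] [IsFractionRing O F]
    [Algebra F₀ F] [Algebra O₀ F] [Algebra O₀ O]
    [IsScalarTower O₀ F₀ F] [IsScalarTower O₀ O F] [IsIntegralClosure O O₀ F] where
  residue_two_ne_zero : (2 : ResidueField O₀) ≠ 0
  finrank_eq : Module.finrank F₀ F = 2
  π₀ : O₀
  π : O
  irreducible_π₀ : Irreducible π₀
  irreducible_π : Irreducible π
  π_sq : π ^ 2 = algebraMap O₀ O π₀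
  σ : F ≃ₐ[F₀] F
  σ_ne : σ ≠ AlgEquiv.refl
  n : ℕ
  ℓ : ℕ
  n_gt : 3 < n
  nonspecial : StronglyNonSpecial n ℓ

variable {O₀ F₀ O F : Type u}
  [CommRing O₀] [IsDomain O₀] [IsDiscreteValuationRing O₀]
  [Field F₀] [Algebra O₀ F₀] [IsFractionRing O₀ F₀]
  [CommRing O] [IsDomain O] [IsDiscreteValuationRing O]
  [Field F] [Algebra O F] [IsFractionRing O F]
  [Algebra F₀ F] [Algebra O₀ F] [Algebra O₀ O]
  [IsScalarTower O₀ F₀ F] [IsScalarTower O₀ O F] [IsIntegralClosure O O₀ F]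

namespace Datum

variable (D : Datum O₀ F₀ O F)

/-! ### The split hermitian space and the standard lattices -/

/-- The split hermitian form on `V = F ^ n` with its standard basis `e_1, …, e_n`:
`φ (a e_i, b e_{n + 1 - j}) = σ(a) b δ_{ij}`. (`Fin.rev` is `i ↦ n + 1 - i` in `1`-based
numbering.) -/
def herm (x y : Fin D.n → F) : F := ∑ i, D.σ (x i) * y (Fin.rev i)

/-- The symmetric form `(x, y) = (1 / 2) Tr_{F / F₀} φ(x, y)`. -/
def symForm : (Fin D.n → F) →ₗ[F₀] (Fin D.n → F) →ₗ[F₀] F₀ :=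
  LinearMap.mk₂ F₀ (fun x y => 2⁻¹ * Algebra.trace F₀ F (D.herm x y))
    (fun x x' y => by
      simp only [herm, Pi.add_apply, map_add, add_mul, Finset.sum_add_distrib, mul_add])
    (fun c x y => by
      have : D.herm (c • x) y = c • D.herm x y := by
        simp only [herm, Pi.smul_apply, map_smul, smul_mul_assoc, Finset.smul_sum]
      rw [this, map_smul, smul_eq_mul, smul_eq_mul]; ring)
    (fun x y y' => by
      simp only [herm, Pi.add_apply, map_add, Finset.sum_add_distrib, mul_add])
    (fun c x y => by
      have : D.herm x (c • y) = c • D.herm x y := by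
        simp only [herm, Pi.smul_apply, mul_smul_comm, Finset.smul_sum]
      rw [this, map_smul, smul_eq_mul, smul_eq_mul]; ring)

/-- The vectors `π⁻¹ e_1, …, π⁻¹ e_i, e_{i+1}, …, e_n`. -/
def latticeVec (i : ℕ) (j : Fin D.n) : Fin D.n → F :=
  if (j : ℕ) < i then (algebraMap O F D.π)⁻¹ • Pi.single j 1 else Pi.single j 1

/-- The standard lattice `Λ_i = span_{O_F} {π⁻¹ e_1, …, π⁻¹ e_i, e_{i+1}, …, e_n}`. -/
def lattice (i : ℕ) : Submodule O (Fin D.n → F) :=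
  Submodule.span O (Set.range (D.latticeVec i))

/-! ### Integrality of the symmetric form -/

theorem sq_F : algebraMap O F D.π ^ 2 = algebraMap O₀ F D.π₀ := by
  rw [← map_pow, D.π_sq, ← IsScalarTower.algebraMap_apply]

theorem π_F_ne : algebraMap O F D.π ≠ 0 := by
  have := (map_ne_zero_iff _ (IsFractionRing.injective O F)).2 D.irreducible_π.ne_zero
  exact this

theorem mem_O₀_of_sq {x : F₀} {c : O₀} (h : x ^ 2 = algebraMap O₀ F₀ c) :
    ∃ b : O₀, algebraMap O₀ F₀ b = x := by
  have hx : IsIntegral O₀ x := by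
    refine ⟨Polynomial.X ^ 2 - Polynomial.C c, Polynomial.monic_X_pow_sub_C c two_ne_zero, ?_⟩
    simp [h]
  exact IsIntegrallyClosed.isIntegral_iff.1 hx

theorem finiteDimensional (D : Datum O₀ F₀ O F) : FiniteDimensional F₀ F :=
  FiniteDimensional.of_finrank_pos (by rw [D.finrank_eq]; norm_num)

theorem univ_gal [Fintype (F ≃ₐ[F₀] F)] [DecidableEq (F ≃ₐ[F₀] F)] :
    (Finset.univ : Finset (F ≃ₐ[F₀] F)) = {AlgEquiv.refl, D.σ} := by
  have := D.finiteDimensional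
  symm
  apply Finset.eq_univ_of_card
  have h1 : Finset.card {AlgEquiv.refl, D.σ} = 2 := Finset.card_pair D.σ_ne.symm
  have h2 : Fintype.card (F ≃ₐ[F₀] F) ≤ 2 := by
    rw [← D.finrank_eq]
    convert AlgEquiv.card_le (F := F₀) (K := F)
  have h3 := Finset.card_le_univ {AlgEquiv.refl, D.σ}
  omega

theorem isGalois (D : Datum O₀ F₀ O F) : IsGalois F₀ F := by
  classical
  have := D.finiteDimensional
  apply IsGalois.of_card_aut_eq_finrank
  have := Fintype.ofFinite (F ≃ₐ[F₀] F)
  rw [Nat.card_eq_fintype_card, D.finrank_eq, ← Finset.card_univ, D.univ_gal,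
    Finset.card_pair D.σ_ne.symm]

theorem trace_eq (x : F) : algebraMap F₀ F (Algebra.trace F₀ F x) = x + D.σ x := by
  classical
  have := D.finiteDimensional
  have := D.isGalois
  rw [trace_eq_sum_automorphisms, D.univ_gal, Finset.sum_pair D.σ_ne.symm]
  rfl

theorem σ_π : D.σ (algebraMap O F D.π) = - algebraMap O F D.π := by
  classical
  have h1 : (D.σ (algebraMap O F D.π)) ^ 2 = (algebraMap O F D.π) ^ 2 := by
    rw [← map_pow, D.sq_F, IsScalarTower.algebraMap_apply O₀ F₀ F, AlgEquiv.commutes]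
  rcases sq_eq_sq_iff_eq_or_eq_neg.1 h1 with h | h
  · exfalso
    have := D.finiteDimensional
    have := D.isGalois
    have h2 : algebraMap O F D.π ∈ Set.range (algebraMap F₀ F) := by
      rw [IsGalois.mem_range_algebraMap_iff_fixed]
      intro f
      have := Fintype.ofFinite (F ≃ₐ[F₀] F)
      have hf := Finset.mem_univ f
      rw [D.univ_gal] at hf
      simp only [Finset.mem_insert, Finset.mem_singleton] at hf
      rcases hf with rfl | rfl
      · rfl
      · exact h
    obtain ⟨x, hx⟩ := h2
    have h3 : x ^ 2 = algebraMap O₀ F₀ D.π₀ := by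
      apply (algebraMap F₀ F).injective
      rw [map_pow, hx, D.sq_F, ← IsScalarTower.algebraMap_apply]
    obtain ⟨b, hb⟩ := mem_O₀_of_sq h3
    have h4 : D.π₀ = b * b := by
      apply IsFractionRing.injective O₀ F₀
      rw [← h3, ← hb, map_mul, sq]
    have h5 := D.irreducible_π₀.isUnit_or_isUnit h4
    have h6 : IsUnit D.π₀ := by rw [h4]; exact (by tauto : IsUnit b).mul (by tauto)
    exact D.irreducible_π₀.not_isUnit h6
  · exact h

theorem σ_mem (a : O) : ∃ b : O, algebraMap O F b = D.σ (algebraMap O F a) := by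
  have h : IsIntegral O₀ (algebraMap O F a) := (IsIntegralClosure.isIntegral O₀ F a).algebraMap
  have h2 : IsIntegral O₀ (D.σ (algebraMap O F a)) :=
    h.map ((D.σ : F →ₐ[F₀] F).restrictScalars O₀)
  exact IsIntegralClosure.isIntegral_iff.1 h2

theorem trace_mem (a : O) : ∃ b : O₀,
    algebraMap O₀ F₀ b = Algebra.trace F₀ F ((algebraMap O F D.π)⁻¹ * algebraMap O F a) := by
  set T := Algebra.trace F₀ F ((algebraMap O F D.π)⁻¹ * algebraMap O F a) with hT
  have h1 : algebraMap O F D.π * algebraMap F₀ F T =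
      algebraMap O F a - D.σ (algebraMap O F a) := by
    rw [hT, D.trace_eq, map_mul, map_inv₀, D.σ_π]
    have := D.π_F_ne
    field_simp
    ring
  obtain ⟨a', ha'⟩ := D.σ_mem a
  -- the square of the left-hand side is integral and lies in `F₀`
  have h2 : algebraMap F₀ F (algebraMap O₀ F₀ D.π₀ * T ^ 2) = algebraMap O F ((a - a') ^ 2) := by
    rw [map_pow, map_sub, ha', ← h1, mul_pow, D.sq_F, map_mul, map_pow,
      ← IsScalarTower.algebraMap_apply]
  have h3 : IsIntegral O₀ (algebraMap O₀ F₀ D.π₀ * T ^ 2) := by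
    rw [← isIntegral_algebraMap_iff (algebraMap F₀ F).injective, h2]
    exact (IsIntegralClosure.isIntegral O₀ F _).algebraMap
  obtain ⟨c, hc⟩ := IsIntegrallyClosed.isIntegral_iff.1 h3
  have h4 : (algebraMap O₀ F₀ D.π₀ * T) ^ 2 = algebraMap O₀ F₀ (D.π₀ * c) := by
    rw [map_mul, hc]; ring
  obtain ⟨b, hb⟩ := mem_O₀_of_sq h4
  have h5 : b ^ 2 = D.π₀ * c := by
    apply IsFractionRing.injective O₀ F₀
    rw [map_pow, hb, h4]
  obtain ⟨b', rfl⟩ := D.irreducible_π₀.prime.dvd_of_dvd_pow (Dvd.intro _ h5.symm)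
  refine ⟨b', ?_⟩
  have h6 : algebraMap O₀ F₀ D.π₀ ≠ 0 :=
    (map_ne_zero_iff _ (IsFractionRing.injective O₀ F₀)).2 D.irreducible_π₀.ne_zero
  rw [map_mul] at hb
  exact mul_left_cancel₀ h6 hb

theorem isUnit_two (D : Datum O₀ F₀ O F) : IsUnit (2 : O₀) := by
  have h := D.residue_two_ne_zero
  have h2 : (2 : ResidueField O₀) = residue O₀ 2 := (map_ofNat _ 2).symm
  rw [h2] at h
  exact (residue_ne_zero_iff_isUnit _).1 h

/-- Coordinates of the vectors of a standard lattice. -/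
theorem lattice_coord {i : ℕ} {x : Fin D.n → F} (hx : x ∈ D.lattice i) (j : Fin D.n) :
    (∃ a : O, x j = (algebraMap O F D.π)⁻¹ * algebraMap O F a) ∧
      (i ≤ j → ∃ a : O, x j = algebraMap O F a) := by
  have hπ := D.π_F_ne
  induction hx using Submodule.span_induction with
  | mem x hx =>
    obtain ⟨k, rfl⟩ := hx
    unfold latticeVec
    by_cases hkj : k = j
    · subst hkj
      split_ifs with h
      · exact ⟨⟨1, by simp⟩, fun h' => by omega⟩
      · exact ⟨⟨D.π, by simp [hπ]⟩, fun _ => ⟨1, by simp⟩⟩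
    · have h0 : (Pi.single k (1 : F) : Fin D.n → F) j = 0 := Pi.single_eq_of_ne (Ne.symm hkj) _
      split_ifs with h
      · exact ⟨⟨0, by simp [h0]⟩, fun _ => ⟨0, by simp [h0]⟩⟩
      · exact ⟨⟨0, by simp [h0]⟩, fun _ => ⟨0, by simp [h0]⟩⟩
  | zero => exact ⟨⟨0, by simp⟩, fun _ => ⟨0, by simp⟩⟩
  | add x y _ _ hx hy =>
    obtain ⟨⟨a, ha⟩, ha'⟩ := hx
    obtain ⟨⟨b, hb⟩, hb'⟩ := hy
    refine ⟨⟨a + b, by rw [Pi.add_apply, ha, hb, map_add, mul_add]⟩, fun h => ?_⟩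
    obtain ⟨a, ha⟩ := ha' h
    obtain ⟨b, hb⟩ := hb' h
    exact ⟨a + b, by rw [Pi.add_apply, ha, hb, map_add]⟩
  | smul r x _ hx =>
    obtain ⟨⟨a, ha⟩, ha'⟩ := hx
    refine ⟨⟨r * a, by rw [Pi.smul_apply, ha, Algebra.smul_def, map_mul]; ring⟩, fun h => ?_⟩
    obtain ⟨a, ha⟩ := ha' h
    exact ⟨r * a, by rw [Pi.smul_apply, ha, Algebra.smul_def, map_mul]⟩

/-- The symmetric form is `O_{F₀}`-valued on `Λ_{n-i} × Λ_i`. -/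
theorem symForm_mem {i : ℕ} {x y : Fin D.n → F}
    (hx : x ∈ D.lattice (D.n - i)) (hy : y ∈ D.lattice i) :
    ∃ a : O₀, algebraMap O₀ F₀ a = D.symForm x y := by
  have key : ∀ j, ∃ a : O, D.σ (x j) * y (Fin.rev j) =
      (algebraMap O F D.π)⁻¹ * algebraMap O F a := by
    intro j
    by_cases hj : D.n - i ≤ j
    · obtain ⟨a, ha⟩ := (D.lattice_coord hx j).2 hj
      obtain ⟨b, hb⟩ := (D.lattice_coord hy (Fin.rev j)).1
      obtain ⟨a', ha'⟩ := D.σ_mem a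
      exact ⟨a' * b, by rw [ha, hb, ← ha', map_mul]; ring⟩
    · have hj' : i ≤ (Fin.rev j : Fin D.n) := by rw [Fin.val_rev]; omega
      obtain ⟨a, ha⟩ := (D.lattice_coord hx j).1
      obtain ⟨b, hb⟩ := (D.lattice_coord hy (Fin.rev j)).2 hj'
      obtain ⟨a', ha'⟩ := D.σ_mem a
      refine ⟨-a' * b, ?_⟩
      rw [ha, hb, map_mul, map_inv₀, D.σ_π, ← ha', map_mul, map_neg, inv_neg]
      ring
  choose a ha using key
  have h1 : D.herm x y = (algebraMap O F D.π)⁻¹ * algebraMap O F (∑ j, a j) := by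
    rw [herm, map_sum, Finset.mul_sum]
    exact Finset.sum_congr rfl fun j _ => ha j
  obtain ⟨b, hb⟩ := D.trace_mem (∑ j, a j)
  obtain ⟨u, hu⟩ := D.isUnit_two
  refine ⟨(↑u⁻¹ : O₀) * b, ?_⟩
  change _ = 2⁻¹ * Algebra.trace F₀ F (D.herm x y)
  rw [h1, ← hb, map_mul]
  congr 1
  apply eq_inv_of_mul_eq_one_left
  have h2 : (2 : F₀) = algebraMap O₀ F₀ u := by rw [hu]; exact (map_ofNat _ 2).symm
  rw [h2, ← map_mul, Units.inv_mul, map_one]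

/-- The `O_{F₀}`-bilinear pairing `( , ) : Λ_{n-i} × Λ_i → O_{F₀}` induced by the symmetric
form. -/
def pairing (i : ℕ) : D.lattice (D.n - i) →ₗ[O₀] D.lattice i →ₗ[O₀] O₀ :=
  have inj := IsFractionRing.injective O₀ F₀
  have spec (x : D.lattice (D.n - i)) (y : D.lattice i) :=
    Classical.choose_spec (D.symForm_mem x.2 y.2)
  LinearMap.mk₂ O₀ (fun x y => Classical.choose (D.symForm_mem x.2 y.2))
    (fun x x' y => inj (by
      rw [map_add, spec, spec, spec, Submodule.coe_add, map_add, LinearMap.add_apply]))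
    (fun c x y => inj (by
      rw [smul_eq_mul, map_mul, spec, spec, ← smul_eq_mul, Submodule.coe_smul_of_tower,
        ← IsScalarTower.algebraMap_smul F₀ c (x : Fin D.n → F), map_smul, LinearMap.smul_apply]))
    (fun x y y' => inj (by
      rw [map_add, spec, spec, spec, Submodule.coe_add, map_add]))
    (fun c x y => inj (by
      rw [smul_eq_mul, map_mul, spec, spec, ← smul_eq_mul, Submodule.coe_smul_of_tower,
        ← IsScalarTower.algebraMap_smul F₀ c (y : Fin D.n → F), map_smul]))

theorem algebraMap_pairing (i : ℕ) (x : D.lattice (D.n - i)) (y : D.lattice i) :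
    algebraMap O₀ F₀ (D.pairing i x y) = D.symForm x y :=
  Classical.choose_spec (D.symForm_mem x.2 y.2)

/-! ### The maps between the lattices -/

theorem ℓ_le : D.ℓ ≤ D.n - D.ℓ := by
  have := D.nonspecial.1
  omega

theorem lattice_mono {i j : ℕ} (h : i ≤ j) : D.lattice i ≤ D.lattice j := by
  rw [lattice, Submodule.span_le]
  rintro _ ⟨k, rfl⟩
  have hk : D.latticeVec j k ∈ D.lattice j := Submodule.subset_span ⟨k, rfl⟩
  unfold latticeVec at hk ⊢
  split_ifs at hk ⊢ with h1 h2
  · exact hk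
  · omega
  · have := (D.lattice j).smul_mem D.π hk
    rw [← IsScalarTower.algebraMap_smul F D.π, smul_smul, mul_inv_cancel₀ D.π_F_ne,
      one_smul] at this
    exact this
  · exact hk

theorem π_smul_mem (i j : ℕ) {x : Fin D.n → F} (hx : x ∈ D.lattice i) :
    D.π • x ∈ D.lattice j := by
  have h0 : D.lattice i ≤ (D.lattice j).comap (LinearMap.lsmul O (Fin D.n → F) D.π) := by
    conv_lhs => rw [lattice]
    rw [Submodule.span_le]
    rintro _ ⟨k, rfl⟩
    change D.π • D.latticeVec i k ∈ D.lattice j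
    have h1 : (Pi.single k 1 : Fin D.n → F) ∈ D.lattice j := by
      have hk : D.latticeVec 0 k ∈ D.lattice 0 := Submodule.subset_span ⟨k, rfl⟩
      simpa [latticeVec] using D.lattice_mono (Nat.zero_le j) hk
    unfold latticeVec
    split_ifs
    · rw [← IsScalarTower.algebraMap_smul F D.π, smul_smul, mul_inv_cancel₀ D.π_F_ne, one_smul]
      exact h1
    · exact (D.lattice j).smul_mem _ h1
  exact h0 hx

/-- Multiplication by `π`, as an `O_{F₀}`-linear map `Λ_i → Λ_j`. For `i = j` this is the operator
`t`; for `i = n - ℓ` and `j = ℓ` it is the inclusion `Λ_{n-ℓ} ⊂ π⁻¹ Λ_ℓ` followed by the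
isomorphism `π : π⁻¹ Λ_ℓ ≃ Λ_ℓ`. -/
def mulπ (i j : ℕ) : D.lattice i →ₗ[O₀] D.lattice j where
  toFun x := ⟨D.π • (x : Fin D.n → F), D.π_smul_mem i j x.2⟩
  map_add' x y := by ext1; simp
  map_smul' c x := by
    ext1
    simp only [Submodule.coe_smul_of_tower, RingHom.id_apply]
    exact smul_comm _ _ _

/-! ### Base change to an `O_F`-algebra `R` -/

section BaseChange

variable (R : Type u) [CommRing R] [Algebra O₀ R] [Algebra O R] [IsScalarTower O₀ O R]

/-- `Λ_i ⊗_{O_{F₀}} R`. -/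
abbrev Lat (i : ℕ) : Type u := R ⊗[O₀] D.lattice i

/-- The `R`-linear operator `t` on `Λ_i ⊗ R`, coming from the action of `π` on `Λ_i`. -/
def t (i : ℕ) : D.Lat R i →ₗ[R] D.Lat R i := (D.mulπ i i).baseChange R

/-- The operator `π` on `Λ_i ⊗ R`: the scalar that is the image of `π` in the
`O_F`-algebra `R`. -/
def πScalar (i : ℕ) : D.Lat R i →ₗ[R] D.Lat R i := algebraMap O R D.π • LinearMap.id

/-- `A_ℓ : Λ_ℓ ⊗ R → Λ_{n-ℓ} ⊗ R`, induced by the inclusion of lattices. -/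
def A : D.Lat R D.ℓ →ₗ[R] D.Lat R (D.n - D.ℓ) :=
  ((Submodule.inclusion (D.lattice_mono D.ℓ_le)).restrictScalars O₀).baseChange R

/-- `A_{n-ℓ} : Λ_{n-ℓ} ⊗ R → π⁻¹ Λ_ℓ ⊗ R ≃ Λ_ℓ ⊗ R`. -/
def A' : D.Lat R (D.n - D.ℓ) →ₗ[R] D.Lat R D.ℓ := (D.mulπ (D.n - D.ℓ) D.ℓ).baseChange R

/-- The base change `(Λ_{n-ℓ} ⊗ R) × (Λ_ℓ ⊗ R) → R` of the pairing `( , )`. -/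
def pairingR : D.Lat R (D.n - D.ℓ) →ₗ[R] D.Lat R D.ℓ →ₗ[R] R :=
  LinearMap.liftBaseChange R
    ((LinearMap.liftBaseChangeEquiv R).toLinearMap.restrictScalars O₀ ∘ₗ
      (LinearMap.llcomp O₀ _ _ _ (Algebra.linearMap O₀ R)) ∘ₗ D.pairing D.ℓ)

theorem pairingR_tmul (r s : R) (x : D.lattice (D.n - D.ℓ)) (y : D.lattice D.ℓ) :
    D.pairingR R (r ⊗ₜ x) (s ⊗ₜ y) = r * s * algebraMap O₀ R (D.pairing D.ℓ x y) := by
  simp [pairingR, mul_assoc]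

variable {R}

/-- The orthogonal complement in `Λ_{n-ℓ} ⊗ R` of a submodule of `Λ_ℓ ⊗ R`. -/
def orthLeft (N : Submodule R (D.Lat R D.ℓ)) : Submodule R (D.Lat R (D.n - D.ℓ)) where
  carrier := {x | ∀ y ∈ N, D.pairingR R x y = 0}
  zero_mem' := by simp
  add_mem' := fun {a b} ha hb y hy => by simp [ha y hy, hb y hy]
  smul_mem' := fun c x hx y hy => by simp [hx y hy]

/-- The orthogonal complement in `Λ_ℓ ⊗ R` of a submodule of `Λ_{n-ℓ} ⊗ R`. -/
def orthRight (N : Submodule R (D.Lat R (D.n - D.ℓ))) : Submodule R (D.Lat R D.ℓ) where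
  carrier := {y | ∀ x ∈ N, D.pairingR R x y = 0}
  zero_mem' := by simp
  add_mem' := fun {a b} ha hb y hy => by simp [ha y hy, hb y hy]
  smul_mem' := fun c x hx y hy => by simp [hx y hy]

/-- `N^{⊥'} ⊂ (t - π) Λ_ℓ`: the orthogonal complement of `N ⊂ (t + π) Λ_{n-ℓ}` for the modified
pairing `{ , } : (t + π) Λ_{n-ℓ} × (t - π) Λ_ℓ → R`, `{(t + π) x, (t - π) y} = ((t + π) x, y)`.
So `(t - π) y` lies in `N^{⊥'}` if and only if `(g, y) = 0` for all `g ∈ N`. -/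
def modOrth (N : Submodule R (D.Lat R (D.n - D.ℓ))) : Submodule R (D.Lat R D.ℓ) :=
  (D.orthRight N).map (D.t R D.ℓ - D.πScalar R D.ℓ)

end BaseChange

end Datum

/-! ### The splitting model -/

/-- `N` is (Zariski locally) a direct summand of `P`, of constant rank `d`. -/
def IsSummandOfRank {R P : Type u} [CommRing R] [AddCommGroup P] [Module R P]
    (N : Submodule R P) (d : ℕ) : Prop :=
  (∃ Q : Submodule R P, IsCompl N Q) ∧ ∀ p : PrimeSpectrum R, Module.rankAtStalk (R := R) N p = d

/-- The endomorphism `g` of the module `N`, which is locally free of rank `d`, has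
characteristic polynomial `P`: this is so on every basic open subset `D(f)` of `Spec R` over which
`N` has a basis, for the matrix of `g` in such a basis. -/
def HasCharpoly {R N : Type u} [CommRing R] [AddCommMonoid N] [Module R N]
    (d : ℕ) (g : N →ₗ[R] N) (P : Polynomial R) : Prop :=
  ∀ (f : R) (b : Module.Basis (Fin d) (Localization.Away f) (Localization.Away f ⊗[R] N)),
    (LinearMap.toMatrix b b (g.baseChange (Localization.Away f))).charpoly =
      P.map (algebraMap R (Localization.Away f))

section Moduli

variable (D : Datum O₀ F₀ O F)

/-- The Kottwitz condition for a `t`-stable `N ⊂ Λ_i ⊗ R` and the signature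
`(r, s) = (n - 1, 1)`: `char_{t | N}(X) = (X + π)^r (X - π)^s`. -/
def Kottwitz {R : Type u} [CommRing R] [Algebra O₀ R] [Algebra O R] {i : ℕ}
    {N : Submodule R (D.Lat R i)} (h : ∀ x ∈ N, D.t R i x ∈ N) : Prop :=
  HasCharpoly D.n ((D.t R i).restrict h)
    ((Polynomial.X + Polynomial.C (algebraMap O R D.π)) ^ (D.n - 1) *
      (Polynomial.X - Polynomial.C (algebraMap O R D.π)) ^ 1)

/-- The wedge condition for a `t`-stable `N ⊂ Λ_i ⊗ R` and the signature `(r, s) = (n - 1, 1)`: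
`∧^{r+1} (t - π | N) = 0` and `∧^{s+1} (t + π | N) = 0`. -/
def Wedge {R : Type u} [CommRing R] [Algebra O₀ R] [Algebra O R] {i : ℕ}
    {N : Submodule R (D.Lat R i)} (h : ∀ x ∈ N, D.t R i x ∈ N) : Prop :=
  exteriorPower.map (R := R) (M := N) (N := N) ((D.n - 1) + 1)
      ((D.t R i - D.πScalar R i).restrict (p := N) (q := N)
        fun x hx => N.sub_mem (h x hx) (N.smul_mem _ hx)) = 0 ∧
    exteriorPower.map (R := R) (M := N) (N := N) (1 + 1)
      ((D.t R i + D.πScalar R i).restrict (p := N) (q := N)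
        fun x hx => N.add_mem (h x hx) (N.smul_mem _ hx)) = 0

/-- The `R`-valued points of the splitting model, for an `O_F`-algebra `R`: the triples
`(F_ℓ, F_{n-ℓ}, G_{n-ℓ})`, written `(Fl, Fnl, G)`. -/
@[ext]
structure SplPoint (R : Type u) [CommRing R] [Algebra O₀ R] [Algebra O R]
    [IsScalarTower O₀ O R] where
  Fl : Submodule R (D.Lat R D.ℓ)
  Fnl : Submodule R (D.Lat R (D.n - D.ℓ))
  G : Submodule R (D.Lat R (D.n - D.ℓ))
  summand_Fl : IsSummandOfRank Fl D.n
  summand_Fnl : IsSummandOfRank Fnl D.n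
  stable_Fl : ∀ x ∈ Fl, D.t R D.ℓ x ∈ Fl
  stable_Fnl : ∀ x ∈ Fnl, D.t R (D.n - D.ℓ) x ∈ Fnl
  map_A_le : Fl.map (D.A R) ≤ Fnl
  map_A'_le : Fnl.map (D.A' R) ≤ Fl
  orth : Fnl = D.orthLeft Fl
  kottwitz_Fl : Kottwitz D stable_Fl
  kottwitz_Fnl : Kottwitz D stable_Fnl
  wedge_Fl : Wedge D stable_Fl
  wedge_Fnl : Wedge D stable_Fnl
  summand_G : IsSummandOfRank G 1
  G_le : G ≤ Fnl
  t_add_π : Fnl.map (D.t R (D.n - D.ℓ) + D.πScalar R (D.n - D.ℓ)) ≤ G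
  t_sub_π : G.map (D.t R (D.n - D.ℓ) - D.πScalar R (D.n - D.ℓ)) = ⊥

/-- The base change along `φ : R → R'` of a submodule of `Λ_i ⊗ R`, as a submodule
of `Λ_i ⊗ R'`. -/
def pullbackSubmodule {R R' : Type u} [CommRing R] [Algebra O₀ R] [CommRing R'] [Algebra O₀ R']
    (φ : R →ₐ[O₀] R') {i : ℕ} (N : Submodule R (D.Lat R i)) : Submodule R' (D.Lat R' i) :=
  Submodule.span R' (φ.toLinearMap.rTensor (D.lattice i) '' (N : Set (D.Lat R i)))

/-- The `R`-valued points of a `B`-scheme `s : M → Spec B`, for a `B`-algebra `R`. -/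
abbrev Points {M : Scheme.{u}} {B : Type u} [CommRing B] (s : M ⟶ Spec (.of B))
    (R : Type u) [CommRing R] [Algebra B R] : Type u :=
  {x : Spec (.of R) ⟶ M // x ≫ s = Spec.map (CommRingCat.ofHom (algebraMap B R))}

/-- A representation of the moduli problem of the splitting model by the `O_F`-scheme
`s : M → Spec O_F`: the `R`-valued points of `M` are identified with the triples over `R`,
functorially in the `O_F`-algebra `R`. Such a pair is unique up to unique isomorphism. -/
structure Representation {M : Scheme.{u}} (s : M ⟶ Spec (.of O)) where
  triple : ∀ (R : Type u) [CommRing R] [Algebra O₀ R] [Algebra O R] [IsScalarTower O₀ O R],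
    Points s R ≃ SplPoint D R
  triple_map : ∀ (R R' : Type u) [CommRing R] [Algebra O₀ R] [Algebra O R] [IsScalarTower O₀ O R]
    [CommRing R'] [Algebra O₀ R'] [Algebra O R'] [IsScalarTower O₀ O R']
    (φ : R →ₐ[O] R') (x : Points s R) (y : Points s R'),
    y.1 = Spec.map (CommRingCat.ofHom (φ : R →+* R')) ≫ x.1 →
      (triple R' y).Fl = pullbackSubmodule D (φ.restrictScalars O₀) (triple R x).Fl ∧
      (triple R' y).Fnl = pullbackSubmodule D (φ.restrictScalars O₀) (triple R x).Fnl ∧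
      (triple R' y).G = pullbackSubmodule D (φ.restrictScalars O₀) (triple R x).G

variable {D}

/-! ### The special fiber and the three loci -/

/-- The special fiber `M ⊗ k` of an `O_F`-scheme, where `k` is the residue field of `O_F`. -/
abbrev specialFiber {M : Scheme.{u}} (s : M ⟶ Spec (.of O)) : Scheme.{u} :=
  pullback s (Spec.map (CommRingCat.ofHom (algebraMap O (ResidueField O))))

/-- The structure morphism `M ⊗ k → Spec k`. -/
abbrev specialFiberTo {M : Scheme.{u}} (s : M ⟶ Spec (.of O)) :
    specialFiber s ⟶ Spec (.of (ResidueField O)) :=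
  pullback.snd s (Spec.map (CommRingCat.ofHom (algebraMap O (ResidueField O))))

/-- The projection `M ⊗ k → M`. -/
abbrev specialFiberι {M : Scheme.{u}} (s : M ⟶ Spec (.of O)) : specialFiber s ⟶ M :=
  pullback.fst s (Spec.map (CommRingCat.ofHom (algebraMap O (ResidueField O))))

section Loci

variable {R : Type u} [CommRing R] [Algebra O₀ R] [Algebra O R] [IsScalarTower O₀ O R]

/-- `t F_ℓ = 0` and `t F_{n-ℓ} = 0`. -/
def InM₁ (x : SplPoint D R) : Prop :=
  x.Fl.map (D.t R D.ℓ) = ⊥ ∧ x.Fnl.map (D.t R (D.n - D.ℓ)) = ⊥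

/-- `t A_ℓ⁻¹(G) ⊂ G^{⊥'}` and `A_ℓ(F_ℓ) ⊂ t Λ_{n-ℓ}`. -/
def InM₂ (x : SplPoint D R) : Prop :=
  (x.G.comap (D.A R)).map (D.t R D.ℓ) ≤ D.modOrth x.G ∧
    x.Fl.map (D.A R) ≤ LinearMap.range (D.t R (D.n - D.ℓ))

/-- `G ⊂ A_ℓ(G^{⊥'})`. -/
def InM₃ (x : SplPoint D R) : Prop :=
  x.G ≤ (D.modOrth x.G).map (D.A R)

end Loci

/-- `ι : Z → M ⊗ k` is the closed subscheme of the special fiber of the splitting model whose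
points with values in a `k`-algebra `R` are the triples over `R` satisfying the condition `C`. -/
def IsClosedLocus {M : Scheme.{u}} {s : M ⟶ Spec (.of O)} (hM : Representation D s)
    (C : ∀ {R : Type u} [CommRing R] [Algebra O₀ R] [Algebra O R] [IsScalarTower O₀ O R],
      SplPoint D R → Prop)
    {Z : Scheme.{u}} (ι : Z ⟶ specialFiber s) : Prop :=
  IsClosedImmersion ι ∧
    ∀ (R : Type u) [CommRing R] [Algebra O₀ R] [Algebra O R] [IsScalarTower O₀ O R]
      [Algebra (ResidueField O) R] [IsScalarTower O (ResidueField O) R]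
      (x : Points (specialFiberTo s) R) (y : Points s R), y.1 = x.1 ≫ specialFiberι s →
        ((∃ z : Spec (.of R) ⟶ Z, z ≫ ι = x.1) ↔ C (hM.triple R y))

end Moduli

end Splitting
end

noncomputable section

namespace Splitting

/-! ### Representing a functor on rings by gluing affine charts -/

/-! Write an element of `Λ_i ⊗ R` as `a + (t - π) b`, that is, as a pair `(a, b)` of vectors of
length `n`, and let `ϖ` be the image of `π` in `R`. The image of `t + π` and the kernel of `t - π`
both consist of the pairs `(2ϖ b, b)`, so `G` is locally spanned by some `(2ϖ v, v)` with `v` a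
point of a projective space. Condition 4 makes the first components of `F_{n-ℓ}` multiples of `v`.
Dually, `F_ℓ` contains the summand of rank `n - 1` formed by the `(0, b)` with `b` orthogonal to
`v`. Rank `n` leaves one more direction: `F_ℓ` consists of the `(a, b)` for which `(a, h(v, b))` is
a multiple of a fixed `(w, c)`, where `h` is `Shape.form`. So a point is a pair `([v], [w : c])` in
a product of projective spaces, subject to the equations `Tup.Ok`; this is `IsPt.exists_tup`, with
converse `Tup.Ok.isPt`. The Kottwitz and wedge conditions are then automatic (`IsRankOne`). The
charts `v_i = 1`, `(w, c)_j = 1` are affine, and `ChartedFunctor` glues them to a scheme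
representing the moduli problem.

Call an index outer if it is one of the first `ℓ` or of the last `ℓ`, and middle otherwise, and let
`q` be the quadratic form `Shape.quad` on middle coordinates. On the special fiber `ϖ = 0` the
equations say that `w_out = l v_out`, `l v_mid = 0`, `q(w) = 2 l c`, `h(v, w) = 0`, that `v_mid` and
`w_mid` are proportional, and that products of coordinates of `v_mid` and `w_out` vanish. The three
conditions become `w = 0` for `M₁`, `q(v) = 0` and `w_out = 0` for `M₂`, and `v_mid = 0` for `M₃`.
Over a field, `v_mid ≠ 0` forces `l = 0` and `w = θ v_mid`, and then `h(v, w) = 0` reads `θ q(v) =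
0`. Hence the loci cover the fiber (`Tup.Ok.inLocus_of_field`).

`M₁` is a projective space, and `M₃` is a bundle of quadrics `q(w_mid) = 2 l c` over a projective
space. On suitable charts the equations can be solved for some of the variables, which makes the
coordinate ring a retract of a polynomial ring, hence a smooth domain (`NormalForm`). The same works
on `M₂` except where `v_mid = 0` and `c ≠ 0`. There, up to an affine space, `M₂` is the cone of
pairs `(x, y)` of proportional isotropic vectors. Its ring embeds by `x ↦ z`, `y ↦ z T` into a
polynomial ring modulo `q(z)` (`coneIdeal_eq_comap`). Strong non-speciality provides at least three
middle indices, so `q` is prime and the cone is integral. It is not smooth at its vertex, because a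
first order vector that is not isotropic does not extend to the next order
(`sq_eq_zero_of_formallySmooth`).

All charts used for a locus are domains and meet one common chart, so each locus is integral.
Explicit rational points lying on exactly one locus rule out inclusions, and three irreducible
closed sets that cover the fiber without inclusions are its components. -/

/-- A set-valued functor on commutative rings. -/
structure RingFunctor where
  obj : CommRingCat.{u} → Type u
  map : ∀ {R R' : CommRingCat.{u}}, (R ⟶ R') → obj R → obj R'
  map_id : ∀ {R : CommRingCat.{u}} (x : obj R), map (𝟙 R) x = x
  map_comp : ∀ {R R' R'' : CommRingCat.{u}} (f : R ⟶ R') (g : R' ⟶ R'') (x : obj R),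
    map (f ≫ g) x = map g (map f x)

/-- The canonical map from a ring to its localization away from an element. -/
abbrev awayHom {R : CommRingCat.{u}} (f : R) : R ⟶ .of (Localization.Away f) :=
  CommRingCat.ofHom (algebraMap R (Localization.Away f))

/-- An ideal attached functorially to the elements of `S`. -/
structure IdealRule (S : RingFunctor.{u}) where
  ideal : ∀ {R : CommRingCat.{u}}, S.obj R → Ideal R
  map : ∀ {R R' : CommRingCat.{u}} (φ : R ⟶ R') (x : S.obj R),
    ideal (S.map φ x) = (ideal x).map φ.hom

/-- The ring `A` with the element `elt` represents the locus where the ideal `D` is the unit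
ideal. -/
structure RepresentsUnitLocus (S : RingFunctor.{u}) (D : IdealRule S)
    (A : CommRingCat.{u}) (elt : S.obj A) : Prop where
  ideal_elt : D.ideal elt = ⊤
  exists_hom : ∀ {R : CommRingCat.{u}} (x : S.obj R), D.ideal x = ⊤ →
    ∃ φ : A ⟶ R, S.map φ elt = x
  hom_ext : ∀ {R : CommRingCat.{u}} (φ ψ : A ⟶ R), S.map φ elt = S.map ψ elt → φ = ψ

/-- A family of charts for a functor on rings with a structure map to `Hom(B, -)`, such that the
elements of the functor glue for the Zariski topology. -/
structure ChartedFunctor (B : CommRingCat.{u}) where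
  S : RingFunctor.{u}
  base : ∀ {R : CommRingCat.{u}}, S.obj R → (B ⟶ R)
  base_map : ∀ {R R' : CommRingCat.{u}} (φ : R ⟶ R') (x : S.obj R),
    base (S.map φ x) = base x ≫ φ
  J : Type u
  D : J → IdealRule S
  A : J → CommRingCat.{u}
  elt : ∀ j, S.obj (A j)
  rep : ∀ j, RepresentsUnitLocus S (D j) (A j) (elt j)
  d : ∀ i, J → A i
  ideal_elt : ∀ i j, (D j).ideal (elt i) = Ideal.span {d i j}
  cover : ∀ {R : CommRingCat.{u}} (x : S.obj R), ⨆ j, (D j).ideal x = ⊤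
  separated : ∀ {R : CommRingCat.{u}} {α : Type u} (f : α → R) (_ : Ideal.span (Set.range f) = ⊤)
    (x y : S.obj R), (∀ a, S.map (awayHom (f a)) x = S.map (awayHom (f a)) y) → x = y
  -- The map `ρ` is part of the data because a morphism to the glued scheme already supplies it.
  -- Compatibility is tested on every ring `T` over both localizations, which avoids choosing a
  -- model of the overlap.
  glue : ∀ {R : CommRingCat.{u}} (ρ : B ⟶ R) {α : Type u} [Finite α] (f : α → R)
    (_ : Ideal.span (Set.range f) = ⊤)
    (x : ∀ a, S.obj (.of (Localization.Away (f a)))) (_ : ∀ a, base (x a) = ρ ≫ awayHom (f a))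
    (_ : ∀ a b (T : CommRingCat.{u}) (g : CommRingCat.of (Localization.Away (f a)) ⟶ T)
      (h : CommRingCat.of (Localization.Away (f b)) ⟶ T),
      awayHom (f a) ≫ g = awayHom (f b) ≫ h → S.map g (x a) = S.map h (x b)),
    ∃ y : S.obj R, ∀ a, S.map (awayHom (f a)) y = x a

namespace ChartedFunctor

variable {B : CommRingCat.{u}} (C : ChartedFunctor B)

/-- The ring homomorphism corresponding to a morphism to an affine scheme. -/
def toHom {T : Scheme.{u}} {A : CommRingCat.{u}} (a : T ⟶ Spec A) : A ⟶ Γ(T, ⊤) :=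
  (Scheme.ΓSpecIso A).inv ≫ a.appTop

theorem toSpecΓ_toHom {T : Scheme.{u}} {A : CommRingCat.{u}} (a : T ⟶ Spec A) :
    T.toSpecΓ ≫ Spec.map (toHom a) = a := by
  rw [toHom, Spec.map_comp, ← Scheme.toSpecΓ_naturality_assoc,
    toSpecΓ_SpecMap_ΓSpecIso_inv, Category.comp_id]

theorem toHom_ofHom {T : Scheme.{u}} {A : CommRingCat.{u}} (g : A ⟶ Γ(T, ⊤)) :
    toHom (T.toSpecΓ ≫ Spec.map g) = g := by
  rw [toHom, Scheme.Hom.comp_appTop, ← Scheme.ΓSpecIso_inv_naturality_assoc,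
    Scheme.toSpecΓ_appTop, Iso.inv_hom_id, Category.comp_id]

theorem toHom_comp {T T' : Scheme.{u}} {A : CommRingCat.{u}} (f : T' ⟶ T) (a : T ⟶ Spec A) :
    toHom (f ≫ a) = toHom a ≫ f.appTop := by
  simp [toHom]

theorem toHom_comp_map {T : Scheme.{u}} {A A' : CommRingCat.{u}} (a : T ⟶ Spec A) (g : A' ⟶ A) :
    toHom (a ≫ Spec.map g) = g ≫ toHom a := by
  simp only [toHom, Scheme.Hom.comp_appTop]
  rw [← Scheme.ΓSpecIso_inv_naturality_assoc]

theorem toHom_injective {T : Scheme.{u}} {A : CommRingCat.{u}} {a b : T ⟶ Spec A}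
    (h : toHom a = toHom b) : a = b := by
  rw [← toSpecΓ_toHom a, h, toSpecΓ_toHom]

theorem toHom_specMap {R A : CommRingCat.{u}} (φ : A ⟶ R) :
    toHom (Spec.map φ) = φ ≫ (Scheme.ΓSpecIso R).inv := by
  rw [toHom, ← Scheme.ΓSpecIso_inv_naturality]

/-- The element classified by a morphism to a chart. -/
def el {T : Scheme.{u}} {i : C.J} (a : T ⟶ Spec (C.A i)) : C.S.obj Γ(T, ⊤) :=
  C.S.map (toHom a) (C.elt i)

theorem el_comp {T T' : Scheme.{u}} {i : C.J} (f : T' ⟶ T) (a : T ⟶ Spec (C.A i)) :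
    C.el (f ≫ a) = C.S.map f.appTop (C.el a) := by
  rw [el, toHom_comp, C.S.map_comp, el]

/-- A chart represents a subfunctor. Every compatibility in the gluing data is reduced by this to an
equality of classified elements. -/
theorem el_injective {T : Scheme.{u}} {i : C.J} {a b : T ⟶ Spec (C.A i)}
    (h : C.el a = C.el b) : a = b :=
  toHom_injective ((C.rep i).hom_ext _ _ h)

theorem ideal_el {T : Scheme.{u}} {i : C.J} (a : T ⟶ Spec (C.A i)) (j : C.J) :
    (C.D j).ideal (C.el a) = Ideal.span {(toHom a).hom (C.d i j)} := by
  rw [el, (C.D j).map, C.ideal_elt, Ideal.map_span, Set.image_singleton]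

theorem ideal_el_self {T : Scheme.{u}} {i : C.J} (a : T ⟶ Spec (C.A i)) :
    (C.D i).ideal (C.el a) = ⊤ := by
  rw [el, (C.D i).map, (C.rep i).ideal_elt, Ideal.map_top]

/-- The overlap of two charts. -/
abbrev V (i j : C.J) : Scheme.{u} := Spec (.of (Localization.Away (C.d i j)))

/-- The inclusion of an overlap into a chart. -/
abbrev incl (i j : C.J) : C.V i j ⟶ Spec (C.A i) := Spec.map (awayHom (C.d i j))

/-- On the chart `i` the ideal of the chart `j` is generated by the single function `d i j`, so it
becomes the unit ideal exactly when this function becomes invertible. -/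
theorem exists_lift {T : Scheme.{u}} {i j : C.J} (a : T ⟶ Spec (C.A i))
    (h : (C.D j).ideal (C.el a) = ⊤) : ∃ b : T ⟶ C.V i j, b ≫ C.incl i j = a := by
  rw [ideal_el, Ideal.span_singleton_eq_top] at h
  refine ⟨T.toSpecΓ ≫ Spec.map (CommRingCat.ofHom (IsLocalization.Away.lift _ h)), ?_⟩
  rw [Category.assoc, ← Spec.map_comp]
  conv_rhs => rw [← toSpecΓ_toHom a]
  congr 2
  ext x
  simp

theorem ideal_el_incl (i j : C.J) : (C.D j).ideal (C.el (C.incl i j)) = ⊤ := by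
  rw [ideal_el, Ideal.span_singleton_eq_top, toHom_specMap]
  have h := IsLocalization.Away.algebraMap_isUnit (S := Localization.Away (C.d i j)) (C.d i j)
  exact h.map (Scheme.ΓSpecIso (.of (Localization.Away (C.d i j)))).inv.hom

instance (i j : C.J) : Mono (C.incl i j) := inferInstance

/-- An element on the chart `i` with unit `j`-th ideal is classified by the chart `j` as well, and
by a morphism that lands in the overlap since its `i`-th ideal is the unit ideal. Applied to the
universal such element, this produces the transition maps. -/
theorem exists_el_eq {T : Scheme.{u}} {i j : C.J} (a : T ⟶ Spec (C.A i))
    (h : (C.D j).ideal (C.el a) = ⊤) :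
    ∃ b : T ⟶ C.V j i, C.el (b ≫ C.incl j i) = C.el a := by
  obtain ⟨φ, hφ⟩ := (C.rep j).exists_hom _ h
  have h1 : C.el (i := j) (T.toSpecΓ ≫ Spec.map φ) = C.el a := by
    rw [el, toHom_ofHom, hφ]
  obtain ⟨b, hb⟩ := C.exists_lift (i := j) (j := i) (T.toSpecΓ ≫ Spec.map φ)
    (by rw [h1, ideal_el_self])
  exact ⟨b, by rw [hb, h1]⟩

/-- The transition map between the two models of an overlap. -/
def trans (i j : C.J) : C.V i j ⟶ C.V j i :=
  (C.exists_el_eq (C.incl i j) (C.ideal_el_incl i j)).choose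

theorem el_trans (i j : C.J) : C.el (C.trans i j ≫ C.incl j i) = C.el (C.incl i j) :=
  (C.exists_el_eq (C.incl i j) (C.ideal_el_incl i j)).choose_spec

theorem exists_triple (i j k : C.J) :
    ∃ b : pullback (C.incl i j) (C.incl i k) ⟶ C.V j k,
      b ≫ C.incl j k = (pullback.fst _ _ ≫ C.trans i j) ≫ C.incl j i := by
  apply C.exists_lift
  rw [Category.assoc, el_comp, el_trans, ← el_comp, pullback.condition, el_comp, (C.D k).map,
    ideal_el_incl, Ideal.map_top]

/-- The transition map on a triple overlap. -/
def trans' (i j k : C.J) :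
    pullback (C.incl i j) (C.incl i k) ⟶ pullback (C.incl j k) (C.incl j i) :=
  pullback.lift (C.exists_triple i j k).choose (pullback.fst _ _ ≫ C.trans i j)
    (C.exists_triple i j k).choose_spec

theorem trans'_snd (i j k : C.J) :
    C.trans' i j k ≫ pullback.snd _ _ = pullback.fst _ _ ≫ C.trans i j :=
  pullback.lift_snd _ _ _

theorem el_trans' (i j k : C.J) :
    C.el (C.trans' i j k ≫ pullback.fst _ _ ≫ C.incl j k) =
      C.el (pullback.fst (C.incl i j) (C.incl i k) ≫ C.incl i j) := by
  rw [pullback.condition, ← Category.assoc, trans'_snd, Category.assoc, el_comp, el_trans, ← el_comp]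

/-- Transition maps preserve the classified element, so the round trip and the identity classify the
same element of a chart. -/
theorem cocycle (i j k : C.J) : C.trans' i j k ≫ C.trans' j k i ≫ C.trans' k i j = 𝟙 _ := by
  have : Mono (pullback.fst (C.incl i j) (C.incl i k) ≫ C.incl i j) := inferInstance
  rw [← cancel_mono (pullback.fst (C.incl i j) (C.incl i k) ≫ C.incl i j)]
  apply C.el_injective
  rw [Category.assoc, Category.assoc, el_comp, el_comp, el_trans', ← el_comp, el_trans', ← el_comp,
    el_trans', Category.id_comp]

/-- The gluing data of the charts. -/
def glueData : Scheme.GlueData.{u} where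
  J := C.J
  U i := Spec (C.A i)
  V p := C.V p.1 p.2
  f i j := C.incl i j
  f_id i := by
    obtain ⟨b, hb⟩ := C.exists_lift (𝟙 (Spec (C.A i))) (C.ideal_el_self _)
    have : IsSplitEpi (C.incl i i) := ⟨⟨⟨b, hb⟩⟩⟩
    exact isIso_of_mono_of_isSplitEpi _
  t i j := C.trans i j
  t_id i := by
    rw [← cancel_mono (C.incl i i)]
    apply C.el_injective
    rw [el_trans, Category.id_comp]
  t' := C.trans'
  t_fac := C.trans'_snd
  cocycle := C.cocycle
  f_open i j := inferInstance

/-- The scheme glued from the charts. -/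
def M : Scheme.{u} := C.glueData.glued

/-- The inclusion of a chart. -/
def chart (i : C.J) : Spec (C.A i) ⟶ C.M := C.glueData.ι i

instance (i : C.J) : IsOpenImmersion (C.chart i) := C.glueData.ι_isOpenImmersion i

theorem chart_surjective (x : C.M) : ∃ i y, C.chart i y = x := C.glueData.ι_jointly_surjective x

/-- Two morphisms to charts agree in the glued scheme iff they factor compatibly through the
overlap. Equality of elements gives this factorization, because the `j`-th ideal of the element of
`b` is the unit ideal. -/
theorem chart_comp_eq_iff {T : Scheme.{u}} {i j : C.J} (a : T ⟶ Spec (C.A i))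
    (b : T ⟶ Spec (C.A j)) : a ≫ C.chart i = b ≫ C.chart j ↔ C.el a = C.el b := by
  have hg : C.trans i j ≫ C.incl j i ≫ C.chart j = C.incl i j ≫ C.chart i :=
    C.glueData.glue_condition i j
  constructor
  · intro h
    let l : T ⟶ C.V i j := PullbackCone.IsLimit.lift (C.glueData.vPullbackConeIsLimit i j) a b h
    have h1 : l ≫ C.incl i j = a := PullbackCone.IsLimit.lift_fst _ _ _ _
    have h2 : l ≫ C.trans i j ≫ C.incl j i = b :=
      PullbackCone.IsLimit.lift_snd (C.glueData.vPullbackConeIsLimit i j) a b h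
    rw [← h1, ← h2, el_comp, el_comp, el_trans]
  · intro h
    obtain ⟨l, rfl⟩ := C.exists_lift (j := j) a (by rw [h, ideal_el_self])
    have h1 : l ≫ C.trans i j ≫ C.incl j i = b := by
      apply C.el_injective
      rw [el_comp, el_trans, ← el_comp, h]
    rw [Category.assoc, ← hg, ← h1]
    simp only [Category.assoc]

/-- The structure morphism of the glued scheme. -/
def str : C.M ⟶ Spec B :=
  Scheme.Cover.glueMorphisms C.glueData.openCover (fun i => Spec.map (C.base (C.elt i)))
    (fun i j => by
      have h := (C.chart_comp_eq_iff (pullback.fst (C.chart i) (C.chart j))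
        (pullback.snd (C.chart i) (C.chart j))).1 pullback.condition
      have h2 := congrArg C.base h
      simp only [el, C.base_map] at h2
      apply toHom_injective
      change toHom (pullback.fst (C.chart i) (C.chart j) ≫ _) =
        toHom (pullback.snd (C.chart i) (C.chart j) ≫ _)
      rw [toHom_comp_map, toHom_comp_map, h2])

theorem chart_str (i : C.J) : C.chart i ≫ C.str = Spec.map (C.base (C.elt i)) :=
  Scheme.Cover.ι_glueMorphisms C.glueData.openCover _ _ i

theorem specMap_chart_eq_iff {R : CommRingCat.{u}} {i j : C.J} (a : C.A i ⟶ R) (b : C.A j ⟶ R) :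
    Spec.map a ≫ C.chart i = Spec.map b ≫ C.chart j ↔
      C.S.map a (C.elt i) = C.S.map b (C.elt j) := by
  rw [chart_comp_eq_iff]
  simp only [el, toHom_specMap, C.S.map_comp]
  refine ⟨fun h => ?_, fun h => by rw [h]⟩
  have := congrArg (C.S.map (Scheme.ΓSpecIso R).hom) h
  simpa only [← C.S.map_comp, Category.assoc, Iso.inv_hom_id, Category.comp_id] using this

/-- The morphism `x` and the element `ξ` correspond to each other. -/
def Rel {R : CommRingCat.{u}} (x : Spec R ⟶ C.M) (ξ : C.S.obj R) : Prop :=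
  ∀ (i : C.J) (R' : CommRingCat.{u}) (φ : R ⟶ R') (a : C.A i ⟶ R'),
    Spec.map φ ≫ x = Spec.map a ≫ C.chart i ↔ C.S.map φ ξ = C.S.map a (C.elt i)

theorem hom_ext_away {R : CommRingCat.{u}} {X : Scheme.{u}} {α : Type u} (f : α → R)
    (hf : Ideal.span (Set.range f) = ⊤) (x y : Spec R ⟶ X)
    (h : ∀ a, Spec.map (awayHom (f a)) ≫ x = Spec.map (awayHom (f a)) ≫ y) : x = y :=
  Scheme.Cover.hom_ext (Scheme.affineOpenCoverOfSpanRangeEqTop f hf).openCover x y h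

theorem span_map_eq_top {R R' : CommRingCat.{u}} (φ : R ⟶ R') {α : Type u} {f : α → R}
    (hf : Ideal.span (Set.range f) = ⊤) :
    Ideal.span (Set.range fun a => φ.hom (f a)) = ⊤ := by
  have := congrArg (Ideal.map φ.hom) hf
  rwa [Ideal.map_span, Ideal.map_top, ← Set.range_comp] at this

theorem exists_awayMap {R R' : CommRingCat.{u}} (φ : R ⟶ R') (f : R) :
    ∃ ψ : CommRingCat.of (Localization.Away f) ⟶ .of (Localization.Away (φ.hom f)),
      awayHom f ≫ ψ = φ ≫ awayHom (φ.hom f) := by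
  refine ⟨CommRingCat.ofHom (IsLocalization.Away.map _ _ φ.hom f), ?_⟩
  ext x
  simp [IsLocalization.Away.map]

/-- Equality of morphisms and equality of elements can both be tested on a Zariski cover, so a match
on one cover already gives the correspondence after every base change. -/
theorem rel_of_local {R : CommRingCat.{u}} (x : Spec R ⟶ C.M) (ξ : C.S.obj R) {α : Type u}
    (f : α → R) (hf : Ideal.span (Set.range f) = ⊤) (j : α → C.J)
    (φ : ∀ a, C.A (j a) ⟶ .of (Localization.Away (f a)))
    (hx : ∀ a, Spec.map (awayHom (f a)) ≫ x = Spec.map (φ a) ≫ C.chart (j a))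
    (hξ : ∀ a, C.S.map (awayHom (f a)) ξ = C.S.map (φ a) (C.elt (j a))) : C.Rel x ξ := by
  intro i R' ψ a
  have key : ∀ c, Spec.map (awayHom (ψ.hom (f c))) ≫ Spec.map ψ ≫ x =
      Spec.map (awayHom (ψ.hom (f c))) ≫ Spec.map a ≫ C.chart i ↔
      C.S.map (awayHom (ψ.hom (f c))) (C.S.map ψ ξ) =
        C.S.map (awayHom (ψ.hom (f c))) (C.S.map a (C.elt i)) := by
    intro c
    obtain ⟨ψ', hψ'⟩ := exists_awayMap ψ (f c)
    rw [← Spec.map_comp_assoc, ← hψ', Spec.map_comp_assoc, hx, ← Spec.map_comp_assoc,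
      ← Spec.map_comp_assoc, specMap_chart_eq_iff, C.S.map_comp, ← hξ, ← C.S.map_comp, hψ',
      C.S.map_comp, C.S.map_comp]
  constructor
  · intro h
    exact C.separated _ (span_map_eq_top ψ hf) _ _ fun c => (key c).1 (by rw [h])
  · intro h
    exact hom_ext_away _ (span_map_eq_top ψ hf) _ _ fun c => (key c).2 (by rw [h])

theorem exists_local_elt {R : CommRingCat.{u}} (ξ : C.S.obj R) :
    ∃ (α : Type u) (f : α → R) (_ : Ideal.span (Set.range f) = ⊤) (j : α → C.J)
      (φ : ∀ a, C.A (j a) ⟶ .of (Localization.Away (f a))),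
      ∀ a, C.S.map (awayHom (f a)) ξ = C.S.map (φ a) (C.elt (j a)) := by
  have h : ∀ a : (Σ j, (C.D j).ideal ξ), ∃ φ : C.A a.1 ⟶ .of (Localization.Away (a.2 : R)),
      C.S.map (awayHom (a.2 : R)) ξ = C.S.map φ (C.elt a.1) := by
    rintro ⟨j, f, hf⟩
    obtain ⟨φ, hφ⟩ := (C.rep j).exists_hom (C.S.map (awayHom f) ξ) (by
      rw [(C.D j).map]
      exact Ideal.eq_top_of_isUnit_mem _ (Ideal.mem_map_of_mem _ hf)
        (IsLocalization.Away.algebraMap_isUnit f))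
    exact ⟨φ, hφ.symm⟩
  choose φ hφ using h
  refine ⟨Σ j, (C.D j).ideal ξ, fun a => a.2, ?_, fun a => a.1, φ, hφ⟩
  rw [eq_top_iff, ← C.cover ξ, iSup_le_iff]
  intro j f hf
  exact Ideal.subset_span ⟨⟨j, f, hf⟩, rfl⟩

theorem exists_rel_hom {R : CommRingCat.{u}} (ξ : C.S.obj R) : ∃ x, C.Rel x ξ := by
  obtain ⟨α, f, hf, j, φ, hφ⟩ := C.exists_local_elt ξ
  let 𝒰 := (Scheme.affineOpenCoverOfSpanRangeEqTop f hf).openCover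
  have hel : ∀ {T : Scheme.{u}} (a : α) (g : T ⟶ Spec (.of (Localization.Away (f a)))),
      C.el (g ≫ Spec.map (φ a)) = C.S.map (toHom (g ≫ Spec.map (awayHom (f a)))) ξ := by
    intro T a g
    rw [el, toHom_comp_map, C.S.map_comp, ← hφ, ← C.S.map_comp, toHom_comp_map]
  refine ⟨Scheme.Cover.glueMorphisms 𝒰 (fun a => Spec.map (φ a) ≫ C.chart (j a)) ?_,
    C.rel_of_local _ ξ f hf j φ (fun a => Scheme.Cover.ι_glueMorphisms 𝒰 _ _ a) hφ⟩
  intro a b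
  have := (C.chart_comp_eq_iff (pullback.fst (𝒰.f a) (𝒰.f b) ≫ Spec.map (φ a))
    (pullback.snd (𝒰.f a) (𝒰.f b) ≫ Spec.map (φ b))).2 ((hel a _).trans
      ((congrArg (fun z => C.S.map (toHom z) ξ) pullback.condition).trans (hel b _).symm))
  exact (Category.assoc _ _ _).symm.trans (this.trans (Category.assoc _ _ _))

/-- Preimages of the charts are open, so basic open sets mapping into one chart cover `Spec R`. A
finite subfamily is extracted because gluing of elements is only available for finite covers. -/
theorem exists_local_hom {R : CommRingCat.{u}} (x : Spec R ⟶ C.M) :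
    ∃ (α : Type u) (_ : Finite α) (f : α → R) (_ : Ideal.span (Set.range f) = ⊤) (j : α → C.J)
      (φ : ∀ a, C.A (j a) ⟶ .of (Localization.Away (f a))),
      ∀ a, Spec.map (awayHom (f a)) ≫ x = Spec.map (φ a) ≫ C.chart (j a) := by
  let s : Set R := {f | ∃ (j : C.J) (φ : C.A j ⟶ .of (Localization.Away f)),
    Spec.map (awayHom f) ≫ x = Spec.map φ ≫ C.chart j}
  have hs : Ideal.span s = ⊤ := by
    by_contra hne
    obtain ⟨m, hm, hsm⟩ := Ideal.exists_le_maximal _ hne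
    let p : PrimeSpectrum R := ⟨m, hm.isPrime⟩
    obtain ⟨j, y, hy⟩ := C.chart_surjective (x p)
    let U : TopologicalSpace.Opens (PrimeSpectrum R) := x ⁻¹ᵁ (C.chart j).opensRange
    have hp : p ∈ U := ⟨y, hy⟩
    obtain ⟨_, ⟨_, ⟨f, rfl⟩, rfl⟩, hpf, hfU⟩ :=
      PrimeSpectrum.isBasis_basic_opens.exists_subset_of_mem_open hp U.2
    have hr : Set.range (Spec.map (awayHom f) ≫ x) ⊆ Set.range (C.chart j) := by
      rintro _ ⟨q, rfl⟩
      have hq : (Spec.map (awayHom f)) q ∈ PrimeSpectrum.basicOpen f := by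
        intro hfq
        exact q.2.ne_top (Ideal.eq_top_of_isUnit_mem _ hfq
          (IsLocalization.Away.algebraMap_isUnit f))
      exact hfU hq
    refine hpf (hsm (Ideal.subset_span ⟨j, Spec.preimage (IsOpenImmersion.lift (C.chart j)
      (Spec.map (awayHom f) ≫ x) hr), ?_⟩))
    rw [Spec.map_preimage, IsOpenImmersion.lift_fac]
  obtain ⟨s', hs', hspan⟩ := (Ideal.span_eq_top_iff_finite s).1 hs
  choose j φ h using fun a : s' => hs' a.2
  exact ⟨s', inferInstance, fun a => a, by simpa using hspan, j, φ, h⟩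

theorem map_base_elt {R : CommRingCat.{u}} {i : C.J} (a : C.A i ⟶ R) :
    Spec.map (C.base (C.S.map a (C.elt i))) = (Spec.map a ≫ C.chart i) ≫ C.str := by
  rw [C.base_map, Spec.map_comp, Category.assoc, chart_str]

theorem exists_rel_elt {R : CommRingCat.{u}} (x : Spec R ⟶ C.M) : ∃ ξ, C.Rel x ξ := by
  obtain ⟨α, _, f, hf, j, φ, hφ⟩ := C.exists_local_hom x
  obtain ⟨ξ, hξ⟩ := C.glue (Spec.preimage (x ≫ C.str)) f hf (fun a => C.S.map (φ a) (C.elt (j a)))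
    (fun a => by
      apply Spec.map_injective
      rw [map_base_elt, ← hφ, Spec.map_comp, Spec.map_preimage, Category.assoc])
    (fun a b T g h hgh => by
      rw [← C.S.map_comp, ← C.S.map_comp, ← specMap_chart_eq_iff, Spec.map_comp_assoc,
        Spec.map_comp_assoc, ← hφ, ← hφ, ← Spec.map_comp_assoc, ← Spec.map_comp_assoc, hgh])
  exact ⟨ξ, C.rel_of_local x ξ f hf j φ hφ hξ⟩

theorem Rel.elt_unique {R : CommRingCat.{u}} {x : Spec R ⟶ C.M} {ξ ξ' : C.S.obj R}
    (h : C.Rel x ξ) (h' : C.Rel x ξ') : ξ = ξ' := by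
  obtain ⟨α, _, f, hf, j, φ, hφ⟩ := C.exists_local_hom x
  exact C.separated f hf _ _ fun a => by rw [(h _ _ _ _).1 (hφ a), (h' _ _ _ _).1 (hφ a)]

theorem Rel.hom_unique {R : CommRingCat.{u}} {x x' : Spec R ⟶ C.M} {ξ : C.S.obj R}
    (h : C.Rel x ξ) (h' : C.Rel x' ξ) : x = x' := by
  obtain ⟨α, f, hf, j, φ, hφ⟩ := C.exists_local_elt ξ
  exact hom_ext_away f hf _ _ fun a => by rw [(h _ _ _ _).2 (hφ a), (h' _ _ _ _).2 (hφ a)]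

/-- The glued scheme represents the functor. -/
def points (R : CommRingCat.{u}) : (Spec R ⟶ C.M) ≃ C.S.obj R where
  toFun x := (C.exists_rel_elt x).choose
  invFun ξ := (C.exists_rel_hom ξ).choose
  left_inv x := Rel.hom_unique C (C.exists_rel_hom _).choose_spec (C.exists_rel_elt x).choose_spec
  right_inv ξ := Rel.elt_unique C (C.exists_rel_elt _).choose_spec (C.exists_rel_hom ξ).choose_spec

theorem rel_points {R : CommRingCat.{u}} (x : Spec R ⟶ C.M) : C.Rel x (C.points R x) :=
  (C.exists_rel_elt x).choose_spec

theorem points_comp {R R' : CommRingCat.{u}} (φ : R ⟶ R') (x : Spec R ⟶ C.M) :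
    C.points R' (Spec.map φ ≫ x) = C.S.map φ (C.points R x) := by
  refine Rel.elt_unique C (C.rel_points _) fun i R'' ψ a => ?_
  rw [← Spec.map_comp_assoc, ← C.S.map_comp]
  exact C.rel_points x i R'' _ a

theorem map_base_points {R : CommRingCat.{u}} (x : Spec R ⟶ C.M) :
    Spec.map (C.base (C.points R x)) = x ≫ C.str := by
  obtain ⟨α, _, f, hf, j, φ, hφ⟩ := C.exists_local_hom x
  refine hom_ext_away f hf _ _ fun a => ?_
  rw [← Spec.map_comp, ← C.base_map, ← points_comp, ← Category.assoc, hφ, ← map_base_elt]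
  congr 2
  have := (C.rel_points x _ _ _ _).1 (hφ a)
  rw [← this, ← points_comp, hφ]

end ChartedFunctor

end Splitting

end

noncomputable section

namespace Splitting

/-! ### Direct summands of constant rank -/

section Summands

variable {R P : Type u} [CommRing R] [AddCommGroup P] [Module R P]

/-- A retraction, unlike a complement, is an equation between linear maps and so passes to base
changes. -/
theorem exists_isCompl_iff_exists_retraction (N : Submodule R P) :
    (∃ Q, IsCompl N Q) ↔ ∃ e : P →ₗ[R] P, (∀ x, e x ∈ N) ∧ ∀ x ∈ N, e x = x := by
  constructor
  · rintro ⟨Q, h⟩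
    exact ⟨N.projection Q h, fun x => Submodule.projection_apply_mem h x,
      fun x hx => Submodule.projection_apply_of_mem_left h hx⟩
  · rintro ⟨e, he, he'⟩
    refine ⟨LinearMap.ker e, ?_⟩
    have := LinearMap.isCompl_of_proj (f := e.codRestrict N he) fun x => Subtype.ext (he' x x.2)
    rwa [LinearMap.ker_codRestrict] at this

variable [Module.Finite R P] [Module.Projective R P]

theorem finite_of_isCompl {N Q : Submodule R P} (h : IsCompl N Q) : Module.Finite R N :=
  Module.Finite.of_surjective (Submodule.projectionOnto N Q h) (by
    rw [← LinearMap.range_eq_top]; exact Submodule.range_projectionOnto h)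

theorem projective_of_isCompl {N Q : Submodule R P} (h : IsCompl N Q) : Module.Projective R N :=
  Module.Projective.of_split N.subtype (Submodule.projectionOnto N Q h) (by ext x; simp)

theorem rankAtStalk_add_of_isCompl {N Q : Submodule R P} (h : IsCompl N Q) (p : PrimeSpectrum R) :
    Module.rankAtStalk N p + Module.rankAtStalk Q p = Module.rankAtStalk P p := by
  have := finite_of_isCompl h
  have := finite_of_isCompl h.symm
  have := projective_of_isCompl h
  have := projective_of_isCompl h.symm
  rw [← Module.rankAtStalk_eq_of_equiv (Submodule.prodEquivOfIsCompl N Q h),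
    Module.rankAtStalk_prod, Pi.add_apply]

theorem IsSummandOfRank.finite {N : Submodule R P} {d : ℕ} (h : IsSummandOfRank N d) :
    Module.Finite R N := finite_of_isCompl h.1.choose_spec

theorem IsSummandOfRank.projective {N : Submodule R P} {d : ℕ} (h : IsSummandOfRank N d) :
    Module.Projective R N := projective_of_isCompl h.1.choose_spec

omit [Module.Finite R P] [Module.Projective R P] in
theorem isCompl_comap_subtype {N G Q : Submodule R P} (h : IsCompl G Q) (hG : G ≤ N) :
    IsCompl (G.comap N.subtype) (Q.comap N.subtype) := by
  constructor
  · rw [disjoint_iff, ← Submodule.comap_inf, h.inf_eq_bot, Submodule.comap_bot,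
      Submodule.ker_subtype]
  · rw [codisjoint_iff, eq_top_iff]
    rintro ⟨x, hx⟩ -
    obtain ⟨g, hg, q, hq, rfl⟩ := Submodule.mem_sup.1 (h.sup_eq_top ▸ Submodule.mem_top : x ∈ G ⊔ Q)
    have hqN : q ∈ N := by simpa using N.sub_mem hx (hG hg)
    exact Submodule.mem_sup.2 ⟨⟨g, hG hg⟩, hg, ⟨q, hqN⟩, hq, rfl⟩

/-- A complement inside `N` of a smaller direct summand. -/
theorem IsSummandOfRank.exists_complement {N G : Submodule R P} {d e : ℕ}
    (hN : IsSummandOfRank N d) (hG : IsSummandOfRank G e) (h : G ≤ N) :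
    ∃ K : Submodule R N, Module.Finite R K ∧ Module.Projective R K ∧
      (∀ p : PrimeSpectrum R, e + Module.rankAtStalk K p = d) ∧
      ∀ x : N, ∃ y ∈ K, ((x : P) - y) ∈ G := by
  obtain ⟨Q, hQ⟩ := hG.1
  have := hN.finite
  have := hN.projective
  have hc := isCompl_comap_subtype hQ h
  refine ⟨Q.comap N.subtype, finite_of_isCompl hc.symm, projective_of_isCompl hc.symm, ?_, ?_⟩
  · intro p
    rw [← hN.2 p, ← rankAtStalk_add_of_isCompl hc p, ← hG.2 p,
      Module.rankAtStalk_eq_of_equiv (Submodule.comapSubtypeEquivOfLe h)]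
  · intro x
    obtain ⟨g, hg, y, hy, rfl⟩ :=
      Submodule.mem_sup.1 (hc.sup_eq_top ▸ Submodule.mem_top : x ∈ G.comap N.subtype ⊔ Q.comap N.subtype)
    exact ⟨y, hy, by simpa using hg⟩

/-- The complement of the smaller summand has rank zero, hence vanishes. Equalities between base
changes of submodules are deduced from one inclusion by this. -/
theorem IsSummandOfRank.eq_of_le {N G : Submodule R P} {d : ℕ}
    (hN : IsSummandOfRank N d) (hG : IsSummandOfRank G d) (h : G ≤ N) : G = N := by
  obtain ⟨K, _, _, hK, hx⟩ := hN.exists_complement hG h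
  have : Subsingleton K := by
    rw [← Module.rankAtStalk_eq_zero_iff_subsingleton (R := R)]
    ext p
    have := hK p
    simp only [Pi.zero_apply]
    omega
  refine le_antisymm h fun x hxN => ?_
  obtain ⟨y, hy, hxy⟩ := hx ⟨x, hxN⟩
  have : (⟨y, hy⟩ : K) = 0 := Subsingleton.elim _ _
  have hy0 : y = 0 := by simpa using congrArg Subtype.val this
  simpa [hy0] using hxy

end Summands

/-! ### Alternating maps on modules of small rank -/

section Alternating

variable {R M W : Type u} [CommRing R] [AddCommGroup M] [Module R M] [AddCommGroup W] [Module R W]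

/-- The stalk at `p` is free of rank `d`. Clearing denominators from a basis and from the given
vectors costs a factor outside `p`, and no basis over an open set is needed. -/
theorem exists_smul_mem_span [Module.Finite R M] [Module.Projective R M] {d : ℕ}
    (hd : ∀ p : PrimeSpectrum R, Module.rankAtStalk (R := R) M p = d) (p : PrimeSpectrum R)
    {k : ℕ} (x : Fin k → M) : ∃ s ∉ p.asIdeal, ∃ L : (Fin d → R) →ₗ[R] M,
      ∀ j, s • x j ∈ LinearMap.range L := by
  let S := p.asIdeal.primeCompl
  have : Module.Free (Localization.AtPrime p.asIdeal) (LocalizedModule S M) :=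
    Module.free_of_flat_of_isLocalRing
  let b := Module.finBasisOfFinrankEq (Localization.AtPrime p.asIdeal) (LocalizedModule S M)
    (hd p)
  choose y hy using fun i => IsLocalizedModule.surj S (LocalizedModule.mkLinearMap S M) (b i)
  let L : (Fin d → R) →ₗ[R] M := Fintype.linearCombination R fun i => (y i).1
  have key : ∀ z : LocalizedModule S M, ∃ s : S,
      s • z ∈ (LinearMap.range L).map (LocalizedModule.mkLinearMap S M) := by
    intro z
    have hz : z ∈ Submodule.span (Localization.AtPrime p.asIdeal) (Set.range b) := by simp
    induction hz using Submodule.span_induction with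
    | mem z hz =>
      obtain ⟨i, rfl⟩ := hz
      refine ⟨(y i).2, (y i).1, ⟨Pi.single i 1, ?_⟩, (hy i).symm⟩
      simp [L, Fintype.linearCombination_apply_single]
    | zero => exact ⟨1, by simp⟩
    | add z z' _ _ h h' =>
      obtain ⟨s, hs⟩ := h
      obtain ⟨s', hs'⟩ := h'
      refine ⟨s * s', ?_⟩
      rw [smul_add]
      refine Submodule.add_mem _ ?_ ?_
      · rw [mul_comm, mul_smul]; exact Submodule.smul_mem _ (s' : R) hs
      · rw [mul_smul]; exact Submodule.smul_mem _ (s : R) hs'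
    | smul a z _ h =>
      obtain ⟨s, hs⟩ := h
      obtain ⟨⟨r, t⟩, ht⟩ := IsLocalization.surj S a
      refine ⟨t * s, ?_⟩
      have : (t * s) • a • z = r • s • z := by
        have h1 : (t : R) • a • z = r • z := by
          rw [← IsScalarTower.algebraMap_smul (Localization.AtPrime p.asIdeal) (t : R), smul_smul,
            mul_comm, ht, IsScalarTower.algebraMap_smul]
        rw [mul_comm, mul_smul, Submonoid.smul_def t, h1, Submonoid.smul_def, Submonoid.smul_def,
          smul_comm]
      rw [this]
      exact Submodule.smul_mem _ r hs
  have key2 : ∀ j, ∃ s : S, (s : R) • x j ∈ LinearMap.range L := by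
    intro j
    obtain ⟨s, z, hz, hsz⟩ := key (LocalizedModule.mkLinearMap S M (x j))
    rw [Submonoid.smul_def, ← map_smul] at hsz
    obtain ⟨c, hc⟩ := IsLocalizedModule.exists_of_eq (S := S) hsz
    refine ⟨c * s, ?_⟩
    have : ((c * s : S) : R) • x j = (c : R) • z := by
      rw [Submonoid.coe_mul, mul_smul]; exact hc.symm
    rw [this]
    exact Submodule.smul_mem _ _ hz
  choose s hs using key2
  refine ⟨∏ j, (s j : R), ?_, L, fun j => ?_⟩
  · exact (S.prod_mem fun j _ => (s j).2 : _ ∈ S)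
  · rw [← Finset.mul_prod_erase _ _ (Finset.mem_univ j), mul_comm, mul_smul]
    exact Submodule.smul_mem _ _ (hs j)

theorem alternatingMap_pi_eq_zero {ι : Type} [Fintype ι] {k : ℕ} (h : Fintype.card ι < k)
    (f : (ι → R) [⋀^Fin k]→ₗ[R] W) : f = 0 := by
  refine Module.Basis.ext_alternating (Pi.basisFun R ι) fun v hv => ?_
  have := Fintype.card_le_of_injective v hv
  simp at this
  omega

/-- The annihilator of `w` is contained in no maximal ideal. -/
theorem eq_zero_of_smul_eq_zero {w : W}
    (h : ∀ p : PrimeSpectrum R, ∃ s : R, s ∉ p.asIdeal ∧ s • w = 0) : w = 0 := by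
  by_contra hw
  have hne : LinearMap.ker (LinearMap.toSpanSingleton R W w) ≠ ⊤ := by
    intro h1
    have : (1 : R) ∈ LinearMap.ker (LinearMap.toSpanSingleton R W w) := h1 ▸ Submodule.mem_top
    simp at this
    exact hw this
  obtain ⟨m, hm, hle⟩ := Ideal.exists_le_maximal _ hne
  obtain ⟨s, hs, hsw⟩ := h ⟨m, hm.isPrime⟩
  exact hs (hle (by simpa using hsw))

/-- Alternating maps in more variables than the rank vanish. -/
theorem alternatingMap_eq_zero [Module.Finite R M] [Module.Projective R M] {d k : ℕ}
    (hd : ∀ p : PrimeSpectrum R, Module.rankAtStalk (R := R) M p = d) (h : d < k)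
    (f : M [⋀^Fin k]→ₗ[R] W) (x : Fin k → M) : f x = 0 := by
  refine eq_zero_of_smul_eq_zero (R := R) fun p => ?_
  obtain ⟨s, hs, L, hL⟩ := exists_smul_mem_span hd p x
  choose c hc using hL
  refine ⟨s ^ k, fun hsk => hs (p.2.mem_of_pow_mem _ hsk), ?_⟩
  have h1 : f (fun j => s • x j) = 0 := by
    have : (fun j => s • x j) = fun j => L (c j) := funext fun j => (hc j).symm
    rw [this]
    exact congrArg (fun g => g c) (alternatingMap_pi_eq_zero (by simpa using h) (f.compLinearMap L))
  rw [← h1]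
  have := f.toMultilinearMap.map_smul_univ (fun _ => s) x
  simpa using this.symm

/-- Two functionals on a module of rank one are proportional. -/
theorem mul_eq_mul_of_rank_one [Module.Finite R M] [Module.Projective R M]
    (hd : ∀ p : PrimeSpectrum R, Module.rankAtStalk (R := R) M p = 1) (f g : M →ₗ[R] R) (x y : M) :
    f x * g y = f y * g x := by
  -- The claim says that the two by two determinant of the values of `f` and `g` vanishes; this
  -- determinant is an alternating form in two variables on a module of rank one.
  let F : M →ₗ[R] (Fin 2 → R) := LinearMap.pi ![f, g]
  have := alternatingMap_eq_zero hd one_lt_two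
    ((Matrix.detRowAlternating (n := Fin 2) (R := R)).compLinearMap F) ![x, y]
  rw [AlternatingMap.compLinearMap_apply] at this
  change Matrix.det (Matrix.of fun i => F (![x, y] i)) = 0 at this
  rw [Matrix.det_fin_two] at this
  simp [F] at this
  linear_combination this

end Alternating

/-! ### Orthogonal complements -/

section Orthogonal

variable {R P P' : Type u} [CommRing R] [AddCommGroup P] [Module R P] [AddCommGroup P']
  [Module R P']

theorem rankAtStalk_dual [Module.Finite R P] [Module.Projective R P] (p : PrimeSpectrum R) :
    Module.rankAtStalk (Module.Dual R P) p = Module.rankAtStalk P p := by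
  let S := p.asIdeal.primeCompl
  let Rp := Localization.AtPrime p.asIdeal
  have : Module.Free Rp (LocalizedModule S P) := Module.free_of_flat_of_isLocalRing
  have : Module.FinitePresentation R P := Module.finitePresentation_of_projective R P
  let e : LocalizedModule S (Module.Dual R P) ≃ₗ[Rp] (LocalizedModule S P →ₗ[Rp] LocalizedModule S R) :=
    (IsLocalizedModule.linearEquiv S (LocalizedModule.mkLinearMap S (Module.Dual R P))
      (LocalizedModule.map S (M := P) (N := R))).extendScalarsOfIsLocalization S Rp
  rw [Module.rankAtStalk, e.finrank_eq, Module.finrank_linearMap]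
  have h1 : Module.finrank Rp (LocalizedModule S R) = 1 := by
    have := Module.finrank_of_isLocalizedModule_of_free Rp S (LocalizedModule.mkLinearMap S R)
    have : Nontrivial R := ⟨0, 1, fun h => p.2.ne_top ((Ideal.eq_top_iff_one _).2 (h ▸ zero_mem _))⟩
    rw [‹Module.finrank _ _ = _›, Module.finrank_self]
  rw [h1, mul_one]
  rfl

variable (B : P' →ₗ[R] P →ₗ[R] R)

/-- The left orthogonal complement. -/
def leftOrth (N : Submodule R P) : Submodule R P' where
  carrier := {x | ∀ y ∈ N, B x y = 0}
  zero_mem' := by simp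
  add_mem' := fun {a b} ha hb y hy => by simp [ha y hy, hb y hy]
  smul_mem' := fun c x hx y hy => by simp [hx y hy]

variable {B} (hB : Function.Bijective B)
include hB

theorem isCompl_leftOrth {N Q : Submodule R P} (h : IsCompl N Q) :
    IsCompl (leftOrth B N) (leftOrth B Q) := by
  constructor
  · rw [Submodule.disjoint_def]
    intro x hx hx'
    apply hB.1
    ext y
    obtain ⟨a, ha, b, hb, rfl⟩ := Submodule.mem_sup.1 (h.sup_eq_top ▸ Submodule.mem_top : y ∈ N ⊔ Q)
    rw [map_add, hx a ha, hx' b hb]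
    simp
  · rw [codisjoint_iff, eq_top_iff]
    intro x _
    obtain ⟨y, hy⟩ := hB.2 (B x ∘ₗ Q.projection N h.symm)
    obtain ⟨z, hz⟩ := hB.2 (B x ∘ₗ N.projection Q h)
    refine Submodule.mem_sup.2 ⟨y, fun n hn => ?_, z, fun q hq => ?_, hB.1 ?_⟩
    · rw [hy, LinearMap.comp_apply, (Submodule.projection_apply_eq_zero_iff h.symm).2 hn,
        map_zero]
    · rw [hz, LinearMap.comp_apply, (Submodule.projection_apply_eq_zero_iff h).2 hq,
        map_zero]
    · rw [map_add, hy, hz]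
      ext w
      have := Submodule.projection_add_projection_eq_self h w
      simp only [LinearMap.add_apply, LinearMap.comp_apply]
      rw [← map_add, add_comm, this]

/-- Perfectness identifies the orthogonal complement of `N` with the dual of a complement of `N`. -/
theorem isSummandOfRank_leftOrth [Module.Finite R P] [Module.Projective R P] {N : Submodule R P}
    {d m : ℕ} (h : IsSummandOfRank N d)
    (hm : ∀ p : PrimeSpectrum R, Module.rankAtStalk (R := R) P p = d + m) :
    IsSummandOfRank (leftOrth B N) m := by
  obtain ⟨Q, hQ⟩ := h.1
  refine ⟨⟨_, isCompl_leftOrth hB hQ⟩, fun p => ?_⟩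
  have := finite_of_isCompl hQ.symm
  have := projective_of_isCompl hQ.symm
  have hr := rankAtStalk_add_of_isCompl hQ p
  rw [h.2, hm] at hr
  have hr' : m = Module.rankAtStalk Q p := by omega
  rw [hr', ← rankAtStalk_dual (P := Q)]
  let f : leftOrth B N →ₗ[R] Module.Dual R Q := Q.subtype.dualMap ∘ₗ B ∘ₗ Submodule.subtype _
  have hf : Function.Bijective f := by
    constructor
    · rw [← LinearMap.ker_eq_bot, LinearMap.ker_eq_bot']
      rintro ⟨x, hx⟩ hfx
      ext1
      apply hB.1
      ext y
      obtain ⟨a, ha, b, hb, rfl⟩ :=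
        Submodule.mem_sup.1 (hQ.sup_eq_top ▸ Submodule.mem_top : y ∈ N ⊔ Q)
      have : B x b = 0 := LinearMap.congr_fun hfx ⟨b, hb⟩
      rw [map_add, hx a ha, this]
      simp
    · intro g
      obtain ⟨y, hy⟩ := hB.2 (g ∘ₗ Submodule.projectionOnto Q N hQ.symm)
      refine ⟨⟨y, fun n hn => ?_⟩, ?_⟩
      · rw [hy, LinearMap.comp_apply,
          (Submodule.projectionOnto_apply_eq_zero_iff hQ.symm).2 hn, map_zero]
      · ext q
        change B y q = g q
        rw [hy, LinearMap.comp_apply, Submodule.projectionOnto_apply_left]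
  exact congrFun (Module.rankAtStalk_eq_of_equiv (LinearEquiv.ofBijective f hf)) p

/-- The double orthogonal of a summand is the summand: the projection of `y` to a complement is
killed by every functional, so it vanishes by projectivity. -/
theorem mem_of_forall_leftOrth [Module.Projective R P] {N : Submodule R P}
    (h : ∃ Q, IsCompl N Q) {y : P} (hy : ∀ x ∈ leftOrth B N, B x y = 0) : y ∈ N := by
  obtain ⟨Q, hQ⟩ := h
  rw [← (Submodule.projection_apply_eq_zero_iff hQ.symm)]
  refine (Module.forall_dual_apply_eq_zero_iff R _).1 fun f => ?_
  obtain ⟨x, hx⟩ := hB.2 (f ∘ₗ Q.projection N hQ.symm)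
  have := hy x fun n hn => by
    rw [hx, LinearMap.comp_apply, (Submodule.projection_apply_eq_zero_iff hQ.symm).2 hn,
      map_zero]
  rwa [hx] at this

end Orthogonal

/-! ### Base change of submodules -/

section BaseChange

variable {R R' P P' : Type u} [CommRing R] [CommRing R'] [Algebra R R'] [AddCommGroup P]
  [Module R P] [AddCommGroup P'] [Module R P'] [Module R' P'] [IsScalarTower R R' P']
  {L : P →ₗ[R] P'} (hL : IsBaseChange R' L)
include hL

theorem span_range_eq_top_of_isBaseChange : Submodule.span R' (Set.range L) = ⊤ := by
  rw [eq_top_iff]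
  intro x _
  induction x using hL.inductionOn with
  | zero => exact Submodule.zero_mem _
  | tmul m => exact Submodule.subset_span ⟨m, rfl⟩
  | smul s n h => exact Submodule.smul_mem _ _ (h trivial)
  | add a b ha hb => exact Submodule.add_mem _ (ha trivial) (hb trivial)

theorem exists_retraction_baseChange {N : Submodule R P} {e : P →ₗ[R] P}
    (he : ∀ x, e x ∈ N) (he' : ∀ x ∈ N, e x = x) :
    ∃ e' : P' →ₗ[R'] P', (∀ x, e' (L x) = L (e x)) ∧
      (∀ x, e' x ∈ Submodule.span R' (L '' (N : Set P))) ∧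
      ∀ x ∈ Submodule.span R' (L '' (N : Set P)), e' x = x := by
  have h1 : ∀ x, hL.lift (L ∘ₗ e) (L x) = L (e x) := fun x => hL.lift_eq _ x
  refine ⟨hL.lift (L ∘ₗ e), h1, fun x => ?_, fun x hx => ?_⟩
  · have hx : x ∈ Submodule.span R' (Set.range L) := by
      rw [span_range_eq_top_of_isBaseChange hL]; trivial
    induction hx using Submodule.span_induction with
    | mem x hx =>
      obtain ⟨y, rfl⟩ := hx
      rw [h1]
      exact Submodule.subset_span ⟨_, he y, rfl⟩
    | zero => simp
    | add a b _ _ ha hb => rw [map_add]; exact Submodule.add_mem _ ha hb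
    | smul c a _ ha => rw [map_smul]; exact Submodule.smul_mem _ _ ha
  · induction hx using Submodule.span_induction with
    | mem x hx =>
      obtain ⟨y, hy, rfl⟩ := hx
      rw [h1, he' y hy]
    | zero => simp
    | add a b _ _ ha hb => rw [map_add, ha, hb]
    | smul c a _ ha => rw [map_smul, ha]

/-- The retraction onto `N` gives a left inverse of the map from `R' ⊗ N` to `P'`, so its image is a
copy of the base change. -/
theorem isBaseChange_span {N : Submodule R P} (hN : ∃ Q, IsCompl N Q) :
    Nonempty ((R' ⊗[R] N) ≃ₗ[R'] Submodule.span R' (L '' (N : Set P))) := by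
  obtain ⟨e, he, he'⟩ := (exists_isCompl_iff_exists_retraction N).1 hN
  let i : (R' ⊗[R] N) →ₗ[R'] P' := hL.equiv.toLinearMap ∘ₗ N.subtype.baseChange R'
  have hi : ∀ (r : R') (x : N), i (r ⊗ₜ x) = r • L x := fun r x => by simp [i]
  let g : P' →ₗ[R'] (R' ⊗[R] N) :=
    (e.codRestrict N he).baseChange R' ∘ₗ hL.equiv.symm.toLinearMap
  have hgi : g ∘ₗ i = LinearMap.id := by
    ext x
    simp [g, i]
    congr 1
    exact Subtype.ext (he' x x.2)
  have hinj : Function.Injective i :=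
    Function.HasLeftInverse.injective ⟨g, fun x => LinearMap.congr_fun hgi x⟩
  have hr : LinearMap.range i = Submodule.span R' (L '' (N : Set P)) := by
    apply le_antisymm
    · rintro _ ⟨x, rfl⟩
      induction x using TensorProduct.induction_on with
      | zero => simp
      | tmul r x =>
        rw [hi]
        exact Submodule.smul_mem _ _ (Submodule.subset_span ⟨x, x.2, rfl⟩)
      | add a b ha hb => rw [map_add]; exact Submodule.add_mem _ ha hb
    · rw [Submodule.span_le]
      rintro _ ⟨x, hx, rfl⟩
      exact ⟨1 ⊗ₜ ⟨x, hx⟩, by rw [hi, one_smul]⟩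
  exact ⟨(LinearEquiv.ofInjective i hinj).trans (LinearEquiv.ofEq _ _ hr)⟩

theorem IsSummandOfRank.baseChange [Module.Finite R P] [Module.Projective R P]
    {N : Submodule R P} {d : ℕ} (h : IsSummandOfRank N d) :
    IsSummandOfRank (Submodule.span R' (L '' (N : Set P))) d := by
  constructor
  · obtain ⟨e, he, he'⟩ := (exists_isCompl_iff_exists_retraction N).1 h.1
    obtain ⟨e', -, h1, h2⟩ := exists_retraction_baseChange hL he he'
    exact (exists_isCompl_iff_exists_retraction _).2 ⟨e', h1, h2⟩
  · intro p
    have := h.finite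
    have := h.projective
    obtain ⟨i⟩ := isBaseChange_span hL h.1
    rw [← Module.rankAtStalk_eq_of_equiv i, Module.rankAtStalk_baseChange, h.2]

end BaseChange

end Splitting

end

noncomputable section

namespace Splitting

/-! ### The lattices in coordinates -/

/-- The numerical data: the dimension `n` and the index `ℓ`. -/
structure Shape where
  n : ℕ
  ℓ : ℕ
  pos : 0 < ℓ
  -- So there are at least three middle indices, which is what makes the quadratic form on the
  -- middle coordinates a prime polynomial.
  le : 2 * ℓ + 3 ≤ n

namespace Shape

variable (s : Shape) {R : Type u} [CommRing R]

/-- The outer indices, at which exactly one of the two lattices `Λ_ℓ`, `Λ_{n-ℓ}` has its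
generators equal up to the uniformizer. -/
def Out (k : Fin s.n) : Prop := (k : ℕ) < s.ℓ ∨ s.n - s.ℓ ≤ (k : ℕ)

instance : DecidablePred s.Out := fun _ => by unfold Out; infer_instance

theorem out_rev (k : Fin s.n) : s.Out k.rev ↔ s.Out k := by
  have := s.le
  simp only [Out, Fin.val_rev]
  omega

/-- The sign in the pairing of basis vectors. -/
def sgn (k : Fin s.n) : R := if (k : ℕ) < s.n - s.ℓ then 1 else -1

theorem sgn_rev (k : Fin s.n) : (s.sgn k.rev : R) = if s.Out k then -s.sgn k else s.sgn k := by
  have := s.le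
  have := s.pos
  have hk := k.2
  have h1 : (k.rev : ℕ) = s.n - (k + 1) := Fin.val_rev k
  by_cases h : s.Out k
  · rw [if_pos h]
    rcases h with h | h
    · rw [sgn, sgn, if_neg (by omega), if_pos (by omega)]
    · rw [sgn, sgn, if_pos (by omega), if_neg (by omega), neg_neg]
  · rw [if_neg h]
    unfold Out at h
    rw [sgn, sgn, if_pos (by omega), if_pos (by omega)]

theorem sgn_mul_self (k : Fin s.n) : (s.sgn k * s.sgn k : R) = 1 := by
  unfold sgn; split_ifs <;> simp

theorem sgn_of_not_out {k : Fin s.n} (h : ¬ s.Out k) : (s.sgn k : R) = 1 := by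
  unfold Out at h
  rw [sgn, if_pos (by omega)]

theorem map_sgn {R' : Type u} [CommRing R'] (φ : R →+* R') (k : Fin s.n) :
    φ (s.sgn k) = s.sgn k := by
  unfold sgn; split_ifs <;> simp

/-- Vectors of length `n`. -/
abbrev Vec (R : Type u) : Type u := Fin s.n → R

/-- The module `Λ_i ⊗ R` in coordinates: `(a, b)` stands for `a + (t - π) b`. -/
abbrev Dbl (R : Type u) : Type u := s.Vec R × s.Vec R

/-- The pairing `(t x, y)` of basis combinations. -/
def form : s.Vec R →ₗ[R] s.Vec R →ₗ[R] R :=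
  LinearMap.mk₂ R (fun x y => ∑ k, s.sgn k * (x k * y k.rev))
    (fun x x' y => by simp only [Pi.add_apply, ← Finset.sum_add_distrib]; congr! 1; ring)
    (fun c x y => by simp only [Pi.smul_apply, smul_eq_mul, Finset.mul_sum]; congr! 1; ring)
    (fun x y y' => by simp only [Pi.add_apply, ← Finset.sum_add_distrib]; congr! 1; ring)
    (fun c x y => by simp only [Pi.smul_apply, smul_eq_mul, Finset.mul_sum]; congr! 1; ring)

theorem form_apply (x y : s.Vec R) : s.form x y = ∑ k, s.sgn k * (x k * y k.rev) := rfl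

theorem form_apply_rev (x y : s.Vec R) :
    s.form x y = ∑ k, (if s.Out k then -s.sgn k else s.sgn k) * (x k.rev * y k) := by
  rw [form_apply, ← Equiv.sum_comp Fin.revPerm]
  refine Finset.sum_congr rfl fun k _ => ?_
  rw [Fin.revPerm_apply, Fin.rev_rev, sgn_rev]

theorem form_single (x : s.Vec R) (k : Fin s.n) (a : R) :
    s.form x (Pi.single k.rev a) = s.sgn k * x k * a := by
  rw [form_apply, Finset.sum_eq_single k]
  · rw [Pi.single_eq_same, mul_assoc]
  · intro k' _ hk
    rw [Pi.single_eq_of_ne (fun h => hk (Fin.rev_injective h)), mul_zero, mul_zero]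
  · simp

theorem form_left_injective {x y : s.Vec R} (h : ∀ z, s.form x z = s.form y z) : x = y := by
  ext k
  have := h (Pi.single k.rev (s.sgn k))
  rw [form_single, form_single] at this
  linear_combination this + (y k - x k) * s.sgn_mul_self (R := R) k

/-- The middle part of a vector. -/
def mid (x : s.Vec R) : s.Vec R := fun k => if s.Out k then 0 else x k

/-- The vector `x_mid - c x_out`. -/
def hat (c : R) (x : s.Vec R) : s.Vec R := fun k => if s.Out k then -(c * x k) else x k

/-- The vector `x_out + c x_mid`. -/
def tilt (c : R) (x : s.Vec R) : s.Vec R := fun k => if s.Out k then x k else c * x k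

/-- The quadratic form on the middle part. -/
def quad (x : s.Vec R) : R := s.form (s.mid x) (s.mid x)

/-- The form is symmetric on middle coordinates and alternating on outer ones, so exchanging the
arguments changes the sign of the outer part. -/
theorem form_swap (x y : s.Vec R) : s.form x y = s.form (s.hat 1 y) x := by
  rw [form_apply, form_apply_rev]
  refine Finset.sum_congr rfl fun k _ => ?_
  simp only [hat, out_rev]
  split_ifs <;> ring

theorem hat_smul (c a : R) (x : s.Vec R) : s.hat c (a • x) = a • s.hat c x := by
  ext k; simp only [hat, Pi.smul_apply, smul_eq_mul]; split_ifs <;> ring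

theorem tilt_smul (c a : R) (x : s.Vec R) : s.tilt c (a • x) = a • s.tilt c x := by
  ext k; simp only [tilt, Pi.smul_apply, smul_eq_mul]; split_ifs <;> ring

/-- The pairing `Λ_{n-ℓ} × Λ_ℓ → R` in coordinates. -/
def pair : s.Dbl R →ₗ[R] s.Dbl R →ₗ[R] R :=
  LinearMap.mk₂ R (fun x y => s.form x.2 y.1 - s.form x.1 y.2)
    (fun x x' y => by simp; ring) (fun c x y => by simp; ring)
    (fun x y y' => by simp; ring) (fun c x y => by simp; ring)

theorem pair_apply (x y : s.Dbl R) : s.pair x y = s.form x.2 y.1 - s.form x.1 y.2 := rfl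

/-- The map `A_ℓ` in coordinates. -/
def up (ϖ : R) : s.Dbl R →ₗ[R] s.Dbl R where
  toFun x := (s.tilt ϖ x.1, fun k => if s.Out k then x.2 k else x.1 k - ϖ * x.2 k)
  map_add' x y := by
    ext k <;> simp only [tilt, Prod.fst_add, Prod.snd_add, Pi.add_apply] <;> split_ifs <;> ring
  map_smul' c x := by
    ext k <;> simp only [tilt, Prod.smul_fst, Prod.smul_snd, Pi.smul_apply, smul_eq_mul,
      RingHom.id_apply] <;> split_ifs <;> ring

/-- The map `A_{n-ℓ}` in coordinates. -/
def down (ϖ : R) : s.Dbl R →ₗ[R] s.Dbl R where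
  toFun x := (fun k => if s.Out k then ϖ * x.1 k else x.1 k,
    fun k => if s.Out k then x.1 k - ϖ * x.2 k else x.2 k)
  map_add' x y := by
    ext k <;> simp only [Prod.fst_add, Prod.snd_add, Pi.add_apply] <;> split_ifs <;> ring
  map_smul' c x := by
    ext k <;> simp only [Prod.smul_fst, Prod.smul_snd, Pi.smul_apply, smul_eq_mul,
      RingHom.id_apply] <;> split_ifs <;> ring

theorem up_fst (ϖ : R) (x : s.Dbl R) : (s.up ϖ x).1 = s.tilt ϖ x.1 := rfl

/-- This expression is visibly symmetric in `x` and `y`; once the tilted vectors are multiples of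
`v` and the first components multiples of `w`, it becomes the equation `quad w = 2 l c`. -/
theorem pair_up (ϖ : R) (x y : s.Dbl R) :
    s.pair (s.up ϖ x) y =
      s.form (s.mid x.1) (s.mid y.1) - s.form (s.tilt ϖ y.1) x.2 - s.form (s.tilt ϖ x.1) y.2 := by
  rw [pair_apply, form_apply_rev s (s.tilt ϖ y.1), up_fst]
  congr 1
  rw [form_apply, form_apply, ← Finset.sum_sub_distrib]
  refine Finset.sum_congr rfl fun k _ => ?_
  simp only [mid, tilt, up, out_rev, LinearMap.coe_mk, AddHom.coe_mk]
  split_ifs <;> ring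

/-- The last term vanishes when the first components of `x` and `y` are proportional, by
`form_out_self`. What remains is a two by two minor condition on the two vectors `hat`. -/
theorem pair_down (ϖ : R) (x y : s.Dbl R) :
    s.pair x (s.down ϖ y) =
      s.form (s.hat ϖ y.1) x.2 - s.form (s.hat ϖ x.1) y.2 -
        s.form (x.1 - s.mid x.1) (y.1 - s.mid y.1) := by
  rw [pair_apply, form_apply_rev s (s.hat ϖ y.1), form_apply, form_apply, form_apply, form_apply,
    ← Finset.sum_sub_distrib, ← Finset.sum_sub_distrib, ← Finset.sum_sub_distrib]
  refine Finset.sum_congr rfl fun k _ => ?_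
  simp only [mid, hat, down, out_rev, LinearMap.coe_mk, AddHom.coe_mk, Pi.sub_apply]
  split_ifs <;> ring

/-- The terms at an outer index and at its opposite cancel; no division by two is involved. -/
theorem form_out_self (x : s.Vec R) : s.form (x - s.mid x) (x - s.mid x) = 0 := by
  rw [form_apply, ← Finset.sum_filter_add_sum_filter_not Finset.univ fun k : Fin s.n => (k : ℕ) < s.ℓ]
  have h2 : ∀ k : Fin s.n, ¬ (k : ℕ) < s.ℓ → ¬ s.n - s.ℓ ≤ (k : ℕ) →
      s.sgn k * ((x - s.mid x) k * (x - s.mid x) k.rev) = 0 := fun k h h' => by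
    have : ¬ s.Out k := by unfold Out; tauto
    simp [mid, this]
  rw [add_eq_zero_iff_eq_neg, ← Finset.sum_neg_distrib]
  refine Finset.sum_bij_ne_zero (fun k _ _ => k.rev) ?_ ?_ ?_ ?_
  · intro k hk _
    simp only [Finset.mem_filter, Finset.mem_univ, true_and, Fin.val_rev] at hk ⊢
    have := s.le
    omega
  · intro k _ _ k' _ _ h
    exact Fin.rev_injective h
  · intro k hk hk'
    simp only [Finset.mem_filter, Finset.mem_univ, true_and] at hk
    have h3 : s.n - s.ℓ ≤ (k : ℕ) := by
      by_contra h4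
      exact hk' (by rw [h2 k hk h4, neg_zero])
    have := k.2
    refine ⟨k.rev, ?_, ?_, Fin.rev_rev k⟩
    · simp only [Finset.mem_filter, Finset.mem_univ, true_and, Fin.val_rev]; omega
    · rw [sgn_rev, if_pos (show s.Out k from Or.inr h3), Fin.rev_rev]
      intro h
      exact hk' (by rw [← h]; ring)
  · intro k hk _
    simp only [Finset.mem_filter, Finset.mem_univ, true_and] at hk
    rw [sgn_rev, if_pos (show s.Out k from Or.inl hk), Fin.rev_rev]
    ring

theorem mid_smul (c : R) (x : s.Vec R) : s.mid (c • x) = c • s.mid x := by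
  ext k; simp [mid]

/-- The pairing matches basis vectors up to sign, hence is perfect over every ring. -/
theorem pair_bijective : Function.Bijective (s.pair (R := R)) := by
  constructor
  · intro x y h
    have h' : ∀ z, s.pair x z = s.pair y z := fun z => by rw [h]
    refine Prod.ext ?_ ?_
    · refine s.form_left_injective fun z => ?_
      have := h' (0, z)
      simpa [pair_apply] using this
    · refine s.form_left_injective fun z => ?_
      have := h' (z, 0)
      simpa [pair_apply] using this
  · intro f
    refine ⟨(fun k => -(s.sgn k * f (0, Pi.single k.rev 1)),
      fun k => s.sgn k * f (Pi.single k.rev 1, 0)), ?_⟩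
    apply LinearMap.prod_ext <;> refine LinearMap.pi_ext' fun k => LinearMap.ext_ring ?_
    · simp only [LinearMap.comp_apply, LinearMap.inl_apply, LinearMap.single_apply, pair_apply,
        map_zero, sub_zero]
      rw [← Fin.rev_rev k, form_single, Fin.rev_rev]
      linear_combination f (Pi.single k 1, 0) * s.sgn_mul_self (R := R) k.rev
    · simp only [LinearMap.comp_apply, LinearMap.inr_apply, LinearMap.single_apply, pair_apply,
        map_zero, zero_sub]
      rw [← Fin.rev_rev k, form_single, Fin.rev_rev]
      linear_combination f (0, Pi.single k 1) * s.sgn_mul_self (R := R) k.rev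

end Shape

/-! ### Summands given by split maps -/

section Split

variable {R P : Type u} [CommRing R] [AddCommGroup P] [Module R P]

theorem rankAtStalk_pi (d : ℕ) (p : PrimeSpectrum R) :
    Module.rankAtStalk (R := R) (Fin d → R) p = d := by
  have : Nontrivial R := p.nontrivial
  rw [Module.rankAtStalk_eq_finrank_of_free]
  simp

theorem Shape.rankAtStalk_dbl (s : Shape) (p : PrimeSpectrum R) :
    Module.rankAtStalk (R := R) (s.Dbl R) p = s.n + s.n := by
  rw [Module.rankAtStalk_prod, Pi.add_apply, rankAtStalk_pi]

theorem isSummandOfRank_span_singleton [Module.Finite R P] [Module.Projective R P] {x : P}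
    (f : P →ₗ[R] R) (h : f x = 1) : IsSummandOfRank (Submodule.span R {x}) 1 := by
  constructor
  · refine (exists_isCompl_iff_exists_retraction _).2
      ⟨LinearMap.toSpanSingleton R P x ∘ₗ f, fun y => ?_, fun y hy => ?_⟩
    · exact Submodule.smul_mem _ _ (Submodule.mem_span_singleton_self x)
    · obtain ⟨c, rfl⟩ := Submodule.mem_span_singleton.1 hy
      simp [h]
  · intro p
    have hinj : Function.Injective (LinearMap.toSpanSingleton R P x) :=
      Function.HasLeftInverse.injective ⟨f, fun c => by simp [h]⟩
    have : Nontrivial R := p.nontrivial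
    rw [← LinearMap.range_toSpanSingleton,
      ← Module.rankAtStalk_eq_of_equiv (LinearEquiv.ofInjective _ hinj),
      Module.rankAtStalk_eq_finrank_of_free]
    simp

theorem isSummandOfRank_ker [Module.Finite R P] [Module.Projective R P] {W : Type u}
    [AddCommGroup W] [Module R W] {d e : ℕ} (g : P →ₗ[R] W) (f : W →ₗ[R] P) (h : g ∘ₗ f = .id)
    (hW : ∀ p : PrimeSpectrum R, Module.rankAtStalk (R := R) W p = e)
    (hP : ∀ p : PrimeSpectrum R, Module.rankAtStalk (R := R) P p = d + e) :
    IsSummandOfRank (LinearMap.ker g) d := by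
  have hc : IsCompl (LinearMap.ker g) (LinearMap.range f) := by
    constructor
    · rw [Submodule.disjoint_def]
      rintro _ hx ⟨y, rfl⟩
      have : g (f y) = y := LinearMap.congr_fun h y
      rw [LinearMap.mem_ker, this] at hx
      rw [hx, map_zero]
    · rw [codisjoint_iff, eq_top_iff]
      intro x _
      refine Submodule.mem_sup.2 ⟨x - f (g x), ?_, f (g x), ⟨_, rfl⟩, by simp⟩
      have : g (f (g x)) = g x := LinearMap.congr_fun h _
      rw [LinearMap.mem_ker, map_sub, this, sub_self]
  refine ⟨⟨_, hc⟩, fun p => ?_⟩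
  have hinj : Function.Injective f :=
    Function.HasLeftInverse.injective ⟨g, fun x => LinearMap.congr_fun h x⟩
  have h1 := rankAtStalk_add_of_isCompl hc p
  rw [hP, ← Module.rankAtStalk_eq_of_equiv (LinearEquiv.ofInjective f hinj), hW] at h1
  omega

end Split

/-! ### The moduli problem in coordinates -/

/-- The conditions defining a point of the splitting model, in coordinates. The Kottwitz condition,
the wedge condition and the stability under `t` follow. -/
structure IsPt (s : Shape) {R : Type u} [CommRing R] (ϖ : R) (Fl Fnl G : Submodule R (s.Dbl R)) :
    Prop where
  summand_Fl : IsSummandOfRank Fl s.n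
  summand_Fnl : IsSummandOfRank Fnl s.n
  summand_G : IsSummandOfRank G 1
  up_mem : ∀ x ∈ Fl, s.up ϖ x ∈ Fnl
  down_mem : ∀ x ∈ Fnl, s.down ϖ x ∈ Fl
  orth : Fnl = leftOrth s.pair Fl
  G_le : G ≤ Fnl
  add_mem : ∀ x ∈ Fnl, ((2 * ϖ) • x.1, x.1) ∈ G
  sub_eq : ∀ x ∈ G, x.1 = (2 * ϖ) • x.2

/-- Coordinates of a point on a chart. -/
@[ext]
structure Tup (s : Shape) (R : Type u) where
  v : s.Vec R
  w : s.Vec R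
  c : R
  l : R

namespace Tup

variable {s : Shape} {R : Type u} [CommRing R]

/-- The coordinates of `(w, c)`. -/
def wc (T : Tup s R) : Option (Fin s.n) → R
  | none => T.c
  | some j => T.w j

/-- The equations of a chart. -/
structure Ok (T : Tup s R) (ϖ : R) (i : Fin s.n) (j : Option (Fin s.n)) : Prop where
  v_eq : T.v i = 1
  wc_eq : T.wc j = 1
  form_eq : s.form T.v T.w = 2 * ϖ * T.c
  tilt_eq : ∀ k, s.tilt ϖ T.w k = T.l * T.v k
  quad_eq : s.quad T.w = 2 * T.l * T.c
  minor_eq : ∀ k k', s.hat ϖ T.v k * s.hat 1 T.w k' = s.hat ϖ T.v k' * s.hat 1 T.w k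

variable (T : Tup s R)

/-- The submodule `F_ℓ` with the given coordinates. -/
def Fl : Submodule R (s.Dbl R) where
  carrier := {x | ∃ μ : R, x.1 = μ • T.w ∧ s.form T.v x.2 = μ * T.c}
  zero_mem' := ⟨0, by simp⟩
  add_mem' := by
    rintro x y ⟨μ, h1, h2⟩ ⟨μ', h1', h2'⟩
    exact ⟨μ + μ', by simp [h1, h1', add_smul], by simp [h2, h2', add_mul]⟩
  smul_mem' := by
    rintro a x ⟨μ, h1, h2⟩
    exact ⟨a * μ, by simp [h1, mul_smul], by simp [h2, mul_assoc]⟩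

/-- The submodule `F_{n-ℓ}` with the given coordinates. -/
def Fnl : Submodule R (s.Dbl R) where
  carrier := {x | ∃ μ : R, x.1 = μ • T.v ∧ s.form x.2 T.w = μ * T.c}
  zero_mem' := ⟨0, by simp⟩
  add_mem' := by
    rintro x y ⟨μ, h1, h2⟩ ⟨μ', h1', h2'⟩
    exact ⟨μ + μ', by simp [h1, h1', add_smul], by simp [h2, h2', add_mul]⟩
  smul_mem' := by
    rintro a x ⟨μ, h1, h2⟩
    exact ⟨a * μ, by simp [h1, mul_smul], by simp [h2, mul_assoc]⟩

variable {T} in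
theorem mem_Fl {x : s.Dbl R} :
    x ∈ T.Fl ↔ ∃ μ : R, x.1 = μ • T.w ∧ s.form T.v x.2 = μ * T.c := Iff.rfl

/-- The generator of `G`. -/
def gen (ϖ : R) : s.Dbl R := ((2 * ϖ) • T.v, T.v)

/-- The line `G` with the given coordinates. -/
def G (ϖ : R) : Submodule R (s.Dbl R) := Submodule.span R {T.gen ϖ}

variable {T} {ϖ : R} {i : Fin s.n} {j : Option (Fin s.n)} (h : T.Ok ϖ i j)
include h

theorem Ok.exists_form_eq (a : R) : ∃ r, s.form T.v r = a :=
  ⟨Pi.single i.rev (s.sgn i * a), by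
    rw [s.form_single, h.v_eq]; linear_combination a * s.sgn_mul_self (R := R) i⟩

/-- The condition that `(a, h(v, b))` is a multiple of `(w, c)` amounts to `n` equations once one
coordinate of `(w, c)` is `1`, and they form a split surjection onto `R ^ n`. -/
theorem Ok.isSummandOfRank_Fl : IsSummandOfRank T.Fl s.n := by
  have hn : ∀ p : PrimeSpectrum R, Module.rankAtStalk (R := R) (s.Vec R) p = s.n :=
    rankAtStalk_pi s.n
  obtain ⟨r, hr⟩ := h.exists_form_eq 1
  cases j with
  | none =>
    have hc : T.c = 1 := h.wc_eq
    let g : s.Dbl R →ₗ[R] s.Vec R :=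
      LinearMap.fst R _ _ - (s.form T.v ∘ₗ LinearMap.snd R _ _).smulRight T.w
    have : T.Fl = LinearMap.ker g := by
      ext x
      rw [mem_Fl, LinearMap.mem_ker, hc]
      simp only [mul_one]
      constructor
      · rintro ⟨μ, h1, h2⟩
        simp [g, h1, h2]
      · intro hx
        exact ⟨s.form T.v x.2, by simpa [g, sub_eq_zero] using hx, rfl⟩
    rw [this]
    refine isSummandOfRank_ker g (LinearMap.inl R _ _) ?_ hn s.rankAtStalk_dbl
    refine LinearMap.ext fun x => ?_
    simp [g]
  | some j =>
    have hw : T.w j = 1 := h.wc_eq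
    let aj : s.Dbl R →ₗ[R] R := LinearMap.proj j ∘ₗ LinearMap.fst R _ _
    -- The `j`-th coordinate of `a - a_j w` is zero, so this slot is free to hold the remaining
    -- equation `h(v, b) = c a_j`.
    let g : s.Dbl R →ₗ[R] s.Vec R :=
      LinearMap.fst R _ _ - aj.smulRight T.w +
        (s.form T.v ∘ₗ LinearMap.snd R _ _ - T.c • aj).smulRight (Pi.single j 1)
    have hg : ∀ x, g x = x.1 - x.1 j • T.w + (s.form T.v x.2 - T.c * x.1 j) • Pi.single j 1 :=
      fun x => rfl
    have : T.Fl = LinearMap.ker g := by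
      ext x
      rw [mem_Fl, LinearMap.mem_ker, hg]
      constructor
      · rintro ⟨μ, h1, h2⟩
        have : x.1 j = μ := by rw [h1]; simp [hw]
        rw [this, h1, h2]
        simp [mul_comm]
      · intro hx
        have h1 := congrFun hx j
        simp [hw] at h1
        rw [h1, zero_smul, add_zero] at hx
        exact ⟨x.1 j, sub_eq_zero.1 hx, by linear_combination h1⟩
    rw [this]
    refine isSummandOfRank_ker g
      (LinearMap.prod (LinearMap.id - LinearMap.smulRight (LinearMap.proj j) (Pi.single j 1))
        (LinearMap.smulRight (LinearMap.proj j) r)) ?_ hn s.rankAtStalk_dbl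
    refine LinearMap.ext fun x => ?_
    change g (x - x j • Pi.single j 1, x j • r) = x
    rw [hg]
    simp [hr]

/-- Pairing with the elements `(0, u)`, `u` orthogonal to `v`, makes the first component a multiple
of `v`. Pairing with one element above `w` gives the other equation. -/
theorem Ok.leftOrth_Fl : leftOrth s.pair T.Fl = T.Fnl := by
  ext y
  constructor
  · intro hy
    have h1 : ∀ u, s.form T.v u = 0 → s.form y.1 u = 0 := fun u hu => by
      have := hy (0, u) ⟨0, by simp, by simp [hu]⟩
      simpa [s.pair_apply] using this
    have h2 : y.1 = y.1 i • T.v := by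
      obtain ⟨r, hr⟩ := h.exists_form_eq 1
      have hrr : s.form y.1 (Pi.single i.rev (s.sgn i)) = y.1 i := by
        rw [s.form_single]; linear_combination y.1 i * s.sgn_mul_self (R := R) i
      have hrv : s.form T.v (Pi.single i.rev (s.sgn i)) = 1 := by
        rw [s.form_single, h.v_eq]; linear_combination s.sgn_mul_self (R := R) i
      refine s.form_left_injective fun z => ?_
      have := h1 (z - s.form T.v z • Pi.single i.rev (s.sgn i)) (by simp [hrv])
      rw [map_sub, map_smul, hrr, sub_eq_zero] at this
      rw [this, map_smul, LinearMap.smul_apply, smul_eq_mul, smul_eq_mul, mul_comm]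
    obtain ⟨r, hr⟩ := h.exists_form_eq T.c
    refine ⟨y.1 i, h2, ?_⟩
    have := hy (T.w, r) ⟨1, by simp, by simp [hr]⟩
    rw [s.pair_apply, sub_eq_zero] at this
    dsimp only at this
    rw [this, h2, map_smul, LinearMap.smul_apply, hr]
    simp [h.v_eq]
  · rintro ⟨μ, h1, h2⟩ x ⟨μ', h1', h2'⟩
    rw [s.pair_apply, h1, h1']
    simp only [map_smul, LinearMap.smul_apply, h2, h2', smul_eq_mul]
    ring

theorem Ok.isPt : IsPt s ϖ T.Fl T.Fnl (T.G ϖ) where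
  summand_Fl := h.isSummandOfRank_Fl
  summand_Fnl := by
    rw [← h.leftOrth_Fl]
    exact isSummandOfRank_leftOrth s.pair_bijective h.isSummandOfRank_Fl s.rankAtStalk_dbl
  summand_G := isSummandOfRank_span_singleton (LinearMap.proj i ∘ₗ LinearMap.snd R _ _) h.v_eq
  orth := h.leftOrth_Fl.symm
  up_mem := by
    rintro x ⟨μ, h1, h2⟩
    rw [← h.leftOrth_Fl]
    rintro y ⟨μ', h1', h2'⟩
    have ht : s.tilt ϖ T.w = T.l • T.v := funext h.tilt_eq
    have hq := h.quad_eq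
    unfold Shape.quad at hq
    rw [s.pair_up, h1, h1']
    simp only [s.tilt_smul, s.mid_smul, map_smul, LinearMap.smul_apply, ht, h2, h2', smul_eq_mul,
      hq]
    ring
  down_mem := by
    rintro y ⟨μ, h1, h2⟩
    -- By double orthogonality it suffices that the image under `down` pairs to zero with `F_{n-ℓ}`.
    refine mem_of_forall_leftOrth s.pair_bijective h.isSummandOfRank_Fl.1 ?_
    rw [h.leftOrth_Fl]
    rintro x ⟨μ', h1', h2'⟩
    rw [s.form_swap] at h2 h2'
    rw [s.pair_down, h1, h1', s.mid_smul, s.mid_smul, ← smul_sub, ← smul_sub]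
    simp only [s.hat_smul, map_smul, LinearMap.smul_apply, s.form_out_self, smul_eq_mul,
      mul_zero, sub_zero]
    cases j with
    | none =>
      have hc : T.c = 1 := h.wc_eq
      rw [hc, mul_one] at h2 h2'
      -- When `c = 1` the multipliers are themselves values of the form, so the claim is a sum of
      -- two by two minors.
      rw [← h2, ← h2', s.form_apply, s.form_apply, s.form_apply, s.form_apply,
        Finset.sum_mul_sum, Finset.sum_mul_sum, Finset.sum_comm, ← Finset.sum_sub_distrib]
      refine Finset.sum_eq_zero fun k _ => ?_
      rw [← Finset.sum_sub_distrib]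
      refine Finset.sum_eq_zero fun k' _ => ?_
      linear_combination (s.sgn k * s.sgn k' * x.2 k.rev * y.2 k'.rev) * h.minor_eq k k'
    | some j =>
      have hw : T.w j = 1 := h.wc_eq
      -- The `j`-th coordinate of `hat 1 w` is `1` or `-1`, so the vanishing minors give honest
      -- proportionality.
      obtain ⟨θ, hθ⟩ : ∃ θ : R, s.hat ϖ T.v = θ • s.hat 1 T.w := by
        refine ⟨s.hat ϖ T.v j * s.hat 1 T.w j, funext fun k => ?_⟩
        have h3 : s.hat 1 T.w j * s.hat 1 T.w j = 1 := by
          simp only [Shape.hat, hw]; split_ifs <;> ring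
        rw [Pi.smul_apply, smul_eq_mul]
        linear_combination (s.hat 1 T.w j) * h.minor_eq k j - s.hat ϖ T.v k * h3
      simp only [hθ, map_smul, LinearMap.smul_apply, h2, h2', smul_eq_mul]
      ring
  G_le := by
    rw [G, Submodule.span_singleton_le_iff_mem]
    -- The first component of the generator is `2ϖ v`, which fixes the multiplier.
    exact ⟨2 * ϖ, rfl, h.form_eq⟩
  add_mem := by
    rintro x ⟨μ, h1, -⟩
    rw [h1]
    refine Submodule.mem_span_singleton.2 ⟨μ, ?_⟩
    ext k <;> simp [gen]
    ring
  sub_eq := by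
    intro x hx
    obtain ⟨μ, rfl⟩ := Submodule.mem_span_singleton.1 hx
    simp [gen, smul_smul, mul_comm]

end Tup

end Splitting

end

noncomputable section

namespace Splitting

/-! ### ### Every point locally comes from a tuple -/

variable {s : Shape} {R : Type u} [CommRing R]

/-- The `j`-th coordinate of `(a, h(v, b))`. -/
def kap (v : s.Vec R) : Option (Fin s.n) → s.Dbl R →ₗ[R] R
  | none => s.form v ∘ₗ LinearMap.snd R _ _
  | some j => LinearMap.proj j ∘ₗ LinearMap.fst R _ _

/-- The vectors `(0, b)` with `b` orthogonal to `v`. -/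
def perp (v : s.Vec R) : Submodule R (s.Dbl R) :=
  LinearMap.ker (LinearMap.prod (LinearMap.fst R (s.Vec R) (s.Vec R))
    (s.form v ∘ₗ LinearMap.snd R (s.Vec R) (s.Vec R)))

theorem mem_perp {v : s.Vec R} {x : s.Dbl R} : x ∈ perp v ↔ x.1 = 0 ∧ s.form v x.2 = 0 := by
  simp [perp]

theorem exists_form_eq {v : s.Vec R} {i : Fin s.n} (hv : v i = 1) (a : R) :
    ∃ r, s.form v r = a :=
  ⟨Pi.single i.rev (s.sgn i * a), by
    rw [s.form_single, hv]; linear_combination a * s.sgn_mul_self (R := R) i⟩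

theorem isSummandOfRank_perp {v : s.Vec R} {i : Fin s.n} (hv : v i = 1) :
    IsSummandOfRank (perp v) (s.n - 1) := by
  obtain ⟨r, hr⟩ := exists_form_eq hv 1
  refine isSummandOfRank_ker (e := s.n + 1) _
    (LinearMap.prodMap LinearMap.id (LinearMap.toSpanSingleton R _ r)) ?_ ?_ ?_
  · refine LinearMap.ext fun x => ?_
    ext <;> simp [hr]
  · intro p
    have : Nontrivial R := p.nontrivial
    rw [Module.rankAtStalk_prod, Pi.add_apply, rankAtStalk_pi,
      Module.rankAtStalk_eq_finrank_of_free, Pi.natCast_apply, Module.finrank_self]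
    simp
  · intro p
    have := s.le
    rw [s.rankAtStalk_dbl]
    omega

namespace IsPt

variable {ϖ : R} {Fl Fnl G : Submodule R (s.Dbl R)} (h : IsPt s ϖ Fl Fnl G)
include h

theorem mem_Fl_of_forall {y : s.Dbl R} (hy : ∀ x ∈ Fnl, s.pair x y = 0) : y ∈ Fl :=
  mem_of_forall_leftOrth s.pair_bijective h.summand_Fl.1 (by rwa [← h.orth])

theorem pair_eq {x y : s.Dbl R} (hx : x ∈ Fnl) (hy : y ∈ Fl) : s.pair x y = 0 := by
  rw [h.orth] at hx; exact hx y hy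

variable {v : s.Vec R} {i : Fin s.n} {g : s.Dbl R} (hg : g ∈ G) (hv : g.2 i = 1)
include hg hv

/-- On a module of rank one all second components are proportional, and on `G` the second component
determines the first. -/
theorem eq_smul {x : s.Dbl R} (hx : x ∈ G) : x = x.2 i • g := by
  have := h.summand_G.finite
  have := h.summand_G.projective
  have key : ∀ k, x.2 k = x.2 i * g.2 k := fun k => by
    have := mul_eq_mul_of_rank_one h.summand_G.2
      (LinearMap.proj k ∘ₗ LinearMap.snd R (s.Vec R) (s.Vec R) ∘ₗ G.subtype)
      (LinearMap.proj i ∘ₗ LinearMap.snd R (s.Vec R) (s.Vec R) ∘ₗ G.subtype) ⟨x, hx⟩ ⟨g, hg⟩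
    simp only [LinearMap.comp_apply, Submodule.subtype_apply, LinearMap.snd_apply,
      LinearMap.proj_apply, hv, mul_one] at this
    rw [this, mul_comm]
  have h2 : x.2 = x.2 i • g.2 := funext key
  refine Prod.ext ?_ h2
  rw [h.sub_eq x hx, Prod.smul_fst, h.sub_eq g hg, h2]
  simp [hv, smul_smul, mul_comm]

theorem G_eq : G = Submodule.span R {g} :=
  le_antisymm (fun x hx => by
    rw [h.eq_smul hg hv hx]; exact Submodule.smul_mem _ _ (Submodule.mem_span_singleton_self g))
    ((Submodule.span_singleton_le_iff_mem _ _).2 hg)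

theorem fst_eq {x : s.Dbl R} (hx : x ∈ Fnl) : x.1 = x.1 i • g.2 :=
  congrArg Prod.snd (h.eq_smul hg hv (h.add_mem x hx))

/-- First components of `F_{n-ℓ}` are multiples of `g.2`, so these vectors are orthogonal to
`F_{n-ℓ}` and lie in its orthogonal complement. -/
theorem perp_le : perp g.2 ≤ Fl := by
  intro y hy
  rw [mem_perp] at hy
  refine h.mem_Fl_of_forall fun x hx => ?_
  rw [s.pair_apply, hy.1, h.fst_eq hg hv hx]
  simp [hy.2]

/-- The functionals `kap` vanish on `perp g.2`, and modulo it `F_ℓ` has rank one. -/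
theorem kap_mul_kap (j k : Option (Fin s.n)) {x y : s.Dbl R} (hx : x ∈ Fl) (hy : y ∈ Fl) :
    kap g.2 j x * kap g.2 k y = kap g.2 j y * kap g.2 k x := by
  obtain ⟨K, _, _, hK, hK'⟩ :=
    h.summand_Fl.exists_complement (isSummandOfRank_perp hv) (h.perp_le hg hv)
  obtain ⟨x', hx', hxx'⟩ := hK' ⟨x, hx⟩
  obtain ⟨y', hy', hyy'⟩ := hK' ⟨y, hy⟩
  have h0 : ∀ j (z : s.Dbl R), z ∈ perp g.2 → kap g.2 j z = 0 := by
    intro j z hz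
    rw [mem_perp] at hz
    cases j with
    | none => exact hz.2
    | some j => exact congrFun hz.1 j
  have h1 : ∀ p : PrimeSpectrum R, Module.rankAtStalk (R := R) K p = 1 := fun p => by
    have := hK p
    have := s.le
    omega
  have hx1 : ∀ j, kap g.2 j x = kap g.2 j x' := fun j => sub_eq_zero.1 (by
    rw [← map_sub]; exact h0 j _ hxx')
  have hy1 : ∀ j, kap g.2 j y = kap g.2 j y' := fun j => sub_eq_zero.1 (by
    rw [← map_sub]; exact h0 j _ hyy')
  rw [hx1, hx1, hy1, hy1]
  exact mul_eq_mul_of_rank_one h1 (kap g.2 j ∘ₗ Fl.subtype ∘ₗ K.subtype)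
    (kap g.2 k ∘ₗ Fl.subtype ∘ₗ K.subtype) ⟨x', hx'⟩ ⟨y', hy'⟩

/-- A normalized generator of `G` and an element of `F_ℓ` with `j`-th coordinate `1` determine the
whole point; each chart equation is the vanishing of a pairing between `F_{n-ℓ}` and `F_ℓ` or an
inclusion between the submodules. -/
theorem exists_tup {j : Option (Fin s.n)} {x₀ : s.Dbl R} (hx₀ : x₀ ∈ Fl)
    (hj : kap g.2 j x₀ = 1) :
    ∃ T : Tup s R, T.Ok ϖ i j ∧ T.Fl = Fl ∧ T.Fnl = Fnl ∧ T.G ϖ = G := by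
  have hkap : ∀ k, ∀ x ∈ Fl, kap g.2 k x = kap g.2 j x * kap g.2 k x₀ := fun k x hx => by
    have := h.kap_mul_kap hg hv j k hx hx₀
    rw [hj, one_mul] at this
    exact this.symm
  let T : Tup s R := ⟨g.2, x₀.1, s.form g.2 x₀.2, s.tilt ϖ x₀.1 i⟩
  have hwc : ∀ k, T.wc k = kap g.2 k x₀ := fun k => by cases k <;> rfl
  have hFl : T.Fl = Fl := by
    ext x
    constructor
    · rintro ⟨μ, h1, h2⟩
      have : x - μ • x₀ ∈ perp g.2 := by
        rw [mem_perp]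
        refine ⟨by simp [h1, T], ?_⟩
        change s.form g.2 x.2 = _ at h2
        simp [h2, T]
      have := Fl.add_mem (h.perp_le hg hv this) (Fl.smul_mem μ hx₀)
      simpa using this
    · intro hx
      exact ⟨kap g.2 j x, funext fun k => hkap (some k) x hx, hkap none x hx⟩
  have hup := h.up_mem x₀ hx₀
  have htilt : s.tilt ϖ x₀.1 = T.l • T.v := h.fst_eq hg hv hup
  -- Pair the generator of `G`, which lies in `F_{n-ℓ}`, with `x₀`.
  have hform : s.form g.2 x₀.1 = 2 * ϖ * s.form g.2 x₀.2 := by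
    have := h.pair_eq (h.G_le hg) hx₀
    rw [s.pair_apply, h.sub_eq g hg] at this
    simp only [map_smul, LinearMap.smul_apply, smul_eq_mul] at this
    linear_combination this
  -- Pair `up x₀` with `x₀` itself: the two mixed terms of `pair_up` are both `l c`.
  have hquad : s.quad x₀.1 = 2 * T.l * T.c := by
    have := h.pair_eq hup hx₀
    rw [s.pair_up, htilt] at this
    simp only [map_smul, LinearMap.smul_apply, smul_eq_mul] at this
    change s.form _ _ = _
    change _ - T.l * T.c - T.l * T.c = 0 at this
    linear_combination this
  have hFnl' : ∀ μ : R, ∀ b, s.form (s.hat 1 x₀.1) b = μ * T.c → ((μ • g.2, b) : s.Dbl R) ∈ Fnl := by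
    intro μ b hb
    rw [h.orth, ← hFl]
    rintro x ⟨μ', h1, h2⟩
    rw [← s.form_swap] at hb
    rw [s.pair_apply, h1]
    simp only [map_smul, LinearMap.smul_apply, smul_eq_mul]
    change μ' * s.form b x₀.1 - μ * s.form g.2 x.2 = 0
    change s.form g.2 x.2 = _ at h2
    rw [hb, h2]
    ring
  -- This is the orthogonality of `F_{n-ℓ}` and of the image of `F_{n-ℓ}` under `down`; the minors
  -- come from evaluating it on basis vectors.
  have hiso : ∀ μ b μ' b', s.form (s.hat 1 x₀.1) b = μ * T.c → s.form (s.hat 1 x₀.1) b' = μ' * T.c →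
      μ * s.form (s.hat ϖ g.2) b' = μ' * s.form (s.hat ϖ g.2) b := by
    intro μ b μ' b' hb hb'
    have := h.pair_eq (hFnl' μ' b' hb') (h.down_mem _ (hFnl' μ b hb))
    rw [s.pair_down, s.mid_smul, s.mid_smul, ← smul_sub, ← smul_sub] at this
    simp only [s.hat_smul, map_smul, LinearMap.smul_apply, s.form_out_self, smul_eq_mul,
      mul_zero, sub_zero] at this
    linear_combination this
  have hsingle : ∀ (x : s.Vec R) k, s.form x (Pi.single k.rev (s.sgn k)) = x k := fun x k => by
    rw [s.form_single]; linear_combination x k * s.sgn_mul_self (R := R) k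
  have hOk : T.Ok ϖ i j := by
    refine ⟨hv, by rw [hwc, hj], hform, fun k => congrFun htilt k, hquad, fun k k' => ?_⟩
    change s.hat ϖ g.2 k * s.hat 1 x₀.1 k' = s.hat ϖ g.2 k' * s.hat 1 x₀.1 k
    cases j with
    | none =>
      have hc : T.c = 1 := hj
      have := hiso (s.hat 1 x₀.1 k) (Pi.single k.rev (s.sgn k)) (s.hat 1 x₀.1 k')
        (Pi.single k'.rev (s.sgn k')) (by rw [hsingle, hc, mul_one]) (by rw [hsingle, hc, mul_one])
      rw [hsingle, hsingle] at this
      linear_combination -this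
    | some j =>
      have hw : x₀.1 j = 1 := hj
      have hj2 : s.hat 1 x₀.1 j * s.hat 1 x₀.1 j = 1 := by
        simp only [Shape.hat, hw]; split_ifs <;> ring
      -- `s.hat ϖ g.2` is proportional to `s.hat 1 x₀.1`
      have hprop : ∀ k, s.hat ϖ g.2 k * s.hat 1 x₀.1 j = s.hat ϖ g.2 j * s.hat 1 x₀.1 k := by
        intro k
        -- The first vector pairs to zero with `hat 1 w`, so its multiplier is `0`; the second pairs
        -- to `c`, so its multiplier is `1`. The identity then says that `hat ϖ v` also kills the
        -- first vector.
        have h1 := hiso 0 (s.hat 1 x₀.1 j • Pi.single k.rev (s.sgn k) -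
            s.hat 1 x₀.1 k • Pi.single j.rev (s.sgn j)) 1
          ((s.hat 1 x₀.1 j * T.c) • Pi.single j.rev (s.sgn j))
          (by simp [hsingle, mul_comm])
          (by rw [map_smul, hsingle, smul_eq_mul]; linear_combination T.c * hj2)
        simp only [map_sub, map_smul, hsingle, smul_eq_mul] at h1
        linear_combination -h1
      linear_combination s.hat 1 x₀.1 j * (s.hat 1 x₀.1 k' * hprop k - s.hat 1 x₀.1 k * hprop k')
        - (s.hat ϖ g.2 k * s.hat 1 x₀.1 k' - s.hat ϖ g.2 k' * s.hat 1 x₀.1 k) * hj2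
  refine ⟨T, hOk, hFl, ?_, ?_⟩
  · rw [← hOk.leftOrth_Fl, hFl, h.orth]
  · rw [h.G_eq hg hv, Tup.G, Tup.gen]
    congr 2
    exact Prod.ext (h.sub_eq g hg).symm rfl

end IsPt

namespace Tup

variable {ϖ : R} {i : Fin s.n} {j : Option (Fin s.n)} {T T' : Tup s R}

/-- The normalizations at `i` and `j` remove the scalars by which `v` and `(w, c)` could differ, and
`l` is read off from the `i`-th tilt equation. -/
theorem Ok.ext (h : T.Ok ϖ i j) (h' : T'.Ok ϖ i j) (hFl : T.Fl = T'.Fl) (hG : T.G ϖ = T'.G ϖ) :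
    T = T' := by
  have hv : T.v = T'.v := by
    have h1 : T.gen ϖ ∈ T'.G ϖ := hG ▸ Submodule.mem_span_singleton_self _
    obtain ⟨μ, hμ⟩ := Submodule.mem_span_singleton.1 h1
    have h2 : μ • T'.v = T.v := congrArg Prod.snd hμ
    have h3 := congrFun h2 i
    rw [Pi.smul_apply, h.v_eq, h'.v_eq, smul_eq_mul, mul_one] at h3
    rw [← h2, h3, one_smul]
  obtain ⟨r, hr⟩ := h.exists_form_eq T.c
  have h1 : ((T.w, r) : s.Dbl R) ∈ T'.Fl := hFl ▸ mem_Fl.2 ⟨1, by simp, by simp [hr]⟩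
  obtain ⟨μ, h2, h3⟩ := h1
  dsimp only at h2 h3
  rw [← hv, hr] at h3
  have h4 : ∀ k, T.wc k = μ * T'.wc k := by
    intro k
    cases k with
    | none => exact h3
    | some k => exact congrFun h2 k
  have h5 := h4 j
  rw [h.wc_eq, h'.wc_eq, mul_one] at h5
  subst h5
  have hw : T.w = T'.w := by rw [h2, one_smul]
  refine Tup.ext hv hw (by rw [h3, one_mul]) ?_
  have h6 := h.tilt_eq i
  rw [h.v_eq, hw, h'.tilt_eq, h'.v_eq] at h6
  simpa using h6.symm

end Tup

end Splitting

end

noncomputable section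

namespace Splitting

/-! ### ### Base change of points and of tuples -/

variable (s : Shape) {R R' R'' : Type u} [CommRing R] [CommRing R'] [CommRing R'']

namespace Shape

/-- Applying a ring homomorphism to coordinates. -/
def dmap (φ : R →+* R') : s.Dbl R →ₛₗ[φ] s.Dbl R' where
  toFun x := (fun k => φ (x.1 k), fun k => φ (x.2 k))
  map_add' x y := by ext <;> simp
  map_smul' c x := by ext <;> simp

theorem dmap_fst (φ : R →+* R') (x : s.Dbl R) : (s.dmap φ x).1 = φ ∘ x.1 := rfl

theorem dmap_snd (φ : R →+* R') (x : s.Dbl R) : (s.dmap φ x).2 = φ ∘ x.2 := rfl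

theorem map_form (φ : R →+* R') (x y : s.Vec R) :
    φ (s.form x y) = s.form (φ ∘ x) (φ ∘ y) := by
  simp [form_apply, map_sgn]

theorem map_tilt (φ : R →+* R') (ϖ : R) (x : s.Vec R) :
    φ ∘ s.tilt ϖ x = s.tilt (φ ϖ) (φ ∘ x) := by
  ext k; simp only [tilt, Function.comp_apply]; split_ifs <;> simp

theorem map_hat (φ : R →+* R') (ϖ : R) (x : s.Vec R) :
    φ ∘ s.hat ϖ x = s.hat (φ ϖ) (φ ∘ x) := by
  ext k; simp only [hat, Function.comp_apply]; split_ifs <;> simp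

theorem map_mid (φ : R →+* R') (x : s.Vec R) : φ ∘ s.mid x = s.mid (φ ∘ x) := by
  ext k; simp only [mid, Function.comp_apply]; split_ifs <;> simp

theorem map_quad (φ : R →+* R') (x : s.Vec R) : φ (s.quad x) = s.quad (φ ∘ x) := by
  rw [quad, map_form, map_mid, quad]

theorem map_pair (φ : R →+* R') (x y : s.Dbl R) :
    φ (s.pair x y) = s.pair (s.dmap φ x) (s.dmap φ y) := by
  rw [pair_apply, map_sub, map_form, map_form]; rfl

theorem dmap_up (φ : R →+* R') (ϖ : R) (x : s.Dbl R) :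
    s.dmap φ (s.up ϖ x) = s.up (φ ϖ) (s.dmap φ x) := by
  ext k <;> simp only [dmap, up, tilt, LinearMap.coe_mk, AddHom.coe_mk] <;> split_ifs <;> simp

theorem dmap_down (φ : R →+* R') (ϖ : R) (x : s.Dbl R) :
    s.dmap φ (s.down ϖ x) = s.down (φ ϖ) (s.dmap φ x) := by
  ext k <;> simp only [dmap, down, LinearMap.coe_mk, AddHom.coe_mk] <;> split_ifs <;> simp

theorem isBaseChange_dmap [Algebra R R'] :
    IsBaseChange R' ({ s.dmap (algebraMap R R') with
      map_smul' := fun c x => by ext <;> simp [dmap, Algebra.smul_def] } : s.Dbl R →ₗ[R] s.Dbl R') :=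
  IsBaseChange.of_equiv ((TensorProduct.prodRight R R' R' (s.Vec R) (s.Vec R)).trans
    ((TensorProduct.piScalarRight R R' R' (Fin s.n)).prodCongr
      (TensorProduct.piScalarRight R R' R' (Fin s.n)))) fun x => by
    ext <;> simp [dmap, Algebra.smul_def]

end Shape

variable {s}

/-- The base change of a submodule along a ring homomorphism. -/
def pull (φ : R →+* R') (N : Submodule R (s.Dbl R)) : Submodule R' (s.Dbl R') :=
  Submodule.span R' (s.dmap φ '' (N : Set (s.Dbl R)))

theorem dmap_mem_pull (φ : R →+* R') {N : Submodule R (s.Dbl R)} {x : s.Dbl R} (hx : x ∈ N) :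
    s.dmap φ x ∈ pull φ N := Submodule.subset_span ⟨x, hx, rfl⟩

theorem pull_le_iff {φ : R →+* R'} {N : Submodule R (s.Dbl R)} {N' : Submodule R' (s.Dbl R')} :
    pull φ N ≤ N' ↔ ∀ x ∈ N, s.dmap φ x ∈ N' := by
  rw [pull, Submodule.span_le, Set.image_subset_iff]
  rfl

theorem pull_id (N : Submodule R (s.Dbl R)) : pull (RingHom.id R) N = N :=
  le_antisymm (pull_le_iff.2 fun _ hx => hx) fun _ hx => dmap_mem_pull (RingHom.id R) hx

theorem pull_pull (φ : R →+* R') (ψ : R' →+* R'') (N : Submodule R (s.Dbl R)) :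
    pull ψ (pull φ N) = pull (ψ.comp φ) N := by
  apply le_antisymm
  · rw [pull_le_iff]
    intro x hx
    induction hx using Submodule.span_induction with
    | mem x hx =>
      obtain ⟨y, hy, rfl⟩ := hx
      exact dmap_mem_pull (ψ.comp φ) hy
    | zero => rw [map_zero]; exact Submodule.zero_mem _
    | add x y _ _ hx hy => rw [map_add]; exact Submodule.add_mem _ hx hy
    | smul c x _ hx => rw [LinearMap.map_smulₛₗ]; exact Submodule.smul_mem _ _ hx
  · exact pull_le_iff.2 fun x hx => dmap_mem_pull ψ (dmap_mem_pull φ hx)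

theorem IsSummandOfRank.pull (φ : R →+* R') {N : Submodule R (s.Dbl R)} {d : ℕ}
    (h : IsSummandOfRank N d) : IsSummandOfRank (pull φ N) d := by
  let := φ.toAlgebra
  exact h.baseChange (s.isBaseChange_dmap (R := R) (R' := R'))

theorem linearMap_mem_of_pull {φ : R →+* R'} {N : Submodule R (s.Dbl R)}
    {N' : Submodule R' (s.Dbl R')} (f : s.Dbl R' →ₗ[R'] s.Dbl R')
    (h : ∀ x ∈ N, f (s.dmap φ x) ∈ N') : ∀ x ∈ Splitting.pull φ N, f x ∈ N' :=
  show Splitting.pull φ N ≤ N'.comap f from pull_le_iff.2 h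

/-- One inclusion is formal, and both sides are summands of rank `n`. -/
theorem leftOrth_pull (φ : R →+* R') {N : Submodule R (s.Dbl R)} (h : IsSummandOfRank N s.n) :
    pull φ (leftOrth s.pair N) = leftOrth s.pair (pull φ N) := by
  have h1 := (isSummandOfRank_leftOrth s.pair_bijective h s.rankAtStalk_dbl).pull φ
  have h2 := isSummandOfRank_leftOrth s.pair_bijective (h.pull φ) s.rankAtStalk_dbl
  refine h2.eq_of_le h1 (pull_le_iff.2 fun x hx => ?_)
  have : pull φ N ≤ LinearMap.ker (s.pair (s.dmap φ x)) := by
    rw [pull_le_iff]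
    intro y hy
    rw [LinearMap.mem_ker, ← s.map_pair, hx y hy, map_zero]
  exact this

theorem IsPt.pull {ϖ : R} {Fl Fnl G : Submodule R (s.Dbl R)} (h : IsPt s ϖ Fl Fnl G)
    (φ : R →+* R') : IsPt s (φ ϖ) (pull φ Fl) (pull φ Fnl) (pull φ G) where
  summand_Fl := h.summand_Fl.pull φ
  summand_Fnl := h.summand_Fnl.pull φ
  summand_G := h.summand_G.pull φ
  up_mem := linearMap_mem_of_pull _ fun x hx => by
    rw [← s.dmap_up]; exact dmap_mem_pull φ (h.up_mem x hx)
  down_mem := linearMap_mem_of_pull _ fun x hx => by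
    rw [← s.dmap_down]; exact dmap_mem_pull φ (h.down_mem x hx)
  orth := by rw [h.orth, leftOrth_pull φ h.summand_Fl]
  G_le := pull_le_iff.2 fun x hx => dmap_mem_pull φ (h.G_le hx)
  add_mem := linearMap_mem_of_pull
    (LinearMap.prod ((2 * φ ϖ) • LinearMap.fst R' _ _) (LinearMap.fst R' _ _)) fun x hx => by
      have := dmap_mem_pull φ (h.add_mem x hx)
      convert this using 1
      ext <;> simp [Shape.dmap, map_ofNat]
  sub_eq := by
    have : Splitting.pull φ G ≤ LinearMap.ker
        (LinearMap.fst R' (s.Vec R') (s.Vec R') - (2 * φ ϖ) • LinearMap.snd R' _ _) := by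
      rw [pull_le_iff]
      intro x hx
      have := h.sub_eq x hx
      rw [LinearMap.mem_ker]
      simp only [LinearMap.sub_apply, LinearMap.smul_apply, LinearMap.fst_apply,
        LinearMap.snd_apply, Shape.dmap_fst, Shape.dmap_snd, this]
      ext k
      simp [map_ofNat]
    intro x hx
    exact sub_eq_zero.1 (this hx)

namespace Tup

/-- Applying a ring homomorphism to the coordinates of a point. -/
def map (φ : R →+* R') (T : Tup s R) : Tup s R' := ⟨φ ∘ T.v, φ ∘ T.w, φ T.c, φ T.l⟩

variable {ϖ : R} {i : Fin s.n} {j : Option (Fin s.n)} {T : Tup s R}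

theorem Ok.map (h : T.Ok ϖ i j) (φ : R →+* R') : (T.map φ).Ok (φ ϖ) i j where
  v_eq := by simp [Tup.map, h.v_eq]
  wc_eq := by
    have := congrArg φ h.wc_eq
    cases j <;> simpa [Tup.map, wc] using this
  form_eq := by
    simp only [Tup.map]
    rw [← s.map_form, h.form_eq]; simp [map_ofNat]
  tilt_eq k := by
    have := congrArg φ (h.tilt_eq k)
    rw [map_mul] at this
    exact (congrFun (s.map_tilt φ ϖ T.w) k).symm.trans this
  quad_eq := by
    simp only [Tup.map]
    rw [← s.map_quad, h.quad_eq]; simp [map_ofNat]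
  minor_eq k k' := by
    have := congrArg φ (h.minor_eq k k')
    rw [map_mul, map_mul] at this
    simp only [Tup.map]
    rw [← s.map_hat, ← map_one φ, ← s.map_hat]
    exact this

theorem Ok.pull_G (φ : R →+* R') : pull φ (T.G ϖ) = (T.map φ).G (φ ϖ) := by
  have hg : s.dmap φ (T.gen ϖ) = (T.map φ).gen (φ ϖ) := by
    ext <;> simp [gen, Shape.dmap, Tup.map, map_ofNat]
  apply le_antisymm
  · rw [pull_le_iff]
    intro x hx
    obtain ⟨a, rfl⟩ := Submodule.mem_span_singleton.1 hx
    rw [LinearMap.map_smulₛₗ, hg]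
    exact Submodule.smul_mem _ _ (Submodule.mem_span_singleton_self _)
  · rw [G, Submodule.span_singleton_le_iff_mem, ← hg]
    exact dmap_mem_pull φ (Submodule.mem_span_singleton_self _)

theorem Ok.pull_Fl (h : T.Ok ϖ i j) (φ : R →+* R') : pull φ T.Fl = (T.map φ).Fl := by
  refine (h.map φ).isSummandOfRank_Fl.eq_of_le (h.isSummandOfRank_Fl.pull φ)
    (pull_le_iff.2 ?_)
  rintro x ⟨μ, h1, h2⟩
  refine ⟨φ μ, ?_, ?_⟩
  · rw [s.dmap_fst, h1]; ext k; simp [Tup.map]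
  · have := congrArg φ h2
    rw [s.map_form, map_mul] at this
    exact this

theorem Ok.pull_Fnl (h : T.Ok ϖ i j) (φ : R →+* R') : pull φ T.Fnl = (T.map φ).Fnl := by
  rw [← h.leftOrth_Fl, leftOrth_pull φ h.isSummandOfRank_Fl, h.pull_Fl φ, (h.map φ).leftOrth_Fl]

end Tup

/-! ### The functor -/

variable (s) {O : Type u} [CommRing O] (π : O)

/-- A point of the splitting model over `R`, together with a structure of `O`-algebra on `R`. -/
@[ext]
structure Pt (R : Type u) [CommRing R] where
  ρ : O →+* R
  Fl : Submodule R (s.Dbl R)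
  Fnl : Submodule R (s.Dbl R)
  G : Submodule R (s.Dbl R)
  isPt : IsPt s (ρ π) Fl Fnl G

variable {s π}

/-- The base change of a point. -/
@[simps]
def Pt.map (φ : R →+* R') (ξ : Pt s π R) : Pt s π R' where
  ρ := φ.comp ξ.ρ
  Fl := pull φ ξ.Fl
  Fnl := pull φ ξ.Fnl
  G := pull φ ξ.G
  isPt := ξ.isPt.pull φ

theorem Pt.map_id (ξ : Pt s π R) : ξ.map (RingHom.id R) = ξ := by
  ext1 <;> simp [pull_id]

theorem Pt.map_map (φ : R →+* R') (ψ : R' →+* R'') (ξ : Pt s π R) :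
    (ξ.map φ).map ψ = ξ.map (ψ.comp φ) := by
  ext1 <;> simp [pull_pull, RingHom.comp_assoc]

/-- The point with the given coordinates. -/
@[simps]
def Tup.Ok.pt {T : Tup s R} {i : Fin s.n} {j : Option (Fin s.n)} {ρ : O →+* R}
    (h : T.Ok (ρ π) i j) : Pt s π R where
  ρ := ρ
  Fl := T.Fl
  Fnl := T.Fnl
  G := T.G (ρ π)
  isPt := h.isPt

theorem Tup.Ok.map_pt {T : Tup s R} {i : Fin s.n} {j : Option (Fin s.n)} {ρ : O →+* R}
    (h : T.Ok (ρ π) i j) (φ : R →+* R') :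
    h.pt.map φ = Tup.Ok.pt (s := s) (ρ := φ.comp ρ) (π := π) (h.map φ) := by
  ext1
  · rfl
  · exact h.pull_Fl φ
  · exact h.pull_Fnl φ
  · exact Tup.Ok.pull_G φ

/-! ### Functorial ideals -/

/-- The ideal of values of a functional on a submodule. -/
def linIdeal (N : Submodule R (s.Dbl R)) (f : s.Dbl R →ₗ[R] R) : Ideal R :=
  Ideal.span (f '' N)

theorem linIdeal_pull (φ : R →+* R') (N : Submodule R (s.Dbl R)) (f : s.Dbl R →ₗ[R] R)
    (f' : s.Dbl R' →ₗ[R'] R') (hf : ∀ x, f' (s.dmap φ x) = φ (f x)) :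
    linIdeal (pull φ N) f' = (linIdeal N f).map φ := by
  apply le_antisymm
  · rw [linIdeal, Ideal.span_le]
    rintro _ ⟨x, hx, rfl⟩
    refine (pull_le_iff (N' := Submodule.comap f' ((linIdeal N f).map φ))).2 (fun y hy => ?_) hx
    rw [Submodule.mem_comap, hf]
    exact Ideal.mem_map_of_mem _ (Ideal.subset_span ⟨y, hy, rfl⟩)
  · rw [linIdeal, Ideal.map_span, Ideal.span_le]
    rintro _ ⟨_, ⟨x, hx, rfl⟩, rfl⟩
    exact Ideal.subset_span ⟨_, dmap_mem_pull φ hx, hf x⟩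

theorem linIdeal_le_iff {N : Submodule R (s.Dbl R)} {f : s.Dbl R →ₗ[R] R} {I : Ideal R} :
    linIdeal N f ≤ I ↔ ∀ x ∈ N, f x ∈ I := by
  rw [linIdeal, Ideal.span_le, Set.image_subset_iff]
  rfl

/-- The values of a functional on a submodule already form an ideal, so a unit ideal yields the
value `1` exactly and no further localization is needed. -/
theorem exists_of_linIdeal_eq_top {N : Submodule R (s.Dbl R)} {f : s.Dbl R →ₗ[R] R}
    (h : linIdeal N f = ⊤) : ∃ x ∈ N, f x = 1 := by
  have h1 : linIdeal N f ≤ N.map f := by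
    rw [linIdeal_le_iff]
    exact fun x hx => ⟨x, hx, rfl⟩
  exact h1 (h ▸ Submodule.mem_top : (1 : R) ∈ linIdeal N f)

/-- The ideal generated by the values of a bilinear form on two submodules. -/
def bilIdeal (N N' : Submodule R (s.Dbl R)) (f : s.Dbl R →ₗ[R] s.Dbl R →ₗ[R] R) : Ideal R :=
  Ideal.span (Set.image2 (fun x y => f x y) N N')

theorem bilIdeal_pull (φ : R →+* R') (N N₁ : Submodule R (s.Dbl R)) (f : s.Dbl R →ₗ[R] s.Dbl R →ₗ[R] R)
    (f' : s.Dbl R' →ₗ[R'] s.Dbl R' →ₗ[R'] R')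
    (hf : ∀ x y, f' (s.dmap φ x) (s.dmap φ y) = φ (f x y)) :
    bilIdeal (pull φ N) (pull φ N₁) f' = (bilIdeal N N₁ f).map φ := by
  apply le_antisymm
  · rw [bilIdeal, Ideal.span_le]
    rintro _ ⟨x, hx, y, hy, rfl⟩
    have h1 : ∀ x ∈ N, ∀ y ∈ pull φ N₁, f' (s.dmap φ x) y ∈ (bilIdeal N N₁ f).map φ := by
      intro x hx y hy
      refine (pull_le_iff (N' := Submodule.comap (f' (s.dmap φ x))
        ((bilIdeal N N₁ f).map φ))).2 (fun y hy => ?_) hy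
      rw [Submodule.mem_comap, hf]
      exact Ideal.mem_map_of_mem _ (Ideal.subset_span ⟨x, hx, y, hy, rfl⟩)
    exact (pull_le_iff (N' := Submodule.comap (f'.flip y)
      ((bilIdeal N N₁ f).map φ))).2 (fun x hx => h1 x hx y hy) hx
  · rw [bilIdeal, Ideal.map_span, Ideal.span_le]
    rintro _ ⟨_, ⟨x, hx, y, hy, rfl⟩, rfl⟩
    exact Ideal.subset_span ⟨_, dmap_mem_pull φ hx, _, dmap_mem_pull φ hy, hf x y⟩

theorem bilIdeal_le_iff {N N' : Submodule R (s.Dbl R)} {f : s.Dbl R →ₗ[R] s.Dbl R →ₗ[R] R} {I : Ideal R} :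
    bilIdeal N N' f ≤ I ↔ ∀ x ∈ N, ∀ y ∈ N', f x y ∈ I := by
  rw [bilIdeal, Ideal.span_le, Set.image2_subset_iff]
  rfl

variable (s π)

/-- The functor of points of the splitting model. -/
def ptFunctor : RingFunctor.{u} where
  obj R := Pt s π R
  map φ ξ := ξ.map φ.hom
  map_id ξ := ξ.map_id
  map_comp f g ξ := (ξ.map_map f.hom g.hom).symm

/-- The coordinates of the second component. -/
def sndCoord (i : Fin s.n) : s.Dbl R →ₗ[R] R := LinearMap.proj i ∘ₗ LinearMap.snd R _ _

/-- The coordinates of the first component. -/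
def fstCoord (i : Fin s.n) : s.Dbl R →ₗ[R] R := LinearMap.proj i ∘ₗ LinearMap.fst R _ _

/-- The form `h` on second components. -/
def sndForm : s.Dbl R →ₗ[R] s.Dbl R →ₗ[R] R :=
  s.form.compl₁₂ (LinearMap.snd R _ _) (LinearMap.snd R _ _)

/-- The ideal of the `i`-th coordinates of the elements of `G`. -/
def vIdeal (i : Fin s.n) : IdealRule (ptFunctor s π) where
  ideal ξ := linIdeal (Pt.G ξ) (sndCoord s i)
  map φ ξ := linIdeal_pull φ.hom (Pt.G ξ) _ _ fun _ => rfl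

/-- The ideal of the values `h(v, b)` for `v` in `G` and `(a, b)` in `F_ℓ`, or of the `j`-th
coordinates of the elements of `F_ℓ`. -/
def wIdeal : Option (Fin s.n) → IdealRule (ptFunctor s π)
  | none =>
    { ideal ξ := bilIdeal (Pt.G ξ) (Pt.Fl ξ) (sndForm s)
      map φ ξ := bilIdeal_pull φ.hom (Pt.G ξ) (Pt.Fl ξ) _ _
        fun x y => (s.map_form φ.hom x.2 y.2).symm }
  | some j =>
    { ideal ξ := linIdeal (Pt.Fl ξ) (fstCoord s j)
      map φ ξ := linIdeal_pull φ.hom (Pt.Fl ξ) _ _ fun _ => rfl }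

/-- The product of two functorial ideals. -/
def IdealRule.mul {S : RingFunctor.{u}} (D D' : IdealRule S) : IdealRule S where
  ideal ξ := D.ideal ξ * D'.ideal ξ
  map φ ξ := by rw [D.map, D'.map, Ideal.map_mul]

/-- The ideal of the complement of a chart. -/
def chartIdeal (p : Fin s.n × Option (Fin s.n)) : IdealRule (ptFunctor s π) :=
  (vIdeal s π p.1).mul (wIdeal s π p.2)

variable {s π}

theorem Tup.Ok.vIdeal_pt {R : CommRingCat.{u}} {T : Tup s R} {i : Fin s.n} {j : Option (Fin s.n)}
    {ρ : O →+* R} (h : T.Ok (ρ π) i j) (i' : Fin s.n) :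
    (vIdeal s π i').ideal h.pt = Ideal.span {T.v i'} := by
  apply le_antisymm
  · refine linIdeal_le_iff.2 fun x hx => ?_
    obtain ⟨a, rfl⟩ := Submodule.mem_span_singleton.1 hx
    exact Ideal.mul_mem_left _ a (Ideal.mem_span_singleton_self _)
  · rw [Ideal.span_singleton_le_iff_mem]
    exact Ideal.subset_span ⟨_, Submodule.mem_span_singleton_self _, rfl⟩

theorem Tup.Ok.wIdeal_pt {R : CommRingCat.{u}} {T : Tup s R} {i : Fin s.n} {j : Option (Fin s.n)}
    {ρ : O →+* R} (h : T.Ok (ρ π) i j) (j' : Option (Fin s.n)) :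
    (wIdeal s π j').ideal h.pt = Ideal.span {T.wc j'} := by
  obtain ⟨r, hr⟩ := h.exists_form_eq T.c
  have hmem : ((T.w, r) : s.Dbl R) ∈ T.Fl := ⟨1, by simp, by simp [hr]⟩
  cases j' with
  | none =>
    apply le_antisymm
    · refine bilIdeal_le_iff.2 fun x hx y hy => ?_
      change s.form x.2 y.2 ∈ _
      obtain ⟨a, rfl⟩ := Submodule.mem_span_singleton.1 hx
      obtain ⟨μ, h1, h2⟩ := hy
      have : s.form (a • T.gen (ρ π)).2 y.2 = a * μ * T.c := by
        change s.form (a • T.v) y.2 = _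
        rw [map_smul, LinearMap.smul_apply, h2, smul_eq_mul, mul_assoc]
      rw [this]
      exact Ideal.mul_mem_left _ _ (Ideal.mem_span_singleton_self _)
    · rw [Ideal.span_singleton_le_iff_mem]
      exact Ideal.subset_span ⟨_, Submodule.mem_span_singleton_self _, _, hmem, hr⟩
  | some j' =>
    apply le_antisymm
    · refine linIdeal_le_iff.2 fun x hx => ?_
      obtain ⟨μ, h1, h2⟩ := hx
      change x.1 j' ∈ _
      rw [h1]
      exact Ideal.mul_mem_left _ _ (Ideal.mem_span_singleton_self _)
    · rw [Ideal.span_singleton_le_iff_mem]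
      exact Ideal.subset_span ⟨_, hmem, rfl⟩

theorem Tup.Ok.chartIdeal_pt {R : CommRingCat.{u}} {T : Tup s R} {i : Fin s.n}
    {j : Option (Fin s.n)} {ρ : O →+* R} (h : T.Ok (ρ π) i j) (p : Fin s.n × Option (Fin s.n)) :
    (chartIdeal s π p).ideal h.pt = Ideal.span {T.v p.1 * T.wc p.2} := by
  change _ * _ = _
  rw [h.vIdeal_pt, h.wIdeal_pt, Ideal.span_singleton_mul_span_singleton]

/-- A product of ideals is the unit ideal only if both factors are; they supply the normalized
elements required by `IsPt.exists_tup`. -/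
theorem exists_tup_of_chartIdeal {R : CommRingCat.{u}} (ξ : Pt s π R)
    (p : Fin s.n × Option (Fin s.n)) (h : (chartIdeal s π p).ideal ξ = ⊤) :
    ∃ (T : Tup s R) (hT : T.Ok (ξ.ρ π) p.1 p.2), hT.pt = ξ := by
  have hI : (vIdeal s π p.1).ideal ξ = ⊤ := eq_top_iff.2 (h.symm.trans_le Ideal.mul_le_left)
  have hJ : (wIdeal s π p.2).ideal ξ = ⊤ := eq_top_iff.2 (h.symm.trans_le Ideal.mul_le_right)
  obtain ⟨g, hg, hv⟩ := exists_of_linIdeal_eq_top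
    (f := sndCoord s p.1) hI
  have hJ' : ∃ x ∈ ξ.Fl, kap g.2 p.2 x = 1 := by
    obtain ⟨i, j⟩ := p
    cases j with
    | none =>
      refine exists_of_linIdeal_eq_top (eq_top_iff.2 (hJ.symm.trans_le ?_))
      refine bilIdeal_le_iff.2 fun x hx y hy => ?_
      -- All of `G` consists of multiples of `g`, so the values of the bilinear form are multiples
      -- of the values of the functional attached to `g`.
      rw [ξ.isPt.eq_smul hg hv hx, map_smul, LinearMap.smul_apply]
      exact Ideal.mul_mem_left _ _ (Ideal.subset_span ⟨y, hy, rfl⟩)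
    | some j => exact exists_of_linIdeal_eq_top (f := kap g.2 (some j)) hJ
  obtain ⟨x, hx, hj⟩ := hJ'
  obtain ⟨T, hT, h1, h2, h3⟩ := ξ.isPt.exists_tup hg hv hx hj
  exact ⟨T, hT, by ext1 <;> simp [h1, h2, h3]⟩

end Splitting

end

noncomputable section

namespace Splitting

variable {s : Shape} {R : Type u} [CommRing R]

/-! ### Localization of submodules -/

/-- The localization map on coordinates. -/
def awayMap (s : Shape) (f : R) : s.Dbl R →ₗ[R] s.Dbl (Localization.Away f) :=
  { s.dmap (algebraMap R (Localization.Away f)) with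
    map_smul' := fun c x => by ext <;> simp [Shape.dmap, Algebra.smul_def] }

instance (f : R) : IsLocalizedModule (.powers f) (awayMap s f) :=
  (isLocalizedModule_iff_isBaseChange (.powers f) (Localization.Away f) _).2 s.isBaseChange_dmap

/-- The base change of a submodule to a localization. -/
abbrev loc (f : R) (N : Submodule R (s.Dbl R)) :
    Submodule (Localization.Away f) (s.Dbl (Localization.Away f)) :=
  pull (algebraMap R (Localization.Away f)) N

theorem localized'_eq_loc (f : R) (N : Submodule R (s.Dbl R)) :
    N.localized' (Localization.Away f) (.powers f) (awayMap s f) = loc f N :=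
  Submodule.localized'_eq_span _ _ _ _

theorem awayMap_mem_loc_iff {f : R} {N : Submodule R (s.Dbl R)} {x : s.Dbl R} :
    awayMap s f x ∈ loc f N ↔ ∃ k : ℕ, f ^ k • x ∈ N := by
  rw [← localized'_eq_loc, Submodule.mem_localized']
  constructor
  · rintro ⟨m, hm, ⟨_, k, rfl⟩, h⟩
    rw [IsLocalizedModule.mk'_eq_iff, Submonoid.smul_def, ← map_smul,
      IsLocalizedModule.eq_iff_exists (.powers f)] at h
    obtain ⟨⟨_, l, rfl⟩, h⟩ := h
    refine ⟨l + k, ?_⟩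
    simp only [Submonoid.smul_def] at h
    rw [pow_add, mul_smul, ← h]
    exact N.smul_mem _ hm
  · rintro ⟨k, hk⟩
    refine ⟨_, hk, ⟨_, k, rfl⟩, ?_⟩
    rw [IsLocalizedModule.mk'_eq_iff, map_smul]
    rfl

theorem exists_smul_eq_awayMap (f : R) (y : s.Dbl (Localization.Away f)) :
    ∃ (k : ℕ) (x : s.Dbl R), awayMap s f x = f ^ k • y := by
  obtain ⟨⟨x, ⟨_, k, rfl⟩⟩, h⟩ := IsLocalizedModule.surj (.powers f) (awayMap s f) y
  exact ⟨k, x, h.symm⟩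

theorem mem_of_forall_loc {S : Set R} (hS : Ideal.span S = ⊤) {N : Submodule R (s.Dbl R)}
    {x : s.Dbl R} (h : ∀ f ∈ S, awayMap s f x ∈ loc f N) : x ∈ N :=
  Submodule.mem_of_span_eq_top_of_smul_pow_mem N S hS x fun f => awayMap_mem_loc_iff.1 (h f f.2)

theorem eq_of_forall_loc {S : Set R} (hS : Ideal.span S = ⊤) {N N' : Submodule R (s.Dbl R)}
    (h : ∀ f ∈ S, loc f N = loc f N') : N = N' := by
  ext x
  exact ⟨fun hx => mem_of_forall_loc hS fun f hf => h f hf ▸ dmap_mem_pull _ hx,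
    fun hx => mem_of_forall_loc hS fun f hf => h f hf ▸ dmap_mem_pull _ hx⟩

theorem eq_of_forall_algebraMap {S : Set R} (hS : Ideal.span S = ⊤) {a b : R}
    (h : ∀ f ∈ S, algebraMap R (Localization.Away f) a = algebraMap R (Localization.Away f) b) :
    a = b := by
  rw [← sub_eq_zero, ← Ideal.mem_bot]
  refine Submodule.mem_of_span_eq_top_of_smul_pow_mem ⊥ S hS _ fun f => ?_
  obtain ⟨⟨_, k, rfl⟩, hk⟩ := (IsLocalization.eq_iff_exists (.powers (f : R))
    (Localization.Away (f : R))).1 (h f f.2)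
  exact ⟨k, by rw [Submodule.mem_bot, smul_eq_mul, mul_sub, sub_eq_zero]; exact hk⟩

/-- Being a direct summand of constant rank is local. -/
theorem isSummandOfRank_of_loc {S : Set R} (hS : Ideal.span S = ⊤) {N : Submodule R (s.Dbl R)}
    {d : ℕ} (h : ∀ f ∈ S, IsSummandOfRank (loc f N) d) : IsSummandOfRank N d := by
  have hQ : ∀ f : S, Module.Projective (Localization.Away (f : R))
      (s.Dbl (Localization.Away (f : R)) ⧸
        N.localized' (Localization.Away (f : R)) (.powers (f : R)) (awayMap s (f : R))) := by
    intro f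
    rw [localized'_eq_loc]
    obtain ⟨Q, hQ⟩ := (h f f.2).1
    have := projective_of_isCompl hQ.symm
    exact Module.Projective.of_equiv (Submodule.quotientEquivOfIsCompl _ _ hQ).symm
  have h1 : Module.FinitePresentation R (s.Dbl R ⧸ N) :=
    Module.FinitePresentation.of_localizationSpan' S hS
      (Rₚ := fun f => Localization.Away (f : R))
      (fun f => N.toLocalizedQuotient' (Localization.Away (f : R)) (.powers (f : R))
        (awayMap s (f : R))) fun f => by
      have := hQ f
      exact Module.finitePresentation_of_projective _ _
  have h2 : Module.Flat R (s.Dbl R ⧸ N) :=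
    Module.flat_of_isLocalized_span (R := R) (S := R) (M := s.Dbl R ⧸ N) S hS _
      (fun f => N.toLocalizedQuotient' (Localization.Away (f : R)) (.powers (f : R))
        (awayMap s (f : R))) fun f => by
      have := hQ f
      have : Module.Flat R (Localization.Away (f : R)) :=
        IsLocalization.flat _ (.powers (f : R))
      exact Module.Flat.trans R (Localization.Away (f : R)) _
  -- Finite presentation and flatness are local properties, whereas a complement is not itself a
  -- local datum. Projectivity of the quotient then splits the inclusion of `N`.
  have h3 : Module.Projective R (s.Dbl R ⧸ N) := Module.Flat.projective_of_finitePresentation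
  obtain ⟨g, hg⟩ := Module.projective_lifting_property N.mkQ LinearMap.id N.mkQ_surjective
  have hc : ∃ Q, IsCompl N Q := by
    refine (exists_isCompl_iff_exists_retraction N).2
      ⟨LinearMap.id - g ∘ₗ N.mkQ, fun x => ?_, fun x hx => ?_⟩
    · rw [← Submodule.Quotient.mk_eq_zero, ← Submodule.mkQ_apply]
      have := LinearMap.congr_fun hg (N.mkQ x)
      simp only [LinearMap.comp_apply, LinearMap.id_apply] at this
      simp only [LinearMap.sub_apply, LinearMap.id_apply, LinearMap.comp_apply, map_sub, this,
        sub_self]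
    · have : N.mkQ x = 0 := by simpa using hx
      simp only [LinearMap.sub_apply, LinearMap.comp_apply, this, map_zero, sub_zero,
        LinearMap.id_apply]
  refine ⟨hc, fun p => ?_⟩
  obtain ⟨f, hf, hfp⟩ : ∃ f ∈ S, f ∉ p.asIdeal := by
    by_contra! hcon
    exact p.2.ne_top (top_le_iff.1 (hS ▸ Ideal.span_le.2 hcon))
  obtain ⟨q, hq⟩ : p ∈ Set.range (PrimeSpectrum.comap (algebraMap R (Localization.Away f))) := by
    rw [PrimeSpectrum.localization_away_comap_range (Localization.Away f) f]
    exact hfp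
  obtain ⟨i⟩ := isBaseChange_span (s.isBaseChange_dmap (R := R) (R' := Localization.Away f)) hc
  have hN : Module.Finite R N := finite_of_isCompl hc.choose_spec
  have hN' : Module.Projective R N := projective_of_isCompl hc.choose_spec
  rw [← (h f hf).2 q, ← hq, ← Module.rankAtStalk_baseChange]
  exact congrFun (Module.rankAtStalk_eq_of_equiv i) q

/-- The submodule with given localizations. -/
def glueSub {α : Type u} (f : α → R)
    (N : ∀ a, Submodule (Localization.Away (f a)) (s.Dbl (Localization.Away (f a)))) :
    Submodule R (s.Dbl R) :=
  ⨅ a, ((N a).restrictScalars R).comap (awayMap s (f a))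

theorem mem_glueSub {α : Type u} {f : α → R}
    {N : ∀ a, Submodule (Localization.Away (f a)) (s.Dbl (Localization.Away (f a)))} {x : s.Dbl R} :
    x ∈ glueSub f N ↔ ∀ a, awayMap s (f a) x ∈ N a := by
  simp [glueSub]

/-- An element of `N a` agrees with `N b` on the overlap, hence lies in `N b` after multiplication
by a power of `f a`. Finiteness of the family bounds these powers uniformly. -/
theorem loc_glueSub {α : Type u} [Finite α] {f : α → R}
    {N : ∀ a, Submodule (Localization.Away (f a)) (s.Dbl (Localization.Away (f a)))}
    (h : ∀ a b (T : CommRingCat.{u}) (g : CommRingCat.of (Localization.Away (f a)) ⟶ T)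
      (h : CommRingCat.of (Localization.Away (f b)) ⟶ T),
      awayHom (R := .of R) (f a) ≫ g = awayHom (R := .of R) (f b) ≫ h →
        pull g.hom (N a) = pull h.hom (N b)) (a : α) :
    loc (f a) (glueSub f N) = N a := by
  apply le_antisymm
  · exact pull_le_iff.2 fun x hx => mem_glueSub.1 hx a
  · intro y hy
    obtain ⟨k, x, hx⟩ := exists_smul_eq_awayMap (f a) y
    have hxN : awayMap s (f a) x ∈ N a := by
      rw [hx]
      exact (N a).smul_of_tower_mem _ hy
    have key : ∀ b, ∃ m : ℕ, awayMap s (f b) (f a ^ m • x) ∈ N b := by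
      intro b
      let Rb := Localization.Away (f b)
      let u : Rb := algebraMap R Rb (f a)
      -- The overlap is realized as the localization of the `b`-th ring at `f a`, which receives a
      -- map from the `a`-th ring.
      let T := Localization.Away u
      have hu : IsUnit (((algebraMap Rb T).comp (algebraMap R Rb)) (f a)) :=
        IsLocalization.Away.algebraMap_isUnit (S := T) u
      let g : Localization.Away (f a) →+* T := IsLocalization.Away.lift (f a) hu
      have hg : g.comp (algebraMap R _) = (algebraMap Rb T).comp (algebraMap R Rb) :=
        IsLocalization.Away.lift_comp (f a) hu
      have h1 := h a b (.of T) (CommRingCat.ofHom g) (CommRingCat.ofHom (algebraMap Rb T))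
        (by ext z; exact congrArg (fun r => r z) hg)
      have h2 : awayMap s u (awayMap s (f b) x) ∈ loc u (N b) := by
        have h3 : s.dmap g (awayMap s (f a) x) ∈ pull g (N a) := dmap_mem_pull g hxN
        have h4 : s.dmap g (awayMap s (f a) x) = awayMap s u (awayMap s (f b) x) := by
          have : ∀ z : R, g (algebraMap R _ z) = algebraMap Rb T (algebraMap R Rb z) :=
            fun z => congrArg (fun r => r z) hg
          ext l <;> exact this _
        rw [h4] at h3
        exact h1.le h3
      obtain ⟨m, hm⟩ := awayMap_mem_loc_iff.1 h2
      refine ⟨m, ?_⟩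
      rw [map_smul, ← algebraMap_smul Rb, map_pow]
      exact hm
    choose m hm using key
    obtain ⟨M, hM⟩ := Set.finite_range m |>.bddAbove
    have hmem : f a ^ M • x ∈ glueSub f N := by
      rw [mem_glueSub]
      intro b
      have hle : m b ≤ M := hM ⟨b, rfl⟩
      rw [← Nat.sub_add_cancel hle, pow_add, mul_smul, map_smul]
      exact (N b).smul_of_tower_mem _ (hm b)
    have h5 := awayMap_mem_loc_iff.2 ⟨M, hmem⟩
    rw [hx] at h5
    have hunit : IsUnit (algebraMap R (Localization.Away (f a)) (f a ^ k)) := by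
      rw [map_pow]
      exact (IsLocalization.Away.algebraMap_isUnit (f a)).pow k
    rw [← algebraMap_smul (Localization.Away (f a))] at h5
    exact (Submodule.smul_mem_iff_of_isUnit _ hunit).1 h5

/-- The defining conditions of a point are local. -/
theorem isPt_of_loc {S : Set R} (hS : Ideal.span S = ⊤) {ϖ : R} {Fl Fnl G : Submodule R (s.Dbl R)}
    (h : ∀ f ∈ S, IsPt s (algebraMap R (Localization.Away f) ϖ) (loc f Fl) (loc f Fnl) (loc f G)) :
    IsPt s ϖ Fl Fnl G where
  summand_Fl := isSummandOfRank_of_loc hS fun f hf => (h f hf).summand_Fl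
  summand_Fnl := isSummandOfRank_of_loc hS fun f hf => (h f hf).summand_Fnl
  summand_G := isSummandOfRank_of_loc hS fun f hf => (h f hf).summand_G
  up_mem x hx := mem_of_forall_loc hS fun f hf => by
    have := (h f hf).up_mem _ (dmap_mem_pull _ hx)
    rwa [← s.dmap_up] at this
  down_mem x hx := mem_of_forall_loc hS fun f hf => by
    have := (h f hf).down_mem _ (dmap_mem_pull _ hx)
    rwa [← s.dmap_down] at this
  orth := by
    have hl : IsSummandOfRank Fl s.n := isSummandOfRank_of_loc hS fun f hf => (h f hf).summand_Fl
    refine eq_of_forall_loc hS fun f hf => ?_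
    rw [(h f hf).orth]
    exact (leftOrth_pull _ hl).symm
  G_le x hx := mem_of_forall_loc hS fun f hf => (h f hf).G_le (dmap_mem_pull _ hx)
  add_mem x hx := mem_of_forall_loc hS fun f hf => by
    have := (h f hf).add_mem _ (dmap_mem_pull _ hx)
    convert this using 1
    ext <;> simp [awayMap, Shape.dmap, map_ofNat]
  sub_eq x hx := by
    ext k
    refine eq_of_forall_algebraMap hS fun f hf => ?_
    have := congrFun ((h f hf).sub_eq _ (dmap_mem_pull _ hx)) k
    simpa [Shape.dmap, map_ofNat] using this

end Splitting

end

noncomputable section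

namespace Splitting

variable {s : Shape} {R R' : Type u} [CommRing R] [CommRing R']

/-! ### The chart rings -/

/-- The variables of a chart ring. -/
inductive Var (s : Shape) : Type
  | v (k : Fin s.n) | w (k : Fin s.n) | c | l

/-- The indices of the equations of a chart. -/
inductive EqIdx (s : Shape) : Type
  | v | wc | form | quad | tilt (k : Fin s.n) | minor (k k' : Fin s.n)

namespace Tup

/-- The equations of a chart, as elements of the ring. -/
def eqn (T : Tup s R) (ϖ : R) (i : Fin s.n) (j : Option (Fin s.n)) : EqIdx s → R
  | .v => T.v i - 1
  | .wc => T.wc j - 1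
  | .form => s.form T.v T.w - 2 * ϖ * T.c
  | .quad => s.quad T.w - 2 * T.l * T.c
  | .tilt k => s.tilt ϖ T.w k - T.l * T.v k
  | .minor k k' => s.hat ϖ T.v k * s.hat 1 T.w k' - s.hat ϖ T.v k' * s.hat 1 T.w k

theorem ok_iff {T : Tup s R} {ϖ : R} {i : Fin s.n} {j : Option (Fin s.n)} :
    T.Ok ϖ i j ↔ ∀ e, T.eqn ϖ i j e = 0 := by
  constructor
  · intro h e
    cases e with
    | v => exact sub_eq_zero.2 h.v_eq
    | wc => exact sub_eq_zero.2 h.wc_eq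
    | form => exact sub_eq_zero.2 h.form_eq
    | quad => exact sub_eq_zero.2 h.quad_eq
    | tilt k => exact sub_eq_zero.2 (h.tilt_eq k)
    | minor k k' => exact sub_eq_zero.2 (h.minor_eq k k')
  · intro h
    exact ⟨sub_eq_zero.1 (h .v), sub_eq_zero.1 (h .wc), sub_eq_zero.1 (h .form),
      fun k => sub_eq_zero.1 (h (.tilt k)), sub_eq_zero.1 (h .quad),
      fun k k' => sub_eq_zero.1 (h (.minor k k'))⟩

theorem map_wc (φ : R →+* R') (T : Tup s R) (j : Option (Fin s.n)) :
    φ (T.wc j) = (T.map φ).wc j := by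
  cases j <;> rfl

theorem map_eqn (φ : R →+* R') (T : Tup s R) (ϖ : R) (i : Fin s.n) (j : Option (Fin s.n))
    (e : EqIdx s) : φ (T.eqn ϖ i j e) = (T.map φ).eqn (φ ϖ) i j e := by
  have h1 : ∀ k, φ (s.hat 1 T.w k) = s.hat 1 (φ ∘ T.w) k := fun k => by
    rw [← map_one φ, ← s.map_hat]; rfl
  have h2 : ∀ k, φ (s.hat ϖ T.v k) = s.hat (φ ϖ) (φ ∘ T.v) k := fun k => by
    rw [← s.map_hat]; rfl
  have h3 : ∀ k, φ (s.tilt ϖ T.w k) = s.tilt (φ ϖ) (φ ∘ T.w) k := fun k => by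
    rw [← s.map_tilt]; rfl
  cases e <;> simp [eqn, map_wc, s.map_form, s.map_quad, h1, h2, h3] <;> simp [Tup.map, map_ofNat]

/-- The coordinates given by the values of the variables. -/
def ofVars (x : Var s → R) : Tup s R := ⟨fun k => x (.v k), fun k => x (.w k), x .c, x .l⟩

/-- The values of the variables. -/
def vars (T : Tup s R) : Var s → R
  | .v k => T.v k
  | .w k => T.w k
  | .c => T.c
  | .l => T.l

end Tup

variable (s) {O : Type u} [CommRing O] (π : O)

/-- The ideal of the equations of a chart. -/
def chartEqs (i : Fin s.n) (j : Option (Fin s.n)) : Ideal (MvPolynomial (Var s) O) :=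
  Ideal.span (Set.range ((Tup.ofVars MvPolynomial.X).eqn (MvPolynomial.C π) i j))

/-- The coordinate ring of a chart. -/
abbrev ChartRing (i : Fin s.n) (j : Option (Fin s.n)) : Type u :=
  MvPolynomial (Var s) O ⧸ chartEqs s π i j

/-- The universal coordinates on a chart. -/
def chartTup (i : Fin s.n) (j : Option (Fin s.n)) : Tup s (ChartRing s π i j) :=
  (Tup.ofVars MvPolynomial.X).map (Ideal.Quotient.mk _)

theorem chartTup_ok (i : Fin s.n) (j : Option (Fin s.n)) :
    (chartTup s π i j).Ok (algebraMap O (ChartRing s π i j) π) i j := by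
  rw [Tup.ok_iff]
  intro e
  have := Tup.map_eqn (Ideal.Quotient.mk (chartEqs s π i j)) (Tup.ofVars MvPolynomial.X)
    (MvPolynomial.C π) i j e
  have h0 : (Tup.ofVars MvPolynomial.X).eqn (MvPolynomial.C π) i j e ∈ chartEqs s π i j :=
    Ideal.subset_span ⟨e, rfl⟩
  exact this.symm.trans (Ideal.Quotient.eq_zero_iff_mem.2 h0)

/-- The universal point on a chart. -/
def chartPt (i : Fin s.n) (j : Option (Fin s.n)) : Pt s π (ChartRing s π i j) :=
  (chartTup_ok s π i j).pt

variable {s π}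

theorem Tup.Ok.exists_hom {T : Tup s R} {i : Fin s.n} {j : Option (Fin s.n)} {ρ : O →+* R}
    (h : T.Ok (ρ π) i j) : ∃ φ : ChartRing s π i j →+* R,
      φ.comp (algebraMap O _) = ρ ∧ (chartTup s π i j).map φ = T := by
  let ev := MvPolynomial.eval₂Hom ρ T.vars
  have hev : (Tup.ofVars MvPolynomial.X).map ev = T := by
    ext <;> simp [Tup.map, Tup.ofVars, ev, Tup.vars]
  have hker : ∀ a ∈ chartEqs s π i j, ev a = 0 := by
    intro a ha
    have : chartEqs s π i j ≤ RingHom.ker ev := by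
      rw [chartEqs, Ideal.span_le]
      rintro _ ⟨e, rfl⟩
      rw [SetLike.mem_coe, RingHom.mem_ker, Tup.map_eqn, hev]
      have : ev (MvPolynomial.C π) = ρ π := by simp [ev]
      rw [this]
      exact Tup.ok_iff.1 h e
    exact this ha
  refine ⟨Ideal.Quotient.lift _ ev hker, ?_, ?_⟩
  · ext x
    exact MvPolynomial.eval₂Hom_C _ _ _
  · conv_rhs => rw [← hev]
    rfl

theorem chartRing_hom_ext {i : Fin s.n} {j : Option (Fin s.n)} {φ ψ : ChartRing s π i j →+* R}
    (h : φ.comp (algebraMap O _) = ψ.comp (algebraMap O _))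
    (h' : (chartTup s π i j).map φ = (chartTup s π i j).map ψ) : φ = ψ := by
  apply Ideal.Quotient.ringHom_ext
  apply MvPolynomial.ringHom_ext
  · intro r
    exact congrArg (fun f => f r) h
  · intro x
    have := congrFun (congrArg Tup.vars h') x
    cases x <;> exact this

theorem pt_ext_ok {T T' : Tup s R} {i : Fin s.n} {j : Option (Fin s.n)} {ρ ρ' : O →+* R}
    (h : T.Ok (ρ π) i j) (h' : T'.Ok (ρ' π) i j) (heq : h.pt = h'.pt) : ρ = ρ' ∧ T = T' := by
  obtain rfl : ρ = ρ' := congrArg Pt.ρ heq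
  exact ⟨rfl, h.ext h' (congrArg Pt.Fl heq) (congrArg Pt.G heq)⟩

/-- On this locus points are the same as tuples satisfying the polynomial equations, which the
quotient ring represents by construction. -/
theorem chartRing_represents (i : Fin s.n) (j : Option (Fin s.n)) :
    RepresentsUnitLocus (ptFunctor s π) (chartIdeal s π (i, j)) (.of (ChartRing s π i j))
      (chartPt s π i j) where
  ideal_elt := by
    refine ((chartTup_ok s π i j).chartIdeal_pt (R := .of (ChartRing s π i j)) (i, j)).trans ?_
    rw [(chartTup_ok s π i j).v_eq, (chartTup_ok s π i j).wc_eq, one_mul, Ideal.span_singleton_one]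
  exists_hom {R} x hx := by
    obtain ⟨T, hT, hTx⟩ := exists_tup_of_chartIdeal x (i, j) hx
    obtain ⟨φ, h1, h2⟩ := hT.exists_hom
    refine ⟨CommRingCat.ofHom φ, ?_⟩
    refine ((chartTup_ok s π i j).map_pt φ).trans (Eq.trans ?_ hTx)
    apply Pt.ext
    · exact h1
    · exact congrArg Tup.Fl h2
    · exact congrArg Tup.Fnl h2
    · refine (congrArg (fun T => Tup.G T _) h2).trans ?_
      exact congrArg (fun r : O →+* R => T.G (r π)) h1
  hom_ext {R} φ ψ h := by
    have h1 := ((chartTup_ok s π i j).map_pt φ.hom).symm.trans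
      (h.trans ((chartTup_ok s π i j).map_pt ψ.hom))
    obtain ⟨h2, h3⟩ := pt_ext_ok (ρ := φ.hom.comp _) (ρ' := ψ.hom.comp _) _ _ h1
    ext1
    exact chartRing_hom_ext h2 h3

/-! ### The charts cover -/

/-- Over a field, `G` has a nonzero vector, whose second component must be nonzero. `F_ℓ` has rank
`n`, so it cannot lie in `perp`, which has rank `n - 1`, and some `(w, c)`-coordinate is nonzero on
it. -/
theorem exists_chartIdeal_ne_bot {K : CommRingCat.{u}} (hK : IsField K) (ξ : Pt s π K) :
    ∃ p, (chartIdeal s π p).ideal ξ = ⊤ := by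
  let := hK.toField
  have hp : ∃ p : PrimeSpectrum K, True := ⟨⟨⊥, Ideal.isPrime_bot⟩, trivial⟩
  obtain ⟨p, -⟩ := hp
  have h := ξ.isPt
  have hG : ∃ g ∈ ξ.G, g ≠ 0 := by
    by_contra! hcon
    have h1 := h.summand_G.2 p
    have : Subsingleton ξ.G := ⟨fun a b => Subtype.ext ((hcon a a.2).trans (hcon b b.2).symm)⟩
    rw [Module.rankAtStalk_eq_zero_of_subsingleton] at h1
    exact zero_ne_one h1
  obtain ⟨g, hg, hg0⟩ := hG
  obtain ⟨i, hi⟩ : ∃ i, g.2 i ≠ 0 := by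
    by_contra! hcon
    have h2 : g.2 = 0 := funext hcon
    exact hg0 (Prod.ext (by rw [h.sub_eq g hg, h2, smul_zero]; rfl) h2)
  have hI : (vIdeal s π i).ideal ξ = ⊤ :=
    Ideal.eq_top_of_isUnit_mem _ (Ideal.subset_span ⟨g, hg, rfl⟩) (isUnit_iff_ne_zero.2 hi)
  have hx : ∃ x ∈ ξ.Fl, x ∉ perp g.2 := by
    by_contra! hcon
    have hv : ((g.2 i)⁻¹ • g.2) i = 1 := inv_mul_cancel₀ hi
    have hle : ξ.Fl ≤ perp ((g.2 i)⁻¹ • g.2) := fun x hx => by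
      have := mem_perp.1 (hcon x hx)
      exact mem_perp.2 ⟨this.1, by rw [map_smul, LinearMap.smul_apply, this.2, smul_zero]⟩
    obtain ⟨L, _, _, hL, -⟩ := (isSummandOfRank_perp hv).exists_complement h.summand_Fl hle
    have := hL p
    have := s.le
    omega
  obtain ⟨x, hx, hx0⟩ := hx
  rw [mem_perp, not_and_or] at hx0
  have key : ∃ j, (wIdeal s π j).ideal ξ = ⊤ := by
    rcases hx0 with hx0 | hx0
    · obtain ⟨j, hj⟩ := Function.ne_iff.1 hx0
      exact ⟨some j,
        Ideal.eq_top_of_isUnit_mem _ (Ideal.subset_span ⟨x, hx, rfl⟩) (isUnit_iff_ne_zero.2 hj)⟩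
    · exact ⟨none, Ideal.eq_top_of_isUnit_mem _ (Ideal.subset_span ⟨g, hg, x, hx, rfl⟩)
        (isUnit_iff_ne_zero.2 hx0)⟩
  obtain ⟨j, hj⟩ := key
  refine ⟨(i, j), ?_⟩
  change _ * _ = _
  rw [hI, hj, Ideal.top_mul]

/-- Were all chart ideals contained in a maximal ideal, they would vanish over its residue field,
contrary to the field case. -/
theorem iSup_chartIdeal {R : CommRingCat.{u}} (ξ : Pt s π R) :
    ⨆ p, (chartIdeal s π p).ideal ξ = ⊤ := by
  by_contra hne
  obtain ⟨m, hm, hle⟩ := Ideal.exists_le_maximal _ hne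
  let φ : R ⟶ .of (R ⧸ m) := CommRingCat.ofHom (Ideal.Quotient.mk m)
  obtain ⟨p, hp⟩ := exists_chartIdeal_ne_bot (K := .of (R ⧸ m))
    ((Ideal.Quotient.maximal_ideal_iff_isField_quotient m).1 hm) (ξ.map φ.hom)
  have h1 : ((chartIdeal s π p).ideal ξ).map φ.hom = ⊤ := ((chartIdeal s π p).map φ ξ).symm.trans hp
  have h2 : ((chartIdeal s π p).ideal ξ).map φ.hom ≤ ⊥ := by
    rw [Ideal.map_le_iff_le_comap]
    intro x hx
    have : x ∈ m := hle (Ideal.mem_iSup_of_mem p hx)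
    exact Ideal.Quotient.eq_zero_iff_mem.2 this
  have h3 : (1 : R ⧸ m) = 0 := h2 (h1 ▸ Submodule.mem_top)
  exact hm.ne_top ((Ideal.eq_top_iff_one m).2 (Ideal.Quotient.eq_zero_iff_mem.1 h3))

/-! ### The splitting model as a scheme -/

variable (s π)

/-- The charts of the splitting model. -/
def charted : ChartedFunctor (.of O) where
  S := ptFunctor s π
  base ξ := CommRingCat.ofHom (Pt.ρ ξ)
  base_map _ _ := rfl
  J := ULift (Fin s.n × Option (Fin s.n))
  D p := chartIdeal s π p.down
  A p := .of (ChartRing s π p.down.1 p.down.2)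
  elt p := chartPt s π p.down.1 p.down.2
  rep p := chartRing_represents p.down.1 p.down.2
  d p q := (chartTup s π p.down.1 p.down.2).v q.down.1 * (chartTup s π p.down.1 p.down.2).wc q.down.2
  ideal_elt p q := (chartTup_ok s π p.down.1 p.down.2).chartIdeal_pt
    (R := .of (ChartRing s π p.down.1 p.down.2)) q.down
  cover ξ := (Equiv.ulift.iSup_comp (g := fun p => (chartIdeal s π p).ideal ξ)).trans
    (iSup_chartIdeal ξ)
  separated f hf x y h := by
    have hS : ∀ g ∈ Set.range f, Pt.map (algebraMap _ (Localization.Away g)) x =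
        Pt.map (algebraMap _ (Localization.Away g)) y := by
      rintro _ ⟨a, rfl⟩
      exact h a
    refine Pt.ext ?_ ?_ ?_ ?_
    · ext r
      exact eq_of_forall_algebraMap hf fun g hg =>
        congrArg (fun f : O →+* _ => f r) (congrArg Pt.ρ (hS g hg))
    · exact eq_of_forall_loc hf fun g hg => congrArg Pt.Fl (hS g hg)
    · exact eq_of_forall_loc hf fun g hg => congrArg Pt.Fnl (hS g hg)
    · exact eq_of_forall_loc hf fun g hg => congrArg Pt.G (hS g hg)
  glue {R} ρ α _ f hf x hx h := by
    have hFl := loc_glueSub (f := f) (N := fun a => Pt.Fl (x a))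
      fun a b T g g' hg => congrArg Pt.Fl (h a b T g g' hg)
    have hFnl := loc_glueSub (f := f) (N := fun a => Pt.Fnl (x a))
      fun a b T g g' hg => congrArg Pt.Fnl (h a b T g g' hg)
    have hG := loc_glueSub (f := f) (N := fun a => Pt.G (x a))
      fun a b T g g' hg => congrArg Pt.G (h a b T g g' hg)
    have hρ : ∀ a, Pt.ρ (x a) = (algebraMap R (Localization.Away (f a))).comp ρ.hom :=
      fun a => congrArg CommRingCat.Hom.hom (hx a)
    refine ⟨(⟨ρ.hom, glueSub f fun a => Pt.Fl (x a), glueSub f fun a => Pt.Fnl (x a),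
      glueSub f fun a => Pt.G (x a), isPt_of_loc hf ?_⟩ : Pt s π R), fun a => ?_⟩
    · rintro _ ⟨a, rfl⟩
      rw [hFl, hFnl, hG]
      have := Pt.isPt (x a)
      rw [hρ] at this
      exact this
    · exact Pt.ext (hρ a).symm (hFl a) (hFnl a) (hG a)

end Splitting

end

noncomputable section

namespace Splitting

/-! ### The Kottwitz and wedge conditions -/

/-- This is the determinant of a scalar matrix perturbed by a matrix of rank one. -/
theorem Matrix.eval_charpoly_vecMulVec {A : Type u} [CommRing A] {d : ℕ} (u v : Fin (d + 1) → A)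
    (c : A) : (Matrix.scalar (Fin (d + 1)) c - Matrix.vecMulVec u v).det =
      c ^ d * (c - u ⬝ᵥ v) := by
  rw [← Matrix.eval_charpoly, Matrix.charpoly_vecMulVec]
  simp
  ring

section RankOne

variable {R N : Type u} [CommRing R] [AddCommGroup N] [Module R N]

/-- Locally, `g + ϖ` is up to a scalar of rank one with trace `2 ϖ`. -/
def IsRankOne (g : N →ₗ[R] N) (ϖ : R) : Prop :=
  ∀ p : PrimeSpectrum R, ∃ a : R, a ∉ p.asIdeal ∧ ∃ (φ : N →ₗ[R] R) (γ : N),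
    (∀ x, a • (g x + ϖ • x) = φ x • γ) ∧ φ γ = 2 * ϖ * a

/-- Up to the factor `a`, `g + ϖ` is the product of a column and a row with trace `2ϖ`, so `X - g`
has determinant `(X + ϖ) ^ (d - 1) (X + ϖ - 2ϖ)`. -/
theorem IsRankOne.hasCharpoly {g : N →ₗ[R] N} {ϖ : R} (h : IsRankOne g ϖ) {d : ℕ} (hd : 0 < d) :
    HasCharpoly d g ((Polynomial.X + Polynomial.C ϖ) ^ (d - 1) *
      (Polynomial.X - Polynomial.C ϖ) ^ 1) := by
  obtain ⟨d, rfl⟩ : ∃ e, d = e + 1 := ⟨d - 1, by omega⟩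
  intro f b
  let A := Localization.Away f
  rw [← sub_eq_zero]
  refine eq_zero_of_smul_eq_zero (R := R) fun p => ?_
  obtain ⟨a, ha, φ, γ, hφ, hγ⟩ := h p
  refine ⟨a ^ (d + 1), fun h' => ha (p.2.mem_of_pow_mem _ h'), ?_⟩
  let a' := algebraMap R A a
  let ϖ' := algebraMap R A ϖ
  let φ' : (A ⊗[R] N) →ₗ[A] A := (TensorProduct.AlgebraTensorModule.rid R A A).toLinearMap ∘ₗ φ.baseChange A
  have hφ' : ∀ (r : A) (x : N), φ' (r ⊗ₜ x) = r * algebraMap R A (φ x) := fun r x => by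
    simp [φ', Algebra.smul_def, mul_comm]
  let γ' : A ⊗[R] N := 1 ⊗ₜ γ
  have h1 : a' • (g.baseChange A + ϖ' • LinearMap.id) = φ'.smulRight γ' := by
    ext x
    have := hφ x
    simp only [LinearMap.smul_apply, LinearMap.add_apply, LinearMap.smulRight_apply, hφ', γ', a',
      ϖ', TensorProduct.AlgebraTensorModule.curry_apply,
      TensorProduct.curry_apply, LinearMap.coe_restrictScalars, LinearMap.baseChange_tmul,
      LinearMap.id_apply, algebraMap_smul, one_mul]
    rw [← TensorProduct.tmul_smul, ← TensorProduct.tmul_add, ← TensorProduct.tmul_smul, this,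
      TensorProduct.tmul_smul]
  have h2 : a' • (LinearMap.toMatrix b b (g.baseChange A) + Matrix.scalar _ ϖ') =
      Matrix.vecMulVec (b.repr γ') (φ' ∘ b) := by
    rw [← LinearMap.toMatrix_smulRight, ← h1]
    simp only [map_smul, map_add, LinearMap.toMatrix_id]
    congr 2
    ext i j
    simp [Matrix.one_apply, Matrix.diagonal_apply]
  have h3 : b.repr γ' ⬝ᵥ (φ' ∘ b) = 2 * ϖ' * a' := by
    have : φ' γ' = 2 * ϖ' * a' := by
      rw [hφ', hγ, one_mul, map_mul, map_mul, map_ofNat]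
    rw [← this]
    conv_rhs => rw [← b.sum_repr γ', map_sum]
    simp [dotProduct]
  let X : Polynomial A := Polynomial.X
  -- Only the multiple by `a` of the characteristic matrix has the form scalar minus rank one. The
  -- resulting factor `a ^ (d + 1)` lies outside `p`, which suffices.
  have h4 : Polynomial.C a' • (Matrix.charmatrix (LinearMap.toMatrix b b (g.baseChange A))) =
      Matrix.scalar _ (Polynomial.C a' * (X + Polynomial.C ϖ')) -
        Matrix.vecMulVec (fun i => Polynomial.C (b.repr γ' i)) (fun j => Polynomial.C (φ' (b j))) := by
    ext1 i j
    have := congrArg Polynomial.C (congrFun (congrFun h2 i) j)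
    simp only [Matrix.smul_apply, Matrix.add_apply, smul_eq_mul, Matrix.vecMulVec_apply,
      map_mul, map_add, Function.comp_apply] at this
    simp only [Matrix.smul_apply, Matrix.sub_apply, Matrix.vecMulVec_apply, smul_eq_mul,
      Matrix.charmatrix_apply, ← this, Matrix.scalar_apply, Matrix.diagonal_apply]
    split_ifs <;> simp [X] <;> ring
  have h5 : Polynomial.C a' ^ (d + 1) * (LinearMap.toMatrix b b (g.baseChange A)).charpoly =
      Polynomial.C a' ^ (d + 1) * ((X + Polynomial.C ϖ') ^ d * (X - Polynomial.C ϖ')) := by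
    have := congrArg Matrix.det h4
    rw [Matrix.det_smul, Fintype.card_fin, Matrix.eval_charpoly_vecMulVec] at this
    have h6 : (fun i => Polynomial.C (b.repr γ' i)) ⬝ᵥ (fun j => Polynomial.C (φ' (b j))) =
        Polynomial.C (2 * ϖ' * a') := by
      rw [← h3]
      simp [dotProduct]
    rw [h6] at this
    rw [Matrix.charpoly, this]
    simp only [map_mul, map_ofNat]
    rw [mul_pow]
    ring
  have h7 : ∀ q : Polynomial A, a ^ (d + 1) • q = Polynomial.C a' ^ (d + 1) * q := fun q => by
    rw [← algebraMap_smul A, Polynomial.smul_eq_C_mul, map_pow, map_pow]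
  rw [smul_sub, sub_eq_zero, h7, h7, h5]
  simp [X, ϖ', A]

/-- Near each prime, the images of any `k` vectors lie, up to a scalar, in a submodule with fewer
than `k` generators, on which alternating maps in `k` variables vanish. -/
theorem exteriorPower_map_eq_zero {g : N →ₗ[R] N} {k : ℕ}
    (h : ∀ (p : PrimeSpectrum R) (x : Fin k → N), ∃ a : R, a ∉ p.asIdeal ∧
      ∃ (ι : Type) (_ : Fintype ι) (_ : Fintype.card ι < k) (L : (ι → R) →ₗ[R] N), ∀ j, a • g (x j) ∈ LinearMap.range L) :
    exteriorPower.map (R := R) k g = 0 := by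
  refine exteriorPower.linearMap_ext ?_
  ext1 x
  refine eq_zero_of_smul_eq_zero (R := R) fun p => ?_
  obtain ⟨a, ha, ι, _, hd, L, hL⟩ := h p x
  choose c hc using hL
  refine ⟨a ^ k, fun h' => ha (p.2.mem_of_pow_mem _ h'), ?_⟩
  have h1 : exteriorPower.ιMulti R k (fun j => a • g (x j)) = 0 := by
    have : (fun j => a • g (x j)) = fun j => L (c j) := funext fun j => (hc j).symm
    rw [this]
    exact congrArg (fun f => f c)
      (alternatingMap_pi_eq_zero hd ((exteriorPower.ιMulti R k).compLinearMap L))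
  have h2 := (exteriorPower.ιMulti R k (M := N)).toMultilinearMap.map_smul_univ (fun _ => a)
    (fun j => g (x j))
  have h3 : exteriorPower.map k g (exteriorPower.ιMulti R k x) =
      exteriorPower.ιMulti R k (fun j => g (x j)) := exteriorPower.map_apply_ιMulti g x
  rw [LinearMap.compAlternatingMap_apply, h3]
  refine Eq.trans ?_ h1
  simpa using h2.symm

theorem IsRankOne.exteriorPower_map_eq_zero {g : N →ₗ[R] N} {ϖ : R} (h : IsRankOne g ϖ)
    {g' : N →ₗ[R] N} (hg' : ∀ x, g' x = g x + ϖ • x) :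
    exteriorPower.map (R := R) (1 + 1) g' = 0 := by
  refine Splitting.exteriorPower_map_eq_zero fun p x => ?_
  obtain ⟨a, ha, φ, γ, hφ, -⟩ := h p
  refine ⟨a, ha, Fin 1, inferInstance, by simp, LinearMap.toSpanSingleton R N γ ∘ₗ LinearMap.proj 0, fun j =>
    ⟨fun _ => φ (x j), ?_⟩⟩
  rw [hg', hφ]
  simp

theorem IsRankOne.of_equiv {N' : Type u} [AddCommGroup N'] [Module R N'] {g : N →ₗ[R] N} {ϖ : R}
    (h : IsRankOne g ϖ) (e : N' ≃ₗ[R] N) {g' : N' →ₗ[R] N'} (he : ∀ x, e (g' x) = g (e x)) :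
    IsRankOne g' ϖ := by
  intro p
  obtain ⟨a, ha, φ, γ, hφ, hγ⟩ := h p
  refine ⟨a, ha, φ ∘ₗ e.toLinearMap, e.symm γ, fun x => ?_, by simpa using hγ⟩
  apply e.injective
  simpa [he] using hφ (e x)

end RankOne

namespace IsPt

variable {s : Shape} {R : Type u} [CommRing R] {ϖ : R} {Fl Fnl G : Submodule R (s.Dbl R)}
  (h : IsPt s ϖ Fl Fnl G)
include h

theorem smul_eq_smul {x y : s.Dbl R} (hx : x ∈ G) (hy : y ∈ G) (i : Fin s.n) :
    x.2 i • y = y.2 i • x := by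
  have := h.summand_G.finite
  have := h.summand_G.projective
  have key : ∀ k, x.2 i * y.2 k = y.2 i * x.2 k := fun k =>
    mul_eq_mul_of_rank_one h.summand_G.2 (sndCoord s i ∘ₗ G.subtype) (sndCoord s k ∘ₗ G.subtype)
      ⟨x, hx⟩ ⟨y, hy⟩
  refine Prod.ext ?_ (funext key)
  rw [Prod.smul_fst, Prod.smul_fst, h.sub_eq x hx, h.sub_eq y hy, smul_comm,
    show x.2 i • y.2 = y.2 i • x.2 from funext key, smul_comm]

/-- This restates that the charts cover, at a prime and without inverting anything; the scalars it
gives are the ones in `IsRankOne`. -/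
theorem exists_notMem (p : PrimeSpectrum R) : ∃ (i : Fin s.n) (j : Option (Fin s.n)),
    (∃ g ∈ G, g.2 i ∉ p.asIdeal) ∧ ∃ g ∈ G, ∃ x ∈ Fl, kap g.2 j x ∉ p.asIdeal := by
  let ξ : Pt s ϖ (CommRingCat.of R) := ⟨RingHom.id R, Fl, Fnl, G, h⟩
  have h1 := iSup_chartIdeal (R := .of R) ξ
  obtain ⟨⟨i, j⟩, hij⟩ : ∃ q, ¬ (chartIdeal s ϖ q).ideal (R := .of R) ξ ≤ p.asIdeal := by
    by_contra! hcon
    exact p.2.ne_top (top_le_iff.1 (h1 ▸ iSup_le hcon))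
  have hI : ¬ (vIdeal s ϖ i).ideal (R := .of R) ξ ≤ p.asIdeal :=
    fun h2 => hij (Ideal.mul_le_left.trans h2)
  have hJ : ¬ (wIdeal s ϖ j).ideal (R := .of R) ξ ≤ p.asIdeal :=
    fun h2 => hij (Ideal.mul_le_right.trans h2)
  have hg : ∃ g ∈ G, g.2 i ∉ p.asIdeal := by
    by_contra! hcon
    exact hI (linIdeal_le_iff.2 hcon)
  refine ⟨i, j, hg, ?_⟩
  obtain ⟨g, hgG, -⟩ := hg
  by_contra! hcon
  cases j with
  | none => exact hJ (bilIdeal_le_iff.2 hcon)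
  | some j => exact hJ (linIdeal_le_iff.2 fun x hx => hcon g hgG x hx)

/-- The normalized case applies after inverting any coordinate of an element of `G`, and these
coordinates generate the unit ideal. The coordinate `none` scales with `g`, whereas the others do
not involve it, hence the four cases. -/
theorem kap_mul_kap' {g : s.Dbl R} (hg : g ∈ G) (j k : Option (Fin s.n)) {x y : s.Dbl R}
    (hx : x ∈ Fl) (hy : y ∈ Fl) : kap g.2 j x * kap g.2 k y = kap g.2 j y * kap g.2 k x := by
  have hS : Ideal.span {f : R | ∃ i, ∃ g ∈ G, g.2 i = f} = ⊤ := by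
    by_contra hne
    obtain ⟨m, hm, hle⟩ := Ideal.exists_le_maximal _ hne
    obtain ⟨i, -, ⟨g, hg, hgi⟩, -⟩ := h.exists_notMem ⟨m, hm.isPrime⟩
    exact hgi (hle (Ideal.subset_span ⟨i, g, hg, rfl⟩))
  refine eq_of_forall_algebraMap hS ?_
  rintro f ⟨i, g', hg', rfl⟩
  let A := Localization.Away (g'.2 i)
  let φ := algebraMap R A
  have hu : IsUnit (φ (g'.2 i)) := IsLocalization.Away.algebraMap_isUnit _
  obtain ⟨u, hu⟩ := hu
  let g₁ : s.Dbl A := (↑u⁻¹ : A) • s.dmap φ g'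
  have hg₁ : g₁ ∈ Splitting.pull φ G := Submodule.smul_mem _ _ (dmap_mem_pull φ hg')
  have hv : g₁.2 i = 1 := by
    change (↑u⁻¹ : A) * φ (g'.2 i) = 1
    rw [← hu, Units.inv_mul]
  have key := fun j k => (h.pull φ).kap_mul_kap hg₁ hv j k (dmap_mem_pull φ hx) (dmap_mem_pull φ hy)
  have hgg : s.dmap φ g = φ (g.2 i) • g₁ := (h.pull φ).eq_smul hg₁ hv (dmap_mem_pull φ hg)
  have hk : ∀ z : s.Dbl R, φ (kap g.2 none z) = φ (g.2 i) * kap g₁.2 none (s.dmap φ z) := by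
    intro z
    change φ (s.form g.2 z.2) = φ (g.2 i) * s.form g₁.2 (s.dmap φ z).2
    rw [s.map_form, ← smul_eq_mul, ← LinearMap.smul_apply, ← map_smul, ← Prod.smul_snd, ← hgg]
    rfl
  have hk' : ∀ j (z : s.Dbl R), φ (kap g.2 (some j) z) = kap g₁.2 (some j) (s.dmap φ z) :=
    fun j z => rfl
  change φ _ = φ _
  rw [map_mul, map_mul]
  cases j <;> cases k <;> simp only [hk, hk']
  · linear_combination φ (g.2 i) * φ (g.2 i) * key none none
  · rename_i k
    linear_combination φ (g.2 i) * key none (some k)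
  · rename_i j
    linear_combination φ (g.2 i) * key (some j) none
  · rename_i j k
    exact key (some j) (some k)

/-- The adjoint of `t` is `-t`, so stability of `F_ℓ` under `t + π` follows by duality from that of
`F_{n-ℓ}`. -/
theorem add_mem_Fl {x : s.Dbl R} (hx : x ∈ Fl) : (((2 * ϖ) • x.1, x.1) : s.Dbl R) ∈ Fl := by
  refine h.mem_Fl_of_forall fun y hy => ?_
  have h1 := h.pair_eq hy hx
  have h2 := h.pair_eq (h.G_le (h.add_mem y hy)) hx
  rw [s.pair_apply] at h1 h2 ⊢
  simp only [map_smul, LinearMap.smul_apply, smul_eq_mul] at h2 ⊢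
  linear_combination (2 * ϖ) * h1 - h2

/-- The operator `t` in coordinates. -/
def _root_.Splitting.tOp (s : Shape) (ϖ : R) : s.Dbl R →ₗ[R] s.Dbl R where
  toFun x := (ϖ • x.1, x.1 - ϖ • x.2)
  map_add' x y := by ext <;> simp <;> ring
  map_smul' c x := by ext <;> simp <;> ring

omit h in
theorem _root_.Splitting.tOp_add (x : s.Dbl R) :
    tOp s ϖ x + ϖ • x = ((2 * ϖ) • x.1, x.1) := by
  ext <;> simp [tOp] <;> ring

omit h in
theorem _root_.Splitting.tOp_sub (x : s.Dbl R) :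
    tOp s ϖ x - ϖ • x = (0, x.1 - (2 * ϖ) • x.2) := by
  ext <;> simp [tOp] <;> ring

theorem tOp_mem_Fl : ∀ x ∈ Fl, tOp s ϖ x ∈ Fl := fun x hx => by
  have := Fl.sub_mem (h.add_mem_Fl hx) (Fl.smul_mem ϖ hx)
  rwa [← tOp_add, add_sub_cancel_right] at this

theorem tOp_mem_Fnl : ∀ x ∈ Fnl, tOp s ϖ x ∈ Fnl := fun x hx => by
  have := Fnl.sub_mem (h.G_le (h.add_mem x hx)) (Fnl.smul_mem ϖ hx)
  rwa [← tOp_add, add_sub_cancel_right] at this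

theorem isRankOne_Fnl : IsRankOne ((tOp s ϖ).restrict h.tOp_mem_Fnl) ϖ := by
  intro p
  obtain ⟨i, -, ⟨g, hg, hgi⟩, -⟩ := h.exists_notMem p
  refine ⟨g.2 i, hgi, fstCoord s i ∘ₗ Fnl.subtype, ⟨g, h.G_le hg⟩, fun x => ?_, ?_⟩
  · ext1
    change g.2 i • (tOp s ϖ x + ϖ • (x : s.Dbl R)) = (x : s.Dbl R).1 i • g
    rw [tOp_add]
    exact h.smul_eq_smul hg (h.add_mem x x.2) i
  · change g.1 i = _
    rw [h.sub_eq g hg]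
    rfl

/-- `t + π` depends only on the first component, and on `F_ℓ` first components are proportional to
that of `x₀`, with `kap` as coefficient. -/
theorem isRankOne_Fl : IsRankOne ((tOp s ϖ).restrict h.tOp_mem_Fl) ϖ := by
  intro p
  obtain ⟨i, j, -, g, hg, x₀, hx₀, hj⟩ := h.exists_notMem p
  refine ⟨_, hj, kap g.2 j ∘ₗ Fl.subtype, ⟨_, h.add_mem_Fl hx₀⟩, fun x => ?_, ?_⟩
  · ext1
    change kap g.2 j x₀ • (tOp s ϖ x + ϖ • (x : s.Dbl R)) =
      kap g.2 j x • (((2 * ϖ) • x₀.1, x₀.1) : s.Dbl R)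
    have key : kap g.2 j x₀ • (x : s.Dbl R).1 = kap g.2 j x • x₀.1 :=
      funext fun k => h.kap_mul_kap' hg j (some k) hx₀ x.2
    rw [tOp_add, Prod.smul_mk, Prod.smul_mk, key, smul_comm, key, smul_comm]
  · change kap g.2 j ((2 * ϖ) • x₀.1, x₀.1) = 2 * ϖ * kap g.2 j x₀
    cases j with
    | none =>
      have := h.pair_eq (h.G_le hg) hx₀
      rw [s.pair_apply, h.sub_eq g hg] at this
      simp only [map_smul, LinearMap.smul_apply, smul_eq_mul] at this
      change s.form g.2 x₀.1 = 2 * ϖ * s.form g.2 x₀.2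
      linear_combination this
    | some j => rfl

/-- `t - π` kills `G`, so it factors through a complement of rank `n - 1`. -/
theorem exteriorPower_sub_Fnl {g' : Fnl →ₗ[R] Fnl}
    (hg' : ∀ x, (g' x : s.Dbl R) = tOp s ϖ x - ϖ • (x : s.Dbl R)) :
    exteriorPower.map (R := R) (s.n - 1 + 1) g' = 0 := by
  obtain ⟨K, _, _, hK, hK'⟩ := h.summand_Fnl.exists_complement h.summand_G h.G_le
  have hn := s.le
  refine exteriorPower_map_eq_zero fun p x => ?_
  choose y hy hxy using fun j => hK' (x j)
  obtain ⟨a, ha, L, hL⟩ := exists_smul_mem_span (d := s.n - 1) (fun p => by have := hK p; omega) p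
    (fun j => (⟨y j, hy j⟩ : K))
  refine ⟨a, ha, Fin (s.n - 1), inferInstance, by simp, g' ∘ₗ K.subtype ∘ₗ L, fun j => ?_⟩
  obtain ⟨c, hc⟩ := hL j
  refine ⟨c, ?_⟩
  have h0 : g' (x j - y j) = 0 := by
    ext1
    rw [hg', tOp_sub]
    have := h.sub_eq _ (hxy j)
    change ((0, ((x j : s.Dbl R) - (y j : s.Dbl R)).1 - _) : s.Dbl R) = 0
    rw [this]
    simp
  rw [map_sub, sub_eq_zero] at h0
  rw [h0, LinearMap.comp_apply, LinearMap.comp_apply, hc]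
  simp

/-- Orthogonality to `G` places the image of `t - π` among the `(0, u)` with `u` orthogonal to `v`,
a summand of rank `n - 1`. -/
theorem exteriorPower_sub_Fl {g' : Fl →ₗ[R] Fl}
    (hg' : ∀ x, (g' x : s.Dbl R) = tOp s ϖ x - ϖ • (x : s.Dbl R)) :
    exteriorPower.map (R := R) (s.n - 1 + 1) g' = 0 := by
  classical
  have hn := s.le
  refine exteriorPower_map_eq_zero fun p x => ?_
  obtain ⟨i, -, ⟨g, hg, hgi⟩, -⟩ := h.exists_notMem p
  let a := g.2 i
  -- vectors orthogonal to `g.2` which span the orthogonal complement after inverting `a`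
  let z : Fin s.n → s.Vec R := fun l => a • Pi.single l 1 -
    (s.sgn i * s.form g.2 (Pi.single l 1)) • Pi.single i.rev 1
  have hsgn := s.sgn_mul_self (R := R) i
  have hz : ∀ l, s.form g.2 (z l) = 0 := fun l => by
    simp only [z, map_sub, map_smul, s.form_single, smul_eq_mul]
    linear_combination (-a * s.form g.2 (Pi.single l 1)) * hsgn
  have hzF : ∀ l, ((0, a • z l) : s.Dbl R) ∈ Fl := fun l => by
    refine h.mem_Fl_of_forall fun y hy => ?_
    have h1 : a • y.1 = y.1 i • g.2 :=
      congrArg Prod.snd (h.smul_eq_smul hg (h.add_mem y hy) i)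
    rw [s.pair_apply, map_smul, ← LinearMap.smul_apply, ← map_smul, h1]
    simp [hz]
  have hu : ∀ u : s.Vec R, s.form g.2 u = 0 → ∑ l : {l // l ≠ i.rev}, u l • z l = a • u := by
    intro u hu
    -- One of the `n` vectors vanishes, which leaves `n - 1`, fewer than the exterior degree.
    have h0 : z i.rev = 0 := by
      simp only [z, s.form_single]
      rw [← sub_smul]
      have : a - s.sgn i * (s.sgn i * g.2 i * 1) = 0 := by
        linear_combination (-a) * hsgn
      rw [this, zero_smul]
    have h1 : ∑ l, u l • z l = a • u := by
      have h2 : ∑ l, u l * s.form g.2 (Pi.single l 1) = 0 := by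
        rw [← hu]
        conv_rhs => rw [pi_eq_sum_univ' u]
        simp
      have h3 : u = ∑ l, u l • (Pi.single l 1 : s.Vec R) := pi_eq_sum_univ' u
      conv_rhs => rw [h3]
      simp only [z, smul_sub, Finset.sum_sub_distrib, smul_smul]
      rw [← Finset.sum_smul]
      have h4 : ∑ l, u l * (s.sgn i * s.form g.2 (Pi.single l 1)) = 0 := by
        rw [← mul_zero (s.sgn i), ← h2, Finset.mul_sum]
        exact Finset.sum_congr rfl fun l _ => by ring
      rw [h4, zero_smul, sub_zero, Finset.smul_sum]
      exact Finset.sum_congr rfl fun l _ => by rw [smul_smul, mul_comm]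
    rw [← h1, ← Fintype.sum_subtype_add_sum_subtype (fun l => l ≠ i.rev)]
    rw [left_eq_add]
    refine Finset.sum_eq_zero fun l _ => ?_
    have : (l : Fin s.n) = i.rev := not_not.1 l.2
    rw [this, h0, smul_zero]
  -- One factor `a` comes from expressing `a u` in the `z l`; the other is needed because only `a •
  -- z l` is known to give an element of `F_ℓ`.
  refine ⟨a * a, fun h' => ((p.2.mem_or_mem h').elim hgi hgi), {l // l ≠ i.rev}, inferInstance, ?_,
    Fintype.linearCombination R fun l : {l // l ≠ i.rev} => (⟨_, hzF l⟩ : Fl), fun j => ?_⟩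
  · rw [Fintype.card_subtype_compl, Fintype.card_subtype_eq, Fintype.card_fin]
    omega
  · have hx := h.pair_eq (h.G_le hg) (x j).2
    rw [s.pair_apply, h.sub_eq g hg] at hx
    refine ⟨fun l => ((x j : s.Dbl R).1 - (2 * ϖ) • (x j : s.Dbl R).2) l, ?_⟩
    ext1
    rw [Submodule.coe_smul, hg', tOp_sub, Fintype.linearCombination_apply,
      AddSubmonoidClass.coe_finsetSum]
    have h5 := hu ((x j : s.Dbl R).1 - (2 * ϖ) • (x j : s.Dbl R).2) (by
      simpa [sub_eq_zero] using hx)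
    refine Prod.ext ?_ ?_
    · rw [Prod.fst_sum]
      simp
    · rw [Prod.snd_sum]
      change ∑ l : {l // l ≠ i.rev}, _ • a • z l = _
      simp only [smul_comm _ a]
      rw [← Finset.smul_sum, h5, smul_smul]
      rfl

end IsPt

end Splitting

end

noncomputable section

namespace Splitting

variable {O₀ F₀ O F : Type u}
  [CommRing O₀] [IsDomain O₀] [IsDiscreteValuationRing O₀]
  [Field F₀] [Algebra O₀ F₀] [IsFractionRing O₀ F₀]
  [CommRing O] [IsDomain O] [IsDiscreteValuationRing O]
  [Field F] [Algebra O F] [IsFractionRing O F]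
  [Algebra F₀ F] [Algebra O₀ F] [Algebra O₀ O]
  [IsScalarTower O₀ F₀ F] [IsScalarTower O₀ O F] [IsIntegralClosure O O₀ F]

namespace Datum

variable (D : Datum O₀ F₀ O F)

/-! ### A basis of the standard lattices -/

/-- The numerical data of the moduli problem. -/
abbrev shape : Shape where
  n := D.n
  ℓ := D.ℓ
  pos := Nat.pos_of_ne_zero D.nonspecial.2.1
  -- For `n = 2m` the excluded values leave `ℓ ≤ m - 2`, and for `n = 2m + 1` they leave `ℓ ≤ m -
  -- 1`; the odd case is the sharp one.
  le := by
    obtain ⟨h1, h2, h3, h4⟩ := D.nonspecial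
    have := D.n_gt
    rcases Nat.even_or_odd D.n with h | h
    · have h5 := h4 h
      obtain ⟨m, hm⟩ := h
      omega
    · obtain ⟨m, hm⟩ := h
      omega

theorem two_F_ne (D : Datum O₀ F₀ O F) : (2 : F) ≠ 0 := by
  have h := (D.isUnit_two.map (algebraMap O₀ F)).ne_zero
  rwa [map_ofNat] at h

/-- The coefficients are half the traces of `x` and of `π⁻¹ x`, which are integral by `trace_mem`.
-/
theorem exists_eq_add (x : O) : ∃ a b : O₀, x = algebraMap O₀ O a + D.π * algebraMap O₀ O b := by
  obtain ⟨c, hc⟩ := D.trace_mem (D.π * x)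
  obtain ⟨d, hd⟩ := D.trace_mem x
  obtain ⟨u, hu⟩ := D.isUnit_two
  have hinj := IsFractionRing.injective O F
  have hπ := D.π_F_ne
  have hF := fun z : O₀ => (IsScalarTower.algebraMap_apply O₀ F₀ F z).symm
  have hO := fun z : O₀ => (IsScalarTower.algebraMap_apply O₀ O F z).symm
  replace hc := congrArg (algebraMap F₀ F) hc
  replace hd := congrArg (algebraMap F₀ F) hd
  rw [hF, D.trace_eq] at hc hd
  simp only [map_mul, map_inv₀, D.σ_π] at hc hd
  have hu2 : algebraMap O₀ F (↑u⁻¹ : O₀) * 2 = 1 := by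
    have : (2 : F) = algebraMap O₀ F u := by rw [hu, map_ofNat]
    rw [this, ← map_mul, Units.inv_mul, map_one]
  refine ⟨↑u⁻¹ * c, ↑u⁻¹ * d, hinj ?_⟩
  rw [map_add, map_mul (algebraMap O F), hO, hO, map_mul (algebraMap O₀ F),
    map_mul (algebraMap O₀ F), hc, hd]
  field_simp
  linear_combination (-algebraMap O F x) * hu2

/-- Apply `σ`, which changes the sign of `π`, and add. -/
theorem add_eq_zero {a b : O₀} (h : algebraMap O₀ F a + algebraMap O F D.π * algebraMap O₀ F b = 0) :
    a = 0 ∧ b = 0 := by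
  have h1 := congrArg D.σ h
  have hσ : ∀ z : O₀, D.σ (algebraMap O₀ F z) = algebraMap O₀ F z := fun z => by
    rw [IsScalarTower.algebraMap_apply O₀ F₀ F, AlgEquiv.commutes]
  rw [map_add, map_mul, hσ, hσ, D.σ_π, map_zero] at h1
  have hinj : Function.Injective (algebraMap O₀ F) := by
    rw [IsScalarTower.algebraMap_eq O₀ F₀ F]
    exact (algebraMap F₀ F).injective.comp (IsFractionRing.injective O₀ F₀)
  have ha : algebraMap O₀ F a = 0 := by
    apply (mul_eq_zero.1 (_ : (2 : F) * algebraMap O₀ F a = 0)).resolve_left D.two_F_ne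
    linear_combination h + h1
  have hb : algebraMap O₀ F b = 0 := by
    rw [ha, zero_add] at h
    exact (mul_eq_zero.1 h).resolve_left D.π_F_ne
  exact ⟨hinj (ha.trans (map_zero _).symm), hinj (hb.trans (map_zero _).symm)⟩

/-- The generators of the standard lattice, as elements of it. -/
def gen (i : ℕ) (k : Fin D.n) : D.lattice i :=
  ⟨D.latticeVec i k, Submodule.subset_span ⟨k, rfl⟩⟩

/-- The multiples by `π` of the generators. -/
def genπ (i : ℕ) (k : Fin D.n) : D.lattice i := D.mulπ i i (D.gen i k)

theorem coe_genπ (i : ℕ) (k : Fin D.n) : (D.genπ i k : Fin D.n → F) = D.π • D.latticeVec i k := rfl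

/-- The coefficient of a generator. -/
def coef (i : ℕ) (k : Fin D.n) : F := if (k : ℕ) < i then (algebraMap O F D.π)⁻¹ else 1

theorem coef_ne (i : ℕ) (k : Fin D.n) : D.coef i k ≠ 0 := by
  unfold coef
  split_ifs
  · exact inv_ne_zero D.π_F_ne
  · exact one_ne_zero

theorem latticeVec_eq (i : ℕ) (k : Fin D.n) : D.latticeVec i k = Pi.single k (D.coef i k) := by
  unfold latticeVec coef
  split_ifs
  · rw [← Pi.single_smul, smul_eq_mul, mul_one]
  · rfl

/-- Coordinates on the lattice over `O₀`. -/
def latticeMap (i : ℕ) : D.shape.Dbl O₀ →ₗ[O₀] D.lattice i :=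
  LinearMap.coprod (Fintype.linearCombination O₀ (D.gen i)) (Fintype.linearCombination O₀ (D.genπ i))

theorem latticeMap_apply (i : ℕ) (x : D.shape.Dbl O₀) :
    D.latticeMap i x = ∑ k, x.1 k • D.gen i k + ∑ k, x.2 k • D.genπ i k := rfl

theorem latticeMap_coord (i : ℕ) (x : D.shape.Dbl O₀) (k : Fin D.n) :
    (D.latticeMap i x : Fin D.n → F) k =
      (algebraMap O₀ F (x.1 k) + algebraMap O F D.π * algebraMap O₀ F (x.2 k)) * D.coef i k := by
  have h1 : ∀ (a : Fin D.n → O₀) (y : Fin D.n → D.lattice i)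
      (_ : ∀ l, l ≠ k → (y l : Fin D.n → F) k = 0),
      ((∑ l, a l • y l : D.lattice i) : Fin D.n → F) k =
        algebraMap O₀ F (a k) * (y k : Fin D.n → F) k := by
    intro a y hy
    rw [AddSubmonoidClass.coe_finsetSum, Finset.sum_apply, Finset.sum_eq_single k]
    · rw [Submodule.coe_smul_of_tower, Pi.smul_apply, Algebra.smul_def]
    · intro l _ hl
      rw [Submodule.coe_smul_of_tower, Pi.smul_apply, hy l hl, smul_zero]
    · simp
  have h2 : ∀ l, l ≠ k → (D.gen i l : Fin D.n → F) k = 0 := fun l hl => by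
    simp [gen, latticeVec_eq, Pi.single_eq_of_ne (Ne.symm hl)]
  have h3 : ∀ l, l ≠ k → (D.genπ i l : Fin D.n → F) k = 0 := fun l hl => by
    simp [coe_genπ, latticeVec_eq, Pi.single_eq_of_ne (Ne.symm hl)]
  rw [latticeMap_apply, Submodule.coe_add, Pi.add_apply, h1 x.1 _ h2, h1 x.2 _ h3]
  simp only [coe_genπ, gen, latticeVec_eq, Pi.smul_apply, Pi.single_eq_same, Algebra.smul_def]
  ring

theorem latticeMap_bijective (i : ℕ) : Function.Bijective (D.latticeMap i) := by
  constructor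
  · rw [← LinearMap.ker_eq_bot, LinearMap.ker_eq_bot']
    intro x hx
    have h1 : ∀ k, x.1 k = 0 ∧ x.2 k = 0 := fun k => by
      have := D.latticeMap_coord i x k
      rw [hx] at this
      exact D.add_eq_zero ((mul_eq_zero.1 this.symm).resolve_right (D.coef_ne i k))
    exact Prod.ext (funext fun k => (h1 k).1) (funext fun k => (h1 k).2)
  · rintro ⟨y, hy⟩
    obtain ⟨c, hc⟩ := (Submodule.mem_span_range_iff_exists_fun O).1 hy
    choose a b hab using fun k => D.exists_eq_add (c k)
    refine ⟨(a, b), Subtype.ext (funext fun k => ?_)⟩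
    rw [latticeMap_coord]
    refine Eq.trans ?_ (congrFun hc k)
    rw [Finset.sum_apply, Finset.sum_eq_single k]
    · rw [Pi.smul_apply, latticeVec_eq, Pi.single_eq_same, Algebra.smul_def, hab]
      simp [← IsScalarTower.algebraMap_apply]
    · intro l _ hl
      simp [latticeVec_eq, Pi.single_eq_of_ne (Ne.symm hl)]
    · simp

/-! ### The maps between the lattices on the generators -/

theorem mulπ_gen (i : ℕ) (k : Fin D.n) : D.mulπ i i (D.gen i k) = D.genπ i k := rfl

theorem coe_gen (i : ℕ) (k : Fin D.n) :
    (D.gen i k : Fin D.n → F) = Pi.single k (D.coef i k) := D.latticeVec_eq i k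

theorem coe_genπ' (i : ℕ) (k : Fin D.n) :
    (D.genπ i k : Fin D.n → F) = Pi.single k (algebraMap O F D.π * D.coef i k) := by
  rw [coe_genπ, latticeVec_eq, ← Pi.single_smul, Algebra.smul_def]

theorem smul_single (k : Fin D.n) (a : F) :
    D.π • (Pi.single k a : Fin D.n → F) = Pi.single k (algebraMap O F D.π * a) := by
  rw [← Pi.single_smul, Algebra.smul_def]

theorem smul_single' (k : Fin D.n) (a : F) : D.π₀ • (Pi.single k a : Fin D.n → F) =
    Pi.single k (algebraMap O F D.π * (algebraMap O F D.π * a)) := by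
  rw [← Pi.single_smul, Algebra.smul_def, ← D.sq_F, sq, mul_assoc]

theorem out_iff (k : Fin D.n) : D.shape.Out k ↔ (k : ℕ) < D.ℓ ∨ D.n - D.ℓ ≤ (k : ℕ) := Iff.rfl

/-- The two lattices have the same generator at outer indices and differ by a factor `π` at middle
ones. This is the origin of the case distinctions in `up` and `down`. -/
theorem coef_eq (k : Fin D.n) : D.coef D.ℓ k =
    if D.shape.Out k then D.coef (D.n - D.ℓ) k else algebraMap O F D.π * D.coef (D.n - D.ℓ) k := by
  have h1 : 2 * D.ℓ + 3 ≤ D.n := D.shape.le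
  have h2 := D.π_F_ne
  unfold coef
  by_cases h : D.shape.Out k
  · rw [if_pos h]
    rcases (D.out_iff k).1 h with h | h
    · rw [if_pos h, if_pos (by omega)]
    · rw [if_neg (by omega), if_neg (by omega)]
  · rw [if_neg h]
    rw [out_iff] at h
    rw [if_neg (by omega), if_pos (by omega), mul_inv_cancel₀ h2]

theorem mulπ_genπ (i : ℕ) (k : Fin D.n) : D.mulπ i i (D.genπ i k) = D.π₀ • D.gen i k := by
  refine Subtype.ext ?_
  change D.π • (D.genπ i k : Fin D.n → F) = D.π₀ • (D.gen i k : Fin D.n → F)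
  rw [coe_genπ', coe_gen, smul_single, smul_single']

theorem inclusion_gen (k : Fin D.n) : Submodule.inclusion (D.lattice_mono D.ℓ_le) (D.gen D.ℓ k) =
    if D.shape.Out k then D.gen (D.n - D.ℓ) k else D.genπ (D.n - D.ℓ) k := by
  refine Subtype.ext ?_
  rw [Submodule.coe_inclusion, apply_ite Subtype.val, coe_gen, coe_gen, coe_genπ', coef_eq]
  split_ifs <;> rfl

theorem inclusion_genπ (k : Fin D.n) :
    Submodule.inclusion (D.lattice_mono D.ℓ_le) (D.genπ D.ℓ k) =
      if D.shape.Out k then D.genπ (D.n - D.ℓ) k else D.π₀ • D.gen (D.n - D.ℓ) k := by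
  refine Subtype.ext ?_
  rw [Submodule.coe_inclusion, apply_ite Subtype.val, Submodule.coe_smul_of_tower, coe_gen,
    coe_genπ', coe_genπ', coef_eq, smul_single']
  split_ifs <;> rfl

theorem mulπ_gen' (k : Fin D.n) : D.mulπ (D.n - D.ℓ) D.ℓ (D.gen (D.n - D.ℓ) k) =
    if D.shape.Out k then D.genπ D.ℓ k else D.gen D.ℓ k := by
  refine Subtype.ext ?_
  change D.π • (D.gen (D.n - D.ℓ) k : Fin D.n → F) = _
  rw [apply_ite Subtype.val, coe_gen, coe_gen, coe_genπ', coef_eq, smul_single]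
  split_ifs <;> rfl

theorem mulπ_genπ' (k : Fin D.n) : D.mulπ (D.n - D.ℓ) D.ℓ (D.genπ (D.n - D.ℓ) k) =
    if D.shape.Out k then D.π₀ • D.gen D.ℓ k else D.genπ D.ℓ k := by
  refine Subtype.ext ?_
  change D.π • (D.genπ (D.n - D.ℓ) k : Fin D.n → F) = _
  rw [apply_ite Subtype.val, Submodule.coe_smul_of_tower, coe_gen, coe_genπ', coe_genπ', coef_eq,
    smul_single', smul_single]
  split_ifs <;> rfl

/-- Exactly one of the two factors contributes `π⁻¹`, and `σ` negates it only if it is the first.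
This is where the sign `sgn` arises. -/
theorem σ_coef (k : Fin D.n) : D.σ (D.coef (D.n - D.ℓ) k) * D.coef D.ℓ k.rev =
    -(D.shape.sgn k * (algebraMap O F D.π)⁻¹) := by
  have h1 := D.shape.le
  have h2 : (k.rev : ℕ) = D.n - (k + 1) := Fin.val_rev k
  have hk := k.2
  unfold coef Shape.sgn
  by_cases h : (k : ℕ) < D.n - D.ℓ
  · rw [if_pos h, if_neg (by omega), if_pos h, map_inv₀, D.σ_π, inv_neg, mul_one, one_mul]
  · rw [if_neg h, if_pos (by omega), if_neg h, map_one, one_mul, neg_mul, neg_neg, one_mul]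

theorem pairing_eq {x : D.lattice (D.n - D.ℓ)} {y : D.lattice D.ℓ} {j k : Fin D.n} {a b : F}
    (hx : (x : Fin D.n → F) = Pi.single k a) (hy : (y : Fin D.n → F) = Pi.single j b) (c : O₀)
    (hc : j = k.rev → D.σ a * b + D.σ (D.σ a * b) = 2 * algebraMap O₀ F c) :
    D.pairing D.ℓ x y = if j = k.rev then c else 0 := by
  apply IsFractionRing.injective O₀ F₀
  apply (algebraMap F₀ F).injective
  rw [algebraMap_pairing, hx, hy]
  change algebraMap F₀ F (2⁻¹ * Algebra.trace F₀ F (D.herm (Pi.single k a) (Pi.single j b))) = _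
  rw [map_mul, D.trace_eq, map_inv₀, map_ofNat, herm, Finset.sum_eq_single k,
    Pi.single_eq_same, ← IsScalarTower.algebraMap_apply]
  · split_ifs with h
    · subst h
      rw [Pi.single_eq_same, hc rfl, inv_mul_cancel_left₀ D.two_F_ne]
    · rw [Pi.single_eq_of_ne (Ne.symm h), mul_zero, map_zero, map_zero, add_zero, mul_zero]
  · intro l _ hl
    rw [Pi.single_eq_of_ne hl, map_zero, zero_mul]
  · simp

theorem σ_sgn (k : Fin D.n) : D.σ (D.shape.sgn k) = D.shape.sgn k :=
  D.shape.map_sgn (D.σ : F →+* F) k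

/-- The hermitian product is zero or plus or minus `π⁻¹`, which has trace zero. -/
theorem pairing_gen_gen (j k : Fin D.n) :
    D.pairing D.ℓ (D.gen _ k) (D.gen _ j) = 0 := by
  rw [D.pairing_eq (D.coe_gen _ k) (D.coe_gen _ j) 0, ite_self]
  rintro rfl
  rw [σ_coef, map_neg, map_mul, map_inv₀, D.σ_π, inv_neg, D.σ_sgn, map_zero]
  ring

theorem pairing_genπ_gen (j k : Fin D.n) :
    D.pairing D.ℓ (D.genπ _ k) (D.gen _ j) = if j = k.rev then D.shape.sgn k else 0 := by
  refine D.pairing_eq (D.coe_genπ' _ k) (D.coe_gen _ j) _ ?_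
  rintro rfl
  rw [map_mul, D.σ_π, mul_assoc, σ_coef, neg_mul_neg, mul_left_comm, mul_inv_cancel₀ D.π_F_ne,
    mul_one, D.σ_sgn, D.shape.map_sgn, two_mul]

theorem pairing_gen_genπ (j k : Fin D.n) :
    D.pairing D.ℓ (D.gen _ k) (D.genπ _ j) = if j = k.rev then -D.shape.sgn k else 0 := by
  refine D.pairing_eq (D.coe_gen _ k) (D.coe_genπ' _ j) _ ?_
  rintro rfl
  rw [mul_left_comm, σ_coef, mul_neg, mul_left_comm, mul_inv_cancel₀ D.π_F_ne,
    mul_one, map_neg, D.σ_sgn, map_neg, D.shape.map_sgn, two_mul]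

theorem pairing_genπ_genπ (j k : Fin D.n) :
    D.pairing D.ℓ (D.genπ _ k) (D.genπ _ j) = 0 := by
  rw [D.pairing_eq (D.coe_genπ' _ k) (D.coe_genπ' _ j) 0, ite_self]
  rintro rfl
  rw [map_mul, D.σ_π, mul_mul_mul_comm, σ_coef, mul_neg, mul_left_comm, neg_mul, neg_mul,
    mul_assoc (algebraMap O F D.π), mul_inv_cancel₀ D.π_F_ne]
  simp only [map_neg, map_mul, map_zero, map_one, D.σ_sgn, D.σ_π]
  ring

/-! ### Coordinates on the base change of a lattice -/

section BaseChange

variable (R : Type u) [CommRing R] [Algebra O₀ R] [Algebra O R] [IsScalarTower O₀ O R]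

/-- Coordinates with respect to the generators and their multiples by `π`. -/
def latMap (i : ℕ) : D.shape.Dbl R →ₗ[R] D.Lat R i :=
  LinearMap.coprod (Fintype.linearCombination R fun k => (1 ⊗ₜ D.gen i k : D.Lat R i))
    (Fintype.linearCombination R fun k => (1 ⊗ₜ D.genπ i k : D.Lat R i))

theorem latMap_apply (i : ℕ) (x : D.shape.Dbl R) :
    D.latMap R i x = ∑ k, x.1 k ⊗ₜ D.gen i k + ∑ k, x.2 k ⊗ₜ D.genπ i k := by
  change ∑ k, x.1 k • (1 ⊗ₜ D.gen i k : D.Lat R i) + ∑ k, x.2 k • (1 ⊗ₜ D.genπ i k : D.Lat R i) = _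
  simp only [TensorProduct.smul_tmul', smul_eq_mul, mul_one]

/-- It is the base change of the coordinate isomorphism over `O₀`; the two agree on the images of
integral vectors, which span. -/
theorem latMap_bijective (i : ℕ) : Function.Bijective (D.latMap R i) := by
  let e : D.shape.Dbl O₀ ≃ₗ[O₀] D.lattice i :=
    LinearEquiv.ofBijective (D.latticeMap i) (D.latticeMap_bijective i)
  let e' : D.shape.Dbl R ≃ₗ[R] D.Lat R i :=
    (D.shape.isBaseChange_dmap (R := O₀) (R' := R)).equiv.symm.trans (e.baseChange O₀ R _ _)
  have he : ∀ x : D.shape.Dbl O₀, e' (D.shape.dmap (algebraMap O₀ R) x) = 1 ⊗ₜ D.latticeMap i x := by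
    intro x
    have := (D.shape.isBaseChange_dmap (R := O₀) (R' := R)).equiv_symm_apply x
    change e.baseChange O₀ R _ _ ((D.shape.isBaseChange_dmap (R := O₀) (R' := R)).equiv.symm _) = _
    erw [this]
    simp [e]
  have : D.latMap R i = e'.toLinearMap := by
    have hs := span_range_eq_top_of_isBaseChange (D.shape.isBaseChange_dmap (R := O₀) (R' := R))
    refine LinearMap.ext_on_range hs fun x => ?_
    refine Eq.trans ?_ (he x).symm
    rw [latMap_apply, latticeMap_apply, TensorProduct.tmul_add, TensorProduct.tmul_sum,
      TensorProduct.tmul_sum]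
    simp only [← TensorProduct.smul_tmul, Algebra.smul_def, mul_one]
    rfl
  rw [this]
  exact e'.bijective

/-- The change of coordinates from `a + (t - π) b` to generators and their multiples by `π`. -/
def shear (c : R) : D.shape.Dbl R ≃ₗ[R] D.shape.Dbl R where
  toFun x := (x.1 - c • x.2, x.2)
  map_add' x y := by ext <;> simp; ring
  map_smul' a x := by ext <;> simp; ring
  invFun x := (x.1 + c • x.2, x.2)
  left_inv x := by ext <;> simp
  right_inv x := by ext <;> simp

/-- The coordinates `(a, b)` of `a + (t - π) b`. -/
def coord (i : ℕ) : D.shape.Dbl R ≃ₗ[R] D.Lat R i :=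
  (D.shear R (algebraMap O R D.π)).trans
    (LinearEquiv.ofBijective (D.latMap R i) (D.latMap_bijective R i))

theorem coord_apply (i : ℕ) (x : D.shape.Dbl R) :
    D.coord R i x = D.latMap R i (x.1 - algebraMap O R D.π • x.2, x.2) := rfl

variable {R} in
theorem coord_dmap {R' : Type u} [CommRing R'] [Algebra O₀ R'] [Algebra O R']
    [IsScalarTower O₀ O R'] (φ : R →ₐ[O] R') (i : ℕ) (x : D.shape.Dbl R) :
    D.coord R' i (D.shape.dmap (φ : R →+* R') x) =
      ((φ.restrictScalars O₀).toLinearMap.rTensor (D.lattice i)) (D.coord R i x) := by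
  rw [coord_apply, coord_apply, latMap_apply, latMap_apply, map_add, map_sum, map_sum]
  simp [Shape.dmap]

theorem sq_R : algebraMap O R D.π ^ 2 = algebraMap O₀ R D.π₀ := by
  rw [← map_pow, D.π_sq, ← IsScalarTower.algebraMap_apply]

theorem tmul_π₀ (i : ℕ) (a : R) (y : D.lattice i) :
    a ⊗ₜ[O₀] (D.π₀ • y) = (algebraMap O R D.π * (algebraMap O R D.π * a)) ⊗ₜ[O₀] y := by
  rw [← TensorProduct.smul_tmul, Algebra.smul_def, ← D.sq_R, sq, mul_assoc]

theorem t_coord (i : ℕ) (x : D.shape.Dbl R) :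
    D.t R i (D.coord R i x) = D.coord R i (tOp D.shape (algebraMap O R D.π) x) := by
  rw [coord_apply, coord_apply, latMap_apply, latMap_apply, ← Finset.sum_add_distrib,
    ← Finset.sum_add_distrib, map_sum]
  refine Finset.sum_congr rfl fun k _ => ?_
  rw [map_add, t, LinearMap.baseChange_tmul, LinearMap.baseChange_tmul, mulπ_gen, mulπ_genπ,
    tmul_π₀, add_comm]
  congr 2
  simp [tOp, Algebra.smul_def]
  ring

theorem A_coord (x : D.shape.Dbl R) :
    D.A R (D.coord R D.ℓ x) = D.coord R (D.n - D.ℓ) (D.shape.up (algebraMap O R D.π) x) := by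
  rw [coord_apply, coord_apply, latMap_apply, latMap_apply, ← Finset.sum_add_distrib,
    ← Finset.sum_add_distrib, map_sum]
  refine Finset.sum_congr rfl fun k _ => ?_
  rw [map_add, A, LinearMap.baseChange_tmul, LinearMap.baseChange_tmul]
  simp only [LinearMap.restrictScalars_apply, inclusion_gen, inclusion_genπ]
  by_cases h : D.shape.Out k
  · simp [h, Shape.up, Shape.tilt, Algebra.smul_def]
  · simp only [if_neg h, tmul_π₀]
    rw [add_comm]
    simp [h, Shape.up, Shape.tilt, Algebra.smul_def]
    congr 2
    ring

theorem A'_coord (x : D.shape.Dbl R) :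
    D.A' R (D.coord R (D.n - D.ℓ) x) = D.coord R D.ℓ (D.shape.down (algebraMap O R D.π) x) := by
  rw [coord_apply, coord_apply, latMap_apply, latMap_apply, ← Finset.sum_add_distrib,
    ← Finset.sum_add_distrib, map_sum]
  refine Finset.sum_congr rfl fun k _ => ?_
  rw [map_add, A', LinearMap.baseChange_tmul, LinearMap.baseChange_tmul, mulπ_gen', mulπ_genπ']
  by_cases h : D.shape.Out k
  · simp only [if_pos h, tmul_π₀]
    rw [add_comm]
    simp [h, Shape.down, Algebra.smul_def]
    congr 2
    ring
  · simp [h, Shape.down, Algebra.smul_def]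

theorem pairingR_coord (x y : D.shape.Dbl R) :
    D.pairingR R (D.coord R (D.n - D.ℓ) x) (D.coord R D.ℓ y) = D.shape.pair x y := by
  have key : ∀ x y : D.shape.Dbl R, D.pairingR R (D.latMap R (D.n - D.ℓ) x) (D.latMap R D.ℓ y) =
      D.shape.pair x y := by
    intro x y
    rw [latMap_apply, latMap_apply, Shape.pair_apply, Shape.form_apply, Shape.form_apply]
    simp only [map_add, map_sum, LinearMap.add_apply, LinearMap.sum_apply, pairingR_tmul,
      pairing_gen_gen, pairing_genπ_gen, pairing_gen_genπ, pairing_genπ_genπ]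
    simp only [apply_ite (algebraMap O₀ R), map_neg, map_zero, Shape.map_sgn, mul_zero,
      Finset.sum_const_zero, zero_add, add_zero, mul_ite]
    rw [sub_eq_add_neg, ← Finset.sum_neg_distrib]
    congr 1 <;> rw [Finset.sum_comm] <;> refine Finset.sum_congr rfl fun k _ => ?_ <;>
      rw [Finset.sum_ite_eq', if_pos (Finset.mem_univ _)] <;> ring
  rw [coord_apply, coord_apply, key, Shape.pair_apply, Shape.pair_apply]
  simp

end BaseChange

end Datum

end Splitting

end

noncomputable section

namespace Splitting

/-! ### Transport along an isomorphism -/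

section Transport

variable {R P P' : Type u} [CommRing R] [AddCommGroup P] [Module R P] [AddCommGroup P'] [Module R P']

theorem IsSummandOfRank.map_equiv (e : P ≃ₗ[R] P') {N : Submodule R P} {d : ℕ}
    (h : IsSummandOfRank N d) : IsSummandOfRank (N.map e.toLinearMap) d := by
  obtain ⟨⟨Q, hQ⟩, hd⟩ := h
  refine ⟨⟨Q.map e.toLinearMap, (Submodule.orderIsoMapComap e).isCompl hQ⟩, fun p => ?_⟩
  rw [← hd p]
  exact congrFun (Module.rankAtStalk_eq_of_equiv (e.submoduleMap N)).symm p

theorem IsSummandOfRank.comap_equiv (e : P ≃ₗ[R] P') {N : Submodule R P'} {d : ℕ}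
    (h : IsSummandOfRank N d) : IsSummandOfRank (N.comap e.toLinearMap) d := by
  have := h.map_equiv e.symm
  rwa [Submodule.map_equiv_eq_comap_symm, LinearEquiv.symm_symm] at this

theorem exteriorPower_map_eq_zero_of_equiv (e : P' ≃ₗ[R] P) {k : ℕ} {g : P →ₗ[R] P}
    {g' : P' →ₗ[R] P'} (he : ∀ x, e (g' x) = g (e x)) (h : exteriorPower.map (R := R) k g = 0) :
    exteriorPower.map (R := R) k g' = 0 := by
  have : g' = e.symm.toLinearMap ∘ₗ g ∘ₗ e.toLinearMap :=
    LinearMap.ext fun x => e.injective (by simp [he])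
  rw [this, exteriorPower.map_comp, exteriorPower.map_comp, h, LinearMap.zero_comp,
    LinearMap.comp_zero]

end Transport

variable {O₀ F₀ O F : Type u}
  [CommRing O₀] [IsDomain O₀] [IsDiscreteValuationRing O₀]
  [Field F₀] [Algebra O₀ F₀] [IsFractionRing O₀ F₀]
  [CommRing O] [IsDomain O] [IsDiscreteValuationRing O]
  [Field F] [Algebra O F] [IsFractionRing O F]
  [Algebra F₀ F] [Algebra O₀ F] [Algebra O₀ O]
  [IsScalarTower O₀ F₀ F] [IsScalarTower O₀ O F] [IsIntegralClosure O O₀ F]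

namespace Datum

variable (D : Datum O₀ F₀ O F)

/-! ### Points of the splitting model in coordinates -/

section Points

variable {R : Type u} [CommRing R] [Algebra O₀ R] [Algebra O R] [IsScalarTower O₀ O R]

theorem add_coord (i : ℕ) (x : D.shape.Dbl R) :
    (D.t R i + D.πScalar R i) (D.coord R i x) =
      D.coord R i ((2 * algebraMap O R D.π) • x.1, x.1) := by
  rw [← tOp_add, map_add, map_smul, ← t_coord]
  rfl

theorem sub_coord (i : ℕ) (x : D.shape.Dbl R) :
    (D.t R i - D.πScalar R i) (D.coord R i x) =
      D.coord R i (0, x.1 - (2 * algebraMap O R D.π) • x.2) := by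
  rw [← tOp_sub, map_sub, map_smul, ← t_coord]
  rfl

theorem isPt_comap (x : SplPoint D R) : IsPt D.shape (algebraMap O R D.π)
    (x.Fl.comap (D.coord R _).toLinearMap) (x.Fnl.comap (D.coord R _).toLinearMap)
    (x.G.comap (D.coord R _).toLinearMap) where
  summand_Fl := x.summand_Fl.comap_equiv _
  summand_Fnl := x.summand_Fnl.comap_equiv _
  summand_G := x.summand_G.comap_equiv _
  up_mem y hy := by
    change D.coord R _ _ ∈ x.Fnl
    rw [← A_coord]
    exact x.map_A_le ⟨_, hy, rfl⟩
  down_mem y hy := by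
    change D.coord R _ _ ∈ x.Fl
    rw [← A'_coord]
    exact x.map_A'_le ⟨_, hy, rfl⟩
  orth := by
    ext y
    change D.coord R _ y ∈ x.Fnl ↔ ∀ z, D.coord R _ z ∈ x.Fl → D.shape.pair y z = 0
    rw [x.orth]
    constructor
    · intro h z hz
      rw [← pairingR_coord]
      exact h _ hz
    · intro h z hz
      obtain ⟨z, rfl⟩ := (D.coord R _).surjective z
      rw [pairingR_coord]
      exact h z hz
  G_le := Submodule.comap_mono x.G_le
  add_mem y hy := by
    change D.coord R _ _ ∈ x.G
    rw [← add_coord]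
    exact x.t_add_π ⟨_, hy, rfl⟩
  sub_eq y hy := by
    have h : (D.t R (D.n - D.ℓ) - D.πScalar R (D.n - D.ℓ)) (D.coord R _ y) ∈
        (⊥ : Submodule R (D.Lat R (D.n - D.ℓ))) := x.t_sub_π ▸ ⟨_, hy, rfl⟩
    rw [Submodule.mem_bot, sub_coord, LinearEquiv.map_eq_zero_iff, Prod.mk_eq_zero] at h
    exact sub_eq_zero.1 h.2

section Transport

variable (i : ℕ) {N : Submodule R (D.shape.Dbl R)}
  (hN : ∀ x ∈ N, tOp D.shape (algebraMap O R D.π) x ∈ N)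
include hN

theorem t_mem_map :
    ∀ x ∈ N.map (D.coord R i).toLinearMap, D.t R i x ∈ N.map (D.coord R i).toLinearMap := by
  rintro _ ⟨x, hx, rfl⟩
  exact ⟨_, hN x hx, (D.t_coord R i x).symm⟩

theorem restrict_map (x : N.map (D.coord R i).toLinearMap) :
    ((D.coord R i).submoduleMap N).symm ((D.t R i).restrict (D.t_mem_map i hN) x) =
      (tOp D.shape (algebraMap O R D.π)).restrict hN (((D.coord R i).submoduleMap N).symm x) := by
  obtain ⟨y, rfl⟩ := ((D.coord R i).submoduleMap N).surjective x
  rw [LinearEquiv.symm_apply_apply, LinearEquiv.symm_apply_eq]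
  exact Subtype.ext (D.t_coord R i y)

variable (h : IsRankOne ((tOp D.shape (algebraMap O R D.π)).restrict hN) (algebraMap O R D.π))
include h

theorem isRankOne_map : IsRankOne (N := N.map (D.coord R i).toLinearMap)
    ((D.t R i).restrict (D.t_mem_map i hN)) (algebraMap O R D.π) :=
  h.of_equiv ((D.coord R i).submoduleMap N).symm (D.restrict_map i hN)

theorem kottwitz_map : Kottwitz D (D.t_mem_map i hN) :=
  (D.isRankOne_map i hN h).hasCharpoly (by have := D.n_gt; omega)

theorem wedge_map (h' : ∀ g' : N →ₗ[R] N, (∀ x, (g' x : D.shape.Dbl R) =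
      tOp D.shape (algebraMap O R D.π) x - algebraMap O R D.π • (x : D.shape.Dbl R)) →
        exteriorPower.map (R := R) (D.n - 1 + 1) g' = 0) : Wedge D (D.t_mem_map i hN) := by
  refine ⟨exteriorPower_map_eq_zero_of_equiv ((D.coord R i).submoduleMap N).symm
    (g := (tOp D.shape (algebraMap O R D.π)).restrict hN - algebraMap O R D.π • LinearMap.id)
    (fun x => ?_) (h' _ fun x => rfl),
    (D.isRankOne_map i hN h).exteriorPower_map_eq_zero fun x => rfl⟩
  rw [LinearMap.sub_apply, ← D.restrict_map i hN, LinearMap.smul_apply, LinearMap.id_apply,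
    ← map_smul, ← map_sub]
  rfl

end Transport

variable {D} in
/-- The point of the splitting model with the given coordinates. -/
@[simps G]
def splPoint {Fl Fnl G : Submodule R (D.shape.Dbl R)}
    (h : IsPt D.shape (algebraMap O R D.π) Fl Fnl G) : SplPoint D R where
  Fl := Fl.map (D.coord R _).toLinearMap
  Fnl := Fnl.map (D.coord R _).toLinearMap
  G := G.map (D.coord R _).toLinearMap
  summand_Fl := h.summand_Fl.map_equiv _
  summand_Fnl := h.summand_Fnl.map_equiv _
  stable_Fl := D.t_mem_map _ h.tOp_mem_Fl
  stable_Fnl := D.t_mem_map _ h.tOp_mem_Fnl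
  map_A_le := by
    rintro _ ⟨_, ⟨x, hx, rfl⟩, rfl⟩
    exact ⟨_, h.up_mem x hx, (D.A_coord R x).symm⟩
  map_A'_le := by
    rintro _ ⟨_, ⟨x, hx, rfl⟩, rfl⟩
    exact ⟨_, h.down_mem x hx, (D.A'_coord R x).symm⟩
  orth := by
    ext y
    obtain ⟨y, rfl⟩ := (D.coord R _).surjective y
    have h1 : D.coord R (D.n - D.ℓ) y ∈ Fnl.map (D.coord R (D.n - D.ℓ)).toLinearMap ↔ y ∈ Fnl :=
      ⟨by
        rintro ⟨z, hz, h2⟩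
        rwa [← (D.coord R _).injective h2], fun h2 => ⟨_, h2, rfl⟩⟩
    rw [h1, h.orth]
    constructor
    · rintro h2 _ ⟨z, hz, rfl⟩
      exact (D.pairingR_coord R y z).trans (h2 z hz)
    · intro h2 z hz
      rw [← D.pairingR_coord]
      exact h2 _ ⟨z, hz, rfl⟩
  kottwitz_Fl := D.kottwitz_map _ h.tOp_mem_Fl h.isRankOne_Fl
  kottwitz_Fnl := D.kottwitz_map _ h.tOp_mem_Fnl h.isRankOne_Fnl
  wedge_Fl := D.wedge_map _ h.tOp_mem_Fl h.isRankOne_Fl fun _ => h.exteriorPower_sub_Fl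
  wedge_Fnl := D.wedge_map _ h.tOp_mem_Fnl h.isRankOne_Fnl fun _ => h.exteriorPower_sub_Fnl
  summand_G := h.summand_G.map_equiv _
  G_le := Submodule.map_mono h.G_le
  t_add_π := by
    rintro _ ⟨_, ⟨x, hx, rfl⟩, rfl⟩
    exact ⟨_, h.add_mem x hx, (D.add_coord _ x).symm⟩
  t_sub_π := by
    rw [eq_bot_iff]
    rintro _ ⟨_, ⟨x, hx, rfl⟩, rfl⟩
    refine (Submodule.mem_bot R).2 ((D.sub_coord _ x).trans ?_)
    rw [h.sub_eq x hx, sub_self]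
    exact map_zero _

variable (R) in
/-- Points of the splitting model in coordinates. -/
def splEquiv : {ξ : Pt D.shape D.π R // ξ.ρ = algebraMap O R} ≃ SplPoint D R where
  toFun ξ := splPoint (R := R) (Fl := ξ.1.Fl) (Fnl := ξ.1.Fnl) (G := ξ.1.G) (by
    have := ξ.1.isPt
    rwa [ξ.2] at this)
  invFun x := ⟨⟨algebraMap O R, _, _, _, D.isPt_comap x⟩, rfl⟩
  left_inv ξ := by
    refine Subtype.ext (Pt.ext ξ.2.symm ?_ ?_ ?_) <;>
      exact Submodule.comap_map_eq_of_injective (f := (D.coord R _).toLinearMap)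
        (D.coord R _).injective _
  right_inv x := by
    refine SplPoint.ext ?_ ?_ ?_ <;>
      exact Submodule.map_comap_eq_of_surjective (f := (D.coord R _).toLinearMap)
        (D.coord R _).surjective _

theorem map_coord_pull {R' : Type u} [CommRing R'] [Algebra O₀ R'] [Algebra O R']
    [IsScalarTower O₀ O R'] (φ : R →ₐ[O] R') (i : ℕ) (N : Submodule R (D.shape.Dbl R)) :
    (pull (φ : R →+* R') N).map (D.coord R' i).toLinearMap =
      pullbackSubmodule D (φ.restrictScalars O₀) (N.map (D.coord R i).toLinearMap) := by
  rw [pull, Submodule.map_span, pullbackSubmodule, Submodule.map_coe, Set.image_image,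
    Set.image_image]
  congr 1
  refine Set.image_congr' fun x => ?_
  exact D.coord_dmap φ i x

end Points

/-- The splitting model. -/
abbrev model : Scheme.{u} := (charted D.shape D.π).M

/-- The structure morphism of the splitting model. -/
abbrev modelTo : D.model ⟶ Spec (.of O) := (charted D.shape D.π).str

theorem comp_modelTo_iff {R : Type u} [CommRing R] [Algebra O R] (x : Spec (.of R) ⟶ D.model) :
    x ≫ D.modelTo = Spec.map (CommRingCat.ofHom (algebraMap O R)) ↔
      Pt.ρ ((charted D.shape D.π).points (.of R) x) = algebraMap O R := by
  rw [modelTo, ← ChartedFunctor.map_base_points]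
  constructor
  · intro h
    exact congrArg CommRingCat.Hom.hom (Spec.map_injective h)
  · intro h
    exact congrArg (fun f => Spec.map (CommRingCat.ofHom f)) h

/-- The splitting model represents the moduli problem. -/
def representation : Representation D D.modelTo where
  triple R _ _ _ _ := (Equiv.subtypeEquiv ((charted D.shape D.π).points (.of R))
    D.comp_modelTo_iff).trans (D.splEquiv R)
  triple_map R R' _ _ _ _ _ _ _ _ φ x y h := by
    have h1 : (charted D.shape D.π).points (.of R') y.1 =
        Pt.map (φ : R →+* R') ((charted D.shape D.π).points (.of R) x.1) := by
      rw [h, ChartedFunctor.points_comp]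
      rfl
    refine ⟨Eq.trans ?_ (D.map_coord_pull φ _ _), Eq.trans ?_ (D.map_coord_pull φ _ _),
      Eq.trans ?_ (D.map_coord_pull φ _ _)⟩
    · exact congrArg (fun ξ : Pt D.shape D.π R' => ξ.Fl.map (D.coord R' D.ℓ).toLinearMap) h1
    · exact congrArg (fun ξ : Pt D.shape D.π R' => ξ.Fnl.map (D.coord R' (D.n - D.ℓ)).toLinearMap) h1
    · exact congrArg (fun ξ : Pt D.shape D.π R' => ξ.G.map (D.coord R' (D.n - D.ℓ)).toLinearMap) h1

end Datum

end Splitting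

end

noncomputable section

namespace Splitting

/-! ### Schemes covered by given open subschemes -/

/-- The cover by the given open subschemes. -/
def openCoverOf {W : Scheme.{u}} {α : Type u} (Y : α → Scheme.{u}) (f : ∀ a, Y a ⟶ W)
    [∀ a, IsOpenImmersion (f a)] (hf : ∀ x : W, ∃ a, x ∈ Set.range (f a)) : W.OpenCover :=
  Scheme.Cover.mkOfCovers α Y f hf inferInstance

/-- Local lifts through a monomorphism are unique, so they glue. -/
theorem exists_lift_of_mono {W S T : Scheme.{u}} {α : Type u} (Y : α → Scheme.{u})
    (f : ∀ a, Y a ⟶ W) [∀ a, IsOpenImmersion (f a)] (hf : ∀ x : W, ∃ a, x ∈ Set.range (f a))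
    (u : T ⟶ S) [Mono u] (v : W ⟶ S) (g : ∀ a, Y a ⟶ T) (hg : ∀ a, g a ≫ u = f a ≫ v) :
    ∃ σ : W ⟶ T, σ ≫ u = v := by
  have h1 : ∀ a b, pullback.fst (f a) (f b) ≫ g a = pullback.snd (f a) (f b) ≫ g b := by
    intro a b
    rw [← cancel_mono u, Category.assoc, Category.assoc, hg, hg, pullback.condition_assoc]
  refine ⟨Scheme.Cover.glueMorphisms (openCoverOf Y f hf) g h1, ?_⟩
  refine Scheme.Cover.hom_ext (openCoverOf Y f hf) _ _ fun a => ?_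
  refine Eq.trans ?_ (hg a)
  exact Scheme.Cover.ι_glueMorphisms_assoc (openCoverOf Y f hf) g h1 a u

theorem exists_affineOpen_le {X : Scheme.{u}} {x : X} {U : X.Opens} (hx : x ∈ U) :
    ∃ V : X.Opens, IsAffineOpen V ∧ x ∈ V ∧ V ≤ U :=
  exists_isAffineOpen_mem_and_subset hx

/-! ### Ideals attached to the affine points of a scheme -/

/-- An ideal attached functorially to the affine points of a scheme. -/
structure PointIdeal (Z : Scheme.{u}) where
  ideal : ∀ {R : CommRingCat.{u}}, (Spec R ⟶ Z) → Ideal R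
  map : ∀ {R R' : CommRingCat.{u}} (φ : R ⟶ R') (x : Spec R ⟶ Z),
    ideal (Spec.map φ ≫ x) = (ideal x).map φ.hom

/-- The restriction of sections over `Spec R` to an open subset. -/
abbrev resHom {R : CommRingCat.{u}} (V : (Spec R).Opens) : R ⟶ Γ(Spec R, V) :=
  (Scheme.ΓSpecIso R).inv ≫ (Spec R).presheaf.map (homOfLE le_top).op

theorem specMap_resHom {R : CommRingCat.{u}} {V : (Spec R).Opens} (hV : IsAffineOpen V) :
    Spec.map (resHom V) = hV.fromSpec := by
  rw [resHom, Spec.map_comp, ← (isAffineOpen_top (Spec R)).map_fromSpec hV (homOfLE le_top).op,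
    IsAffineOpen.fromSpec_top, Scheme.isoSpec_Spec_inv]

theorem section_eq_zero {X : Scheme.{u}} {U : X.Opens} (s : Γ(X, U))
    (h : ∀ p ∈ U, ∃ (V : X.Opens) (e : V ≤ U), p ∈ V ∧ X.presheaf.map (homOfLE e).op s = 0) :
    s = 0 := by
  choose V e hp hV using fun p : U => h p p.2
  refine X.sheaf.eq_of_locally_eq' V U (fun p => homOfLE (e p)) (fun p hp' => ?_) s 0 fun p => ?_
  · exact TopologicalSpace.Opens.mem_iSup.2 ⟨⟨p, hp'⟩, hp _⟩
  · exact (hV p).trans (map_zero _).symm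

namespace PointIdeal

variable {Z : Scheme.{u}} (I : PointIdeal Z)

/-- Both sides are the ideal of the restriction of `x` to `V`, computed through `U` and through
`Spec R`. -/
theorem map_appLE {R : CommRingCat.{u}} (x : Spec R ⟶ Z) {U : Z.Opens} (hU : IsAffineOpen U)
    {V : (Spec R).Opens} (hV : IsAffineOpen V) (e : V ≤ x ⁻¹ᵁ U) :
    (I.ideal hU.fromSpec).map (x.appLE U V e).hom = (I.ideal x).map (resHom V).hom := by
  rw [← I.map, ← I.map, specMap_resHom hV]
  congr 1
  exact hU.SpecMap_appLE_fromSpec x hV e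

/-- The ideal sheaf of the values on the affine open subsets. -/
def sheafData : Z.IdealSheafData where
  ideal U := I.ideal U.2.fromSpec
  map_ideal_basicOpen U f := by
    rw [← I.map]
    congr 1
    exact U.2.map_fromSpec (Z.affineBasicOpen f).2 _

/-- Factoring through the closed subscheme means that sections of the ideal sheaf pull back to zero.
By `map_appLE` this can be compared, on small affine open sets, with the vanishing of the ideal of
`x`. -/
theorem exists_comp_subschemeι_iff {R : CommRingCat.{u}} (x : Spec R ⟶ Z) :
    (∃ z, z ≫ I.sheafData.subschemeι = x) ↔ I.ideal x = ⊥ := by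
  constructor
  · rintro ⟨z, rfl⟩
    rw [eq_bot_iff]
    intro r hr
    have key : (Scheme.ΓSpecIso R).inv r = 0 := by
      refine section_eq_zero _ fun p _ => ?_
      obtain ⟨U, hU, hpU, -⟩ := exists_affineOpen_le
        (x := (z ≫ I.sheafData.subschemeι) p) (U := ⊤) trivial
      obtain ⟨V, hV, hpV, hVU⟩ := exists_affineOpen_le (x := p)
        (U := (z ≫ I.sheafData.subschemeι) ⁻¹ᵁ U) hpU
      refine ⟨V, le_top, hpV, ?_⟩
      have h1 := I.map_appLE (z ≫ I.sheafData.subschemeι) hU hV hVU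
      have h2 : (I.ideal hU.fromSpec).map ((z ≫ I.sheafData.subschemeι).appLE U V hVU).hom ≤ ⊥ := by
        rw [Ideal.map_le_iff_le_comap]
        intro f hf
        have h3 : I.sheafData.subschemeι.app U f = 0 :=
          (I.sheafData.ker_subschemeι_app ⟨U, hU⟩).ge hf
        change (z ≫ I.sheafData.subschemeι).appLE U V hVU f = 0
        rw [Scheme.Hom.comp_appLE, CommRingCat.comp_apply, h3, map_zero]
      rw [h1] at h2
      exact h2 (Ideal.mem_map_of_mem _ hr)
    have := congrArg (Scheme.ΓSpecIso R).hom key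
    simpa using this
  · intro h
    refine ⟨IsClosedImmersion.lift I.sheafData.subschemeι x ?_,
      IsClosedImmersion.lift_fac I.sheafData.subschemeι x _⟩
    rw [Scheme.IdealSheafData.ker_subschemeι, Scheme.Hom.ker,
      Scheme.IdealSheafData.le_ofIdeals_iff]
    intro U f hf
    refine section_eq_zero _ fun p hp => ?_
    obtain ⟨V, hV, hpV, hVU⟩ := exists_affineOpen_le (x := p) hp
    refine ⟨V, hVU, hpV, ?_⟩
    have h1 := I.map_appLE x U.2 hV hVU
    rw [h, Ideal.map_bot] at h1
    exact h1.le (Ideal.mem_map_of_mem _ hf)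

variable {Q : CommRingCat.{u}} {u : Spec Q ⟶ Z} (hu : I.ideal u = ⊤)
  (hex : ∀ {R : CommRingCat.{u}} (x : Spec R ⟶ Z), I.ideal x = ⊤ → ∃ φ, Spec.map φ ≫ u = x)
  (huniq : ∀ {R : CommRingCat.{u}} (φ ψ : Q ⟶ R), Spec.map φ ≫ u = Spec.map ψ ≫ u → φ = ψ)

include huniq in
theorem mono_of_unique : Mono u := by
  refine ⟨fun {T} g h hgh => ?_⟩
  have key : ∀ {R : CommRingCat.{u}} (c : Spec R ⟶ T), c ≫ g = c ≫ h := by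
    intro R c
    obtain ⟨φ, hφ⟩ := Spec.map_surjective (c ≫ g)
    obtain ⟨ψ, hψ⟩ := Spec.map_surjective (c ≫ h)
    rw [← hφ, ← hψ, huniq φ ψ (by rw [hφ, hψ, Category.assoc, Category.assoc, hgh])]
  exact Scheme.Cover.hom_ext T.affineCover _ _ fun i => key (T.affineCover.f i)

include hu in
-- Some member `f` of the ideal on an affine neighbourhood of `u q` does not vanish at `q`; on the
-- basic open set of `f` the ideal contains a unit.
theorem exists_affineOpen (q : Spec Q) :
    ∃ (U : Z.Opens) (hU : IsAffineOpen U), u q ∈ U ∧ I.ideal hU.fromSpec = ⊤ := by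
  obtain ⟨U, hU, hqU, -⟩ := exists_affineOpen_le (x := u q) (U := ⊤) trivial
  obtain ⟨V, hV, hqV, hVU⟩ := exists_affineOpen_le (x := q) (U := u ⁻¹ᵁ U) hqU
  have h1 := I.map_appLE u hU hV hVU
  rw [hu, Ideal.map_top] at h1
  obtain ⟨f, hf, hqf⟩ : ∃ f ∈ I.ideal hU.fromSpec, q ∈ (Spec Q).basicOpen (u.appLE U V hVU f) := by
    by_contra! hcon
    have h2 : (I.ideal hU.fromSpec).map (u.appLE U V hVU).hom ≤
        (maximalIdeal ((Spec Q).presheaf.stalk q)).comap ((Spec Q).presheaf.germ V q hqV).hom := by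
      rw [Ideal.map_le_iff_le_comap]
      intro f hf
      have := hcon f hf
      rw [Scheme.mem_basicOpen _ _ _ hqV] at this
      exact this
    rw [h1, top_le_iff] at h2
    exact Ideal.comap_ne_top _ (maximalIdeal.isMaximal _).ne_top h2
  replace hqf := (Scheme.basicOpen_appLE u V U hVU f).le hqf
  refine ⟨_, (Z.affineBasicOpen (U := ⟨U, hU⟩) f).2, hqf.2, ?_⟩
  have h3 := I.sheafData.map_ideal_basicOpen ⟨U, hU⟩ f
  refine h3.symm.trans (Ideal.eq_top_of_isUnit_mem _ (Ideal.mem_map_of_mem _ hf) ?_)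
  exact RingedSpace.isUnit_res_basicOpen _ f

include hu hex huniq in
/-- A scheme representing the locus where a functorial ideal is the unit ideal is an open
subscheme. -/
theorem isOpenImmersion : IsOpenImmersion u := by
  have := mono_of_unique huniq
  let ι := {U : Z.Opens // ∃ hU : IsAffineOpen U, I.ideal hU.fromSpec = ⊤}
  let U : Z.Opens := ⨆ i : ι, i.1
  have hU : Set.range u ⊆ Set.range U.ι := by
    rw [Scheme.Opens.range_ι]
    rintro _ ⟨q, rfl⟩
    obtain ⟨V, hV, hqV, hV'⟩ := I.exists_affineOpen hu q
    exact TopologicalSpace.Opens.mem_iSup.2 ⟨⟨V, hV, hV'⟩, hqV⟩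
  let u' : Spec Q ⟶ U := IsOpenImmersion.lift U.ι u hU
  have hu' : u' ≫ U.ι = u := IsOpenImmersion.lift_fac _ _ _
  have hloc : ∀ i : ι, ∃ g : (i.1 : Scheme.{u}) ⟶ Spec Q, g ≫ u = i.1.ι := by
    rintro ⟨V, hV, hV'⟩
    obtain ⟨φ, hφ⟩ := hex _ hV'
    refine ⟨hV.isoSpec.hom ≫ Spec.map φ, ?_⟩
    rw [Category.assoc, hφ, IsAffineOpen.isoSpec_hom_fromSpec]
  choose g hg using hloc
  have hlift : ∀ i : ι, Set.range ((U.ι ⁻¹ᵁ i.1).ι ≫ U.ι) ⊆ Set.range i.1.ι := by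
    intro i
    rw [Scheme.Opens.range_ι]
    rintro _ ⟨p, rfl⟩
    exact p.2
  -- On the union `U` of the affine open sets with unit ideal, the local factorizations through `u`
  -- glue to a section of `u'`; being also a monomorphism, `u'` is an isomorphism onto `U`.
  obtain ⟨σ, hσ⟩ := exists_lift_of_mono (fun i : ι => (U.ι ⁻¹ᵁ i.1 : Scheme.{u}))
    (fun i => (U.ι ⁻¹ᵁ i.1).ι) (fun p => by
      obtain ⟨i, hi⟩ := TopologicalSpace.Opens.mem_iSup.1 p.2
      exact ⟨i, ⟨p, hi⟩, rfl⟩) u U.ι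
    (fun i => IsOpenImmersion.lift i.1.ι _ (hlift i) ≫ g i)
    (fun i => by rw [Category.assoc, hg, IsOpenImmersion.lift_fac])
  have h1 : σ ≫ u' = 𝟙 _ := by
    rw [← cancel_mono U.ι, Category.assoc, hu', hσ, Category.id_comp]
  have : Mono u' := mono_of_mono_fac hu'
  have : IsSplitEpi u' := ⟨⟨⟨σ, h1⟩⟩⟩
  have : IsIso u' := isIso_of_mono_of_isSplitEpi u'
  rw [← hu']
  infer_instance

end PointIdeal

section Cover

variable {W : Scheme.{u}} {α : Type u} (Y : α → Scheme.{u}) (f : ∀ a, Y a ⟶ W)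
  [∀ a, IsOpenImmersion (f a)] (hf : ∀ x : W, ∃ a, x ∈ Set.range (f a))

include hf


theorem smooth_of_cover {S : Scheme.{u}} (g : W ⟶ S) (h : ∀ a, Smooth (f a ≫ g)) : Smooth g :=
  have : IsZariskiLocalAtSource (@Smooth.{u}) :=
    HasRingHomProperty.instIsZariskiLocalAtSource (Q := RingHom.Smooth)
  (IsZariskiLocalAtSource.iff_of_openCover (P := @Smooth.{u}) (openCoverOf Y f hf)).2 h

/-- A nonempty open set meets some irreducible chart, hence meets its intersection with the chart
`a₀`; two nonempty open sets of that chart intersect. -/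
theorem isIntegral_of_cover [∀ a, IsIntegral (Y a)] (a₀ : α)
    (h : ∀ a, (Set.range (f a) ∩ Set.range (f a₀)).Nonempty) : IsIntegral W := by
  have h0 : ∀ a, IsReduced (Y a) := fun a => inferInstance
  have : IsReduced W := @IsReduced.of_openCover _ (openCoverOf Y f hf) h0
  have hirr : ∀ a, IsPreirreducible (Set.range (f a)) := fun a => by
    rw [← Set.image_univ]
    exact (PreirreducibleSpace.isPreirreducible_univ).image _ (f a).continuous.continuousOn
  have hopen : ∀ a, IsOpen (Set.range (f a)) := fun a => (f a).isOpenEmbedding.isOpen_range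
  have : PreirreducibleSpace W := by
    refine ⟨fun U V hU hV hU' hV' => ?_⟩
    obtain ⟨x, -, hx⟩ := hU'
    obtain ⟨y, -, hy⟩ := hV'
    have step : ∀ (U : Set W), IsOpen U → ∀ x ∈ U, (Set.range (f a₀) ∩ U).Nonempty := by
      intro U hU x hx
      obtain ⟨a, ha⟩ := hf x
      obtain ⟨z, hz, hz', hz''⟩ := hirr a U (Set.range (f a₀)) hU (hopen a₀) ⟨x, ha, hx⟩ (h a)
      exact ⟨z, hz'', hz'⟩
    obtain ⟨z, -, hz⟩ := hirr a₀ U V hU hV (step U hU x hx) (step V hV y hy)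
    exact ⟨z, trivial, hz⟩
  have : IrreducibleSpace W := ⟨⟨(h a₀).some⟩⟩
  exact isIntegral_of_irreducibleSpace_of_isReduced W

end Cover

end Splitting

end

noncomputable section

namespace Splitting

/-! ### Functorial ideals defining the three loci -/

section Rules

/-- The supremum of a family of functorial ideals. -/
def IdealRule.iSup {S : RingFunctor.{u}} {α : Type} (D : α → IdealRule S) : IdealRule S where
  ideal ξ := ⨆ a, (D a).ideal ξ
  map φ ξ := by simp only [(D _).map, Ideal.map_iSup]

theorem IdealRule.iSup_eq_bot {S : RingFunctor.{u}} {α : Type} {D : α → IdealRule S}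
    {R : CommRingCat.{u}} {ξ : S.obj R} :
    (IdealRule.iSup D).ideal ξ = ⊥ ↔ ∀ a, (D a).ideal ξ = ⊥ := _root_.iSup_eq_bot

variable (s : Shape) {O : Type u} [CommRing O] (π : O)

/-- The ideal of the `k`-th first coordinates of the elements of `F_{n-ℓ}`. -/
def fnlIdeal (k : Fin s.n) : IdealRule (ptFunctor s π) where
  ideal ξ := linIdeal (Pt.Fnl ξ) (fstCoord s k)
  map φ ξ := linIdeal_pull φ.hom (Pt.Fnl ξ) _ _ fun _ => rfl

/-- The middle part of the form `h` on second components. -/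
def midForm {R : Type u} [CommRing R] : s.Dbl R →ₗ[R] s.Dbl R →ₗ[R] R :=
  LinearMap.mk₂ R (fun x y => s.form x.2 (s.mid y.2))
    (fun x x' y => by simp) (fun c x y => by simp)
    (fun x y y' => by
      have : s.mid (y + y').2 = s.mid y.2 + s.mid y'.2 := by ext k; simp [Shape.mid]; split_ifs <;> simp
      rw [this, map_add])
    (fun c x y => by rw [Prod.smul_snd, s.mid_smul, map_smul])

/-- The ideal of the values of the quadratic form on `G`. -/
def quadIdeal : IdealRule (ptFunctor s π) where
  ideal ξ := bilIdeal (Pt.G ξ) (Pt.G ξ) (midForm s)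
  map φ ξ := bilIdeal_pull φ.hom (Pt.G ξ) (Pt.G ξ) _ _ fun x y => by
    change s.form (φ.hom ∘ x.2) (s.mid (φ.hom ∘ y.2)) = φ.hom (s.form x.2 (s.mid y.2))
    rw [← s.map_mid, s.map_form]

/-- The ideal of the first locus. -/
def locusIdeal₁ : IdealRule (ptFunctor s π) :=
  IdealRule.iSup fun k : Fin s.n ⊕ Fin s.n =>
    k.elim (fun k => wIdeal s π (some k)) (fnlIdeal s π)

/-- The ideal of the second locus. -/
def locusIdeal₂ : IdealRule (ptFunctor s π) :=
  IdealRule.iSup fun k : Option {k : Fin s.n // s.Out k} =>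
    k.elim (quadIdeal s π) fun k => wIdeal s π (some k)

/-- The ideal of the third locus. -/
def locusIdeal₃ : IdealRule (ptFunctor s π) :=
  IdealRule.iSup fun k : {k : Fin s.n // ¬ s.Out k} => vIdeal s π k

variable {s π} {R : CommRingCat.{u}} (ξ : Pt s π R)

theorem linIdeal_eq_bot {R : Type u} [CommRing R] {N : Submodule R (s.Dbl R)}
    {f : s.Dbl R →ₗ[R] R} : linIdeal N f = ⊥ ↔ ∀ x ∈ N, f x = 0 := by
  rw [eq_bot_iff, linIdeal_le_iff]
  rfl

theorem locusIdeal₁_eq_bot : (locusIdeal₁ s π).ideal ξ = ⊥ ↔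
    (∀ x ∈ ξ.Fl, x.1 = 0) ∧ ∀ x ∈ ξ.Fnl, x.1 = 0 := by
  refine (IdealRule.iSup_eq_bot (S := ptFunctor s π) (ξ := ξ)).trans (Sum.forall.trans ?_)
  refine and_congr ?_ ?_
  · refine (forall_congr' fun k => linIdeal_eq_bot).trans
      ⟨fun h x hx => funext fun k => h k x hx, fun h k x hx => congrFun (h x hx) k⟩
  · refine (forall_congr' fun k => linIdeal_eq_bot).trans
      ⟨fun h x hx => funext fun k => h k x hx, fun h k x hx => congrFun (h x hx) k⟩

theorem locusIdeal₂_eq_bot : (locusIdeal₂ s π).ideal ξ = ⊥ ↔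
    (∀ x ∈ ξ.G, ∀ y ∈ ξ.G, s.form x.2 (s.mid y.2) = 0) ∧ ∀ x ∈ ξ.Fl, ∀ k, s.Out k → x.1 k = 0 := by
  refine (IdealRule.iSup_eq_bot (S := ptFunctor s π) (ξ := ξ)).trans (Option.forall.trans ?_)
  refine and_congr ?_ ?_
  · exact eq_bot_iff.trans bilIdeal_le_iff
  · refine (forall_congr' fun k => linIdeal_eq_bot).trans
      ⟨fun h x hx k hk => h ⟨k, hk⟩ x hx, fun h k x hx => h x hx k k.2⟩

theorem locusIdeal₃_eq_bot : (locusIdeal₃ s π).ideal ξ = ⊥ ↔ ∀ x ∈ ξ.G, s.mid x.2 = 0 := by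
  refine (IdealRule.iSup_eq_bot (S := ptFunctor s π) (ξ := ξ)).trans ?_
  refine (forall_congr' fun k => linIdeal_eq_bot).trans
      ⟨fun h x hx => funext fun k => ?_, fun h k x hx => ?_⟩
  · rw [Shape.mid]
    split_ifs with hk
    · rfl
    · exact h ⟨k, hk⟩ x hx
  · have := congrFun (h x hx) k
    rwa [Shape.mid, if_neg k.2] at this

variable {i : Fin s.n} {j : Option (Fin s.n)} {T : Tup s R} {ρ : O →+* R} (h : T.Ok (ρ π) i j)
include h

theorem Tup.Ok.exists_mem_Fl : ∃ r, ((T.w, r) : s.Dbl R) ∈ T.Fl := by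
  obtain ⟨r, hr⟩ := h.exists_form_eq T.c
  exact ⟨r, 1, by simp, by simp [hr]⟩

theorem Tup.Ok.locusIdeal₁_eq_bot : (locusIdeal₁ s π).ideal h.pt = ⊥ ↔ T.w = 0 := by
  rw [Splitting.locusIdeal₁_eq_bot]
  constructor
  · rintro ⟨h1, -⟩
    obtain ⟨r, hr⟩ := h.exists_mem_Fl
    exact h1 _ hr
  · intro hw
    refine ⟨?_, ?_⟩
    · rintro x ⟨μ, h1, -⟩
      rw [h1, hw, smul_zero]
    · rintro x ⟨μ, h1, h2⟩
      rw [hw, map_zero] at h2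
      -- With `w = 0` the normalization must be `c = 1`, since `w_j = 1` would make the ring
      -- trivial.
      cases j with
      | none =>
        rw [show T.c = 1 from h.wc_eq, mul_one] at h2
        rw [h1, ← h2, zero_smul]
      | some j =>
        have h3 : T.w j = 1 := h.wc_eq
        rw [hw] at h3
        have : Subsingleton R := subsingleton_of_zero_eq_one h3
        exact Subsingleton.elim _ _

/-- `G` and the first components of `F_ℓ` are generated by `v` and `w`, so both conditions need only
be tested on these vectors. -/
theorem Tup.Ok.locusIdeal₂_eq_bot : (locusIdeal₂ s π).ideal h.pt = ⊥ ↔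
    s.quad T.v = 0 ∧ ∀ k, s.Out k → T.w k = 0 := by
  rw [Splitting.locusIdeal₂_eq_bot]
  have hq : s.form T.v (s.mid T.v) = s.quad T.v := by
    rw [Shape.quad, s.form_apply, s.form_apply]
    refine Finset.sum_congr rfl fun k _ => ?_
    simp only [Shape.mid, s.out_rev]
    split_ifs <;> ring
  refine and_congr ⟨fun h1 => ?_, fun h1 => ?_⟩ ⟨fun h1 => ?_, fun h1 => ?_⟩
  · rw [← hq]
    exact h1 (T.gen (ρ π)) (Submodule.mem_span_singleton_self _) _
      (Submodule.mem_span_singleton_self _)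
  · intro x hx y hy
    obtain ⟨a, rfl⟩ := Submodule.mem_span_singleton.1 hx
    obtain ⟨b, rfl⟩ := Submodule.mem_span_singleton.1 hy
    change s.form (a • T.v) (s.mid (b • T.v)) = 0
    rw [s.mid_smul, map_smul, map_smul, LinearMap.smul_apply, hq, h1, smul_zero, smul_zero]
  · obtain ⟨r, hr⟩ := h.exists_mem_Fl
    exact h1 _ hr
  · rintro x ⟨μ, h2, -⟩ k hk
    rw [h2, Pi.smul_apply, h1 k hk, smul_zero]

theorem Tup.Ok.locusIdeal₃_eq_bot : (locusIdeal₃ s π).ideal h.pt = ⊥ ↔ s.mid T.v = 0 := by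
  rw [Splitting.locusIdeal₃_eq_bot]
  constructor
  · intro h1
    exact h1 (T.gen (ρ π)) (Submodule.mem_span_singleton_self _)
  · intro h1 x hx
    obtain ⟨a, rfl⟩ := Submodule.mem_span_singleton.1 hx
    change s.mid (a • T.v) = 0
    rw [s.mid_smul, h1, smul_zero]

end Rules

variable {O₀ F₀ O F : Type u}
  [CommRing O₀] [IsDomain O₀] [IsDiscreteValuationRing O₀]
  [Field F₀] [Algebra O₀ F₀] [IsFractionRing O₀ F₀]
  [CommRing O] [IsDomain O] [IsDiscreteValuationRing O]
  [Field F] [Algebra O F] [IsFractionRing O F]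
  [Algebra F₀ F] [Algebra O₀ F] [Algebra O₀ O]
  [IsScalarTower O₀ F₀ F] [IsScalarTower O₀ O F] [IsIntegralClosure O O₀ F]

namespace Datum

variable (D : Datum O₀ F₀ O F)

/-! ### The three conditions in coordinates -/

section Conditions

variable {R : Type u} [CommRing R] [Algebra O₀ R] [Algebra O R] [IsScalarTower O₀ O R]
  {Fl Fnl G : Submodule R (D.shape.Dbl R)} (h : IsPt D.shape (algebraMap O R D.π) Fl Fnl G)
  (h0 : algebraMap O R D.π = 0)

include h0 in
theorem t_coord_of_eq_zero (i : ℕ) (x : D.shape.Dbl R) :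
    D.t R i (D.coord R i x) = D.coord R i (0, x.1) := by
  rw [t_coord, h0]
  simp [tOp]

include h0 in
theorem mem_modOrth_iff (y : D.shape.Dbl R) :
    D.coord R _ y ∈ D.modOrth (G.map (D.coord R _).toLinearMap) ↔
      ∃ z : D.shape.Dbl R, (∀ x ∈ G, D.shape.pair x z = 0) ∧ (0, z.1) = y := by
  constructor
  · rintro ⟨z, hz, hz'⟩
    obtain ⟨z, rfl⟩ := (D.coord R _).surjective z
    refine ⟨z, fun x hx => ?_, ?_⟩
    · rw [← pairingR_coord]
      exact hz _ ⟨x, hx, rfl⟩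
    · rw [sub_coord, h0, mul_zero, zero_smul, sub_zero] at hz'
      exact (D.coord R _).injective hz'
  · rintro ⟨z, hz, rfl⟩
    refine ⟨D.coord R _ z, ?_, ?_⟩
    · rintro _ ⟨x, hx, rfl⟩
      exact (D.pairingR_coord R x z).trans (hz x hx)
    · rw [sub_coord, h0, mul_zero, zero_smul, sub_zero]

include h h0 in
theorem fst_eq_zero {x : D.shape.Dbl R} (hx : x ∈ G) : x.1 = 0 := by
  rw [h.sub_eq x hx, h0, mul_zero, zero_smul]

include h0 in
theorem inM₁_iff : InM₁ (splPoint h) ↔ (∀ x ∈ Fl, x.1 = 0) ∧ ∀ x ∈ Fnl, x.1 = 0 := by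
  have key : ∀ (i : ℕ) (N : Submodule R (D.shape.Dbl R)),
      (N.map (D.coord R i).toLinearMap).map (D.t R i) = ⊥ ↔ ∀ x ∈ N, x.1 = 0 := by
    intro i N
    rw [eq_bot_iff]
    constructor
    · intro h1 x hx
      have h2 : D.t R i (D.coord R i x) = 0 := h1 ⟨_, ⟨x, hx, rfl⟩, rfl⟩
      rw [D.t_coord_of_eq_zero h0, LinearEquiv.map_eq_zero_iff] at h2
      exact congrArg Prod.snd h2
    · rintro h1 _ ⟨_, ⟨x, hx, rfl⟩, rfl⟩
      refine (Submodule.mem_bot R).2 ((D.t_coord_of_eq_zero h0 i x).trans ?_)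
      rw [h1 x hx]
      exact map_zero _
  exact and_congr (key _ _) (key _ _)

include h0 in
-- When `ϖ = 0`, a preimage under `A_ℓ` of an element of `G` with second component `y` has first
-- component `y_mid`, so its image under `t` is `(0, y_mid)`. The second condition says that first
-- components of `A_ℓ(F_ℓ)`, which are the outer parts of those of `F_ℓ`, vanish.
theorem inM₂_iff : InM₂ (splPoint h) ↔
    (∀ x ∈ G, ∀ y ∈ G, D.shape.form x.2 (D.shape.mid y.2) = 0) ∧
      ∀ x ∈ Fl, ∀ k, D.shape.Out k → x.1 k = 0 := by
  refine and_congr ⟨fun h1 => ?_, fun h1 => ?_⟩ ⟨fun h1 => ?_, fun h1 => ?_⟩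
  · intro x hx y hy
    have h2 : D.shape.up (algebraMap O R D.π) (D.shape.mid y.2, y.2) = y := by
      rw [h0]
      refine Prod.ext ?_ ?_
      · rw [D.fst_eq_zero h h0 hy]
        ext k
        simp only [Shape.up, Shape.tilt, Shape.mid, LinearMap.coe_mk, AddHom.coe_mk, Pi.zero_apply]
        split_ifs <;> ring
      · ext k
        simp only [Shape.up, Shape.mid, LinearMap.coe_mk, AddHom.coe_mk]
        split_ifs <;> ring
    have h3 : D.t R D.ℓ (D.coord R D.ℓ (D.shape.mid y.2, y.2)) ∈
        D.modOrth (G.map (D.coord R _).toLinearMap) := by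
      refine h1 ⟨_, ?_, rfl⟩
      change D.A R _ ∈ G.map (D.coord R _).toLinearMap
      rw [A_coord, h2]
      exact ⟨y, hy, rfl⟩
    rw [D.t_coord_of_eq_zero h0, D.mem_modOrth_iff h0] at h3
    obtain ⟨z, hz, hz'⟩ := h3
    have h4 := hz x hx
    rw [Shape.pair_apply, D.fst_eq_zero h h0 hx, map_zero, LinearMap.zero_apply, sub_zero,
      show z.1 = D.shape.mid y.2 from congrArg Prod.snd hz'] at h4
    exact h4
  · rintro _ ⟨a, ha, rfl⟩
    obtain ⟨a, rfl⟩ := (D.coord R _).surjective a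
    rw [D.t_coord_of_eq_zero h0, splPoint_G, D.mem_modOrth_iff h0]
    obtain ⟨y, hy, hy'⟩ : D.A R (D.coord R _ a) ∈ G.map (D.coord R _).toLinearMap := ha
    rw [A_coord] at hy'
    have h2 : y = D.shape.up (algebraMap O R D.π) a := (D.coord R _).injective hy'
    have h3 : a.1 = D.shape.mid y.2 := by
      have h4 := D.fst_eq_zero h h0 hy
      rw [h2, h0] at h4
      rw [h2, h0]
      ext k
      have h5 := congrFun h4 k
      simp only [Shape.up, Shape.tilt, Shape.mid, LinearMap.coe_mk, AddHom.coe_mk,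
        Pi.zero_apply] at h5 ⊢
      split_ifs at h5 ⊢ with hk
      · exact h5
      · ring
    refine ⟨(a.1, 0), fun x hx => ?_, rfl⟩
    rw [Shape.pair_apply, map_zero, sub_zero, h3]
    exact h1 x hx y hy
  · intro x hx k hk
    obtain ⟨z, hz⟩ := h1 ⟨_, ⟨x, hx, rfl⟩, rfl⟩
    obtain ⟨z, rfl⟩ := (D.coord R _).surjective z
    rw [D.t_coord_of_eq_zero h0] at hz
    have h2 := (D.coord R _).injective (hz.trans (D.A_coord R x))
    have h3 := congrFun (congrArg Prod.fst h2) k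
    simp only [Shape.up, Shape.tilt, LinearMap.coe_mk, AddHom.coe_mk, if_pos hk] at h3
    exact h3.symm
  · rintro _ ⟨_, ⟨x, hx, rfl⟩, rfl⟩
    refine ⟨D.coord R _ ((D.shape.up (algebraMap O R D.π) x).2, 0), ?_⟩
    rw [D.t_coord_of_eq_zero h0]
    refine Eq.trans ?_ (D.A_coord R x).symm
    congr 1
    refine Prod.ext ?_ rfl
    rw [h0]
    ext k
    simp only [Shape.up, Shape.tilt, LinearMap.coe_mk, AddHom.coe_mk, Pi.zero_apply]
    split_ifs with hk
    · exact (h1 x hx k hk).symm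
    · ring

include h0 in
-- When `ϖ = 0` the map `A_ℓ` sends `(0, b)` to `(0, b_out)`. Conversely, a line of outer vectors is
-- automatically orthogonal to itself.
theorem inM₃_iff : InM₃ (splPoint h) ↔ ∀ x ∈ G, D.shape.mid x.2 = 0 := by
  constructor
  · intro h1 x hx
    obtain ⟨z, hz, hz'⟩ := h1 ⟨x, hx, rfl⟩
    obtain ⟨z, rfl⟩ := (D.coord R _).surjective z
    rw [splPoint_G] at hz
    obtain ⟨y, -, rfl⟩ := (D.mem_modOrth_iff h0 z).1 hz
    have h2 := (D.coord R _).injective ((D.A_coord R _).symm.trans hz')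
    rw [h0] at h2
    rw [← h2]
    ext k
    simp only [Shape.up, Shape.mid, LinearMap.coe_mk, AddHom.coe_mk, Pi.zero_apply]
    split_ifs <;> ring
  · rintro h1 _ ⟨x, hx, rfl⟩
    have h2 : D.shape.up (algebraMap O R D.π) (0, x.2) = x := by
      rw [h0]
      refine Prod.ext ?_ ?_
      · rw [D.fst_eq_zero h h0 hx]
        ext k
        simp [Shape.up, Shape.tilt]
      · ext k
        have := congrFun (h1 x hx) k
        simp only [Shape.up, Shape.mid, LinearMap.coe_mk, AddHom.coe_mk, Pi.zero_apply] at this ⊢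
        split_ifs at this ⊢
        · rfl
        · rw [this]; ring
    refine ⟨D.coord R _ (0, x.2), ?_, (D.A_coord R _).trans (congrArg _ h2)⟩
    change D.coord R _ _ ∈ D.modOrth _
    rw [splPoint_G, D.mem_modOrth_iff h0]
    refine ⟨(x.2, 0), fun y hy => ?_, rfl⟩
    rw [Shape.pair_apply, map_zero, sub_zero]
    have h2R : IsUnit (2 : R) := by
      have := (D.isUnit_two.map (algebraMap O₀ R))
      rwa [map_ofNat] at this
    have h3 : ∀ x ∈ G, ∀ k, ¬ D.shape.Out k → x.2 k = 0 := fun x hx k hk => by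
      have := congrFun (h1 x hx) k
      rwa [Shape.mid, if_neg hk] at this
    -- The form is alternating on outer vectors but, the two vectors spanning the same line, also
    -- symmetric here; `2` is a unit.
    have h4 : D.shape.form y.2 x.2 = -D.shape.form x.2 y.2 := by
      rw [D.shape.form_swap, ← LinearMap.neg_apply, ← map_neg]
      congr 2
      ext k
      rw [Shape.hat]
      split_ifs with hk
      · simp
      · simp [h3 x hx k hk]
    have h5 : D.shape.form y.2 x.2 = D.shape.form x.2 y.2 := by
      rw [Shape.form_apply, Shape.form_apply]
      refine Finset.sum_congr rfl fun k _ => ?_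
      have := congrArg (fun z : D.shape.Dbl R => z.2 k.rev) (h.smul_eq_smul hx hy k)
      simp only [Prod.smul_snd, Pi.smul_apply, smul_eq_mul] at this
      rw [this]
    rw [h5, eq_neg_iff_add_eq_zero, ← two_mul] at h4
    rw [h5]
    exact (h2R.mul_right_eq_zero).1 h4

end Conditions

end Datum

end Splitting

end

noncomputable section

namespace Splitting

/-! ### ### Closed loci of the special fiber and their charts -/

variable {O₀ F₀ O F : Type u}
  [CommRing O₀] [IsDomain O₀] [IsDiscreteValuationRing O₀]
  [Field F₀] [Algebra O₀ F₀] [IsFractionRing O₀ F₀]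
  [CommRing O] [IsDomain O] [IsDiscreteValuationRing O]
  [Field F] [Algebra O F] [IsFractionRing O F]
  [Algebra F₀ F] [Algebra O₀ F] [Algebra O₀ O]
  [IsScalarTower O₀ F₀ F] [IsScalarTower O₀ O F] [IsIntegralClosure O O₀ F]

/-- A ring with a tuple on it which is universal among the tuples over `k`-algebras that satisfy
the equations of a chart of the special fiber and the condition `C`. -/
structure TupChart (s : Shape) (k : Type u) [Field k]
    (C : ∀ {R : Type u} [CommRing R], Tup s R → Prop) (i : Fin s.n) (j : Option (Fin s.n)) where
  Q : Type u
  [commRing : CommRing Q]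
  [algebra : Algebra k Q]
  T : Tup s Q
  ok : T.Ok 0 i j
  mem : C T
  exists_hom : ∀ {R : Type u} [CommRing R] [Algebra k R] (T' : Tup s R), T'.Ok 0 i j → C T' →
    ∃ φ : Q →ₐ[k] R, T.map (φ : Q →+* R) = T'
  hom_ext : ∀ {R : Type u} [CommRing R] [Algebra k R] (φ ψ : Q →ₐ[k] R),
    T.map (φ : Q →+* R) = T.map (ψ : Q →+* R) → φ = ψ

attribute [instance] TupChart.commRing TupChart.algebra

namespace Datum

variable (D : Datum O₀ F₀ O F)

/-! ### Points of the special fiber -/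

section Fiber

variable {R R' : CommRingCat.{u}}

/-- The point of the splitting model given by a point of the special fiber. -/
def fib (x : Spec R ⟶ specialFiber D.modelTo) : Pt D.shape D.π R :=
  (charted D.shape D.π).points R (x ≫ specialFiberι D.modelTo)

theorem fib_comp (φ : R ⟶ R') (x : Spec R ⟶ specialFiber D.modelTo) :
    D.fib (Spec.map φ ≫ x) = (D.fib x).map φ.hom := by
  rw [fib, Category.assoc, ChartedFunctor.points_comp]
  rfl

/-- The structure of a `k`-algebra given by a point of the special fiber. -/
def fibHom (x : Spec R ⟶ specialFiber D.modelTo) : ResidueField O →+* R :=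
  (Spec.preimage (x ≫ specialFiberTo D.modelTo)).hom

theorem specMap_fibHom (x : Spec R ⟶ specialFiber D.modelTo) :
    Spec.map (CommRingCat.ofHom (D.fibHom x)) = x ≫ specialFiberTo D.modelTo :=
  Spec.map_preimage _

theorem fib_ρ (x : Spec R ⟶ specialFiber D.modelTo) :
    (D.fib x).ρ = (D.fibHom x).comp (algebraMap O (ResidueField O)) := by
  have h1 : Spec.map (CommRingCat.ofHom (D.fib x).ρ) =
      (x ≫ specialFiberι D.modelTo) ≫ D.modelTo :=
    (charted D.shape D.π).map_base_points (x ≫ specialFiberι D.modelTo)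
  rw [Category.assoc, pullback.condition, ← Category.assoc, ← specMap_fibHom, ← Spec.map_comp] at h1
  exact congrArg CommRingCat.Hom.hom (Spec.map_injective h1)

theorem residue_π : algebraMap O (ResidueField O) D.π = 0 :=
  (residue_eq_zero_iff _).2 ((mem_maximalIdeal _).2 D.irreducible_π.not_isUnit)

theorem fib_ρ_π (x : Spec R ⟶ specialFiber D.modelTo) : (D.fib x).ρ D.π = 0 := by
  rw [fib_ρ, RingHom.comp_apply, residue_π, map_zero]

instance : IsClosedImmersion (Spec.map (CommRingCat.ofHom (algebraMap O (ResidueField O)))) :=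
  IsClosedImmersion.spec_of_surjective _ residue_surjective

/-- The special fiber is a closed subscheme of the model, so its points are determined by points of
the model. -/
theorem fib_injective {x y : Spec R ⟶ specialFiber D.modelTo} (h : D.fib x = D.fib y) : x = y := by
  rw [← cancel_mono (specialFiberι D.modelTo)]
  exact ((charted D.shape D.π).points R).injective h

theorem exists_fib (κ : ResidueField O →+* R) (ξ : Pt D.shape D.π R)
    (h : ξ.ρ = κ.comp (algebraMap O (ResidueField O))) :
    ∃ x, D.fib x = ξ ∧ D.fibHom x = κ := by
  obtain ⟨y, hy⟩ := ((charted D.shape D.π).points R).surjective ξ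
  have h1 : y ≫ D.modelTo = Spec.map (CommRingCat.ofHom κ) ≫
      Spec.map (CommRingCat.ofHom (algebraMap O (ResidueField O))) := by
    rw [← Spec.map_comp, modelTo, ← ChartedFunctor.map_base_points, hy]
    exact congrArg (fun f => Spec.map (CommRingCat.ofHom f)) h
  refine ⟨pullback.lift y _ h1, ?_, ?_⟩
  · rw [fib, pullback.lift_fst, hy]
  · have := D.specMap_fibHom (pullback.lift y _ h1)
    rw [pullback.lift_snd] at this
    exact congrArg CommRingCat.Hom.hom (Spec.map_injective this)

end Fiber

/-! ### The closed subscheme of the special fiber cut out by a functorial ideal -/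

section Locus

variable (I : IdealRule (ptFunctor D.shape D.π))

/-- A functorial ideal on the special fiber. -/
def locusIdeal : PointIdeal (specialFiber D.modelTo) where
  ideal x := I.ideal (D.fib x)
  map φ x := by
    rw [fib_comp]
    exact I.map φ (D.fib x)

/-- The closed subscheme of the special fiber where a functorial ideal vanishes. -/
abbrev locus : Scheme.{u} := (D.locusIdeal I).sheafData.subscheme

/-- The inclusion of the locus where a functorial ideal vanishes. -/
abbrev locusι : D.locus I ⟶ specialFiber D.modelTo := (D.locusIdeal I).sheafData.subschemeι

theorem exists_comp_locusι_iff {R : CommRingCat.{u}} (x : Spec R ⟶ specialFiber D.modelTo) :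
    (∃ z, z ≫ D.locusι I = x) ↔ I.ideal (D.fib x) = ⊥ :=
  (D.locusIdeal I).exists_comp_subschemeι_iff x

/-- It suffices to match the vanishing of the functorial ideal with the lattice condition over rings
in which `π` is zero. -/
theorem isClosedLocus
    (C : ∀ {R : Type u} [CommRing R] [Algebra O₀ R] [Algebra O R] [IsScalarTower O₀ O R],
      SplPoint D R → Prop)
    (hC : ∀ {R : Type u} [CommRing R] [Algebra O₀ R] [Algebra O R] [IsScalarTower O₀ O R]
      (ξ : Pt D.shape D.π R) (h : IsPt D.shape (algebraMap O R D.π) ξ.Fl ξ.Fnl ξ.G),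
      algebraMap O R D.π = 0 →
        (IdealRule.ideal I (R := .of R) ξ = ⊥ ↔ C (splPoint h))) :
    IsClosedLocus D.representation C (D.locusι I) := by
  refine ⟨inferInstance, fun R _ _ _ _ _ _ x y hxy => ?_⟩
  rw [exists_comp_locusι_iff]
  have h0 : algebraMap O R D.π = 0 := by
    rw [IsScalarTower.algebraMap_apply O (ResidueField O) R, residue_π, map_zero]
  have h1 : D.fib x.1 = (charted D.shape D.π).points (.of R) y.1 := by rw [hxy]; rfl
  rw [h1]
  refine hC (R := R) ((charted D.shape D.π).points (.of R) y.1) ?_ h0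
  have h2 := Pt.isPt ((charted D.shape D.π).points (.of R) y.1)
  rwa [(D.comp_modelTo_iff y.1).1 y.2] at h2

variable {I}

/-- Extensions of residue fields are injective, so vanishing of the ideal can be detected at the
residue field of the point. -/
theorem mem_range_locusι_iff (z : specialFiber D.modelTo) :
    z ∈ Set.range (D.locusι I) ↔
      I.ideal (D.fib ((specialFiber D.modelTo).fromSpecResidueField z)) = ⊥ := by
  constructor
  · rintro ⟨z, rfl⟩
    have h1 := (D.exists_comp_locusι_iff I _).1 ⟨(D.locus I).fromSpecResidueField z, rfl⟩
    rw [← Scheme.Hom.SpecMap_residueFieldMap_fromSpecResidueField, fib_comp] at h1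
    refine (Ideal.map_eq_bot_iff_of_injective (f := ((D.locusι I).residueFieldMap z).hom)
      (RingHom.injective _)).1 ?_
    rw [← h1]
    exact (I.map _ _).symm
  · intro h
    obtain ⟨y, hy⟩ := (D.exists_comp_locusι_iff I _).2 h
    exact ⟨y (closedPoint _), (congrArg
      (fun f : Spec ((specialFiber D.modelTo).residueField z) ⟶ specialFiber D.modelTo =>
        f (closedPoint _)) hy).trans
      (Scheme.fromSpecResidueField_apply _ _)⟩

theorem closedPoint_mem_range_locusι_iff {K : Type u} [Field K]
    (x : Spec (.of K) ⟶ specialFiber D.modelTo) :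
    x (closedPoint K) ∈ Set.range (D.locusι I) ↔ I.ideal (D.fib x) = ⊥ := by
  rw [mem_range_locusι_iff]
  conv_rhs => rw [← Scheme.descResidueField_stalkClosedPointTo_fromSpecResidueField K _ x, fib_comp]
  refine (Ideal.map_eq_bot_iff_of_injective
    (f := (Scheme.descResidueField (Scheme.stalkClosedPointTo x)).hom)
      (RingHom.injective _)).symm.trans ?_
  exact Eq.congr_left (I.map _ _).symm

theorem exists_tup_of_fib {R : CommRingCat.{u}} (x : Spec R ⟶ specialFiber D.modelTo)
    (p : Fin D.shape.n × Option (Fin D.shape.n))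
    (h : (chartIdeal D.shape D.π p).ideal (D.fib x) = ⊤) :
    ∃ (T : Tup D.shape R) (_ : T.Ok 0 p.1 p.2) (hT' : T.Ok ((D.fib x).ρ D.π) p.1 p.2),
      hT'.pt = D.fib x := by
  obtain ⟨T, hT, hT'⟩ := exists_tup_of_chartIdeal (D.fib x) p h
  exact ⟨T, D.fib_ρ_π x ▸ hT, hT, hT'⟩

variable {C : ∀ {R : Type u} [CommRing R], Tup D.shape R → Prop}
  (hC : ∀ {R : Type u} [CommRing R] {T : Tup D.shape R} {ρ : O →+* R} {i j}
    (h : T.Ok (ρ D.π) i j), IdealRule.ideal I (R := .of R) h.pt = ⊥ ↔ C T)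

include hC in
/-- A universal tuple gives an open chart of the locus. -/
theorem exists_chart {i : Fin D.shape.n} {j : Option (Fin D.shape.n)}
    (c : TupChart D.shape (ResidueField O) C i j) :
    ∃ u : Spec (.of c.Q) ⟶ D.locus I, IsOpenImmersion u ∧
      u ≫ D.locusι I ≫ specialFiberTo D.modelTo =
        Spec.map (CommRingCat.ofHom (algebraMap (ResidueField O) c.Q)) ∧
      (∃ (ρ : O →+* c.Q) (h : c.T.Ok (ρ D.π) i j), D.fib (u ≫ D.locusι I) = h.pt) ∧
      ∀ {R : CommRingCat.{u}} (x : Spec R ⟶ D.locus I),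
        (chartIdeal D.shape D.π (i, j)).ideal (D.fib (x ≫ D.locusι I)) = ⊤ →
          ∃ φ, Spec.map φ ≫ u = x := by
  let ρ : O →+* c.Q := (algebraMap (ResidueField O) c.Q).comp (algebraMap O (ResidueField O))
  have hρ : ρ D.π = 0 := by rw [RingHom.comp_apply, residue_π, map_zero]
  have hok : c.T.Ok (ρ D.π) i j := hρ ▸ c.ok
  obtain ⟨x₀, hx₀, hx₀'⟩ := D.exists_fib (R := .of c.Q) (algebraMap (ResidueField O) c.Q) hok.pt rfl
  obtain ⟨u, hu⟩ := (D.exists_comp_locusι_iff I x₀).2 (by rw [hx₀]; exact (hC hok).2 c.mem)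
  have htop : (chartIdeal D.shape D.π (i, j)).ideal (D.fib (u ≫ D.locusι I)) = ⊤ := by
    rw [hu, hx₀]
    refine (hok.chartIdeal_pt (R := .of c.Q) (i, j)).trans ?_
    rw [hok.v_eq, hok.wc_eq, mul_one, Ideal.span_singleton_one]
  have hstr : u ≫ D.locusι I ≫ specialFiberTo D.modelTo =
      Spec.map (CommRingCat.ofHom (algebraMap (ResidueField O) c.Q)) := by
    rw [← Category.assoc, hu, ← specMap_fibHom, hx₀']
  have hex : ∀ {R : CommRingCat.{u}} (x : Spec R ⟶ D.locus I),
      (chartIdeal D.shape D.π (i, j)).ideal (D.fib (x ≫ D.locusι I)) = ⊤ →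
        ∃ φ, Spec.map φ ≫ u = x := by
    intro R x hx
    obtain ⟨T, hT, hT', hTx⟩ := D.exists_tup_of_fib _ _ hx
    have hCT : C T := by
      rw [← hC hT', hTx]
      exact (D.exists_comp_locusι_iff I _).1 ⟨x, rfl⟩
    algebraize [D.fibHom (x ≫ D.locusι I)]
    obtain ⟨φ, hφ⟩ := c.exists_hom T hT hCT
    refine ⟨CommRingCat.ofHom (φ : c.Q →+* R), ?_⟩
    rw [← cancel_mono (D.locusι I), Category.assoc, hu]
    apply D.fib_injective
    rw [fib_comp, hx₀, ← hTx]
    refine (hok.map_pt (φ : c.Q →+* R)).trans ?_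
    have hρ' : (φ : c.Q →+* R).comp ρ = (D.fib (x ≫ D.locusι I)).ρ := by
      rw [fib_ρ, ← RingHom.comp_assoc, AlgHom.comp_algebraMap]
      rfl
    refine Pt.ext hρ' ?_ ?_ ?_
    · change (c.T.map _).Fl = T.Fl
      rw [hφ]
    · change (c.T.map _).Fnl = T.Fnl
      rw [hφ]
    · change (c.T.map _).G _ = T.G _
      rw [hφ, hρ']
  refine ⟨u, ?_, hstr, ⟨ρ, hok, by rw [hu, hx₀]⟩, hex⟩
  refine PointIdeal.isOpenImmersion
    (I := { ideal := fun x => (chartIdeal D.shape D.π (i, j)).ideal (D.fib (x ≫ D.locusι I))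
            map := fun φ x => by
              rw [Category.assoc, fib_comp]
              exact (chartIdeal D.shape D.π (i, j)).map φ _ }) htop hex ?_
  intro R φ ψ h
  have h1 : φ.hom.comp (algebraMap (ResidueField O) c.Q) =
      ψ.hom.comp (algebraMap (ResidueField O) c.Q) := by
    have h2 := congrArg (fun z => z ≫ D.locusι I ≫ specialFiberTo D.modelTo) h
    simp only [Category.assoc, hstr, ← Spec.map_comp] at h2
    exact congrArg CommRingCat.Hom.hom (Spec.map_injective h2)
  have h2 : Pt.map φ.hom hok.pt = Pt.map ψ.hom hok.pt := by
    rw [← hx₀, ← hu, ← fib_comp, ← fib_comp, ← Category.assoc, h, Category.assoc]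
  have h3 := (pt_ext_ok (ρ := φ.hom.comp ρ) (ρ' := ψ.hom.comp ρ) _ _
    ((hok.map_pt φ.hom).symm.trans (h2.trans (hok.map_pt ψ.hom)))).2
  algebraize [φ.hom.comp (algebraMap (ResidueField O) c.Q)]
  have h4 := c.hom_ext (R := R) ⟨φ.hom, fun _ => rfl⟩
    ⟨ψ.hom, fun a => (congrArg (fun f : ResidueField O →+* R => f a) h1).symm⟩ h3
  ext a
  exact congrArg (fun f : c.Q →ₐ[ResidueField O] R => f a) h4

section Charts

variable {α : Type} {i : α → Fin D.shape.n} {j : α → Option (Fin D.shape.n)}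
  (c : ∀ a, TupChart D.shape (ResidueField O) C (i a) (j a))
  (hcov : ∀ {L : Type u} [Field L] [Algebra (ResidueField O) L] (T : Tup D.shape L) (i' : Fin D.shape.n)
    (j' : Option (Fin D.shape.n)), T.Ok 0 i' j' → C T → ∃ a, T.v (i a) ≠ 0 ∧ T.wc (j a) ≠ 0)

theorem exists_tup_of_isField {L : CommRingCat.{u}} (hL : IsField L)
    (x : Spec L ⟶ specialFiber D.modelTo) :
    ∃ (p : Fin D.shape.n × Option (Fin D.shape.n)) (T : Tup D.shape L) (_ : T.Ok 0 p.1 p.2)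
      (hT' : T.Ok ((D.fib x).ρ D.π) p.1 p.2), hT'.pt = D.fib x := by
  obtain ⟨p, hp⟩ := exists_chartIdeal_ne_bot hL (D.fib x)
  exact ⟨p, D.exists_tup_of_fib x p hp⟩

theorem chartIdeal_eq_top {L : CommRingCat.{u}} (hL : IsField L) {p : Fin D.shape.n × Option (Fin D.shape.n)}
    {T : Tup D.shape L} {ρ : O →+* L} (hT : T.Ok (ρ D.π) p.1 p.2) {i : Fin D.shape.n}
    {j : Option (Fin D.shape.n)} (hv : T.v i ≠ 0) (hw : T.wc j ≠ 0) :
    (chartIdeal D.shape D.π (i, j)).ideal hT.pt = ⊤ := by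
  let := hL.toField
  refine (hT.chartIdeal_pt (R := L) (i, j)).trans ?_
  rw [Ideal.span_singleton_eq_top]
  exact IsUnit.mk0 _ (mul_ne_zero hv hw)

include hC hcov in
/-- Universal tuples give an open cover of the locus. -/
theorem exists_charts : ∃ u : ∀ a, Spec (.of (c a).Q) ⟶ D.locus I,
    (∀ a, IsOpenImmersion (u a)) ∧ (∀ x, ∃ a, x ∈ Set.range (u a)) ∧
      (∀ a, u a ≫ D.locusι I ≫ specialFiberTo D.modelTo =
        Spec.map (CommRingCat.ofHom (algebraMap (ResidueField O) (c a).Q))) ∧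
      ∀ a a₀, IsDomain (c a).Q → (c a).T.v (i a₀) ≠ 0 → (c a).T.wc (j a₀) ≠ 0 →
        (Set.range (u a) ∩ Set.range (u a₀)).Nonempty := by
  choose u h1 h2 h3 h4 using fun a => D.exists_chart hC (c a)
  refine ⟨u, h1, fun z => ?_, h2, fun a a₀ hdom hv hw => ?_⟩
  · let x := (D.locus I).fromSpecResidueField z
    obtain ⟨p, T, hT, hT', hTx⟩ := D.exists_tup_of_isField
      (Field.toIsField ((D.locus I).residueField z)) (x ≫ D.locusι I)
    have hCT : C T := by
      rw [← hC hT', hTx]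
      exact (D.exists_comp_locusι_iff I _).1 ⟨x, rfl⟩
    algebraize [D.fibHom (x ≫ D.locusι I)]
    obtain ⟨a, hv, hw⟩ := hcov T _ _ hT hCT
    obtain ⟨φ, hφ⟩ := h4 a x (hTx ▸ D.chartIdeal_eq_top (Field.toIsField _) hT' hv hw)
    refine ⟨a, ?_⟩
    have hz : z ∈ Set.range x := by rw [Scheme.range_fromSpecResidueField]; rfl
    obtain ⟨y, hy⟩ := hz
    exact ⟨Spec.map φ y, (congrArg (fun f : Spec ((D.locus I).residueField z) ⟶ D.locus I => f y) hφ).trans hy⟩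
  -- The generic point of the chart `a` lies in the chart `a₀`, because the two coordinates that
  -- define it are nonzero in the fraction field.
  · let L : CommRingCat.{u} := .of (FractionRing (c a).Q)
    let ψ : CommRingCat.of (c a).Q ⟶ L := CommRingCat.ofHom (algebraMap (c a).Q (FractionRing (c a).Q))
    have hψ : Function.Injective (algebraMap (c a).Q (FractionRing (c a).Q)) :=
      IsFractionRing.injective _ _
    obtain ⟨ρ, h, hu⟩ := h3 a
    obtain ⟨φ, hφ⟩ := h4 a₀ (Spec.map ψ ≫ u a) (by
      rw [Category.assoc, fib_comp, hu, h.map_pt]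
      refine D.chartIdeal_eq_top (L := L) (p := (_, _)) (Field.toIsField (FractionRing (c a).Q)) _ ?_ ?_
      · exact fun h0 => hv (hψ (h0.trans (map_zero _).symm))
      · intro h0
        apply hw
        apply hψ
        rw [map_zero, ← h0]
        cases j a₀ <;> rfl)
    have y : Spec L := (inferInstance : Nonempty (Spec (.of (FractionRing (c a).Q)))).some
    exact ⟨(Spec.map ψ ≫ u a) y, ⟨Spec.map ψ y, rfl⟩, ⟨Spec.map φ y, by rw [← hφ]; rfl⟩⟩

theorem smooth_specMap_iff {k Q : Type u} [CommRing k] [CommRing Q] [Algebra k Q] :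
    Smooth (Spec.map (CommRingCat.ofHom (algebraMap k Q))) ↔ Algebra.Smooth k Q := by
  rw [HasRingHomProperty.Spec_iff (P := @Smooth.{u}) (Q := RingHom.Smooth)]
  exact RingHom.smooth_algebraMap

include hC hcov in
theorem smooth_locus (h : ∀ a, Algebra.Smooth (ResidueField O) (c a).Q) :
    Smooth (D.locusι I ≫ specialFiberTo D.modelTo) := by
  obtain ⟨u, h1, h2, h3, -⟩ := D.exists_charts hC c hcov
  refine smooth_of_cover (fun a : ULift.{u} α => Spec (.of (c a.down).Q)) (fun a => u a.down)
    (fun x => ?_) _ fun a => ?_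
  · obtain ⟨a, ha⟩ := h2 x
    exact ⟨⟨a⟩, ha⟩
  · rw [h3, smooth_specMap_iff]
    exact h _

include hC in
theorem not_smooth_locus {i : Fin D.shape.n} {j : Option (Fin D.shape.n)}
    (c : TupChart D.shape (ResidueField O) C i j) (h : ¬ Algebra.Smooth (ResidueField O) c.Q) :
    ¬ Smooth (D.locusι I ≫ specialFiberTo D.modelTo) := by
  intro hs
  obtain ⟨u, h1, h2, -⟩ := D.exists_chart hC c
  apply h
  rw [← smooth_specMap_iff, ← h2]
  infer_instance

include hC hcov in
theorem isIntegral_locus (h : ∀ a, IsDomain (c a).Q) (a₀ : α)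
    (h0 : ∀ a, (c a).T.v (i a₀) ≠ 0 ∧ (c a).T.wc (j a₀) ≠ 0) : IsIntegral (D.locus I) := by
  obtain ⟨u, h1, h2, -, h4⟩ := D.exists_charts hC c hcov
  have : ∀ a, IsIntegral (Spec (.of (c a).Q)) := fun a => inferInstance
  refine isIntegral_of_cover (fun a : ULift.{u} α => Spec (.of (c a.down).Q)) (fun a => u a.down)
    (fun x => ?_) ⟨a₀⟩ fun a => ?_
  · obtain ⟨a, ha⟩ := h2 x
    exact ⟨⟨a⟩, ha⟩
  · exact h4 _ _ (h _) (h0 _).1 (h0 _).2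

end Charts

end Locus

end Datum

end Splitting

end

noncomputable section

namespace Splitting

/-! ### Universal tuples from normal forms -/

namespace TupChart

section Normal

variable {s : Shape} {k : Type u} [Field k] {C : ∀ {R : Type u} [CommRing R], Tup s R → Prop}
  {i : Fin s.n} {j : Option (Fin s.n)}

/-- A coordinate that is nonzero at one point is nonzero in the universal ring; overlaps of charts
are verified on explicit points in this way. -/
theorem v_ne_zero (c : TupChart s k C i j) {R : Type u} [CommRing R] [Algebra k R] {T : Tup s R}
    (hT : T.Ok 0 i j) (hC : C T) {i' : Fin s.n} (h : T.v i' ≠ 0) : c.T.v i' ≠ 0 := by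
  obtain ⟨φ, hφ⟩ := c.exists_hom T hT hC
  intro h0
  apply h
  rw [← hφ]
  exact (congrArg φ h0).trans (map_zero φ)

theorem c_ne_zero (c : TupChart s k C i j) {R : Type u} [CommRing R] [Algebra k R] {T : Tup s R}
    (hT : T.Ok 0 i j) (hC : C T) (h : T.c ≠ 0) : c.T.c ≠ 0 := by
  obtain ⟨φ, hφ⟩ := c.exists_hom T hT hC
  intro h0
  apply h
  rw [← hφ]
  exact (congrArg φ h0).trans (map_zero φ)

end Normal

end TupChart

/-- The tuple with the given coordinates. -/
def Tup.ofFun {s : Shape} {R : Type u} (p : Fin s.n ⊕ Fin s.n ⊕ Bool → R) : Tup s R :=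
  ⟨fun a => p (.inl a), fun a => p (.inr (.inl a)), p (.inr (.inr true)), p (.inr (.inr false))⟩

/-- The coordinates of a tuple. -/
def Tup.toFun {s : Shape} {R : Type u} (T : Tup s R) : Fin s.n ⊕ Fin s.n ⊕ Bool → R
  | .inl a => T.v a
  | .inr (.inl a) => T.w a
  | .inr (.inr true) => T.c
  | .inr (.inr false) => T.l

theorem Tup.toFun_injective {s : Shape} {R : Type u} {T T' : Tup s R} (h : T.toFun = T'.toFun) :
    T = T' := by
  refine Tup.ext ?_ ?_ ?_ ?_
  · exact funext fun a => congrFun h (.inl a)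
  · exact funext fun a => congrFun h (.inr (.inl a))
  · exact congrFun h (.inr (.inr true))
  · exact congrFun h (.inr (.inr false))

theorem Tup.toFun_map {s : Shape} {R R' : Type u} [CommRing R] [CommRing R'] (φ : R →+* R')
    (T : Tup s R) : (T.map φ).toFun = φ ∘ T.toFun := by
  ext (a | a | a | a) <;> rfl

theorem Tup.map_injective {s : Shape} {R R' : Type u} [CommRing R] [CommRing R'] {φ : R →+* R'}
    (hφ : Function.Injective φ) {T T' : Tup s R} (h : T.map φ = T'.map φ) : T = T' := by
  apply Tup.toFun_injective
  have := congrArg Tup.toFun h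
  rw [Tup.toFun_map, Tup.toFun_map] at this
  exact hφ.comp_left this

/-- A natural normal form of the tuples over `k`-algebras, which exhibits those that satisfy the
equations of a chart of the special fiber and the condition `C` as a retract of an affine space. -/
structure NormalForm (s : Shape) (k : Type u) [Field k]
    (C : ∀ {R : Type u} [CommRing R], Tup s R → Prop) (i : Fin s.n) (j : Option (Fin s.n)) where
  nf : ∀ {R : Type u} [CommRing R] [Algebra k R], Tup s R → Tup s R
  map_nf : ∀ {R R' : Type u} [CommRing R] [Algebra k R] [CommRing R'] [Algebra k R']
    (φ : R →ₐ[k] R') (T : Tup s R), (nf T).map (φ : R →+* R') = nf (T.map (φ : R →+* R'))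
  ok : ∀ {R : Type u} [CommRing R] [Algebra k R] (T : Tup s R), (nf T).Ok 0 i j
  mem : ∀ {R : Type u} [CommRing R] [Algebra k R] (T : Tup s R), C (nf T)
  fix : ∀ {R : Type u} [CommRing R] [Algebra k R] (T : Tup s R), T.Ok 0 i j → C T → nf T = T

namespace NormalForm

variable {s : Shape} {k : Type u} [Field k] {C : ∀ {R : Type u} [CommRing R], Tup s R → Prop}
  {i : Fin s.n} {j : Option (Fin s.n)} (B : NormalForm s k C i j)

/-- The coordinate ring of an affine space. -/
abbrev Poly (s : Shape) (k : Type u) [Field k] : Type u := MvPolynomial (Fin s.n ⊕ Fin s.n ⊕ Bool) k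

/-- The generic tuple. -/
def generic (s : Shape) (k : Type u) [Field k] : Tup s (Poly s k) := Tup.ofFun MvPolynomial.X

theorem toFun_generic : (generic s k).toFun = MvPolynomial.X := by
  ext1 (a | a | a | a) <;> rfl

/-- The homomorphism that sends the generic tuple to a given one. -/
def eval {R : Type u} [CommRing R] [Algebra k R] (T : Tup s R) : Poly s k →ₐ[k] R :=
  MvPolynomial.aeval T.toFun

theorem generic_map {R : Type u} [CommRing R] [Algebra k R] (T : Tup s R) :
    (generic s k).map (eval (k := k) T : Poly s k →+* R) = T := by
  apply Tup.toFun_injective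
  rw [Tup.toFun_map, toFun_generic]
  ext a
  exact MvPolynomial.aeval_X _ a

theorem hom_ext {R : Type u} [CommRing R] [Algebra k R] {φ ψ : Poly s k →ₐ[k] R}
    (h : (generic s k).map (φ : Poly s k →+* R) = (generic s k).map (ψ : Poly s k →+* R)) :
    φ = ψ := by
  refine MvPolynomial.algHom_ext fun a => ?_
  have := congrFun (congrArg Tup.toFun h) a
  rw [Tup.toFun_map, Tup.toFun_map, toFun_generic] at this
  exact this

/-- The endomorphism of the affine space given by the normal form. -/
def retr : Poly s k →ₐ[k] Poly s k := eval (B.nf (generic s k))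

/-- The image of the endomorphism given by the normal form. -/
abbrev Ring : Type u := B.retr.range

/-- The projection onto the coordinate ring of the space of normal forms. -/
abbrev proj : Poly s k →ₐ[k] B.Ring := B.retr.rangeRestrict

/-- The universal normal form. -/
def tup : Tup s B.Ring := (generic s k).map (B.proj : Poly s k →+* B.Ring)

theorem tup_map_val : B.tup.map (B.retr.range.val : B.Ring →+* Poly s k) = B.nf (generic s k) :=
  generic_map _

theorem nf_nf {R : Type u} [CommRing R] [Algebra k R] (T : Tup s R) : B.nf (B.nf T) = B.nf T :=
  B.fix _ (B.ok _) (B.mem _)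

theorem nf_tup : B.nf B.tup = B.tup := by
  apply Tup.map_injective (φ := (B.retr.range.val : B.Ring →+* Poly s k)) Subtype.val_injective
  rw [B.map_nf, tup_map_val, nf_nf]

/-- The normal form is idempotent, so the image of the endomorphism is a retract of the polynomial
ring. -/
theorem proj_comp_val : B.proj.comp B.retr.range.val = AlgHom.id k B.Ring := by
  rw [← AlgHom.cancel_right B.retr.rangeRestrict_surjective]
  apply hom_ext
  change (B.tup.map (B.retr.range.val : B.Ring →+* Poly s k)).map (B.proj : Poly s k →+* B.Ring) =
    B.tup
  rw [tup_map_val, B.map_nf]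
  exact B.nf_tup

/-- The universal tuple given by a normal form. -/
def chart : TupChart s k C i j where
  Q := B.Ring
  T := B.tup
  ok := B.nf_tup ▸ B.ok B.tup
  mem := B.nf_tup ▸ B.mem B.tup
  exists_hom T' h hC := by
    refine ⟨(eval T').comp B.retr.range.val, ?_⟩
    change (B.tup.map (B.retr.range.val : B.Ring →+* Poly s k)).map (eval (k := k) T' : Poly s k →+* _) = T'
    rw [tup_map_val, B.map_nf, generic_map, B.fix T' h hC]
  hom_ext φ ψ h := by
    rw [← AlgHom.cancel_right B.retr.rangeRestrict_surjective]
    exact hom_ext h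

/-- The ring was taken as a subalgebra of the polynomial ring, rather than as a quotient, so that
this is immediate. -/
instance : IsDomain B.chart.Q := inferInstanceAs (IsDomain B.Ring)

/-- A retract of a formally smooth algebra is formally smooth, and finite type over a field is
finite presentation. -/
instance : Algebra.Smooth k B.chart.Q := by
  change Algebra.Smooth k B.Ring
  refine ⟨?_, ?_⟩
  · refine Algebra.FormallySmooth.of_split B.proj
      ((Ideal.Quotient.mkₐ k _).comp B.retr.range.val) ?_
    rw [← AlgHom.comp_assoc]
    exact B.proj_comp_val
  · have : Algebra.FiniteType k B.Ring :=
      Algebra.FiniteType.of_surjective B.proj B.retr.rangeRestrict_surjective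
    exact Algebra.FinitePresentation.of_finiteType.1 this

end NormalForm

/-! ### Solving the quadratic equation -/

namespace Shape

variable (s : Shape) {R : Type u} [CommRing R]

theorem quad_apply (x : s.Vec R) : s.quad x = ∑ k, if s.Out k then 0 else x k * x k.rev := by
  rw [quad, form_apply]
  refine Finset.sum_congr rfl fun k _ => ?_
  simp only [mid, out_rev]
  split_ifs with h
  · simp
  · rw [s.sgn_of_not_out h, one_mul]

theorem quad_congr {x y : s.Vec R} (h : ∀ k, ¬ s.Out k → x k = y k) : s.quad x = s.quad y := by
  rw [quad_apply, quad_apply]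
  refine Finset.sum_congr rfl fun k _ => ?_
  split_ifs with hk
  · rfl
  · rw [h k hk, h k.rev ((s.out_rev k).not.2 hk)]

/-- The vector with the coordinates at `p` and its opposite index replaced by zero. -/
def clear (p : Fin s.n) (x : s.Vec R) : s.Vec R := fun k => if k = p ∨ k = p.rev then 0 else x k

/-- Splitting off a hyperbolic plane makes the form linear in the coordinate opposite to `p`, so the
quadric can be solved for it once `x p = 1`. -/
theorem quad_eq_add {p : Fin s.n} (h : ¬ s.Out p) (hp : p ≠ p.rev) (x : s.Vec R) :
    s.quad x = 2 * (x p * x p.rev) + s.quad (s.clear p x) := by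
  rw [← sub_eq_iff_eq_add, quad_apply, quad_apply, ← Finset.sum_sub_distrib,
    Finset.sum_eq_add p p.rev hp]
  · simp only [clear, out_rev, if_neg h, true_or, or_true, if_true, Fin.rev_rev]
    ring
  · rintro k - ⟨h1, h2⟩
    have h3 : k.rev ≠ p := fun h3 => h2 (by rw [← h3, Fin.rev_rev])
    have h4 : k.rev ≠ p.rev := fun h4 => h1 (Fin.rev_injective h4)
    simp [clear, h1, h2, h3, h4]
  · simp
  · simp

/-- The vector on the affine quadric `quad = t` with coordinate `1` at `p`, and with the given
coordinates apart from those at `p` and its opposite index; `half` is the inverse of `2`. -/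
def solve (half : R) (p : Fin s.n) (x : s.Vec R) (t : R) : s.Vec R := fun k =>
  if k = p then 1 else if k = p.rev then half * (t - s.quad (s.clear p x)) else x k

variable {half : R} (h2 : 2 * half = 1) {p : Fin s.n} (h : ¬ s.Out p) (hp : p ≠ p.rev)

theorem solve_self (x : s.Vec R) (t : R) : s.solve half p x t p = 1 := if_pos rfl

include h2 h hp in
theorem quad_solve (x : s.Vec R) (t : R) : s.quad (s.solve half p x t) = t := by
  have h3 : s.clear p (s.solve half p x t) = s.clear p x := by
    ext k
    simp only [clear, solve]
    split_ifs <;> tauto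
  rw [s.quad_eq_add h hp, h3, solve_self, solve, if_neg hp.symm, if_pos rfl]
  linear_combination (t - s.quad (s.clear p x)) * h2

include h2 h hp in
theorem solve_eq {x : s.Vec R} {t : R} (hx : x p = 1) (ht : s.quad x = t) :
    s.solve half p x t = x := by
  ext k
  rw [solve]
  split_ifs with h3 h4
  · rw [h3, hx]
  · rw [s.quad_eq_add h hp, hx] at ht
    rw [h4]
    linear_combination half * (-ht) + x p.rev * h2
  · rfl

theorem map_clear {R' : Type u} [CommRing R'] (φ : R →+* R') (x : s.Vec R) :
    s.clear p (φ ∘ x) = φ ∘ s.clear p x := by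
  ext k
  simp only [clear, Function.comp]
  split_ifs <;> simp

theorem map_solve {R' : Type u} [CommRing R'] (φ : R →+* R') (x : s.Vec R) (t : R) :
    φ ∘ s.solve half p x t = s.solve (φ half) p (φ ∘ x) (φ t) := by
  ext k
  simp only [solve, Function.comp]
  split_ifs
  · simp
  · rw [map_mul, map_sub]
    congr 2
    rw [map_clear, s.map_quad]
  · rfl

/-- At most one index is its own opposite. If only this coordinate were nonzero, the form would be
its square, contradicting isotropy. -/
theorem exists_pivot {K : Type u} [Field K] {x : s.Vec K} (hx : s.quad x = 0) (h0 : s.mid x ≠ 0) :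
    ∃ p, ¬ s.Out p ∧ p ≠ p.rev ∧ x p ≠ 0 := by
  by_contra! hcon
  apply h0
  ext k
  rw [mid, Pi.zero_apply]
  split_ifs with hk
  · rfl
  · by_cases hk' : k = k.rev
    · rw [quad_apply, Finset.sum_eq_single k, if_neg hk, ← hk', mul_self_eq_zero] at hx
      · exact hx
      · intro k' _ hne
        split_ifs with h3
        · rfl
        · rw [hcon k' h3, zero_mul]
          intro h4
          have e1 := congrArg Fin.val h4
          have e2 := congrArg Fin.val hk'
          rw [Fin.val_rev] at e1 e2
          exact hne (Fin.ext (by omega))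
      · simp
    · exact hcon k hk hk'

end Shape

end Splitting

end

noncomputable section

namespace Splitting

/-! ### Normal forms on the three loci -/

namespace Tup

variable {s : Shape} {R : Type u} [CommRing R]

/-- The first locus, in terms of tuples. -/
def InLocus₁ (T : Tup s R) : Prop := T.w = 0

/-- The second locus, in terms of tuples. -/
def InLocus₂ (T : Tup s R) : Prop := s.quad T.v = 0 ∧ ∀ k, s.Out k → T.w k = 0

/-- The third locus, in terms of tuples. -/
def InLocus₃ (T : Tup s R) : Prop := s.mid T.v = 0

variable {T : Tup s R} {i : Fin s.n} {j : Option (Fin s.n)}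

theorem ok_of_inLocus₁ (hw : T.w = 0) (hl : T.l = 0) (hv : T.v i = 1) (hj : T.wc j = 1) :
    T.Ok 0 i j where
  v_eq := hv
  wc_eq := hj
  form_eq := by rw [hw, map_zero]; ring
  tilt_eq k := by rw [hw, hl]; simp [Shape.tilt]
  quad_eq := by rw [hw, hl]; simp [Shape.quad_apply]
  minor_eq k k' := by rw [hw]; simp [Shape.hat]

/-- The `i`-th tilt equation reads `l` off from the outer part of `w`. -/
theorem Ok.l_eq_zero (h : T.Ok 0 i j) (hw : ∀ k, s.Out k → T.w k = 0) : T.l = 0 := by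
  have := h.tilt_eq i
  rw [h.v_eq, mul_one, Shape.tilt] at this
  rw [← this]
  split_ifs with hk
  · exact hw i hk
  · exact zero_mul _

theorem Ok.minor_mid (h : T.Ok 0 i j) {k k' : Fin s.n} (hk : ¬ s.Out k) (hk' : ¬ s.Out k') :
    T.v k * T.w k' = T.v k' * T.w k := by
  have := h.minor_eq k k'
  simpa only [Shape.hat, if_neg hk, if_neg hk'] using this

/-- Tuples whose middle parts are proportional to an isotropic vector are on the second locus. -/
theorem ok_of_inLocus₂ {u : s.Vec R} (hu : s.quad u = 0) (α β : R)
    (hTv : ∀ k, ¬ s.Out k → T.v k = α * u k) (hTw : T.w = β • s.mid u) (hl : T.l = 0)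
    (hv : T.v i = 1) (hj : T.wc j = 1) : T.Ok 0 i j ∧ T.InLocus₂ := by
  have h1 : s.mid T.v = α • s.mid u := by
    ext k
    simp only [Shape.mid, Pi.smul_apply, smul_eq_mul]
    split_ifs with hk
    · rw [mul_zero]
    · exact hTv k hk
  have h2 : s.mid (s.mid u) = s.mid u := by
    ext k; simp only [Shape.mid]; split_ifs <;> rfl
  have h3 : s.form T.v T.w = s.form (s.mid T.v) T.w := by
    rw [Shape.form_apply, Shape.form_apply]
    refine Finset.sum_congr rfl fun k _ => ?_
    simp only [hTw, Shape.mid, Pi.smul_apply, s.out_rev]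
    split_ifs <;> simp
  have h4 : ∀ k, s.hat 0 T.v k = α * s.mid u k := fun k => by
    simp only [Shape.hat, Shape.mid]
    split_ifs with hk
    · ring
    · exact hTv k hk
  have h5 : ∀ k, s.hat 1 T.w k = β * s.mid u k := fun k => by
    simp only [hTw, Shape.hat, Shape.mid, Pi.smul_apply, smul_eq_mul]
    split_ifs <;> ring
  refine ⟨⟨hv, hj, ?_, fun k => ?_, ?_, fun k k' => ?_⟩, ?_, fun k hk => ?_⟩
  · rw [h3, h1, hTw, map_smul, map_smul, LinearMap.smul_apply, ← Shape.quad, hu]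
    simp
  · rw [hl, hTw]
    simp only [Shape.tilt, Shape.mid, Pi.smul_apply, smul_eq_mul]
    split_ifs <;> ring
  · rw [Shape.quad, hTw, s.mid_smul, h2, map_smul, map_smul, LinearMap.smul_apply, ← Shape.quad, hu,
      hl]
    simp
  · rw [h4, h4, h5, h5]
    ring
  · rw [Shape.quad, h1, map_smul, map_smul, LinearMap.smul_apply, ← Shape.quad, hu]
    simp
  · simp [hTw, Shape.mid, hk]

/-- Tuples with `v` outer and with the outer part of `w` proportional to `v` are on the third
locus. -/
theorem ok_of_inLocus₃ (hTv : ∀ k, ¬ s.Out k → T.v k = 0)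
    (hTw : ∀ k, s.Out k → T.w k = T.l * T.v k) (hq : s.quad T.w = 2 * T.l * T.c)
    (hv : T.v i = 1) (hj : T.wc j = 1) : T.Ok 0 i j ∧ T.InLocus₃ := by
  have h1 : s.mid T.v = 0 := by
    ext k
    simp only [Shape.mid, Pi.zero_apply]
    split_ifs with hk
    · rfl
    · exact hTv k hk
  have h2 : s.form T.v T.w = T.l * s.form T.v T.v := by
    rw [Shape.form_apply, Shape.form_apply, Finset.mul_sum]
    refine Finset.sum_congr rfl fun k _ => ?_
    by_cases hk : s.Out k
    · rw [hTw k.rev ((s.out_rev k).2 hk)]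
      ring
    · rw [hTv k hk]
      ring
  have h3 : s.hat 0 T.v = 0 := by
    ext k
    simp only [Shape.hat, Pi.zero_apply]
    split_ifs with hk
    · ring
    · exact hTv k hk
  refine ⟨⟨hv, hj, ?_, fun k => ?_, hq, fun k k' => ?_⟩, h1⟩
  · have := s.form_out_self T.v
    rw [h1, sub_zero] at this
    rw [h2, this]
    ring
  · simp only [Shape.tilt]
    split_ifs with hk
    · exact hTw k hk
    · rw [hTv k hk]
      ring
  · rw [h3]
    simp

theorem InLocus₃.v_eq_zero (h : T.InLocus₃) {k : Fin s.n} (hk : ¬ s.Out k) : T.v k = 0 := by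
  have := congrFun h k
  rwa [Shape.mid, if_neg hk] at this

theorem Ok.w_out (h : T.Ok 0 i j) {k : Fin s.n} (hk : s.Out k) : T.w k = T.l * T.v k := by
  have := h.tilt_eq k
  rwa [Shape.tilt, if_pos hk] at this

end Tup

section NormalForms

variable {s : Shape} {k : Type u} [Field k]

/-- The inverse of `2`. -/
abbrev half (k R : Type u) [Field k] [CommRing R] [Algebra k R] : R := algebraMap k R 2⁻¹

theorem two_mul_half (h2 : (2 : k) ≠ 0) (R : Type u) [CommRing R] [Algebra k R] :
    2 * half k R = 1 := by
  rw [half, ← map_ofNat (algebraMap k R) 2, ← map_mul, mul_inv_cancel₀ h2, map_one]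

/-- A normal form on the first locus. -/
def normalForm₁ (s : Shape) (k : Type u) [Field k] (i : Fin s.n) :
    NormalForm s k Tup.InLocus₁ i none where
  nf T := ⟨Function.update T.v i 1, 0, 1, 0⟩
  map_nf φ T := by
    refine Tup.ext ?_ ?_ (map_one _) (map_zero _)
    · ext a
      simp only [Tup.map, Function.comp_apply, Function.update_apply]
      split_ifs <;> simp
    · ext a
      exact map_zero φ
  ok T := Tup.ok_of_inLocus₁ rfl rfl (Function.update_self _ _ _) rfl
  mem T := rfl
  fix T h hC := by
    refine Tup.ext ?_ (Eq.symm hC) (Eq.symm h.wc_eq) (Eq.symm (h.l_eq_zero fun k _ => ?_))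
    · exact Function.update_eq_self_iff.2 h.v_eq.symm
    · rw [show T.w = 0 from hC]
      rfl

variable (h2 : (2 : k) ≠ 0) {i p : Fin s.n} (hi : s.Out i) (hp : ¬ s.Out p) (hp' : p ≠ p.rev)

theorem map_half {R R' : Type u} [CommRing R] [Algebra k R] [CommRing R'] [Algebra k R']
    (φ : R →ₐ[k] R') : (φ : R →+* R') (half k R) = half k R' :=
  φ.commutes _

include h2 hp hp' in
theorem Tup.Ok.solve_v {R : Type u} [CommRing R] [Algebra k R] {T : Tup s R} {j : Option (Fin s.n)}
    (h : T.Ok 0 p j) (hC : T.InLocus₂) : s.solve (half k R) p T.v 0 = T.v :=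
  s.solve_eq (two_mul_half h2 R) hp hp' h.v_eq hC.1

/-- A normal form on the second locus, at a middle index of `v`. -/
def normalForm₂ : NormalForm s k Tup.InLocus₂ p none where
  -- With `v_p = 1`, proportionality of the middle parts reads `w_mid = w_p v_mid`.
  nf {R} _ _ T := ⟨s.solve (half k R) p T.v 0, T.w p • s.mid (s.solve (half k R) p T.v 0), 1, 0⟩
  map_nf {R R'} _ _ _ _ φ T := by
    have h1 := s.map_solve (p := p) (φ : R →+* R') (half := half k R) T.v 0
    rw [map_half, map_zero] at h1
    refine Tup.ext h1 ?_ (map_one _) (map_zero _)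
    ext a
    have h3 := congrFun (s.map_mid (φ : R →+* R') (s.solve (half k R) p T.v 0)) a
    rw [h1] at h3
    exact (map_mul φ _ _).trans (congrArg _ h3)
  ok {R} _ _ T := (Tup.ok_of_inLocus₂ (s.quad_solve (two_mul_half h2 R) hp hp' T.v 0) 1 _
    (fun _ _ => (one_mul _).symm) rfl rfl (s.solve_self _ _) rfl).1
  mem {R} _ _ T := (Tup.ok_of_inLocus₂ (i := p) (j := none)
    (s.quad_solve (two_mul_half h2 R) hp hp' T.v 0) 1 _
    (fun _ _ => (one_mul _).symm) rfl rfl (s.solve_self _ _) rfl).2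
  fix T h hC := by
    refine Tup.ext (h.solve_v h2 hp hp' hC) ?_ h.wc_eq.symm (h.l_eq_zero hC.2).symm
    dsimp only
    rw [h.solve_v h2 hp hp' hC]
    ext a
    simp only [Shape.mid, Pi.smul_apply, smul_eq_mul]
    split_ifs with ha
    · rw [hC.2 a ha, mul_zero]
    · rw [mul_comm, ← h.minor_mid hp ha, h.v_eq, one_mul]

/-- A normal form on the second locus, at a middle index of both `v` and `w`. -/
def normalForm₂' : NormalForm s k Tup.InLocus₂ p (some p) where
  nf {R} _ _ T := ⟨s.solve (half k R) p T.v 0, (1 : R) • s.mid (s.solve (half k R) p T.v 0), T.c, 0⟩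
  map_nf {R R'} _ _ _ _ φ T := by
    have h1 := s.map_solve (p := p) (φ : R →+* R') (half := half k R) T.v 0
    rw [map_half, map_zero] at h1
    refine Tup.ext h1 ?_ rfl (map_zero _)
    dsimp only [Tup.map]
    rw [one_smul, one_smul, s.map_mid, h1]
  ok {R} _ _ T := (Tup.ok_of_inLocus₂ (s.quad_solve (two_mul_half h2 R) hp hp' T.v 0) 1 _
    (fun _ _ => (one_mul _).symm) rfl rfl (s.solve_self _ _) (by
      simp [Tup.wc, Shape.mid, hp, s.solve_self])).1
  mem {R} _ _ T := (Tup.ok_of_inLocus₂ (i := p) (j := some p)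
    (s.quad_solve (two_mul_half h2 R) hp hp' T.v 0) 1 _
    (fun _ _ => (one_mul _).symm) rfl rfl (s.solve_self _ _) (by
      simp [Tup.wc, Shape.mid, hp, s.solve_self])).2
  fix T h hC := by
    refine Tup.ext (h.solve_v h2 hp hp' hC) ?_ rfl (h.l_eq_zero hC.2).symm
    dsimp only
    rw [h.solve_v h2 hp hp' hC, one_smul]
    ext a
    simp only [Shape.mid]
    split_ifs with ha
    · rw [hC.2 a ha]
    · have h3 : T.w p = 1 := h.wc_eq
      have h4 := h.minor_mid hp ha
      rw [h3, h.v_eq, one_mul, mul_one] at h4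
      exact h4.symm

/-- A normal form on the second locus, at a middle index of `w` and an outer index of `v`. -/
def normalForm₂'' : NormalForm s k Tup.InLocus₂ i (some p) where
  nf {R} _ _ T :=
    ⟨fun a => if a = i then 1 else if s.Out a then T.v a else T.v p * s.solve (half k R) p T.w 0 a,
      (1 : R) • s.mid (s.solve (half k R) p T.w 0), T.c, 0⟩
  map_nf {R R'} _ _ _ _ φ T := by
    have h1 := s.map_solve (p := p) (φ : R →+* R') (half := half k R) T.w 0
    rw [map_half, map_zero] at h1
    refine Tup.ext ?_ ?_ rfl (map_zero _)
    · ext a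
      have h3 := congrFun h1 a
      dsimp only [Tup.map, Function.comp_apply] at h3 ⊢
      split_ifs
      · exact map_one _
      · rfl
      · exact (map_mul _ _ _).trans (congrArg _ h3)
    · dsimp only [Tup.map]
      rw [one_smul, one_smul, s.map_mid, h1]
  ok {R} _ _ T := (Tup.ok_of_inLocus₂ (s.quad_solve (two_mul_half h2 R) hp hp' T.w 0) (T.v p) _
    (fun a ha => by
      have : a ≠ i := fun h => ha (h ▸ hi)
      simp [this, ha]) rfl rfl (if_pos rfl) (by
      simp [Tup.wc, Shape.mid, hp, s.solve_self])).1
  mem {R} _ _ T := (Tup.ok_of_inLocus₂ (i := i) (j := some p)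
    (s.quad_solve (two_mul_half h2 R) hp hp' T.w 0) (T.v p) _
    (fun a ha => by
      have : a ≠ i := fun h => ha (h ▸ hi)
      simp [this, ha]) rfl rfl (if_pos rfl) (by
      simp [Tup.wc, Shape.mid, hp, s.solve_self])).2
  fix {R} _ _ T h hC := by
    have h3 : T.w p = 1 := h.wc_eq
    have h4 : s.solve (half k R) p T.w 0 = T.w := by
      refine s.solve_eq (two_mul_half h2 R) hp hp' h3 ?_
      rw [h.quad_eq, h.l_eq_zero hC.2]
      ring
    refine Tup.ext ?_ ?_ rfl (h.l_eq_zero hC.2).symm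
    · ext a
      dsimp only
      rw [h4]
      split_ifs with ha ha'
      · rw [ha, h.v_eq]
      · rfl
      · rw [h.minor_mid hp ha', h3, mul_one]
    · dsimp only
      rw [h4, one_smul]
      ext a
      simp only [Shape.mid]
      split_ifs with ha
      · rw [hC.2 a ha]
      · rfl

/-- The vector `v` with its middle part removed and the coordinate at `i` replaced by `1`. -/
def outerPart {R : Type u} [CommRing R] (i : Fin s.n) (x : s.Vec R) : s.Vec R := fun a =>
  if a = i then 1 else if s.Out a then x a else 0

/-- The vector with the outer part `l v` and the middle part of `x`. -/
def glueParts {R : Type u} [CommRing R] (l : R) (v x : s.Vec R) : s.Vec R := fun a =>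
  if s.Out a then l * v a else x a

section Parts

variable {R R' : Type u} [CommRing R] [CommRing R'] (φ : R →+* R')

theorem map_outerPart (x : s.Vec R) : φ ∘ outerPart i x = outerPart i (φ ∘ x) := by
  ext a
  simp only [outerPart, Function.comp_apply]
  split_ifs <;> simp

theorem map_glueParts (l : R) (v x : s.Vec R) :
    φ ∘ glueParts l v x = glueParts (φ l) (φ ∘ v) (φ ∘ x) := by
  ext a
  simp only [glueParts, Function.comp_apply]
  split_ifs <;> simp

theorem quad_glueParts (l : R) (v x : s.Vec R) : s.quad (glueParts l v x) = s.quad x :=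
  s.quad_congr fun _ hk => if_neg hk

include hi in
theorem ok_glueParts {v x : s.Vec R} {c l : R} {j : Option (Fin s.n)} (hq : s.quad x = 2 * l * c)
    (hj : (⟨outerPart i v, glueParts l (outerPart i v) x, c, l⟩ : Tup s R).wc j = 1) :
    (⟨outerPart i v, glueParts l (outerPart i v) x, c, l⟩ : Tup s R).Ok 0 i j ∧
      (⟨outerPart i v, glueParts l (outerPart i v) x, c, l⟩ : Tup s R).InLocus₃ := by
  refine Tup.ok_of_inLocus₃ (fun a ha => ?_) (fun a ha => if_pos ha) ?_ (if_pos rfl) hj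
  · have : a ≠ i := fun h => ha (h ▸ hi)
    simp [outerPart, this, ha]
  · rw [quad_glueParts, hq]

theorem outerPart_eq {T : Tup s R} {j : Option (Fin s.n)} (h : T.Ok 0 i j) (hC : T.InLocus₃) :
    outerPart i T.v = T.v := by
  ext a
  rw [outerPart]
  split_ifs with ha ha'
  · rw [ha, h.v_eq]
  · rfl
  · exact (hC.v_eq_zero ha').symm

theorem glueParts_eq {T : Tup s R} {j : Option (Fin s.n)} (h : T.Ok 0 i j) :
    glueParts T.l T.v T.w = T.w := by
  ext a
  rw [glueParts]
  split_ifs with ha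
  · exact (h.w_out ha).symm
  · rfl

end Parts

/-- A normal form on the third locus, where `c = 1`. -/
def normalForm₃ : NormalForm s k Tup.InLocus₃ i none where
  nf {R} _ _ T := ⟨outerPart i T.v,
    -- With `c = 1` the equation `quad w = 2 l c` gives `l` in terms of the free middle coordinates
    -- of `w`.
    glueParts (half k R * s.quad T.w) (outerPart i T.v) T.w, 1, half k R * s.quad T.w⟩
  map_nf {R R'} _ _ _ _ φ T := by
    have h1 : (φ : R →+* R') (half k R * s.quad T.w) = half k R' * s.quad ((φ : R →+* R') ∘ T.w) := by
      rw [map_mul, map_half, s.map_quad]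
    refine Tup.ext (map_outerPart _ _) ?_ (map_one _) h1
    dsimp only [Tup.map]
    rw [map_glueParts, map_outerPart, h1]
  ok {R} _ _ T := (ok_glueParts hi (by
    linear_combination -s.quad T.w * two_mul_half h2 R) rfl).1
  mem {R} _ _ T := (ok_glueParts (j := none) hi (by
    linear_combination -s.quad T.w * two_mul_half h2 R) rfl).2
  fix {R} _ _ T h hC := by
    have hc : T.c = 1 := h.wc_eq
    have hl : half k R * s.quad T.w = T.l := by
      rw [h.quad_eq, hc]
      linear_combination T.l * two_mul_half h2 R
    refine Tup.ext (outerPart_eq h hC) ?_ hc.symm hl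
    dsimp only
    rw [outerPart_eq h hC, hl, glueParts_eq h]

/-- A normal form on the third locus, where `l = 1`. -/
def normalForm₃' : NormalForm s k Tup.InLocus₃ i (some i) where
  -- Here `w_i = l v_i` with `w_i = v_i = 1`, so `l = 1` and the quadratic equation gives `c`.
  nf {R} _ _ T := ⟨outerPart i T.v, glueParts 1 (outerPart i T.v) T.w, half k R * s.quad T.w, 1⟩
  map_nf {R R'} _ _ _ _ φ T := by
    have h1 : (φ : R →+* R') (half k R * s.quad T.w) = half k R' * s.quad ((φ : R →+* R') ∘ T.w) := by
      rw [map_mul, map_half, s.map_quad]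
    refine Tup.ext (map_outerPart _ _) ?_ h1 (map_one _)
    dsimp only [Tup.map]
    rw [map_glueParts, map_outerPart, map_one]
  ok {R} _ _ T := (ok_glueParts hi (by
    linear_combination -s.quad T.w * two_mul_half h2 R) (by
      simp [Tup.wc, glueParts, outerPart, hi])).1
  mem {R} _ _ T := (ok_glueParts (j := some i) hi (by
    linear_combination -s.quad T.w * two_mul_half h2 R) (by
      simp [Tup.wc, glueParts, outerPart, hi])).2
  fix {R} _ _ T h hC := by
    have hl : T.l = 1 := by
      have h3 := h.w_out hi
      rw [h.v_eq, mul_one] at h3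
      exact h3.symm.trans h.wc_eq
    refine Tup.ext (outerPart_eq h hC) ?_ ?_ hl.symm
    · dsimp only
      rw [outerPart_eq h hC, ← hl, glueParts_eq h]
    · dsimp only
      rw [h.quad_eq, hl]
      linear_combination T.c * two_mul_half h2 R

/-- A normal form on the third locus, at a middle index of `w`. -/
def normalForm₃'' : NormalForm s k Tup.InLocus₃ i (some p) where
  nf {R} _ _ T := ⟨outerPart i T.v,
    glueParts T.l (outerPart i T.v) (s.solve (half k R) p T.w (2 * T.l * T.c)), T.c, T.l⟩
  map_nf {R R'} _ _ _ _ φ T := by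
    refine Tup.ext (map_outerPart _ _) ?_ rfl rfl
    dsimp only [Tup.map]
    rw [map_glueParts, map_outerPart, s.map_solve, map_half, map_mul, map_mul, map_ofNat]
  ok {R} _ _ T := (ok_glueParts hi (s.quad_solve (two_mul_half h2 R) hp hp' _ _) (by
      simp [Tup.wc, glueParts, hp, s.solve_self])).1
  mem {R} _ _ T := (ok_glueParts (j := some p) hi (s.quad_solve (two_mul_half h2 R) hp hp' _ _) (by
      simp [Tup.wc, glueParts, hp, s.solve_self])).2
  fix {R} _ _ T h hC := by
    refine Tup.ext (outerPart_eq h hC) ?_ rfl rfl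
    dsimp only
    rw [s.solve_eq (two_mul_half h2 R) hp hp' h.wc_eq h.quad_eq, outerPart_eq h hC, glueParts_eq h]

end NormalForms

end Splitting

end

noncomputable section

namespace Splitting

/-! ### The cone over a product of a quadric with a line -/

section Words

variable {ι B : Type*} [CommRing B] (x y : ι → B)

/-- The product over a list of the values of `y` at the first `b` entries and of `x` at the other
ones. -/
def word : ℕ → List ι → B
  | 0, [] => 1
  -- Asking for more letters `y` than there are entries gives zero.
  | _ + 1, [] => 0
  | 0, a :: l => x a * word 0 l
  | b + 1, a :: l => y a * word b l

variable {x y} (h : ∀ a b, x a * y b = x b * y a)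

include h in
-- The relations `x_a y_b = x_b y_a` make it irrelevant which of the letters carry `y`.
theorem word_perm {l l' : List ι} (hl : l.Perm l') (b : ℕ) : word x y b l = word x y b l' := by
  induction hl generalizing b with
  | nil => rfl
  | cons a _ ih => cases b <;> simp only [word, ih]
  | swap a a' l =>
    match b with
    | 0 => simp only [word]; ring
    | 1 => simp only [word]; linear_combination h a a' * word x y 0 l
    | b + 2 => simp only [word]; ring
  | trans _ _ ih ih' => rw [ih, ih']

/-- `word` on multisets. -/
def mword (b : ℕ) (m : Multiset ι) : B :=
  Quot.liftOn m (word x y b) fun _ _ hl => word_perm h hl b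

theorem mword_zero_cons (a : ι) (m : Multiset ι) : mword h 0 (a ::ₘ m) = x a * mword h 0 m :=
  Quot.inductionOn m fun _ => rfl

theorem mword_succ_cons (b : ℕ) (a : ι) (m : Multiset ι) :
    mword h (b + 1) (a ::ₘ m) = y a * mword h b m :=
  Quot.inductionOn m fun _ => rfl

/-- The bound is essential: if `b` is one more than the size of `m`, the right-hand side is zero
while the left-hand side is a product of letters `y`. -/
theorem mword_cons (b : ℕ) (a : ι) (m : Multiset ι) (hb : b ≤ m.card) :
    mword h b (a ::ₘ m) = x a * mword h b m := by
  induction b generalizing m with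
  | zero => exact mword_zero_cons h a m
  | succ b ih =>
    obtain ⟨c, m, rfl⟩ : ∃ c m', m = c ::ₘ m' := by
      obtain ⟨c, hc⟩ := Multiset.card_pos_iff_exists_mem.1 (Nat.succ_pos b |>.trans_le hb)
      exact ⟨c, _, (Multiset.exists_cons_of_mem hc).choose_spec⟩
    rw [Multiset.card_cons] at hb
    rw [Multiset.cons_swap, mword_succ_cons, mword_succ_cons, ih m (by omega)]
    ring

end Words

section Cone

open MvPolynomial

variable {ι A B : Type*} [CommRing A] [CommRing B] [Algebra A B] {x y : ι → B}
  (h : ∀ a b, x a * y b = x b * y a)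

/-- The linear map that sends `z ^ m T ^ b` to a word with `b` letters `y`. -/
def polarize : Polynomial (MvPolynomial ι A) →ₗ[A] B :=
  Polynomial.lsum fun b => (basisMonomials ι A).constr A fun m => mword h b (Finsupp.toMultiset m)

theorem polarize_monomial (b : ℕ) (m : ι →₀ ℕ) :
    polarize h (Polynomial.monomial b (monomial m (1 : A))) = mword h b (Finsupp.toMultiset m) := by
  rw [polarize, Polynomial.lsum_apply, Polynomial.sum_monomial_index]
  swap
  · exact map_zero _
  have := (basisMonomials ι A).constr_basis A (fun m => mword h b (Finsupp.toMultiset m)) m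
  rwa [coe_basisMonomials] at this

variable (ι A) in
/-- The span of the monomials `z ^ m T ^ b` with `b ≤ |m|`. -/
def admissible : Submodule A (Polynomial (MvPolynomial ι A)) :=
  Submodule.span A {g | ∃ (b : ℕ) (m : ι →₀ ℕ), b ≤ (Finsupp.toMultiset m).card ∧
    Polynomial.monomial b (monomial m (1 : A)) = g}

theorem C_X_mul_monomial (a : ι) (b : ℕ) (m : ι →₀ ℕ) :
    Polynomial.C (X a : MvPolynomial ι A) * Polynomial.monomial b (monomial m (1 : A)) =
      Polynomial.monomial b (monomial (Finsupp.single a 1 + m) (1 : A)) := by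
  rw [Polynomial.C_mul_monomial, X, monomial_mul, one_mul]

theorem toMultiset_single_add (a : ι) (m : ι →₀ ℕ) :
    Finsupp.toMultiset (Finsupp.single a 1 + m) = a ::ₘ Finsupp.toMultiset m := by
  rw [map_add, Finsupp.toMultiset_single, one_smul, Multiset.singleton_add]

theorem polarize_C_X_mul (a : ι) {g : Polynomial (MvPolynomial ι A)} (hg : g ∈ admissible ι A) :
    Polynomial.C (X a) * g ∈ admissible ι A ∧
      polarize h (Polynomial.C (X a) * g) = x a * polarize h g := by
  induction hg using Submodule.span_induction with
  | mem g hg =>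
    obtain ⟨b, m, hb, rfl⟩ := hg
    rw [C_X_mul_monomial, polarize_monomial, polarize_monomial, toMultiset_single_add,
      mword_cons h b a _ hb]
    refine ⟨Submodule.subset_span ⟨b, _, ?_, rfl⟩, rfl⟩
    rw [toMultiset_single_add, Multiset.card_cons]
    omega
  | zero => simp
  | add g g' _ _ ih ih' =>
    rw [mul_add, map_add, map_add, mul_add, ih.2, ih'.2]
    exact ⟨Submodule.add_mem _ ih.1 ih'.1, rfl⟩
  | smul r g _ ih =>
    rw [mul_smul_comm, map_smul, map_smul, ih.2, mul_smul_comm]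
    exact ⟨Submodule.smul_mem _ r ih.1, rfl⟩

theorem polarize_C_X_mul_X_mul (a : ι) {g : Polynomial (MvPolynomial ι A)}
    (hg : g ∈ admissible ι A) :
    Polynomial.C (X a) * Polynomial.X * g ∈ admissible ι A ∧
      polarize h (Polynomial.C (X a) * Polynomial.X * g) = y a * polarize h g := by
  induction hg using Submodule.span_induction with
  | mem g hg =>
    obtain ⟨b, m, hb, rfl⟩ := hg
    rw [mul_assoc, Polynomial.X_mul_monomial, C_X_mul_monomial, polarize_monomial,
      polarize_monomial, toMultiset_single_add, mword_succ_cons]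
    refine ⟨Submodule.subset_span ⟨b + 1, _, ?_, rfl⟩, rfl⟩
    rw [toMultiset_single_add, Multiset.card_cons]
    omega
  | zero => simp
  | add g g' _ _ ih ih' =>
    rw [mul_add, map_add, map_add, mul_add, ih.2, ih'.2]
    exact ⟨Submodule.add_mem _ ih.1 ih'.1, rfl⟩
  | smul r g _ ih =>
    rw [mul_smul_comm, map_smul, map_smul, ih.2, mul_smul_comm]
    exact ⟨Submodule.smul_mem _ r ih.1, rfl⟩

variable (ι A) in
/-- The homomorphism with `x_a ↦ z_a` and `y_a ↦ z_a T`. -/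
def coneHom : MvPolynomial (ι ⊕ ι) A →ₐ[A] Polynomial (MvPolynomial ι A) :=
  aeval (Sum.elim (fun a => Polynomial.C (X a)) fun a => Polynomial.C (X a) * Polynomial.X)

/-- On monomials with `b ≤ |m|`, polarization is compatible with multiplication by `z_a` and by `z_a
T`, the images of the generators. So it inverts `coneHom` modulo the relations. -/
theorem polarize_coneHom (p : MvPolynomial (ι ⊕ ι) A) :
    coneHom ι A p ∈ admissible ι A ∧ polarize h (coneHom ι A p) = aeval (Sum.elim x y) p := by
  induction p using MvPolynomial.induction_on with
  | C r =>
    have h1 : coneHom ι A (C r) = r • Polynomial.monomial 0 (monomial 0 (1 : A)) := by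
      rw [Algebra.smul_def, ← MvPolynomial.algebraMap_eq, AlgHom.commutes]
      exact (mul_one _).symm
    rw [h1, map_smul, polarize_monomial]
    refine ⟨Submodule.smul_mem _ r (Submodule.subset_span ⟨0, 0, Nat.zero_le _, rfl⟩), ?_⟩
    rw [aeval_C, Algebra.smul_def, map_zero]
    exact mul_one _
  | add p q ihp ihq =>
    rw [map_add, map_add, map_add, ihp.2, ihq.2]
    exact ⟨Submodule.add_mem _ ihp.1 ihq.1, rfl⟩
  | mul_X p a ih =>
    rw [mul_comm p, map_mul (coneHom ι A), map_mul (aeval _), ← ih.2]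
    cases a with
    | inl a =>
      have := polarize_C_X_mul h a ih.1
      simpa [coneHom] using this
    | inr a =>
      have := polarize_C_X_mul_X_mul h a ih.1
      simpa [coneHom] using this

variable [Fintype ι] (τ : ι → ι)

/-- According to whether none, one or at least two letters `y` are available, multiplication by the
quadric produces one of the three quadratic relations as a factor. No bound on the degree in `T` is
needed. -/
theorem polarize_quadric_mul (hxx : ∑ a, x a * x (τ a) = 0) (hyx : ∑ a, y a * x (τ a) = 0)
    (hyy : ∑ a, y a * y (τ a) = 0) (g : Polynomial (MvPolynomial ι A)) :
    polarize h (Polynomial.C (∑ a, X a * X (τ a)) * g) = 0 := by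
  induction g using Polynomial.induction_on' with
  | add g g' ih ih' => rw [mul_add, map_add, ih, ih', add_zero]
  | monomial b p =>
    induction p using MvPolynomial.induction_on' with
    | monomial m r =>
      have h1 : monomial m r = r • monomial m (1 : A) := by rw [smul_monomial, smul_eq_mul, mul_one]
      rw [h1, ← Polynomial.smul_monomial, mul_smul_comm, map_smul, map_sum, Finset.sum_mul, map_sum]
      have h2 : ∀ a, polarize h (Polynomial.C (X a * X (τ a)) *
          Polynomial.monomial b (monomial m (1 : A))) =
            mword h b (a ::ₘ τ a ::ₘ Finsupp.toMultiset m) := fun a => by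
        rw [Polynomial.C_mul, mul_assoc, C_X_mul_monomial, C_X_mul_monomial, polarize_monomial,
          toMultiset_single_add, toMultiset_single_add]
      simp only [h2]
      match b with
      | 0 =>
        simp only [mword_zero_cons, ← mul_assoc]
        rw [← Finset.sum_mul, hxx, zero_mul, smul_zero]
      | 1 =>
        simp only [mword_succ_cons, mword_zero_cons, ← mul_assoc]
        rw [← Finset.sum_mul, hyx, zero_mul, smul_zero]
      | b + 2 =>
        simp only [mword_succ_cons, ← mul_assoc]
        rw [← Finset.sum_mul, hyy, zero_mul, smul_zero]
    | add p q ih ih' => rw [map_add, mul_add, map_add, ih, ih', add_zero]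

variable (A) in
/-- The ideal of the cone of pairs of proportional isotropic vectors. -/
def coneIdeal : Ideal (MvPolynomial (ι ⊕ ι) A) :=
  Ideal.span (Set.range (fun p : ι × ι =>
      X (.inl p.1) * X (.inr p.2) - X (.inl p.2) * X (.inr p.1)) ∪
    {∑ a, X (.inl a) * X (.inl (τ a)), ∑ a, X (.inr a) * X (.inl (τ a)),
      ∑ a, X (.inr a) * X (.inr (τ a))})

theorem coneIdeal_le_iff {J : Ideal (MvPolynomial (ι ⊕ ι) A)} : coneIdeal A τ ≤ J ↔
    (∀ a b, X (.inl a) * X (.inr b) - X (.inl b) * X (.inr a) ∈ J) ∧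
      (∑ a, X (.inl a) * X (.inl (τ a)) ∈ J) ∧ (∑ a, X (.inr a) * X (.inl (τ a)) ∈ J) ∧
        ∑ a, X (.inr a) * X (.inr (τ a)) ∈ J := by
  rw [coneIdeal, Ideal.span_le, Set.union_subset_iff, Set.range_subset_iff, Prod.forall]
  simp [Set.insert_subset_iff]

/-- If `coneHom p` is a multiple of the quadric, polarizing into the quotient by `coneIdeal` gives
the class of `p` on one side and zero on the other. -/
theorem coneIdeal_eq_comap : coneIdeal A τ =
    (Ideal.span {Polynomial.C (∑ a, X a * X (τ a) : MvPolynomial ι A)}).comap (coneHom ι A) := by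
  apply le_antisymm
  · have hx : ∀ a, coneHom ι A (X (.inl a)) = Polynomial.C (X a) := fun a => by simp [coneHom]
    have hy : ∀ a, coneHom ι A (X (.inr a)) = Polynomial.C (X a) * Polynomial.X := fun a => by
      simp [coneHom]
    refine (coneIdeal_le_iff τ).2 ⟨fun a b => ?_, ?_, ?_, ?_⟩
    · rw [Ideal.mem_comap, map_sub, map_mul, map_mul, hx, hx, hy, hy]
      convert Ideal.zero_mem _ using 1
      ring
    · rw [Ideal.mem_comap, Ideal.mem_span_singleton]
      refine ⟨1, ?_⟩
      simp [hx]
    · rw [Ideal.mem_comap, Ideal.mem_span_singleton]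
      refine ⟨Polynomial.X, ?_⟩
      simp only [map_sum, map_mul, hx, hy, Finset.sum_mul]
      exact Finset.sum_congr rfl fun a _ => by ring
    · rw [Ideal.mem_comap, Ideal.mem_span_singleton]
      refine ⟨Polynomial.X ^ 2, ?_⟩
      simp only [map_sum, map_mul, hy, Finset.sum_mul]
      exact Finset.sum_congr rfl fun a _ => by ring
  · intro p hp
    rw [Ideal.mem_comap, Ideal.mem_span_singleton] at hp
    obtain ⟨g, hg⟩ := hp
    obtain ⟨h1, h2, h3, h4⟩ := (coneIdeal_le_iff τ).1 (le_refl (coneIdeal A τ))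
    let f := Ideal.Quotient.mkₐ A (coneIdeal A τ)
    have hm : ∀ a b, f (X (.inl a)) * f (X (.inr b)) = f (X (.inl b)) * f (X (.inr a)) := by
      intro a b
      rw [← map_mul, ← map_mul, ← sub_eq_zero, ← map_sub]
      exact Ideal.Quotient.eq_zero_iff_mem.2 (h1 a b)
    have key := (polarize_coneHom hm p).2
    have hf : aeval (Sum.elim (fun a => f (X (.inl a))) fun a => f (X (.inr a))) = f := by
      refine MvPolynomial.algHom_ext fun a => ?_
      rw [aeval_X]
      cases a <;> rfl
    rw [hg, hf, polarize_quadric_mul hm τ] at key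
    · exact Ideal.Quotient.eq_zero_iff_mem.1 key.symm
    all_goals
      simp only [← map_mul, ← map_sum]
      apply Ideal.Quotient.eq_zero_iff_mem.2
      assumption

theorem isPrime_coneIdeal [IsDomain A] (hq : Prime (∑ a, X a * X (τ a) : MvPolynomial ι A)) :
    (coneIdeal A τ).IsPrime := by
  rw [coneIdeal_eq_comap]
  have := Polynomial.prime_C_iff.2 hq
  have := (Ideal.span_singleton_prime this.ne_zero).2 this
  exact Ideal.comap_isPrime _ _

end Cone

end Splitting

end

noncomputable section

namespace Splitting

/-! ### Quadrics of rank at least three are prime -/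

section Quadric

open MvPolynomial

/-- The polynomial is linear in the variable at `τ p`, with coefficient `2 X_p`. It is irreducible
because `X_p` does not divide the remainder, which has a nonzero value at a point where `X_p`
vanishes; the extra index `q` provides this point. -/
theorem prime_quadric {ι A : Type*} [Fintype ι] [CommRing A] [IsDomain A]
    [UniqueFactorizationMonoid A] (h2 : IsUnit (2 : A)) {τ : ι → ι} (hτ : Function.Involutive τ)
    {p q : ι} (hp : p ≠ τ p) (hqp : q ≠ p) (hqp' : q ≠ τ p) :
    Prime (∑ a, X a * X (τ a) : MvPolynomial ι A) := by
  classical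
  have h20 : (2 : A) ≠ 0 := h2.ne_zero
  let S : Finset ι := Finset.univ.filter fun a => ¬ (a = p ∨ a = τ p)
  let g : MvPolynomial ι A := ∑ a ∈ S, X a * X (τ a)
  have hsum : (∑ a, X a * X (τ a) : MvPolynomial ι A) = C 2 * X p * X (τ p) + g := by
    rw [← Finset.sum_filter_add_sum_filter_not Finset.univ fun a => a = p ∨ a = τ p]
    congr 1
    rw [Finset.filter_or, Finset.filter_eq' Finset.univ p, Finset.filter_eq' Finset.univ (τ p),
      if_pos (Finset.mem_univ _), if_pos (Finset.mem_univ _), ← Finset.insert_eq,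
      Finset.sum_pair hp, hτ p, map_ofNat]
    ring
  -- The remainder takes at this point the value `1` or `2`, according to whether `q` is its own
  -- opposite.
  let u : ι → A := fun a => if a = q ∨ a = τ q then 1 else 0
  have hu : ∀ a, u (τ a) = u a := fun a => by
    have : (τ a = q ∨ τ a = τ q) ↔ (a = q ∨ a = τ q) := by
      rw [hτ.eq_iff, hτ.injective.eq_iff, or_comm]
    simp only [u, this]
  have hgu : eval u g ≠ 0 := by
    have h1 : eval u g = ∑ a ∈ S, u a := by
      simp only [g, map_sum, map_mul, eval_X, hu]
      refine Finset.sum_congr rfl fun a _ => ?_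
      simp only [u]
      split_ifs <;> simp
    have h3 : S.filter (fun a => a = q ∨ a = τ q) = {q, τ q} := by
      ext a
      simp only [S, Finset.mem_filter, Finset.mem_univ, true_and, Finset.mem_insert,
        Finset.mem_singleton, and_iff_right_iff_imp]
      rintro (rfl | rfl)
      · exact fun h => h.elim hqp hqp'
      · exact fun h => h.elim (fun h => hqp' (by rw [← h, hτ q])) fun h => hqp (hτ.injective h)
    rw [h1, Finset.sum_boole, h3]
    by_cases hq : q = τ q
    · rw [← hq]
      simp
    · rw [Finset.card_pair hq]
      exact_mod_cast h20
  have hup : u p = 0 := if_neg fun h => h.elim (fun h => hqp h.symm) fun h => hqp' (by rw [h, hτ q])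
  have hdvd : ¬ X p ∣ g := by
    rintro ⟨f, hf⟩
    apply hgu
    rw [hf, map_mul, eval_X, hup, zero_mul]
  have hC2 : IsUnit (C 2 : MvPolynomial ι A) := h2.map C
  refine Irreducible.prime ?_
  rw [hsum]
  refine irreducible_mul_X_add _ _ _ (mul_ne_zero hC2.ne_zero (X_ne_zero p)) ?_ ?_ ?_
  · intro h
    have := vars_mul _ _ h
    rw [vars_C, Finset.empty_union, vars_X, Finset.mem_singleton] at this
    exact hp this.symm
  · intro h
    obtain ⟨a, ha, ha'⟩ := Finset.mem_biUnion.1 (vars_sum_subset _ _ h)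
    simp only [S, Finset.mem_filter, Finset.mem_univ, true_and, not_or] at ha
    have := vars_mul _ _ ha'
    rw [vars_X, vars_X, Finset.mem_union, Finset.mem_singleton, Finset.mem_singleton] at this
    exact this.elim (fun h => ha.2 h.symm) fun h => ha.1 (hτ.injective h).symm
  · rw [isRelPrime_mul_unit_left_left hC2]
    exact (X_prime.irreducible.isRelPrime_iff_not_dvd).2 hdvd

end Quadric

/-! ### The cone chart of the second locus -/

namespace Shape

variable (s : Shape)

/-- The middle indices. -/
abbrev Mid : Type := {a : Fin s.n // ¬ s.Out a}

variable {s} in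
/-- The opposite middle index. -/
def Mid.rev (a : s.Mid) : s.Mid := ⟨a.1.rev, (s.out_rev a.1).not.2 a.2⟩

theorem Mid.rev_involutive : Function.Involutive (Mid.rev (s := s)) := fun a =>
  Subtype.ext (Fin.rev_rev a.1)

theorem sum_mid {R : Type*} [AddCommMonoid R] (f : Fin s.n → R) :
    ∑ a, (if s.Out a then 0 else f a) = ∑ a : s.Mid, f a := by
  rw [← Finset.sum_subtype (Finset.univ.filter fun a => ¬ s.Out a) (by simp), Finset.sum_filter]
  refine Finset.sum_congr rfl fun a _ => ?_
  split_ifs <;> rfl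

end Shape

section ConeChart

variable {s : Shape} {i : Fin s.n}

/-- The tuple with given middle parts `x` and `y`, and outer part `o` of `v`. -/
def coneTup (i : Fin s.n) {R : Type u} [CommRing R] (o : {a : Fin s.n // s.Out a ∧ a ≠ i} → R)
    (x y : s.Mid → R) : Tup s R :=
  ⟨fun a => if h : s.Out a then (if h' : a = i then 1 else o ⟨a, h, h'⟩) else x ⟨a, h⟩,
    fun a => if h : s.Out a then 0 else y ⟨a, h⟩, 1, 0⟩

theorem coneTup_map {R R' : Type u} [CommRing R] [CommRing R'] (φ : R →+* R')
    (o : {a : Fin s.n // s.Out a ∧ a ≠ i} → R) (x y : s.Mid → R) :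
    (coneTup i o x y).map φ = coneTup i (φ ∘ o) (φ ∘ x) (φ ∘ y) := by
  refine Tup.ext ?_ ?_ (map_one φ) (map_zero φ) <;> ext a <;>
    simp only [Tup.map, coneTup, Function.comp_apply] <;> split_ifs <;> simp

theorem coneTup_ok (hi : s.Out i) {R : Type u} [CommRing R]
    (o : {a : Fin s.n // s.Out a ∧ a ≠ i} → R) {x y : s.Mid → R}
    (h : ∀ a b, x a * y b = x b * y a) (hxx : ∑ a, x a * x a.rev = 0)
    (hyx : ∑ a, y a * x a.rev = 0) (hyy : ∑ a, y a * y a.rev = 0) :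
    (coneTup i o x y).Ok 0 i none ∧ (coneTup i o x y).InLocus₂ := by
  have hv : ∀ a : s.Mid, (coneTup i o x y).v a = x a := fun a => dif_neg a.2
  have hw : ∀ a : s.Mid, (coneTup i o x y).w a = y a := fun a => dif_neg a.2
  have hw' : ∀ a, s.Out a → (coneTup i o x y).w a = 0 := fun a ha => dif_pos ha
  refine ⟨⟨?_, rfl, ?_, ?_, ?_, ?_⟩, ?_, hw'⟩
  · simp [coneTup, hi]
  · have h1 : s.form (coneTup i o x y).v (coneTup i o x y).w =
        ∑ a, if s.Out a then 0 else (coneTup i o x y).v a * (coneTup i o x y).w a.rev := by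
      rw [Shape.form_apply]
      refine Finset.sum_congr rfl fun a _ => ?_
      split_ifs with ha
      · rw [hw' _ ((s.out_rev a).2 ha)]
        ring
      · rw [s.sgn_of_not_out ha, one_mul]
    rw [h1, s.sum_mid, mul_zero, zero_mul, ← hyx]
    refine Finset.sum_congr rfl fun a _ => ?_
    rw [hv a, show (coneTup i o x y).w a.1.rev = y a.rev from hw a.rev, h, mul_comm]
  · intro a
    simp only [Shape.tilt]
    split_ifs with ha
    · rw [hw' a ha]
      exact (zero_mul _).symm
    · exact (zero_mul _).trans (zero_mul _).symm
  · rw [Shape.quad_apply, s.sum_mid]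
    refine (Finset.sum_congr rfl fun a _ => ?_).trans (hyy.trans (by simp [coneTup]))
    rw [hw a, show (coneTup i o x y).w a.1.rev = y a.rev from hw a.rev]
  · intro a b
    simp only [Shape.hat]
    split_ifs with ha hb hb
    · rw [hw' a ha, hw' b hb]
      ring
    · rw [hw' a ha]
      ring
    · rw [hw' b hb]
      ring
    · rw [hv ⟨a, ha⟩, hv ⟨b, hb⟩, hw ⟨a, ha⟩, hw ⟨b, hb⟩, h]
  · rw [Shape.quad_apply, s.sum_mid]
    refine (Finset.sum_congr rfl fun a _ => ?_).trans hxx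
    rw [hv a, show (coneTup i o x y).v a.1.rev = x a.rev from hv a.rev]

theorem Tup.Ok.eq_coneTup {R : Type u} [CommRing R] {T : Tup s R} (h : T.Ok 0 i none)
    (hC : T.InLocus₂) :
    coneTup i (fun a => T.v a) (fun a => T.v a) (fun a => T.w a) = T := by
  refine Tup.ext ?_ ?_ h.wc_eq.symm (h.l_eq_zero hC.2).symm <;> ext a <;> simp only [coneTup]
  · split_ifs with ha ha'
    · rw [ha', h.v_eq]
    · rfl
    · rfl
  · split_ifs with ha
    · exact (hC.2 a ha).symm
    · rfl

/-- This is the equation `h(v, w) = 0`, where the minors allow the roles of `v` and `w` to be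
exchanged in each term. -/
theorem Tup.Ok.sum_v_w {R : Type u} [CommRing R] {T : Tup s R} {j : Option (Fin s.n)} (h : T.Ok 0 i j)
    (hw : ∀ a, s.Out a → T.w a = 0) : ∑ a : s.Mid, T.w a * T.v a.rev = 0 := by
  have h1 : s.form T.v T.w = ∑ a, if s.Out a then 0 else T.w a * T.v a.rev := by
    rw [Shape.form_apply]
    refine Finset.sum_congr rfl fun a _ => ?_
    split_ifs with ha
    · rw [hw _ ((s.out_rev a).2 ha)]
      ring
    · rw [s.sgn_of_not_out ha, one_mul, h.minor_mid ha ((s.out_rev a).not.2 ha), mul_comm]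
  rw [s.sum_mid fun a => T.w a * T.v a.rev] at h1
  exact h1.symm.trans (h.form_eq.trans (by ring))

variable (s) (k : Type u) [Field k] (i)

/-- The polynomial ring in the outer coordinates. -/
abbrev ConeBase : Type u := MvPolynomial {a : Fin s.n // s.Out a ∧ a ≠ i} k

/-- The coordinate ring of the cone chart. -/
abbrev ConeRing : Type u :=
  MvPolynomial (s.Mid ⊕ s.Mid) (ConeBase s i k) ⧸ coneIdeal (ConeBase s i k) (Shape.Mid.rev (s := s))

variable {s i}

/-- The outer coordinates on the cone chart. -/
def coneO (a : {a : Fin s.n // s.Out a ∧ a ≠ i}) : ConeRing s i k :=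
  Ideal.Quotient.mk _ (MvPolynomial.C (MvPolynomial.X a))

variable (i) in
/-- The middle coordinates of `v` on the cone chart. -/
def coneX (a : s.Mid) : ConeRing s i k := Ideal.Quotient.mk _ (MvPolynomial.X (.inl a))

variable (i) in
/-- The middle coordinates of `w` on the cone chart. -/
def coneY (a : s.Mid) : ConeRing s i k := Ideal.Quotient.mk _ (MvPolynomial.X (.inr a))

variable {k} in
theorem coneRing_hom_ext {R : Type u} [CommRing R] [Algebra k R] {φ ψ : ConeRing s i k →ₐ[k] R}
    (ho : ∀ a, φ (coneO k a) = ψ (coneO k a)) (hx : ∀ a, φ (coneX i k a) = ψ (coneX i k a))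
    (hy : ∀ a, φ (coneY i k a) = ψ (coneY i k a)) : φ = ψ := by
  apply AlgHom.coe_ringHom_injective
  refine Ideal.Quotient.ringHom_ext (MvPolynomial.ringHom_ext' ?_ fun a => ?_)
  · exact MvPolynomial.ringHom_ext (fun r => (φ.commutes r).trans (ψ.commutes r).symm) ho
  · cases a with
    | inl a => exact hx a
    | inr a => exact hy a

variable {k} in
theorem exists_coneRing_hom {R : Type u} [CommRing R] [Algebra k R]
    (o : {a : Fin s.n // s.Out a ∧ a ≠ i} → R) {x y : s.Mid → R}
    (h : ∀ a b, x a * y b = x b * y a) (hxx : ∑ a, x a * x a.rev = 0)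
    (hyx : ∑ a, y a * x a.rev = 0) (hyy : ∑ a, y a * y a.rev = 0) :
    ∃ φ : ConeRing s i k →ₐ[k] R, (∀ a, φ (coneO k a) = o a) ∧ (∀ a, φ (coneX i k a) = x a) ∧
      ∀ a, φ (coneY i k a) = y a := by
  let o' : ConeBase s i k →+* R := MvPolynomial.eval₂Hom (algebraMap k R) o
  let g : MvPolynomial (s.Mid ⊕ s.Mid) (ConeBase s i k) →+* R :=
    MvPolynomial.eval₂Hom o' (Sum.elim x y)
  have hgx : ∀ a, g (MvPolynomial.X (.inl a)) = x a := fun a => MvPolynomial.eval₂Hom_X' _ _ _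
  have hgy : ∀ a, g (MvPolynomial.X (.inr a)) = y a := fun a => MvPolynomial.eval₂Hom_X' _ _ _
  have hgo : ∀ r, g (MvPolynomial.C r) = o' r := fun r => MvPolynomial.eval₂Hom_C _ _ _
  have hg : coneIdeal (ConeBase s i k) (Shape.Mid.rev (s := s)) ≤ RingHom.ker g := by
    refine (coneIdeal_le_iff _).2 ⟨fun a b => ?_, ?_, ?_, ?_⟩ <;> rw [RingHom.mem_ker]
    · rw [map_sub, map_mul, map_mul, hgx, hgx, hgy, hgy, h, sub_self]
    · simpa only [map_sum, map_mul, hgx] using hxx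
    · simpa only [map_sum, map_mul, hgx, hgy] using hyx
    · simpa only [map_sum, map_mul, hgy] using hyy
  refine ⟨⟨Ideal.Quotient.lift _ g fun a ha => hg ha, fun r => ?_⟩, fun a => ?_, hgx, hgy⟩
  · change g (MvPolynomial.C (MvPolynomial.C r)) = _
    rw [hgo]
    exact MvPolynomial.eval₂Hom_C _ _ _
  · change g (MvPolynomial.C (MvPolynomial.X a)) = _
    rw [hgo]
    exact MvPolynomial.eval₂Hom_X' _ _ _

theorem cone_relations : (∀ a b, coneX i k a * coneY i k b = coneX i k b * coneY i k a) ∧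
    (∑ a, coneX i k a * coneX i k a.rev = 0) ∧ (∑ a, coneY i k a * coneX i k a.rev = 0) ∧
      ∑ a, coneY i k a * coneY i k a.rev = 0 := by
  have hrel := (coneIdeal_le_iff (Shape.Mid.rev (s := s))).1
    (le_refl (coneIdeal (ConeBase s i k) (Shape.Mid.rev (s := s))))
  refine ⟨fun a b => ?_, ?_, ?_, ?_⟩ <;> simp only [coneX, coneY, ← map_mul, ← map_sum]
  · rw [← sub_eq_zero, ← map_sub]
    exact Ideal.Quotient.eq_zero_iff_mem.2 (hrel.1 a b)
  · exact Ideal.Quotient.eq_zero_iff_mem.2 hrel.2.1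
  · exact Ideal.Quotient.eq_zero_iff_mem.2 hrel.2.2.1
  · exact Ideal.Quotient.eq_zero_iff_mem.2 hrel.2.2.2

theorem coneTup_cone_ok (hi : s.Out i) :
    (coneTup i (coneO k) (coneX i k) (coneY i k)).Ok 0 i none ∧
      (coneTup i (coneO k) (coneX i k) (coneY i k)).InLocus₂ :=
  have h := cone_relations (s := s) (i := i) k
  coneTup_ok hi _ h.1 h.2.1 h.2.2.1 h.2.2.2

variable {k} in
theorem exists_coneRing_hom_of_ok {R : Type u} [CommRing R] [Algebra k R] {T : Tup s R}
    (h : T.Ok 0 i none) (hC : T.InLocus₂) : ∃ φ : ConeRing s i k →ₐ[k] R,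
      (coneTup i (coneO k) (coneX i k) (coneY i k)).map (φ : ConeRing s i k →+* R) = T := by
  obtain ⟨φ, ho, hx, hy⟩ := exists_coneRing_hom (k := k) (i := i) (fun a => T.v a)
    (x := fun a : s.Mid => T.v a) (y := fun a : s.Mid => T.w a)
    (fun a b => h.minor_mid a.2 b.2) (by
      have := hC.1
      rwa [Shape.quad_apply, s.sum_mid fun a => T.v a * T.v a.rev] at this) (h.sum_v_w hC.2) (by
      have := h.quad_eq
      rwa [h.l_eq_zero hC.2, mul_zero, zero_mul, Shape.quad_apply,
        s.sum_mid fun a => T.w a * T.w a.rev] at this)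
  refine ⟨φ, ?_⟩
  rw [coneTup_map]
  refine Eq.trans ?_ (h.eq_coneTup hC)
  congr 1
  · exact funext ho
  · exact funext hx
  · exact funext hy

variable {k} in
theorem coneRing_hom_ext_of_map {R : Type u} [CommRing R] [Algebra k R]
    {φ ψ : ConeRing s i k →ₐ[k] R}
    (h : (coneTup i (coneO k) (coneX i k) (coneY i k)).map (φ : ConeRing s i k →+* R) =
      (coneTup i (coneO k) (coneX i k) (coneY i k)).map (ψ : ConeRing s i k →+* R)) : φ = ψ := by
  rw [coneTup_map, coneTup_map] at h
  have hv := congrFun (congrArg Tup.v h)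
  have hw := congrFun (congrArg Tup.w h)
  refine coneRing_hom_ext (fun a => ?_) (fun a => ?_) fun a => ?_
  · have := hv a.1
    simp only [coneTup, dif_pos a.2.1, dif_neg a.2.2] at this
    exact this
  · have := hv a.1
    simp only [coneTup, dif_neg a.2] at this
    exact this
  · have := hw a.1
    simp only [coneTup, dif_neg a.2] at this
    exact this

/-- The universal tuple on the cone chart. -/
def coneChart (hi : s.Out i) : TupChart s k Tup.InLocus₂ i none where
  Q := ConeRing s i k
  T := coneTup i (coneO k) (coneX i k) (coneY i k)
  ok := (coneTup_cone_ok k hi).1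
  mem := (coneTup_cone_ok k hi).2
  exists_hom _ h hC := exists_coneRing_hom_of_ok h hC
  hom_ext _ _ h := coneRing_hom_ext_of_map h

variable {k} (h2 : (2 : k) ≠ 0)

/-- The first middle index. -/
def Shape.firstMid (s : Shape) : Fin s.n := ⟨s.ℓ, by have := s.le; omega⟩

theorem Shape.not_out_firstMid (s : Shape) : ¬ s.Out s.firstMid := by
  have := s.le
  simp only [Shape.Out, Shape.firstMid]
  omega

theorem Shape.firstMid_ne_rev (s : Shape) : s.firstMid ≠ s.firstMid.rev := by
  have := s.le
  intro h
  have := congrArg Fin.val h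
  rw [Fin.val_rev] at this
  simp only [Shape.firstMid] at this
  omega

include h2 in
-- The first two middle indices serve as the pair required by `prime_quadric`; the second differs
-- from the opposite of the first because there are at least three.
theorem isDomain_coneChart (hi : s.Out i) : IsDomain (coneChart k hi).Q := by
  have := s.le
  have hq : ¬ s.Out (⟨s.ℓ + 1, by omega⟩ : Fin s.n) := by
    simp only [Shape.Out]
    omega
  have hprime : Prime (∑ a, MvPolynomial.X a * MvPolynomial.X a.rev :
      MvPolynomial s.Mid (ConeBase s i k)) := by
    refine prime_quadric ?_ (Shape.Mid.rev_involutive s) (p := ⟨s.firstMid, s.not_out_firstMid⟩)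
      (q := ⟨⟨s.ℓ + 1, by omega⟩, hq⟩) ?_ ?_ ?_
    · have := (IsUnit.mk0 (2 : k) h2).map (algebraMap k (ConeBase s i k))
      rwa [map_ofNat] at this
    · exact fun h => s.firstMid_ne_rev (congrArg Subtype.val h)
    · intro h
      have := congrArg (fun a : s.Mid => (a.1 : ℕ)) h
      simp only [Shape.firstMid] at this
      omega
    · intro h
      have := congrArg (fun a : s.Mid => (a.1 : ℕ)) h
      simp only [Shape.firstMid, Shape.Mid.rev, Fin.val_rev] at this
      omega
  have := isPrime_coneIdeal (A := ConeBase s i k) _ hprime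
  exact Ideal.Quotient.isDomain _

end ConeChart

end Splitting

end

noncomputable section

namespace Splitting

/-! ### ### The singularity of the second locus -/

section NotSmooth

variable {s : Shape} {i : Fin s.n} {k : Type u} [Field k]

theorem Shape.quad_single {p : Fin s.n} (hp : ¬ s.Out p) (hp' : p ≠ p.rev) {R : Type u} [CommRing R] :
    s.quad (Pi.single p (1 : R)) = 0 := by
  have h1 : s.quad (s.clear p (Pi.single p (1 : R))) = s.quad 0 := s.quad_congr fun a _ => by
    simp only [Shape.clear, Pi.zero_apply, ite_eq_left_iff, not_or]
    exact fun h => Pi.single_eq_of_ne h.1 _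
  rw [s.quad_eq_add hp hp', h1, Pi.single_eq_of_ne hp'.symm, Shape.quad_apply]
  simp

/-- A vector with square-zero coordinates. -/
def nilVec {R : Type u} [CommRing R] (p : Fin s.n) (η : R) (a : s.Mid) : R :=
  if a.1 = p ∨ a.1 = p.rev then η else 0

theorem coneTup_nilVec_ok (hi : s.Out i) {R : Type u} [CommRing R] (p : Fin s.n) {η : R}
    (hη : η * η = 0) : (coneTup i (fun _ => 0) (nilVec p η) fun _ => 0).Ok 0 i none ∧
      (coneTup i (fun _ => 0) (nilVec p η) fun _ => 0).InLocus₂ := by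
  refine coneTup_ok hi _ (fun a b => by simp) (Finset.sum_eq_zero fun a _ => ?_) (by simp) (by simp)
  simp only [nilVec]
  split_ifs <;> simp [hη]

/-- The second locus is singular at its points with `v` outer and `w = 0`: if it were smooth, then
the cubic tangent direction `ε` could only be quadratic. -/
theorem sq_eq_zero_of_formallySmooth (h2 : (2 : k) ≠ 0) (hi : s.Out i)
    (c : TupChart s k Tup.InLocus₂ i none) [Algebra.FormallySmooth k c.Q]
    {B : Type u} [CommRing B] [Algebra k B] {ε : B} (hε3 : ε ^ 3 = 0) : ε ^ 2 = 0 := by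
  let I : Ideal B := Ideal.span {ε ^ 2}
  -- The ideal generated by `ε ^ 2` has square zero, so formal smoothness lifts points across it.
  have hI : IsNilpotent I := ⟨2, by
    rw [Ideal.span_singleton_pow, show (ε ^ 2) ^ 2 = ε * ε ^ 3 by ring, hε3, mul_zero]
    exact Ideal.span_singleton_eq_bot.2 rfl⟩
  let p := s.firstMid
  have hp := s.not_out_firstMid
  have hp' := s.firstMid_ne_rev
  let η : B ⧸ I := Ideal.Quotient.mk I ε
  have hη : η * η = 0 := by
    rw [← map_mul, ← sq]
    exact Ideal.Quotient.eq_zero_iff_mem.2 (Ideal.mem_span_singleton_self _)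
  have hT := coneTup_nilVec_ok (R := B ⧸ I) hi p (η := η) hη
  obtain ⟨φ, hφ⟩ := c.exists_hom _ hT.1 hT.2
  obtain ⟨ψ, rfl⟩ := Algebra.FormallySmooth.exists_lift I hI φ
  have hC : s.quad (ψ ∘ c.T.v) = 0 := by
    have := congrArg ψ c.mem.1
    rw [map_zero] at this
    rw [← this]
    exact (s.map_quad (ψ : c.Q →+* B) c.T.v).symm
  have hv : ∀ a : s.Mid, Ideal.Quotient.mk I (ψ (c.T.v a)) = nilVec p η a := fun a => by
    have := congrFun (congrArg Tup.v hφ) a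
    simp only [coneTup, dif_neg a.2] at this
    exact this
  have hval : ∀ a : s.Mid, a.1 = p ∨ a.1 = p.rev → ∃ b, ψ (c.T.v a) = ε + ε ^ 2 * b := by
    intro a ha
    have h1 := hv a
    simp only [nilVec, if_pos ha] at h1
    obtain ⟨b, hb⟩ := Ideal.mem_span_singleton.1 (Ideal.Quotient.eq.1 h1)
    exact ⟨b, by rw [← hb]; ring⟩
  have hval' : ∀ a : s.Mid, ¬ (a.1 = p ∨ a.1 = p.rev) → ∃ b, ψ (c.T.v a) = ε ^ 2 * b := by
    intro a ha
    have h1 := hv a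
    simp only [nilVec, if_neg ha] at h1
    exact Ideal.mem_span_singleton.1 (Ideal.Quotient.eq_zero_iff_mem.1 h1)
  have hclear : s.quad (s.clear p (ψ ∘ c.T.v)) = 0 := by
    rw [Shape.quad_apply]
    refine Finset.sum_eq_zero fun a _ => ?_
    split_ifs with ha
    · rfl
    · simp only [Shape.clear, Function.comp_apply]
      split_ifs with h1 h3 h3
      · ring
      · ring
      · ring
      · obtain ⟨b, hb⟩ := hval' ⟨a, ha⟩ h1
        obtain ⟨b', hb'⟩ := hval' ⟨a.rev, (s.out_rev a).not.2 ha⟩ h3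
        dsimp only at hb hb'
        rw [hb, hb']
        linear_combination ε * b * b' * hε3
  obtain ⟨b, hb⟩ := hval ⟨p, hp⟩ (Or.inl rfl)
  obtain ⟨b', hb'⟩ := hval ⟨p.rev, (s.out_rev p).not.2 hp⟩ (Or.inr rfl)
  rw [s.quad_eq_add hp hp', hclear, Function.comp_apply, Function.comp_apply, hb, hb'] at hC
  have h3 : 2 * half k B = 1 := two_mul_half h2 B
  -- The lifted coordinates at `p` and its opposite are `ε` modulo `ε ^ 2` and the others contribute
  -- `ε ^ 4`, so isotropy says `2 ε ^ 2 = 0`.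
  linear_combination half k B * hC - ε ^ 2 * h3 -
    2 * half k B * (b + b' + ε * b * b') * hε3

/-- The lifting criterion is violated in `k[X] / (X ^ 3)`, where `X ^ 2` is not zero. -/
theorem not_smooth_of_inLocus₂ (h2 : (2 : k) ≠ 0) (hi : s.Out i)
    (c : TupChart s k Tup.InLocus₂ i none) : ¬ Algebra.Smooth k c.Q := by
  intro hs
  have h := sq_eq_zero_of_formallySmooth h2 hi c
    (ε := Ideal.Quotient.mk (Ideal.span {(Polynomial.X : Polynomial k) ^ 3}) Polynomial.X)
    (by
      rw [← map_pow]
      exact Ideal.Quotient.eq_zero_iff_mem.2 (Ideal.mem_span_singleton_self _))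
  rw [← map_pow, Ideal.Quotient.eq_zero_iff_mem, Ideal.mem_span_singleton,
    Polynomial.X_pow_dvd_iff] at h
  simpa using h 2 (by norm_num)

end NotSmooth

/-! ### Covering the loci by charts -/

section Covering

variable {s : Shape} {k : Type u} [Field k]

/-- The first outer index. -/
def Shape.firstOut (s : Shape) : Fin s.n := ⟨0, by have := s.le; omega⟩

theorem Shape.out_firstOut (s : Shape) : s.Out s.firstOut := Or.inl s.pos

/-- The chart is integral and meets the one where the first coordinate of `v` and `c` are
invertible. -/
structure TupChart.IsGood {C : ∀ {R : Type u} [CommRing R], Tup s R → Prop} {i : Fin s.n}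
    {j : Option (Fin s.n)} (c : TupChart s k C i j) : Prop where
  isDomain : IsDomain c.Q
  v_ne : c.T.v s.firstOut ≠ 0
  c_ne : c.T.c ≠ 0

theorem TupChart.IsGood.of_point {C : ∀ {R : Type u} [CommRing R], Tup s R → Prop} {i : Fin s.n}
    {j : Option (Fin s.n)} {c : TupChart s k C i j} (hc : IsDomain c.Q) {T : Tup s k}
    (hT : T.Ok 0 i j ∧ C T) (hv : T.v s.firstOut = 1) (hc' : T.c = 1) : c.IsGood where
  isDomain := hc
  v_ne := c.v_ne_zero hT.1 hT.2 (by rw [hv]; exact one_ne_zero)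
  c_ne := c.c_ne_zero hT.1 hT.2 (by rw [hc']; exact one_ne_zero)

theorem isGood₁ (i : Fin s.n) : (normalForm₁ s k i).chart.IsGood := by
  refine .of_point (T := ⟨1, 0, 1, 0⟩) inferInstance ⟨?_, rfl⟩ rfl rfl
  exact Tup.ok_of_inLocus₁ rfl rfl rfl rfl

/-- A point on many charts of the second locus. -/
def point₂ (s : Shape) (k : Type u) [Field k] (p : Fin s.n) : Tup s k :=
  ⟨fun a => if s.Out a then 1 else (Pi.single p 1 : s.Vec k) a, s.mid (Pi.single p 1), 1, 0⟩

variable {i p : Fin s.n} (hi : s.Out i) (hp : ¬ s.Out p) (hp' : p ≠ p.rev)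

include hp hp' in
theorem point₂_ok {i : Fin s.n} {j : Option (Fin s.n)} (hi : (point₂ s k p).v i = 1)
    (hj : (point₂ s k p).wc j = 1) : (point₂ s k p).Ok 0 i j ∧ (point₂ s k p).InLocus₂ :=
  Tup.ok_of_inLocus₂ (Shape.quad_single hp hp') 1 1
    (fun a ha => by simp [point₂, ha]) (one_smul _ _).symm rfl hi hj

theorem point₂_v_out {a : Fin s.n} (ha : s.Out a) : (point₂ s k p).v a = 1 := if_pos ha

include hp in
theorem point₂_v : (point₂ s k p).v p = 1 := (if_neg hp).trans (Pi.single_eq_same _ _)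

include hp in
theorem point₂_w : (point₂ s k p).wc (some p) = 1 := by
  simp [point₂, Tup.wc, Shape.mid, hp]

/-- A point on many charts of the third locus. -/
def point₃ (s : Shape) (k : Type u) [Field k] (p : Fin s.n) : Tup s k :=
  ⟨fun a => if s.Out a then 1 else 0, fun a => if s.Out a ∨ a = p ∨ a = p.rev then 1 else 0, 1, 1⟩

include hp hp' in
theorem point₃_ok {i : Fin s.n} {j : Option (Fin s.n)} (hi : s.Out i)
    (hj : (point₃ s k p).wc j = 1) : (point₃ s k p).Ok 0 i j ∧ (point₃ s k p).InLocus₃ := by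
  refine Tup.ok_of_inLocus₃ (fun a ha => if_neg ha) (fun a ha => ?_) ?_ (if_pos hi) hj
  · simp [point₃, ha]
  · have h1 : s.quad (s.clear p (point₃ s k p).w) = s.quad 0 := s.quad_congr fun a ha => by
      simp only [Shape.clear, point₃, ha, false_or, Pi.zero_apply]
      split_ifs <;> rfl
    have h3 : s.quad (0 : s.Vec k) = 0 := by simp [Shape.quad_apply]
    rw [s.quad_eq_add hp hp', h1, h3]
    simp [point₃]

variable (h2 : (2 : k) ≠ 0) {L : Type u} [Field L] [Algebra k L]

theorem exists_chart₁ (T : Tup s L) {i : Fin s.n} {j : Option (Fin s.n)} (h : T.Ok 0 i j)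
    (hC : T.InLocus₁) : ∃ i j, T.v i ≠ 0 ∧ T.wc j ≠ 0 ∧
      ∃ c : TupChart s k Tup.InLocus₁ i j, c.IsGood ∧ Algebra.Smooth k c.Q := by
  refine ⟨i, j, by rw [h.v_eq]; exact one_ne_zero, by rw [h.wc_eq]; exact one_ne_zero, ?_⟩
  cases j with
  | none => exact ⟨_, isGood₁ i, inferInstance⟩
  | some j =>
    have h1 : T.w j = 1 := h.wc_eq
    rw [show T.w = 0 from hC] at h1
    exact absurd h1.symm one_ne_zero

include h2 in
-- If `v_mid ≠ 0`, it is isotropic and has a pivot `p`; when `c = 0`, proportionality makes `w_p`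
-- nonzero too. If `v_mid = 0`, then `c = 0` gives a pivot of the isotropic `w_mid`, and only `c ≠
-- 0` requires the cone.
theorem exists_chart₂ (T : Tup s L) {i : Fin s.n} {j : Option (Fin s.n)} (h : T.Ok 0 i j)
    (hC : T.InLocus₂) : ∃ i j, T.v i ≠ 0 ∧ T.wc j ≠ 0 ∧
      ∃ c : TupChart s k Tup.InLocus₂ i j, c.IsGood := by
  have hw0 : T.c = 0 → ∃ a, ¬ s.Out a ∧ T.w a ≠ 0 := by
    intro hc
    cases j with
    | none => exact absurd (hc.symm.trans h.wc_eq) zero_ne_one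
    | some j =>
      have h1 : T.w j = 1 := h.wc_eq
      refine ⟨j, fun hj => ?_, by rw [h1]; exact one_ne_zero⟩
      rw [hC.2 j hj] at h1
      exact zero_ne_one h1
  by_cases hv : s.mid T.v = 0
  · have hi : s.Out i := by
      by_contra hi
      have := congrFun hv i
      rw [Shape.mid, if_neg hi, h.v_eq] at this
      exact one_ne_zero this
    have hvi : T.v i ≠ 0 := by rw [h.v_eq]; exact one_ne_zero
    by_cases hc : T.c = 0
    · obtain ⟨a, ha, ha'⟩ := hw0 hc
      have hq : s.quad T.w = 0 := by rw [h.quad_eq, h.l_eq_zero hC.2]; ring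
      obtain ⟨p, hp, hp', hwp⟩ := s.exists_pivot hq fun h0 => ha' (by
        have := congrFun h0 a
        rwa [Shape.mid, if_neg ha] at this)
      exact ⟨i, some p, hvi, hwp, (normalForm₂'' h2 hi hp hp').chart, .of_point inferInstance
        (point₂_ok hp hp' (point₂_v_out hi) (point₂_w hp)) (point₂_v_out s.out_firstOut) rfl⟩
    · exact ⟨i, none, hvi, hc, coneChart k hi, .of_point (isDomain_coneChart h2 hi)
        (point₂_ok s.not_out_firstMid s.firstMid_ne_rev (point₂_v_out hi) rfl)
        (point₂_v_out s.out_firstOut) rfl⟩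
  · obtain ⟨p, hp, hp', hvp⟩ := s.exists_pivot hC.1 hv
    by_cases hc : T.c = 0
    · obtain ⟨a, ha, ha'⟩ := hw0 hc
      have hwp : T.w p ≠ 0 := by
        intro h0
        have := h.minor_mid hp ha
        rw [h0, mul_zero] at this
        exact mul_ne_zero hvp ha' this
      exact ⟨p, some p, hvp, hwp, (normalForm₂' h2 hp hp').chart, .of_point inferInstance
        (point₂_ok hp hp' (point₂_v hp) (point₂_w hp)) (point₂_v_out s.out_firstOut) rfl⟩
    · exact ⟨p, none, hvp, hc, (normalForm₂ h2 hp hp').chart, .of_point inferInstance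
        (point₂_ok hp hp' (point₂_v hp) rfl) (point₂_v_out s.out_firstOut) rfl⟩

include h2 in
-- If `c = 0` and `l ≠ 0`, then `w_i = l v_i` is nonzero. If both vanish, `w` is a nonzero isotropic
-- middle vector and has a pivot.
theorem exists_chart₃ (T : Tup s L) {i : Fin s.n} {j : Option (Fin s.n)} (h : T.Ok 0 i j)
    (hC : T.InLocus₃) : ∃ i j, T.v i ≠ 0 ∧ T.wc j ≠ 0 ∧
      ∃ c : TupChart s k Tup.InLocus₃ i j, c.IsGood ∧ Algebra.Smooth k c.Q := by
  have hvi : T.v i ≠ 0 := by rw [h.v_eq]; exact one_ne_zero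
  have hi : s.Out i := by
    by_contra hi
    exact hvi (hC.v_eq_zero hi)
  have hm := s.not_out_firstMid
  have hm' := s.firstMid_ne_rev
  by_cases hc : T.c = 0
  · by_cases hl : T.l = 0
    · have hq : s.quad T.w = 0 := by rw [h.quad_eq, hc, mul_zero]
      have hw : s.mid T.w ≠ 0 := by
        intro h0
        cases j with
        | none => exact absurd (hc.symm.trans h.wc_eq) zero_ne_one
        | some j =>
          have h1 : T.w j = 1 := h.wc_eq
          have h3 : T.w j = 0 := by
            by_cases hj : s.Out j
            · rw [h.w_out hj, hl, zero_mul]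
            · have := congrFun h0 j
              rwa [Shape.mid, if_neg hj] at this
          exact one_ne_zero (h1.symm.trans h3)
      obtain ⟨p, hp, hp', hwp⟩ := s.exists_pivot hq hw
      exact ⟨i, some p, hvi, hwp, (normalForm₃'' h2 hi hp hp').chart, .of_point inferInstance
        (point₃_ok hp hp' hi (by simp [point₃, Tup.wc])) (if_pos s.out_firstOut) rfl, inferInstance⟩
    · have hwi : T.w i ≠ 0 := by
        rw [h.w_out hi]
        exact mul_ne_zero hl hvi
      exact ⟨i, some i, hvi, hwi, (normalForm₃' h2 hi).chart, .of_point inferInstance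
        (point₃_ok hm hm' hi (by simp [point₃, Tup.wc, hi])) (if_pos s.out_firstOut) rfl,
        inferInstance⟩
  · exact ⟨i, none, hvi, hc, (normalForm₃ h2 hi).chart, .of_point inferInstance
      (point₃_ok hm hm' hi rfl) (if_pos s.out_firstOut) rfl, inferInstance⟩

/-- The three loci cover the special fiber. -/
theorem Tup.Ok.inLocus_of_field {T : Tup s L} {i : Fin s.n} {j : Option (Fin s.n)}
    (h : T.Ok 0 i j) : T.InLocus₁ ∨ T.InLocus₂ ∨ T.InLocus₃ := by
  by_cases hv : s.mid T.v = 0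
  · exact Or.inr (Or.inr hv)
  obtain ⟨p, hp, hvp⟩ : ∃ p, ¬ s.Out p ∧ T.v p ≠ 0 := by
    by_contra! hcon
    apply hv
    ext a
    rw [Shape.mid, Pi.zero_apply]
    split_ifs with ha
    · rfl
    · exact hcon a ha
  have hl : T.l = 0 := by
    have := h.tilt_eq p
    rw [Shape.tilt, if_neg hp, zero_mul] at this
    exact (mul_eq_zero.1 this.symm).resolve_right hvp
  have hw : ∀ a, s.Out a → T.w a = 0 := fun a ha => by rw [h.w_out ha, hl, zero_mul]
  -- So `w_mid = θ v_mid` with `θ = w_p / v_p`, and `h(v, w) = 0` becomes `θ q(v) = 0`.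
  have hw' : ∀ a, ¬ s.Out a → T.w a = T.w p / T.v p * T.v a := fun a ha => by
    rw [div_mul_eq_mul_div, eq_div_iff hvp]
    linear_combination h.minor_mid hp ha
  have h1 := h.sum_v_w hw
  have h3 : T.w p / T.v p * s.quad T.v = 0 := by
    rw [← h1, Shape.quad_apply, s.sum_mid fun a => T.v a * T.v a.rev, Finset.mul_sum]
    exact Finset.sum_congr rfl fun a _ => by rw [hw' a a.2, mul_assoc]; rfl
  rcases mul_eq_zero.1 h3 with h4 | h4
  · refine Or.inl (funext fun a => ?_)
    by_cases ha : s.Out a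
    · exact hw a ha
    · rw [hw' a ha, h4, zero_mul]
      rfl
  · exact Or.inr (Or.inl ⟨h4, hw⟩)

end Covering

end Splitting

end

noncomputable section

/-! ### ### Integrality, smoothness and irreducible components of the loci -/

namespace Splitting

/-- A finite cover by irreducible closed subsets without inclusions among them consists of the
irreducible components. -/
theorem irreducibleComponents_eq_of_isAntichain {X : Type*} [TopologicalSpace X] {S : Set (Set X)}
    (hS : S.Finite) (hcl : ∀ s ∈ S, IsClosed s) (hirr : ∀ s ∈ S, IsIrreducible s)
    (hcov : ⋃₀ S = Set.univ) (hanti : IsAntichain (· ⊆ ·) S) : irreducibleComponents X = S := by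
  have key : ∀ t : Set X, IsIrreducible t → ∃ s ∈ S, t ⊆ s := fun t ht => by
    obtain ⟨s, hs, hts⟩ := isIrreducible_iff_sUnion_isClosed.1 ht hS.toFinset
      (fun s hs => hcl s (hS.mem_toFinset.1 hs)) (by
        rw [hS.coe_toFinset, hcov]
        exact Set.subset_univ _)
    exact ⟨s, hS.mem_toFinset.1 hs, hts⟩
  ext t
  constructor
  · intro ht
    obtain ⟨s, hs, hts⟩ := key t ht.prop
    rwa [ht.eq_of_subset (hirr s hs) hts]
  · intro ht
    refine ⟨hirr t ht, fun u hu htu => ?_⟩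
    obtain ⟨s, hs, hus⟩ := key u hu
    rwa [hanti.eq ht hs (htu.trans hus)]

/-- A point of the first locus only. -/
def point₁ (s : Shape) (k : Type u) [Field k] : Tup s k :=
  ⟨fun a => if a = s.firstMid ∨ a = s.firstMid.rev then 1 else 0, 0, 1, 0⟩

variable {s : Shape} {k : Type u} [Field k]

theorem point₁_ok : (point₁ s k).Ok 0 s.firstMid none ∧ (point₁ s k).InLocus₁ :=
  ⟨Tup.ok_of_inLocus₁ rfl rfl (if_pos (Or.inl rfl)) rfl, rfl⟩

theorem quad_point₁ : s.quad (point₁ s k).v = 2 := by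
  have h1 : s.quad (s.clear s.firstMid (point₁ s k).v) = s.quad (0 : s.Vec k) :=
    s.quad_congr fun a _ => by
      simp only [Shape.clear, point₁, Pi.zero_apply]
      split_ifs <;> rfl
  have h3 : s.quad (0 : s.Vec k) = 0 := by simp [Shape.quad_apply]
  rw [s.quad_eq_add s.not_out_firstMid s.firstMid_ne_rev, h1, h3]
  simp [point₁]

namespace Datum

variable {O₀ F₀ O F : Type u}
  [CommRing O₀] [IsDomain O₀] [IsDiscreteValuationRing O₀]
  [Field F₀] [Algebra O₀ F₀] [IsFractionRing O₀ F₀]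
  [CommRing O] [IsDomain O] [IsDiscreteValuationRing O]
  [Field F] [Algebra O F] [IsFractionRing O F]
  [Algebra F₀ F] [Algebra O₀ F] [Algebra O₀ O]
  [IsScalarTower O₀ F₀ F] [IsScalarTower O₀ O F] [IsIntegralClosure O O₀ F]

variable (D : Datum O₀ F₀ O F)

theorem residueField_two_ne_zero (D : Datum O₀ F₀ O F) : (2 : ResidueField O) ≠ 0 := by
  have h := (D.isUnit_two.map (algebraMap O₀ O)).map (algebraMap O (ResidueField O))
  rw [map_ofNat, map_ofNat] at h
  exact h.ne_zero

section Locus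

variable {I : IdealRule (ptFunctor D.shape D.π)}
  {C : ∀ {R : Type u} [CommRing R], Tup D.shape R → Prop}
  (hC : ∀ {R : Type u} [CommRing R] {T : Tup D.shape R} {ρ : O →+* R} {i j}
    (h : T.Ok (ρ D.π) i j), IdealRule.ideal I (R := .of R) h.pt = ⊥ ↔ C T)

include hC in
-- All good charts are taken at once; each meets the chart where the first coordinate of `v` and `c`
-- are invertible.
theorem isIntegral_locus_of_isGood
    (hcov : ∀ {L : Type u} [Field L] [Algebra (ResidueField O) L] (T : Tup D.shape L)
      {i : Fin D.shape.n} {j : Option (Fin D.shape.n)}, T.Ok 0 i j → C T →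
      ∃ i j, T.v i ≠ 0 ∧ T.wc j ≠ 0 ∧ ∃ c : TupChart D.shape (ResidueField O) C i j, c.IsGood)
    (c₀ : TupChart D.shape (ResidueField O) C D.shape.firstOut none) (h₀ : c₀.IsGood) :
    IsIntegral (D.locus I) := by
  let α := {p : Fin D.shape.n × Option (Fin D.shape.n) //
    ∃ c : TupChart D.shape (ResidueField O) C p.1 p.2, c.IsGood}
  refine D.isIntegral_locus hC (fun a : α => a.2.choose) ?_
    (fun a => a.2.choose_spec.isDomain) ⟨(D.shape.firstOut, none), c₀, h₀⟩
    fun a => ⟨a.2.choose_spec.v_ne, a.2.choose_spec.c_ne⟩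
  intro L _ _ T i j h hT
  obtain ⟨i, j, hv, hw, hc⟩ := hcov T h hT
  exact ⟨⟨(i, j), hc⟩, hv, hw⟩

include hC in
theorem smooth_locus_of_isGood
    (hcov : ∀ {L : Type u} [Field L] [Algebra (ResidueField O) L] (T : Tup D.shape L)
      {i : Fin D.shape.n} {j : Option (Fin D.shape.n)}, T.Ok 0 i j → C T →
      ∃ i j, T.v i ≠ 0 ∧ T.wc j ≠ 0 ∧ ∃ c : TupChart D.shape (ResidueField O) C i j,
        c.IsGood ∧ Algebra.Smooth (ResidueField O) c.Q) :
    Smooth (D.locusι I ≫ specialFiberTo D.modelTo) := by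
  let α := {p : Fin D.shape.n × Option (Fin D.shape.n) //
    ∃ c : TupChart D.shape (ResidueField O) C p.1 p.2, Algebra.Smooth (ResidueField O) c.Q}
  refine D.smooth_locus hC (fun a : α => a.2.choose) ?_ fun a => a.2.choose_spec
  intro L _ _ T i j h hT
  obtain ⟨i, j, hv, hw, c, -, hc⟩ := hcov T h hT
  exact ⟨⟨(i, j), c, hc⟩, hv, hw⟩

end Locus

instance : IsIntegral (D.locus (locusIdeal₁ D.shape D.π)) :=
  D.isIntegral_locus_of_isGood (fun h => h.locusIdeal₁_eq_bot)
    (fun T _ _ h hT => by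
      obtain ⟨i, j, hv, hw, c, hc, -⟩ := exists_chart₁ (k := ResidueField O) T h hT
      exact ⟨i, j, hv, hw, c, hc⟩) _ (isGood₁ _)

instance : IsIntegral (D.locus (locusIdeal₂ D.shape D.π)) :=
  D.isIntegral_locus_of_isGood (fun h => h.locusIdeal₂_eq_bot)
    (fun T _ _ h hT => exists_chart₂ D.residueField_two_ne_zero T h hT)
    (coneChart _ D.shape.out_firstOut) (.of_point (isDomain_coneChart D.residueField_two_ne_zero _)
      (point₂_ok D.shape.not_out_firstMid D.shape.firstMid_ne_rev
        (point₂_v_out D.shape.out_firstOut) rfl) (point₂_v_out D.shape.out_firstOut) rfl)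

instance : IsIntegral (D.locus (locusIdeal₃ D.shape D.π)) :=
  D.isIntegral_locus_of_isGood (fun h => h.locusIdeal₃_eq_bot)
    (fun T _ _ h hT => by
      obtain ⟨i, j, hv, hw, c, hc, -⟩ := exists_chart₃ D.residueField_two_ne_zero T h hT
      exact ⟨i, j, hv, hw, c, hc⟩)
    (normalForm₃ D.residueField_two_ne_zero D.shape.out_firstOut).chart (.of_point inferInstance
      (point₃_ok D.shape.not_out_firstMid D.shape.firstMid_ne_rev D.shape.out_firstOut rfl)
      (if_pos D.shape.out_firstOut) rfl)

theorem smooth_locus₁ : Smooth (D.locusι (locusIdeal₁ D.shape D.π) ≫ specialFiberTo D.modelTo) :=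
  D.smooth_locus_of_isGood (fun h => h.locusIdeal₁_eq_bot)
    fun T _ _ h hT => exists_chart₁ (k := ResidueField O) T h hT

theorem not_smooth_locus₂ :
    ¬ Smooth (D.locusι (locusIdeal₂ D.shape D.π) ≫ specialFiberTo D.modelTo) :=
  D.not_smooth_locus (fun h => h.locusIdeal₂_eq_bot) (coneChart _ D.shape.out_firstOut)
    (not_smooth_of_inLocus₂ D.residueField_two_ne_zero D.shape.out_firstOut _)

theorem smooth_locus₃ : Smooth (D.locusι (locusIdeal₃ D.shape D.π) ≫ specialFiberTo D.modelTo) :=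
  D.smooth_locus_of_isGood (fun h => h.locusIdeal₃_eq_bot)
    fun T _ _ h hT => exists_chart₃ D.residueField_two_ne_zero T h hT

theorem isClosedLocus₁ :
    IsClosedLocus D.representation InM₁ (D.locusι (locusIdeal₁ D.shape D.π)) := by
  apply D.isClosedLocus
  intro R _ _ _ _ ξ h h0
  have h1 := locusIdeal₁_eq_bot (R := .of R) ξ
  have h3 := D.inM₁_iff h h0
  exact h1.trans h3.symm

theorem isClosedLocus₂ :
    IsClosedLocus D.representation InM₂ (D.locusι (locusIdeal₂ D.shape D.π)) := by
  apply D.isClosedLocus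
  intro R _ _ _ _ ξ h h0
  have h1 := locusIdeal₂_eq_bot (R := .of R) ξ
  have h3 := D.inM₂_iff h h0
  exact h1.trans h3.symm

theorem isClosedLocus₃ :
    IsClosedLocus D.representation InM₃ (D.locusι (locusIdeal₃ D.shape D.π)) := by
  apply D.isClosedLocus
  intro R _ _ _ _ ξ h h0
  have h1 := locusIdeal₃_eq_bot (R := .of R) ξ
  have h3 := D.inM₃_iff h h0
  exact h1.trans h3.symm

/-! ### The irreducible components -/

/-- Membership of a rational point in the loci is decided on its coordinates. -/
theorem exists_point_of_tup {T : Tup D.shape (ResidueField O)} {i : Fin D.shape.n}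
    {j : Option (Fin D.shape.n)} (h : T.Ok 0 i j) : ∃ z : specialFiber D.modelTo,
      (z ∈ Set.range (D.locusι (locusIdeal₁ D.shape D.π)) ↔ T.InLocus₁) ∧
      (z ∈ Set.range (D.locusι (locusIdeal₂ D.shape D.π)) ↔ T.InLocus₂) ∧
      (z ∈ Set.range (D.locusι (locusIdeal₃ D.shape D.π)) ↔ T.InLocus₃) := by
  have h' : T.Ok (algebraMap O (ResidueField O) D.π) i j := D.residue_π.symm ▸ h
  obtain ⟨x, hx, -⟩ := D.exists_fib (R := .of (ResidueField O)) (RingHom.id _) h'.pt rfl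
  refine ⟨x (closedPoint _), ?_, ?_, ?_⟩
  · rw [closedPoint_mem_range_locusι_iff, hx]
    exact h'.locusIdeal₁_eq_bot
  · rw [closedPoint_mem_range_locusι_iff, hx]
    exact h'.locusIdeal₂_eq_bot
  · rw [closedPoint_mem_range_locusι_iff, hx]
    exact h'.locusIdeal₃_eq_bot

theorem mem_range_locusι (z : specialFiber D.modelTo) :
    z ∈ Set.range (D.locusι (locusIdeal₁ D.shape D.π)) ∨
      z ∈ Set.range (D.locusι (locusIdeal₂ D.shape D.π)) ∨
      z ∈ Set.range (D.locusι (locusIdeal₃ D.shape D.π)) := by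
  obtain ⟨p, T, hT, hT', hTx⟩ := D.exists_tup_of_isField
    (Field.toIsField ((specialFiber D.modelTo).residueField z))
    ((specialFiber D.modelTo).fromSpecResidueField z)
  rw [mem_range_locusι_iff, mem_range_locusι_iff, mem_range_locusι_iff, ← hTx]
  refine hT.inLocus_of_field.imp hT'.locusIdeal₁_eq_bot.2
    (Or.imp hT'.locusIdeal₂_eq_bot.2 hT'.locusIdeal₃_eq_bot.2)

/-- Each of `point₁`, `point₂`, `point₃` lies on its own locus and on neither of the other two. -/
theorem not_range_subset :
    ¬ Set.range (D.locusι (locusIdeal₁ D.shape D.π)) ⊆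
      Set.range (D.locusι (locusIdeal₂ D.shape D.π)) ∧
    ¬ Set.range (D.locusι (locusIdeal₁ D.shape D.π)) ⊆
      Set.range (D.locusι (locusIdeal₃ D.shape D.π)) ∧
    ¬ Set.range (D.locusι (locusIdeal₂ D.shape D.π)) ⊆
      Set.range (D.locusι (locusIdeal₁ D.shape D.π)) ∧
    ¬ Set.range (D.locusι (locusIdeal₂ D.shape D.π)) ⊆
      Set.range (D.locusι (locusIdeal₃ D.shape D.π)) ∧
    ¬ Set.range (D.locusι (locusIdeal₃ D.shape D.π)) ⊆
      Set.range (D.locusι (locusIdeal₁ D.shape D.π)) ∧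
    ¬ Set.range (D.locusι (locusIdeal₃ D.shape D.π)) ⊆
      Set.range (D.locusι (locusIdeal₂ D.shape D.π)) := by
  have hm := D.shape.not_out_firstMid
  have hm' := D.shape.firstMid_ne_rev
  have ho := D.shape.out_firstOut
  have hok₁ := point₁_ok (s := D.shape) (k := ResidueField O)
  have hok₂ := point₂_ok (k := ResidueField O) hm hm' (point₂_v_out ho) (j := none) rfl
  have hok₃ := point₃_ok (k := ResidueField O) hm hm' ho (j := none) rfl
  obtain ⟨z₁, h11, h12, h13⟩ := D.exists_point_of_tup hok₁.1
  obtain ⟨z₂, h21, h22, h23⟩ := D.exists_point_of_tup hok₂.1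
  obtain ⟨z₃, h31, h32, h33⟩ := D.exists_point_of_tup hok₃.1
  refine ⟨fun h => ?_, fun h => ?_, fun h => ?_, fun h => ?_, fun h => ?_, fun h => ?_⟩
  · exact D.residueField_two_ne_zero (quad_point₁.symm.trans (h12.1 (h (h11.2 hok₁.2))).1)
  · have := (h13.1 (h (h11.2 hok₁.2))).v_eq_zero hm
    simp [point₁] at this
  · have := congrFun (h21.1 (h (h22.2 hok₂.2))) D.shape.firstMid
    exact one_ne_zero ((point₂_w hm).symm.trans this)
  · have := (h23.1 (h (h22.2 hok₂.2))).v_eq_zero hm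
    exact one_ne_zero ((point₂_v hm).symm.trans this)
  · have := congrFun (h31.1 (h (h33.2 hok₃.2))) D.shape.firstMid
    simp [point₃] at this
  · have := (h32.1 (h (h33.2 hok₃.2))).2 _ ho
    simp [point₃, ho] at this

theorem isClosed_range_locusι (I : IdealRule (ptFunctor D.shape D.π)) :
    IsClosed (Set.range (D.locusι I)) :=
  (D.locusι I).isClosedEmbedding.isClosed_range

theorem isIrreducible_range_locusι (I : IdealRule (ptFunctor D.shape D.π))
    [IsIntegral (D.locus I)] : IsIrreducible (Set.range (D.locusι I)) := by
  rw [← Set.image_univ]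
  exact (IrreducibleSpace.isIrreducible_univ _).image _ (D.locusι I).continuous.continuousOn

theorem irreducibleComponents_eq : irreducibleComponents (specialFiber D.modelTo) =
    {Set.range (D.locusι (locusIdeal₁ D.shape D.π)),
      Set.range (D.locusι (locusIdeal₂ D.shape D.π)),
      Set.range (D.locusι (locusIdeal₃ D.shape D.π))} := by
  obtain ⟨h12, h13, h21, h23, h31, h32⟩ := D.not_range_subset
  refine irreducibleComponents_eq_of_isAntichain (Set.toFinite _) ?_ ?_ ?_ ?_
  · rintro _ (rfl | rfl | rfl) <;> exact D.isClosed_range_locusι _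
  · rintro _ (rfl | rfl | rfl) <;> exact D.isIrreducible_range_locusι _
  · refine Set.eq_univ_of_forall fun z => ?_
    rcases D.mem_range_locusι z with h | h | h
    · exact ⟨_, Or.inl rfl, h⟩
    · exact ⟨_, Or.inr (Or.inl rfl), h⟩
    · exact ⟨_, Or.inr (Or.inr rfl), h⟩
  · rintro _ (rfl | rfl | rfl) _ (rfl | rfl | rfl) hne h
    · exact hne rfl
    · exact h12 h
    · exact h13 h
    · exact h21 h
    · exact hne rfl
    · exact h23 h
    · exact h31 h
    · exact h32 h
    · exact hne rfl

end Datum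

end Splitting

end

/-- The special fiber of the splitting model has exactly three irreducible components, namely the
closed subschemes `M₁`, `M₂`, `M₃` given by their moduli descriptions; `M₁` and `M₃` are smooth
over the residue field and `M₂` is not. (A scheme representing the moduli problem is unique up to
unique isomorphism.) -/
theorem mainTheorem5 {O₀ F₀ O F : Type u}
    [CommRing O₀] [IsDomain O₀] [IsDiscreteValuationRing O₀]
    [IsAdicComplete (maximalIdeal O₀) O₀] [PerfectField (ResidueField O₀)]
    [Field F₀] [Algebra O₀ F₀] [IsFractionRing O₀ F₀]
    [CommRing O] [IsDomain O] [IsDiscreteValuationRing O]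
    [Field F] [Algebra O F] [IsFractionRing O F]
    [Algebra F₀ F] [Algebra O₀ F] [Algebra O₀ O]
    [IsScalarTower O₀ F₀ F] [IsScalarTower O₀ O F] [IsIntegralClosure O O₀ F]
    (D : Splitting.Datum O₀ F₀ O F) :
    ∃ (M : Scheme.{u}) (s : M ⟶ Spec (.of O)) (hM : Splitting.Representation D s)
      (M₁ M₂ M₃ : Scheme.{u})
      (ι₁ : M₁ ⟶ Splitting.specialFiber s) (ι₂ : M₂ ⟶ Splitting.specialFiber s)
      (ι₃ : M₃ ⟶ Splitting.specialFiber s),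
      Splitting.IsClosedLocus hM Splitting.InM₁ ι₁ ∧
      Splitting.IsClosedLocus hM Splitting.InM₂ ι₂ ∧
      Splitting.IsClosedLocus hM Splitting.InM₃ ι₃ ∧
      IsIntegral M₁ ∧ IsIntegral M₂ ∧ IsIntegral M₃ ∧
      irreducibleComponents (Splitting.specialFiber s) =
        {Set.range ι₁, Set.range ι₂, Set.range ι₃} ∧
      Set.range ι₁ ≠ Set.range ι₂ ∧ Set.range ι₁ ≠ Set.range ι₃ ∧ Set.range ι₂ ≠ Set.range ι₃ ∧
      Smooth (ι₁ ≫ Splitting.specialFiberTo s) ∧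
      ¬ Smooth (ι₂ ≫ Splitting.specialFiberTo s) ∧
      Smooth (ι₃ ≫ Splitting.specialFiberTo s) := by
  obtain ⟨h12, h13, -, h23, -, -⟩ := D.not_range_subset
  refine ⟨D.model, D.modelTo, D.representation, _, _, _,
    D.locusι (Splitting.locusIdeal₁ D.shape D.π), D.locusι (Splitting.locusIdeal₂ D.shape D.π),
    D.locusι (Splitting.locusIdeal₃ D.shape D.π), ?_⟩
  exact ⟨D.isClosedLocus₁, D.isClosedLocus₂, D.isClosedLocus₃, inferInstance, inferInstance,
    inferInstance, D.irreducibleComponents_eq, fun h => h12 h.subset, fun h => h13 h.subset,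
    fun h => h23 h.subset, D.smooth_locus₁, D.not_smooth_locus₂, D.smooth_locus₃⟩
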